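/- **Theorem (algebraic Kiso–Morimoto theorem).** Let $\rho\colon M\to S$ be a smooth morphism (a regular submersion) between smooth irreducible affine complex varieties whose generic fibre $M_s=\rho^{-1}(s)$ is irreducible, and let $m=\dim M-\dim S\neq 1$. Write $J(TM/M)$ for the bundle of formal vector fields on $M$: its elements are the pairs of a point $p\in M$ and a (continuous) derivation of the completed local ring $\widehat{\mathcal O}_{M,p}$; it is the projective limit of the jet bundles $J_k(TM/M)$ and carries the initial (Zariski) topology. A *rational linear sub-bundle* of $J(TM/M)$ is an irreducible closed subset $\mathcal L=\{\mathcal L_k\}_{k}$ such that each $\mathcal L_k\subset J_k(TM/M)$ is a linear sub-bundle over some nonempty Zariski open subset of $M$. It is a *$\mathcal D$-Lie algebra* if its rational sections are closed under the (fibrewise) Lie bracket of formal vector fields and if the space of rational linear differential operators from vector fields to functions that vanish on $\mathcal L$ is stable under composition with rational vector fields, i.e. is a $\mathcal D_M$-module. Let $\mathcal L$ be a $\mathcal D$-Lie algebra on $M$ such that: 1. $\mathcal L$ is tangent to $\rho$: $d\rho(\vec X)=0$ for every formal vector field $\vec X\in\mathcal L$. For $s\in S$ let $\mathcal L|_{M_s}$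 be the set of restrictions to $M_s$ of the $\vec X\in\mathcal L$ based at points of $M_s$. 2. There is a rational $m$-form $\omega$ on $M$ such that for generic $s\in S$ the form $\omega|_{M_s}$ is defined and not zero, and, over a nonempty Zariski open subset of $M_s$, $$\mathcal L|_{M_s}=\{\vec X\in J(TM_s/M_s)\;:\;\mathrm{Lie}_{\vec X}(\omega|_{M_s})=0\}.$$ (Here "generic $s$" means all $s$ outside some countable union of proper Zariski closed subsets of $S$; this includes the case of all $s$ in a nonempty Zariski open subset.) Then there is a singular foliation $\mathcal H$ on $M$, i.e. a $\mathbb C(M)$-subspace $\mathfrak X_{\mathcal H}$, closed under the Lie bracket, of the space of rational vector fields on $M$, such that $$\mathcal L=\Big\{\vec X\in J(TM/M)\;:\; d\rho(\vec X)=0,\quad \mathrm{Lie}_{\vec X}\omega\equiv 0 \bmod \rho^*\Omega^1_S,\quad [\vec X,\vec Y]\in\mathfrak X_{\mathcal H}\ \text{ for all } \vec Y\in\mathfrak X_{\mathcal H}\Big\}$$ at every point of $M$ (the last two conditions being understood for formal meromorphic forms and vector fields at the base point of $\vec X$). Moreover $\mathcal H$ is $\rho$-projectable, i.e. there is a rational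 linear sub-bundle $\rho_*\mathcal H$ of $TS$ with $d\rho(\mathcal H_p)=(\rho_*\mathcal H)_{\rho(p)}$ at the generic point of $M$, and $\operatorname{rank}\mathcal H=\operatorname{rank}\rho_*\mathcal H$. -/

import Mathlib

open scoped KaehlerDifferential

noncomputable section

namespace KisoMorimoto

/-! ### Points, formal functions and formal vector fields

An affine complex variety is given by its coordinate ring `A`; its points are the `ℂ`-algebra
morphisms `A → ℂ`. -/

section Formal

variable {A : Type*} [CommRing A] [Algebra ℂ A]

/-- The (closed) points of the affine variety with coordinate ring `A`. -/
abbrev Pt (A : Type*) [CommRing A] [Algebra ℂ A] : Type _ := A →ₐ[ℂ] ℂ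

/-- A property of points holds generically if it holds outside of a countable union of proper
Zariski closed subsets of the irreducible variety. (It then does in particular if it holds on a
nonempty Zariski open subset.) -/
def Generically (A : Type*) [CommRing A] [Algebra ℂ A] (P : Pt A → Prop) : Prop :=
  ∃ a : ℕ → A, (∀ i, a i ≠ 0) ∧ ∀ p : Pt A, (∀ i, p (a i) ≠ 0) → P p

/-- The completed local ring at a point `p`: formal functions at `p`. -/
abbrev FormalRing (p : Pt A) : Type _ := AdicCompletion (RingHom.ker p) A

/-- Formal vector fields at `p`: derivations of the completed local ring (for a variety they are
automatically continuous for the adic topology). -/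
abbrev FormalVF (p : Pt A) : Type _ := Derivation ℂ (FormalRing p) (FormalRing p)

/-- The value at `p` of a formal function at `p`. -/
def evalAt (p : Pt A) : FormalRing p →ₐ[ℂ] ℂ :=
  (Ideal.Quotient.liftₐ (RingHom.ker p) p (fun _ h => h)).comp
    ((AdicCompletion.evalOneₐ (RingHom.ker p)).restrictScalars ℂ)

theorem evalAt_algebraMap (p : Pt A) (a : A) :
    evalAt p (algebraMap A (FormalRing p) a) = p a := rfl

/-- A compatible sequence of classes modulo powers of an ideal defines an element of the
completion. -/
def ofCompatible {R : Type*} [CommRing R] (I : Ideal R) (f : ∀ n, R ⧸ I ^ n)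
    (hf : ∀ {m n : ℕ} (h : m ≤ n), Ideal.Quotient.factorPow I h (f n) = f m) :
    AdicCompletion I R :=
  ⟨fun n => Ideal.Quotient.factor (le_of_eq (Ideal.mul_top _).symm) (f n), by
    intro m n h
    obtain ⟨a, ha⟩ := Ideal.Quotient.mk_surjective (f n)
    have hm := hf h
    rw [← ha] at hm
    simp only [← ha, ← hm]
    rfl⟩

theorem evalₐ_ofCompatible {R : Type*} [CommRing R] (I : Ideal R) (f : ∀ n, R ⧸ I ^ n)
    (hf : ∀ {m n : ℕ} (h : m ≤ n), Ideal.Quotient.factorPow I h (f n) = f m) (n : ℕ) :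
    AdicCompletion.evalₐ I n (ofCompatible I f hf) = f n := by
  rw [← AdicCompletion.factor_eval_eq_evalₐ I _ (le_of_eq (Ideal.mul_top _))]
  obtain ⟨a, ha⟩ := Ideal.Quotient.mk_surjective (f n)
  change Ideal.Quotient.factor (by simp) (Ideal.Quotient.factor (by simp) (f n)) = f n
  rw [← ha]
  rfl

theorem der_mem_pow (I : Ideal A) (D : Derivation ℂ A A) (n : ℕ) :
    ∀ x ∈ I ^ (n + 1), D x ∈ I ^ n := by
  induction n with
  | zero => intro x _; simp
  | succ n ih =>
    intro x hx
    rw [pow_succ (n := n + 1)] at hx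
    refine Submodule.mul_induction_on hx ?_ ?_
    · intro a ha b hb
      rw [Derivation.leibniz]
      refine Ideal.add_mem _ (Ideal.mul_mem_right _ _ ha) ?_
      rw [smul_eq_mul, mul_comm, pow_succ]
      exact Ideal.mul_mem_mul (ih a ha) hb
    · intro a b ha hb
      rw [map_add]
      exact Ideal.add_mem _ ha hb

/-- The map `A / I ^ (n + 1) → A / I ^ n` induced by a derivation of `A`. -/
def derQuot (I : Ideal A) (D : Derivation ℂ A A) (n : ℕ) : A ⧸ I ^ (n + 1) →+ A ⧸ I ^ n :=
  QuotientAddGroup.map (I ^ (n + 1)).toAddSubgroup (I ^ n).toAddSubgroup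
    (D : A →ₗ[ℂ] A).toAddMonoidHom (fun x hx => der_mem_pow I D n x hx)

theorem derQuot_mk (I : Ideal A) (D : Derivation ℂ A A) (n : ℕ) (a : A) :
    derQuot I D n (Ideal.Quotient.mk _ a) = Ideal.Quotient.mk _ (D a) := rfl

theorem extendFun_compat (I : Ideal A) (D : Derivation ℂ A A) (x : AdicCompletion I A)
    {m n : ℕ} (h : m ≤ n) :
    Ideal.Quotient.factorPow I h (derQuot I D n (AdicCompletion.evalₐ I (n + 1) x))
      = derQuot I D m (AdicCompletion.evalₐ I (m + 1) x) := by
  obtain ⟨c, rfl⟩ := AdicCompletion.mk_surjective I A x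
  have h1 : AdicCompletion.evalₐ I (m + 1) (AdicCompletion.mk I A c)
      = Ideal.Quotient.mk _ (c.val (n + 1)) := by
    rw [AdicCompletion.evalₐ_mk]
    exact (AdicCompletion.Ideal.mk_eq_mk I (by omega : m + 1 ≤ n + 1) c).symm
  rw [h1, AdicCompletion.evalₐ_mk]
  rfl

/-- The underlying function of the continuous extension of a derivation to a completion. -/
def extendFun (I : Ideal A) (D : Derivation ℂ A A) (x : AdicCompletion I A) :
    AdicCompletion I A :=
  ofCompatible I (fun n => derQuot I D n (AdicCompletion.evalₐ I (n + 1) x))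
    (extendFun_compat I D x)

theorem evalₐ_extendFun (I : Ideal A) (D : Derivation ℂ A A) (x : AdicCompletion I A) (n : ℕ)
    (a : A) (ha : AdicCompletion.evalₐ I (n + 1) x = Ideal.Quotient.mk _ a) :
    AdicCompletion.evalₐ I n (extendFun I D x) = Ideal.Quotient.mk _ (D a) := by
  have h := evalₐ_ofCompatible I (fun n => derQuot I D n (AdicCompletion.evalₐ I (n + 1) x))
    (extendFun_compat I D x) n
  rw [extendFun, h, ha, derQuot_mk]

theorem exists_rep {R : Type*} [CommRing R] (I : Ideal R) (x : AdicCompletion I R) (n : ℕ) :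
    ∃ a : R, AdicCompletion.evalₐ I (n + 1) x = Ideal.Quotient.mk _ a ∧
      AdicCompletion.evalₐ I n x = Ideal.Quotient.mk _ a := by
  obtain ⟨c, rfl⟩ := AdicCompletion.mk_surjective I R x
  refine ⟨c.val (n + 1), AdicCompletion.evalₐ_mk I (n + 1) c, ?_⟩
  rw [AdicCompletion.evalₐ_mk]
  exact (AdicCompletion.Ideal.mk_eq_mk I (by omega : n ≤ n + 1) c).symm

/-- The continuous extension to the completed local ring at `p` of a (regular) vector field: the
formal vector field at `p` which it defines. -/
def extendDer (p : Pt A) (D : Derivation ℂ A A) : FormalVF p :=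
  Derivation.mk'
    { toFun := extendFun (RingHom.ker p) D
      map_add' := fun x y => by
        refine AdicCompletion.ext_evalₐ fun n => ?_
        obtain ⟨a, ha, -⟩ := exists_rep _ x n
        obtain ⟨b, hb, -⟩ := exists_rep _ y n
        have hx := evalₐ_extendFun _ D x n a ha
        have hy := evalₐ_extendFun _ D y n b hb
        have hs := evalₐ_extendFun _ D (x + y) n (a + b) (by rw [map_add, ha, hb, map_add])
        rw [hs, map_add (AdicCompletion.evalₐ _ n), hx, hy, map_add D, map_add]
      map_smul' := fun c x => by
        refine AdicCompletion.ext_evalₐ fun n => ?_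
        obtain ⟨a, ha, -⟩ := exists_rep _ x n
        have key : ∀ (k : ℕ) (z : FormalRing p),
            AdicCompletion.evalₐ (RingHom.ker p) k (c • z)
              = c • AdicCompletion.evalₐ (RingHom.ker p) k z := fun k z =>
          map_smul ((AdicCompletion.evalₐ (RingHom.ker p) k).restrictScalars ℂ) c z
        rw [RingHom.id_apply, key, evalₐ_extendFun _ D x n a ha,
          evalₐ_extendFun _ D (c • x) n (c • a) (by rw [key, ha]; rfl), D.map_smul]
        rfl }
    (fun x y => by
      refine AdicCompletion.ext_evalₐ fun n => ?_
      obtain ⟨a, ha, ha'⟩ := exists_rep _ x n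
      obtain ⟨b, hb, hb'⟩ := exists_rep _ y n
      change AdicCompletion.evalₐ _ n (extendFun _ D (x * y)) = AdicCompletion.evalₐ _ n
        (x * extendFun _ D y + y * extendFun _ D x)
      have hx := evalₐ_extendFun _ D x n a ha
      have hy := evalₐ_extendFun _ D y n b hb
      have hs := evalₐ_extendFun _ D (x * y) n (a * b) (by rw [map_mul, ha, hb, map_mul])
      rw [hs, map_add (AdicCompletion.evalₐ _ n), map_mul (AdicCompletion.evalₐ _ n),
        map_mul (AdicCompletion.evalₐ _ n), hx, hy, ha', hb', Derivation.leibniz, map_add,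
        smul_eq_mul, smul_eq_mul, map_mul, map_mul])

theorem extendDer_algebraMap (p : Pt A) (D : Derivation ℂ A A) (a : A) :
    extendDer p D (algebraMap A (FormalRing p) a) = algebraMap A (FormalRing p) (D a) := by
  refine AdicCompletion.ext_evalₐ fun n => ?_
  change AdicCompletion.evalₐ _ n (extendFun _ D _) = _
  refine (evalₐ_extendFun _ D _ n a (AdicCompletion.evalₐ_of _ _ a)).trans ?_
  exact (AdicCompletion.evalₐ_of _ _ (D a)).symm

section Functoriality

variable {A' : Type*} [CommRing A'] [Algebra ℂ A']

theorem ker_pow_le (φ : A →ₐ[ℂ] A') (q : Pt A') (n : ℕ) :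
    RingHom.ker (q.comp φ) ^ n ≤ (RingHom.ker q ^ n).comap φ := by
  rw [← Ideal.map_le_iff_le_comap, Ideal.map_pow]
  refine Ideal.pow_right_mono ?_ n
  rw [Ideal.map_le_iff_le_comap]
  intro x hx
  exact hx

/-- The morphism from the completed local ring at `φ(q)` to functions on the infinitesimal
neighbourhood of order `n` of `q`. -/
def formalMapQuot (φ : A →ₐ[ℂ] A') (q : Pt A') (n : ℕ) :
    FormalRing (q.comp φ) →ₐ[ℂ] A' ⧸ RingHom.ker q ^ n :=
  (Ideal.quotientMapₐ (RingHom.ker q ^ n) φ (ker_pow_le φ q n)).comp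
    ((AdicCompletion.evalₐ (RingHom.ker (q.comp φ)) n).restrictScalars ℂ)

theorem formalMapQuot_compat (φ : A →ₐ[ℂ] A') (q : Pt A') {m n : ℕ} (h : m ≤ n) :
    (Ideal.Quotient.factorₐ ℂ (Ideal.pow_le_pow_right h)).comp (formalMapQuot φ q n)
      = formalMapQuot φ q m := by
  refine AlgHom.ext fun x => ?_
  obtain ⟨c, rfl⟩ := AdicCompletion.mk_surjective _ _ x
  have h1 : AdicCompletion.evalₐ (RingHom.ker (q.comp φ)) m (AdicCompletion.mk _ A c)
      = Ideal.Quotient.mk _ (c.val n) := by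
    rw [AdicCompletion.evalₐ_mk]
    exact (AdicCompletion.Ideal.mk_eq_mk _ h c).symm
  simp only [AlgHom.comp_apply, formalMapQuot, AlgHom.restrictScalars_apply]
  rw [h1, AdicCompletion.evalₐ_mk]
  rfl

/-- The morphism of completed local rings induced by a morphism of affine varieties. -/
def formalMap (φ : A →ₐ[ℂ] A') (q : Pt A') : FormalRing (q.comp φ) →ₐ[ℂ] FormalRing q :=
  AdicCompletion.liftAlgHom (RingHom.ker q) (formalMapQuot φ q) (formalMapQuot_compat φ q)

theorem formalMap_algebraMap (φ : A →ₐ[ℂ] A') (q : Pt A') (a : A) :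
    formalMap φ q (algebraMap A _ a) = algebraMap A' _ (φ a) := by
  refine AdicCompletion.ext_evalₐ fun n => ?_
  exact AdicCompletion.evalₐ_liftAlgHom (RingHom.ker q) (formalMapQuot φ q)
    (formalMapQuot_compat φ q) n _

/-- `X` is tangent to the image of the closed embedding `φ` and restricts there to `Z`. -/
def RestrictsTo (φ : A →ₐ[ℂ] A') (q : Pt A')
    (X : FormalVF (q.comp φ)) (Z : FormalVF q) : Prop :=
  ∀ f, formalMap φ q (X f) = Z (formalMap φ q f)

end Functoriality

end Formal

/-! ### The bundle of jets of vector fields -/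

section Jets

variable (A : Type*) [CommRing A] [Algebra ℂ A]

/-- The total space of the bundle `J(TM/M)` of jets of infinite order of vector fields: pairs of
a point and a formal vector field at this point. -/
abbrev Jet : Type _ := Σ p : Pt A, FormalVF p

/-- Linear maps, at each point, from formal vector fields to formal functions. -/
abbrev FormalOp : Type _ := ∀ p : Pt A, FormalVF p →ₗ[ℂ] FormalRing p

variable {A}

/-- The operator `X ↦ da(X) = X a`. -/
def diffOfFun (a : A) : FormalOp A := fun p =>
  { toFun := fun X => X (algebraMap A (FormalRing p) a)
    map_add' := fun _ _ => rfl
    map_smul' := fun _ _ => rfl }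

/-- The composition of an operator with a regular vector field. -/
def derComp (D : Derivation ℂ A A) (θ : FormalOp A) : FormalOp A := fun p =>
  (extendDer p D : FormalRing p →ₗ[ℂ] FormalRing p) ∘ₗ θ p

/-- The value at `p` of the function obtained by applying an operator: the coupling of an operator
with a formal vector field. -/
def couple (θ : FormalOp A) (p : Pt A) : FormalVF p →ₗ[ℂ] ℂ :=
  (evalAt p).toLinearMap ∘ₗ θ p

variable (A)

/-- Regular differential operators of order at most `k` from vector fields to functions: spanned
over `A` by the operators `X ↦ D₁ (⋯ (Dⱼ (X a)))` with `j ≤ k`. -/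
def diffOp : ℕ → Submodule A (FormalOp A)
  | 0 => Submodule.span A (Set.range diffOfFun)
  | k + 1 => diffOp k ⊔
      Submodule.span A {η | ∃ (D : Derivation ℂ A A) (θ : FormalOp A), θ ∈ diffOp k ∧
        η = derComp D θ}

/-- Regular functions on the variety `J_k(TM/M)` of jets of order `k`, as functions on `J(TM/M)`:
the algebra generated by the functions on `M` and by the couplings with operators of order at
most `k`. -/
def jetFun (k : ℕ) : Subalgebra ℂ (Jet A → ℂ) :=
  Algebra.adjoin ℂ
    ({f | ∃ a : A, f = fun x => x.1 a} ∪
      {f | ∃ θ ∈ diffOp A k, f = fun x => couple θ x.1 x.2})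

/-- The Zariski topology of `J_k(TM/M)`, pulled back to `J(TM/M)`. -/
@[reducible] def jetTopology (k : ℕ) : TopologicalSpace (Jet A) :=
  TopologicalSpace.generateFrom {U | ∃ f ∈ jetFun A k, U = {x | f x ≠ 0}}

/-- The initial topology on `J(TM/M)` with respect to all projections to `J_k(TM/M)`. -/
@[reducible] def proTopology : TopologicalSpace (Jet A) := ⨅ k, jetTopology A k

variable {A}

/-- For `L` in `J(TM/M)`, the Zariski closure `L_k` of its projection to `J_k(TM/M)`, pulled back
to `J(TM/M)`. -/
def jetClosure (k : ℕ) (L : Set (Jet A)) : Set (Jet A) := @closure (Jet A) (jetTopology A k) L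

/-- `L` is a rational linear sub-bundle of `J(TM/M)`: an irreducible closed subset such that for
every `k` the restriction of `L_k` to some nonempty Zariski open subset of `M` is a linear
sub-bundle of `J_k(TM/M)`, that is, the kernel of `r` everywhere linearly independent linear
functions on `J_k(TM/M)`. -/
structure IsRationalSubbundle (L : Set (Jet A)) : Prop where
  closed : @IsClosed (Jet A) (proTopology A) L
  irreducible : @IsIrreducible (Jet A) (proTopology A) L
  bundle : ∀ k, ∃ g : A, g ≠ 0 ∧ ∃ (r : ℕ) (θ : Fin r → FormalOp A),
    (∀ i, θ i ∈ diffOp A k) ∧ ∀ p : Pt A, p g ≠ 0 →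
      LinearIndependent ℂ (fun i => couple (θ i) p) ∧
      ∀ X : FormalVF p, (⟨p, X⟩ : Jet A) ∈ jetClosure k L ↔ ∀ i, couple (θ i) p X = 0

/-- The differential operator `θ` vanishes along `L`. As `L` is irreducible and dominates `M`, a
rational operator annihilates `L` if and only if its regular multiples do. -/
def Annihilates (θ : FormalOp A) (L : Set (Jet A)) : Prop :=
  ∀ x ∈ L, couple θ x.1 x.2 = 0

/-- A `𝒟`-Lie algebra: a rational linear sub-bundle of `J(TM/M)` whose fibres are generically
closed under the bracket of formal vector fields (the bracket of rational sections of `J(TM/M)` is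
computed fibrewise, so that this says that the rational sections of `L` form a Lie algebra), and
whose annihilator is stable under the composition with vector fields. -/
structure IsDLieAlgebra (L : Set (Jet A)) : Prop extends IsRationalSubbundle L where
  lie : Generically A fun p => ∀ X Y : FormalVF p,
    (⟨p, X⟩ : Jet A) ∈ L → (⟨p, Y⟩ : Jet A) ∈ L → (⟨p, ⁅X, Y⁆⟩ : Jet A) ∈ L
  ann_stable : ∀ (k : ℕ), ∀ θ ∈ diffOp A k, Annihilates θ L →
    ∀ D : Derivation ℂ A A, Annihilates (derComp D θ) L

end Jets

/-! ### Rational forms and their Lie derivatives -/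

section Forms

variable (A : Type*) [CommRing A] [Algebra ℂ A]

/-- The pull-back of `m`-forms along a morphism of algebras. -/
def formMap (A' : Type*) [CommRing A'] [Algebra ℂ A'] [Algebra A A'] [IsScalarTower ℂ A A']
    (m : ℕ) : ⋀[A]^m Ω[A⁄ℂ] →ₗ[A] ⋀[A']^m Ω[A'⁄ℂ] :=
  exteriorPower.alternatingMapLinearEquiv
    { toMultilinearMap :=
        ((exteriorPower.ιMulti A' m (M := Ω[A'⁄ℂ])).toMultilinearMap.restrictScalars A).compLinearMap
          (fun _ => KaehlerDifferential.map ℂ ℂ A A')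
      map_eq_zero_of_eq' := fun v i j h hij => by
        exact (exteriorPower.ιMulti A' m (M := Ω[A'⁄ℂ])).map_eq_zero_of_eq
          (fun i => KaehlerDifferential.map ℂ ℂ A A' (v i)) (by simp only [h]) hij }

variable {A} {m : ℕ}

/-- The value `α(Y₁, …, Yₘ)` of a regular `m`-form on formal vector fields at `p`; for
`α = da₁ ∧ ⋯ ∧ daₘ` it is the determinant of `(Yᵢ aⱼ)`. -/
def evalForm (p : Pt A) (Y : Fin m → FormalVF p) : ⋀[A]^m Ω[A⁄ℂ] →ₗ[A] FormalRing p :=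
  exteriorPower.alternatingMapLinearEquiv
    { toMultilinearMap :=
        ((Matrix.detRowAlternating (n := Fin m) (R := FormalRing p)).toMultilinearMap.restrictScalars
          A).compLinearMap
          (fun _ => LinearMap.pi fun i => ((Y i).compAlgebraMap A).liftKaehlerDifferential)
      map_eq_zero_of_eq' := fun v i j h hij => by
        exact (Matrix.detRowAlternating (n := Fin m) (R := FormalRing p)).map_eq_zero_of_eq
          (fun k => LinearMap.pi (fun i => ((Y i).compAlgebraMap A).liftKaehlerDifferential) (v k))
          (by simp only [h]) hij }

/-- The value `(Lie_X α)(Y₁, …, Yₘ)` of the Lie derivative of a regular `m`-form. -/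
def lieDeriv (p : Pt A) (X : FormalVF p) (α : ⋀[A]^m Ω[A⁄ℂ]) (Y : Fin m → FormalVF p) :
    FormalRing p :=
  X (evalForm p Y α) - ∑ i, evalForm p (Function.update Y i ⁅X, Y i⁆) α

variable {K : Type*} [CommRing K] [Algebra ℂ K] [Algebra A K] [IsScalarTower ℂ A K]

/-- The formal meromorphic form `Lie_X ω` vanishes on all `m`-tuples of formal vector fields in
`T`, where `ω` is a rational `m`-form. With `g ω = α` regular one has
`g² Lie_X ω = g Lie_X α - X(g) α`. -/
def LieVanishesOn (p : Pt A) (X : FormalVF p) (ω : ⋀[K]^m Ω[K⁄ℂ]) (T : Set (FormalVF p)) : Prop :=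
  ∃ g ∈ nonZeroDivisors A, ∃ α : ⋀[A]^m Ω[A⁄ℂ], algebraMap A K g • ω = formMap A K m α ∧
    ∀ Y : Fin m → FormalVF p, (∀ i, Y i ∈ T) →
      algebraMap A (FormalRing p) g * lieDeriv p X α Y
        = X (algebraMap A (FormalRing p) g) * evalForm p Y α

/-- The rational form `ω` on the variety of `A` restricts to the rational form `η` on the variety
of `A'`: for some regular multiple `α = g ω`, with `g` a nonzerodivisor on the subvariety, the
restriction of `α` is `g η`. -/
def FormRestrictsTo (A' K' : Type*) [CommRing A'] [Algebra ℂ A'] [Algebra A A']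
    [IsScalarTower ℂ A A'] [CommRing K'] [Algebra ℂ K'] [Algebra A' K'] [IsScalarTower ℂ A' K']
    (ω : ⋀[K]^m Ω[K⁄ℂ]) (η : ⋀[K']^m Ω[K'⁄ℂ]) : Prop :=
  ∃ (g : A) (α : ⋀[A]^m Ω[A⁄ℂ]), algebraMap A A' g ∈ nonZeroDivisors A' ∧
    algebraMap A K g • ω = formMap A K m α ∧
    algebraMap A' K' (algebraMap A A' g) • η = formMap A' K' m (formMap A A' m α)

end Forms

/-! ### Submersions, restriction to the fibres -/

section Submersion

variable {B : Type*} [CommRing B] [Algebra ℂ B]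
variable (A : Type*) [CommRing A] [Algebra ℂ A] [Algebra B A]

/-- The coordinate ring of the fibre over the point `s`. -/
abbrev FibreRing (s : Pt B) : Type _ := A ⧸ (RingHom.ker s).map (algebraMap B A)

/-- The inclusion of the fibre over `s`. -/
abbrev fibreIncl (s : Pt B) : A →ₐ[ℂ] FibreRing A s := Ideal.Quotient.mkₐ ℂ _

variable {A}

/-- The formal vector field `X` is tangent to the fibres of `ρ`, that is `dρ(X) = 0`. -/
def IsVertical (B : Type*) [CommRing B] [Algebra B A] {p : Pt A} (X : FormalVF p) : Prop :=
  ∀ b : B, X (algebraMap A (FormalRing p) (algebraMap B A b)) = 0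

/-- The restriction of `L` to the fibre over `s`, as a set of formal vector fields on the fibre. -/
def restrictFibre (L : Set (Jet A)) (s : Pt B) : Set (Jet (FibreRing A s)) :=
  {z | ∃ X : FormalVF (z.1.comp (fibreIncl A s)),
    (⟨z.1.comp (fibreIncl A s), X⟩ : Jet A) ∈ L ∧ RestrictsTo (fibreIncl A s) z.1 X z.2}

end Submersion

/-- The dimension of an irreducible variety with function field `K`. -/
def varietyDim (K : Type*) [Field K] [Algebra ℂ K] : ℕ := Cardinal.toNat (Algebra.trdeg ℂ K)

/-! ### Singular foliations -/

section Foliations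

variable {A : Type*} [CommRing A] [Algebra ℂ A]
variable {K : Type*} [Field K] [Algebra ℂ K] [Algebra A K]

/-- A singular foliation: a rational linear sub-bundle of the tangent bundle, given by its space of
rational sections over the function field `K`, which is closed under the Lie bracket. -/
def IsFoliation (H : Submodule K (Derivation ℂ K K)) : Prop :=
  ∀ Y ∈ H, ∀ Z ∈ H, ⁅Y, Z⁆ ∈ H

/-- The regular vector fields tangent to `H`. They span `H` over `K`. -/
def regularFields (A : Type*) [CommRing A] [Algebra ℂ A] [Algebra A K]
    (H : Submodule K (Derivation ℂ K K)) : Set (Derivation ℂ A A) :=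
  {D | ∃ Y ∈ H, ∀ a, Y (algebraMap A K a) = algebraMap A K (D a)}

/-- The formal vector field `Z` is tangent to `H`: it is a combination, with formal meromorphic
coefficients, of vector fields tangent to `H`. -/
def IsTangentTo (H : Submodule K (Derivation ℂ K K)) (p : Pt A) (Z : FormalVF p) : Prop :=
  ∃ g ∈ nonZeroDivisors (FormalRing p),
    g • Z ∈ Submodule.span (FormalRing p) (extendDer p '' regularFields A H)

/-- `[X, Y]` is tangent to `H` for all rational `Y` tangent to `H`. By the Leibniz rule it is
enough to test this on regular `Y`, because these span `H` over `K`. -/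
def Normalizes (p : Pt A) (X : FormalVF p) (H : Submodule K (Derivation ℂ K K)) : Prop :=
  ∀ D ∈ regularFields A H, IsTangentTo H p ⁅X, extendDer p D⁆

/-- `H` is projectable with projection `F`: the sub-bundles `dρ(H)` and `ρ^* F` of `ρ^* TS`
agree. Here `k` and `K` are the function fields of `S` and `M`, rational sections of `ρ^* TS` are
derivations from `k` to `K`, and `dρ` restricts a derivation of `K` to `k`. -/
def ProjectsTo {k : Type*} [Field k] [Algebra ℂ k] [Algebra k K] [IsScalarTower ℂ k K]
    (H : Submodule K (Derivation ℂ K K)) (F : Submodule k (Derivation ℂ k k)) : Prop :=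
  H.map (Derivation.compAlgebraMapL ℂ k K K)
    = Submodule.span K ((fun Y => (Algebra.linearMap k K).compDer Y) '' (F : Set (Derivation ℂ k k)))

end Foliations

end KisoMorimoto

end

set_option linter.unusedSectionVars false
set_option linter.unusedSimpArgs false

noncomputable section

namespace KisoMorimoto

/-! ### Linear differential operators on vertical vector fields

An operator is a finite combination of the divided powers `∂^α / α!` applied to the components of
a vertical vector field. The exponents involve base directions (`inl`) and fibre directions
(`inr`). -/

section Operators

open Finsupp

variable {κ : Type} [Fintype κ] {m : ℕ}

/-- Exponents of monomials in base and fibre directions. -/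
abbrev Expo (κ : Type) (m : ℕ) : Type := (κ ⊕ Fin m) →₀ ℕ

/-- The space of linear differential operators on vertical vector fields. -/
abbrev Op (κ : Type) (m : ℕ) (K : Type*) [Field K] : Type _ := (Fin m × Expo κ m) →₀ K

/-- The exponent of a single direction. -/
abbrev unitE (j : κ ⊕ Fin m) : Expo κ m := Finsupp.single j 1

/-- Degree in the base directions. -/
def sdeg (α : Expo κ m) : ℕ := ∑ k, α (Sum.inl k)

/-- Degree in the fibre directions. -/
def ydeg (α : Expo κ m) : ℕ := ∑ l, α (Sum.inr l)

@[simp] theorem sdeg_zero : sdeg (0 : Expo κ m) = 0 := by simp [sdeg]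
@[simp] theorem ydeg_zero : ydeg (0 : Expo κ m) = 0 := by simp [ydeg]
@[simp] theorem sdeg_add (α β : Expo κ m) : sdeg (α + β) = sdeg α + sdeg β := by
  simp [sdeg, Finset.sum_add_distrib]
@[simp] theorem ydeg_add (α β : Expo κ m) : ydeg (α + β) = ydeg α + ydeg β := by
  simp [ydeg, Finset.sum_add_distrib]
@[simp] theorem sdeg_inl (k : κ) : sdeg (unitE (m := m) (Sum.inl k)) = 1 := by
  classical simp [sdeg, unitE, Finsupp.single_apply]
@[simp] theorem sdeg_inr (l : Fin m) : sdeg (unitE (κ := κ) (Sum.inr l)) = 0 := by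
  classical simp [sdeg, unitE, Finsupp.single_apply]
@[simp] theorem ydeg_inl (k : κ) : ydeg (unitE (m := m) (Sum.inl k)) = 0 := by
  classical simp [ydeg, unitE, Finsupp.single_apply]
@[simp] theorem ydeg_inr (l : Fin m) : ydeg (unitE (κ := κ) (Sum.inr l)) = 1 := by
  classical simp [ydeg, unitE, Finsupp.single_apply]

theorem expo_ext {α β : Expo κ m} (h1 : ∀ k, α (Sum.inl k) = β (Sum.inl k))
    (h2 : ∀ l, α (Sum.inr l) = β (Sum.inr l)) : α = β := by
  ext (k | l)
  · exact h1 k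
  · exact h2 l

theorem inl_eq_zero_of_sdeg {α : Expo κ m} (h : sdeg α = 0) (k : κ) : α (Sum.inl k) = 0 := by
  simpa [sdeg] using (Finset.sum_eq_zero_iff.mp h) k (Finset.mem_univ _)

theorem inr_eq_zero_of_ydeg {α : Expo κ m} (h : ydeg α = 0) (l : Fin m) : α (Sum.inr l) = 0 := by
  simpa [ydeg] using (Finset.sum_eq_zero_iff.mp h) l (Finset.mem_univ _)

/-- The base part of an exponent. -/
def spart (α : Expo κ m) : Expo κ m :=
  Finsupp.equivFunOnFinite.symm (Sum.elim (fun k => α (Sum.inl k)) (fun _ => 0))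

/-- The fibre part of an exponent. -/
def ypart (α : Expo κ m) : Expo κ m :=
  Finsupp.equivFunOnFinite.symm (Sum.elim (fun _ => 0) (fun l => α (Sum.inr l)))

@[simp] theorem spart_inl (α : Expo κ m) (k : κ) : spart α (Sum.inl k) = α (Sum.inl k) := rfl
@[simp] theorem spart_inr (α : Expo κ m) (l : Fin m) : spart α (Sum.inr l) = 0 := rfl
@[simp] theorem ypart_inl (α : Expo κ m) (k : κ) : ypart α (Sum.inl k) = 0 := rfl
@[simp] theorem ypart_inr (α : Expo κ m) (l : Fin m) : ypart α (Sum.inr l) = α (Sum.inr l) := rfl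

theorem spart_add_ypart (α : Expo κ m) : spart α + ypart α = α :=
  expo_ext (by simp) (by simp)

@[simp] theorem sdeg_spart (α : Expo κ m) : sdeg (spart α) = sdeg α := by simp [sdeg]
@[simp] theorem ydeg_spart (α : Expo κ m) : ydeg (spart α) = 0 := by simp [ydeg]
@[simp] theorem sdeg_ypart (α : Expo κ m) : sdeg (ypart α) = 0 := by simp [sdeg]
@[simp] theorem ydeg_ypart (α : Expo κ m) : ydeg (ypart α) = ydeg α := by simp [ydeg]

variable {K : Type*} [Field K]

/-- The pairing of operators with formal vertical vector fields at the generic point, given by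
their Taylor series. -/
def pair (X : Fin m → MvPowerSeries (κ ⊕ Fin m) K) : Op κ m K →ₗ[K] K :=
  Finsupp.linearCombination K fun p => MvPowerSeries.coeff p.2 (X p.1)

@[simp] theorem pair_single (X : Fin m → MvPowerSeries (κ ⊕ Fin m) K) (p : Fin m × Expo κ m)
    (c : K) : pair X (single p c) = c * MvPowerSeries.coeff p.2 (X p.1) := by
  simp [pair]

theorem exists_pair_eq (φ : Op κ m K →ₗ[K] K) :
    ∃ X : Fin m → MvPowerSeries (κ ⊕ Fin m) K, pair X = φ := by
  let X : Fin m → MvPowerSeries (κ ⊕ Fin m) K := fun i α => φ (single (i, α) 1)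
  refine ⟨X, Finsupp.lhom_ext fun p c => ?_⟩
  have h1 : single p c = c • single p (1 : K) := by simp
  have h2 : MvPowerSeries.coeff p.2 (X p.1) = φ (single p 1) := rfl
  rw [pair_single, h1, map_smul, smul_eq_mul, h2]

/-- The bracket of formal vertical vector fields. -/
def vbracket {R : Type*} [CommRing R] (X Y : Fin m → MvPowerSeries (κ ⊕ Fin m) R) :
    Fin m → MvPowerSeries (κ ⊕ Fin m) R := fun i =>
  ∑ j, (X j * MvPowerSeries.pderiv R (Sum.inr j) (Y i)
    - Y j * MvPowerSeries.pderiv R (Sum.inr j) (X i))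

/-- Multiplication of operators by a direction. -/
def shift (j : κ ⊕ Fin m) : Op κ m K →ₗ[K] Op κ m K :=
  Finsupp.linearCombination K fun p => single (p.1, p.2 + unitE j) ((p.2 j : K) + 1)

@[simp] theorem shift_single (j : κ ⊕ Fin m) (p : Fin m × Expo κ m) (c : K) :
    shift j (single p c) = single (p.1, p.2 + unitE j) (c * ((p.2 j : K) + 1)) := by
  rw [shift, Finsupp.linearCombination_single, Finsupp.smul_single, smul_eq_mul]

/-- Differentiation of the coefficients of an operator. -/
def coefD [Algebra ℂ K] (δ : Derivation ℂ K K) : Op κ m K →+ Op κ m K :=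
  Finsupp.mapRange.addMonoidHom (δ : K →ₗ[ℂ] K).toAddMonoidHom

@[simp] theorem coefD_single [Algebra ℂ K] (δ : Derivation ℂ K K) (p : Fin m × Expo κ m) (c : K) :
    coefD δ (single p c) = single p (δ c) := by
  simp [coefD]

@[simp] theorem coefD_apply [Algebra ℂ K] (δ : Derivation ℂ K K) (θ : Op κ m K)
    (p : Fin m × Expo κ m) : coefD δ θ p = δ (θ p) := by
  simp [coefD]

/-- The composition of an operator with a derivation of the coefficient field. -/
def dmul [Algebra ℂ K] (δ : κ ⊕ Fin m → Derivation ℂ K K) (j : κ ⊕ Fin m) :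
    Op κ m K →+ Op κ m K :=
  (shift j : Op κ m K →ₗ[K] Op κ m K).toAddMonoidHom + coefD (δ j)

theorem dmul_apply [Algebra ℂ K] (δ : κ ⊕ Fin m → Derivation ℂ K K) (j : κ ⊕ Fin m)
    (θ : Op κ m K) : dmul δ j θ = shift j θ + coefD (δ j) θ := rfl

/-- Stability under composition with derivations. -/
def DStable [Algebra ℂ K] (δ : κ ⊕ Fin m → Derivation ℂ K K) (N : Submodule K (Op κ m K)) : Prop :=
  ∀ j, ∀ θ ∈ N, dmul δ j θ ∈ N

open Classical in
/-- The adjoint of the bracket with a formal vector field. -/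
def contr (X : Fin m → MvPowerSeries (κ ⊕ Fin m) K) : Op κ m K →ₗ[K] Op κ m K :=
  Finsupp.linearCombination K fun p => ∑ q ∈ Finset.HasAntidiagonal.antidiagonal p.2, ∑ j : Fin m,
    (single (p.1, q.1 + unitE (Sum.inr j))
        (((q.1 (Sum.inr j) : K) + 1) * MvPowerSeries.coeff q.2 (X j))
      - single (j, q.1) (((q.2 (Sum.inr j) : K) + 1)
          * MvPowerSeries.coeff (q.2 + unitE (Sum.inr j)) (X p.1)))

open Classical in
theorem contr_single (X : Fin m → MvPowerSeries (κ ⊕ Fin m) K) (p : Fin m × Expo κ m) (c : K) :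
    contr X (single p c) = c • ∑ q ∈ Finset.HasAntidiagonal.antidiagonal p.2, ∑ j : Fin m,
    (single (p.1, q.1 + unitE (Sum.inr j))
        (((q.1 (Sum.inr j) : K) + 1) * MvPowerSeries.coeff q.2 (X j))
      - single (j, q.1) (((q.2 (Sum.inr j) : K) + 1)
          * MvPowerSeries.coeff (q.2 + unitE (Sum.inr j)) (X p.1))) := by
  rw [contr, Finsupp.linearCombination_single]

theorem pair_contr (X Y : Fin m → MvPowerSeries (κ ⊕ Fin m) K) (θ : Op κ m K) :
    pair Y (contr X θ) = pair (vbracket X Y) θ := by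
  classical
  induction θ using Finsupp.induction_linear with
  | zero => simp
  | add f g hf hg => simp only [map_add, hf, hg]
  | single p c =>
    rw [contr_single, map_smul, pair_single, smul_eq_mul, vbracket, map_sum, map_sum]
    congr 1
    simp only [map_sum]
    rw [Finset.sum_comm]
    refine Finset.sum_congr rfl fun j _ => ?_
    rw [map_sub, mul_comm (X j), MvPowerSeries.coeff_mul, MvPowerSeries.coeff_mul,
      ← Finset.sum_sub_distrib]
    refine Finset.sum_congr rfl fun q _ => ?_
    simp only [map_sub, pair_single, MvPowerSeries.coeff_pderiv]
    ring

/-- The formal vector fields annihilated by a space of operators. -/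
def perp (N : Submodule K (Op κ m K)) : Set (Fin m → MvPowerSeries (κ ⊕ Fin m) K) :=
  {X | ∀ θ ∈ N, pair X θ = 0}

theorem mem_of_perp (N : Submodule K (Op κ m K)) (θ : Op κ m K)
    (h : ∀ X ∈ perp N, pair X θ = 0) : θ ∈ N := by
  by_contra hθ
  obtain ⟨φ, h1, h2⟩ := Submodule.exists_le_ker_of_notMem hθ
  obtain ⟨X, hX⟩ := exists_pair_eq φ
  exact h1 (hX ▸ h X fun τ hτ => by rw [hX]; exact h2 hτ)

/-- A linear functional on a subspace `U` vanishing on `N ⊓ U` extends to a functional vanishing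
on `N`. -/
theorem exists_functional_extending {V : Type*} [AddCommGroup V] [Module K V] (N U : Submodule K V)
    (z : V →ₗ[K] K) (h : ∀ θ ∈ N, θ ∈ U → z θ = 0) :
    ∃ φ : V →ₗ[K] K, (∀ θ ∈ N, φ θ = 0) ∧ ∀ θ ∈ U, φ θ = z θ := by
  let g : U →ₗ[K] (V ⧸ N) := N.mkQ ∘ₗ U.subtype
  have hz : z ∘ₗ U.subtype ∈ LinearMap.range g.dualMap := by
    rw [LinearMap.range_dualMap_eq_dualAnnihilator_ker, Submodule.mem_dualAnnihilator]
    intro u hu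
    refine h u ?_ u.2
    simpa [g] using hu
  obtain ⟨φ, hφ⟩ := hz
  refine ⟨φ ∘ₗ N.mkQ, fun θ hθ => ?_, fun θ hθ => LinearMap.congr_fun hφ ⟨θ, hθ⟩⟩
  rw [LinearMap.comp_apply, Submodule.mkQ_apply, (Submodule.Quotient.mk_eq_zero N).mpr hθ, map_zero]

theorem exists_perp_extending (N U : Submodule K (Op κ m K)) (z : Op κ m K →ₗ[K] K)
    (h : ∀ θ ∈ N, θ ∈ U → z θ = 0) : ∃ X ∈ perp N, ∀ θ ∈ U, pair X θ = z θ := by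
  obtain ⟨φ, h1, h2⟩ := exists_functional_extending N U z h
  obtain ⟨X, rfl⟩ := exists_pair_eq φ
  exact ⟨X, h1, h2⟩

/-- The annihilated fields form a Lie algebra. -/
def BracketClosed (N : Submodule K (Op κ m K)) : Prop :=
  ∀ X ∈ perp N, ∀ Y ∈ perp N, vbracket X Y ∈ perp N

theorem BracketClosed.contr_mem {N : Submodule K (Op κ m K)} (h : BracketClosed N)
    {X : Fin m → MvPowerSeries (κ ⊕ Fin m) K} (hX : X ∈ perp N) {θ : Op κ m K} (hθ : θ ∈ N) :
    contr X θ ∈ N :=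
  mem_of_perp N _ fun Y hY => by rw [pair_contr]; exact h X hX Y hY θ hθ

/-- Operators whose monomials have base degree less than `a`, or base degree `a` and fibre degree
less than `d`. -/
def Fil (κ : Type) [Fintype κ] (m : ℕ) (K : Type*) [Field K] (a d : ℕ) : Submodule K (Op κ m K) :=
  Finsupp.supported K K {p | sdeg p.2 < a ∨ (sdeg p.2 = a ∧ ydeg p.2 < d)}

theorem single_mem_Fil {a d : ℕ} {p : Fin m × Expo κ m} {c : K}
    (h : sdeg p.2 < a ∨ (sdeg p.2 = a ∧ ydeg p.2 < d)) : single p c ∈ Fil κ m K a d :=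
  Finsupp.single_mem_supported K c h

theorem mem_Fil {a d : ℕ} {θ : Op κ m K} : θ ∈ Fil κ m K a d ↔
    ∀ p, ¬ (sdeg p.2 < a ∨ (sdeg p.2 = a ∧ ydeg p.2 < d)) → θ p = 0 :=
  Finsupp.mem_supported' K θ

/-- To show that a linear map sends a step of the filtration to a submodule one may check it on
monomials. -/
theorem Fil_induction {a d : ℕ} {M : Type*} [AddCommGroup M] [Module K M] (f : Op κ m K →ₗ[K] M)
    (S : Submodule K M)
    (h : ∀ p : Fin m × Expo κ m, (sdeg p.2 < a ∨ (sdeg p.2 = a ∧ ydeg p.2 < d)) →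
      f (single p 1) ∈ S) {θ : Op κ m K} (hθ : θ ∈ Fil κ m K a d) : f θ ∈ S := by
  have : Fil κ m K a d ≤ S.comap f := by
    rw [Fil, Finsupp.supported_eq_span_single, Submodule.span_le]
    rintro _ ⟨p, hp, rfl⟩
    exact h p hp
  exact this hθ

theorem Fil_mono_right {a d d' : ℕ} (h : d ≤ d') : Fil κ m K a d ≤ Fil κ m K a d' := by
  refine Finsupp.supported_mono fun p hp => ?_
  simp only [Set.mem_ofPred_eq] at hp ⊢
  omega

theorem Fil_mono_left {a a' d d' : ℕ} (h : a < a') : Fil κ m K a d ≤ Fil κ m K a' d' := by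
  refine Finsupp.supported_mono fun p hp => ?_
  simp only [Set.mem_ofPred_eq] at hp ⊢
  omega

theorem exists_mem_Fil {a : ℕ} {θ : Op κ m K} (hθ : θ ∈ Fil κ m K (a + 1) 0) :
    ∃ d, θ ∈ Fil κ m K a d := by
  refine ⟨(θ.support.sup fun p => ydeg p.2) + 1, ?_⟩
  intro p hp
  have h1 := hθ hp
  have h2 : ydeg p.2 ≤ θ.support.sup fun p => ydeg p.2 :=
    Finset.le_sup (f := fun p : Fin m × Expo κ m => ydeg p.2) hp
  simp only [Set.mem_ofPred_eq] at h1 ⊢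
  omega

theorem exists_mem_Fil_zero (θ : Op κ m K) : ∃ a, θ ∈ Fil κ m K a 0 := by
  refine ⟨(θ.support.sup fun p => sdeg p.2) + 1, ?_⟩
  intro p hp
  have h2 : sdeg p.2 ≤ θ.support.sup fun p => sdeg p.2 :=
    Finset.le_sup (f := fun p : Fin m × Expo κ m => sdeg p.2) hp
  simp only [Set.mem_ofPred_eq]
  omega

theorem coefD_mem_Fil [Algebra ℂ K] (δ : Derivation ℂ K K) {a d : ℕ} {θ : Op κ m K}
    (hθ : θ ∈ Fil κ m K a d) : coefD δ θ ∈ Fil κ m K a d := by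
  rw [mem_Fil] at hθ ⊢
  intro p hp
  rw [coefD_apply, hθ p hp, map_zero]

theorem shift_inl_mem_Fil (k : κ) {a d : ℕ} {θ : Op κ m K} (hθ : θ ∈ Fil κ m K a d) :
    shift (Sum.inl k) θ ∈ Fil κ m K (a + 1) d := by
  refine Fil_induction (shift (Sum.inl k)) _ (fun p hp => ?_) hθ
  rw [shift_single]
  refine single_mem_Fil ?_
  simp only [sdeg_add, ydeg_add, sdeg_inl, ydeg_inl]
  omega

theorem shift_inr_mem_Fil (l : Fin m) {a d : ℕ} {θ : Op κ m K} (hθ : θ ∈ Fil κ m K a d) :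
    shift (Sum.inr l) θ ∈ Fil κ m K a (d + 1) := by
  refine Fil_induction (shift (Sum.inr l)) _ (fun p hp => ?_) hθ
  rw [shift_single]
  refine single_mem_Fil ?_
  simp only [sdeg_add, ydeg_add, sdeg_inr, ydeg_inr]
  omega

theorem shift_inr_mem_Fil_zero (l : Fin m) {a : ℕ} {θ : Op κ m K} (hθ : θ ∈ Fil κ m K a 0) :
    shift (Sum.inr l) θ ∈ Fil κ m K a 0 := by
  refine Fil_induction (shift (Sum.inr l)) _ (fun p hp => ?_) hθ
  rw [shift_single]
  refine single_mem_Fil ?_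
  simp only [sdeg_add, sdeg_inr]
  omega

theorem contr_mem_Fil_zero (X : Fin m → MvPowerSeries (κ ⊕ Fin m) K) {a : ℕ} {θ : Op κ m K}
    (hθ : θ ∈ Fil κ m K a 0) : contr X θ ∈ Fil κ m K a 0 := by
  classical
  refine Fil_induction (contr X) _ (fun p hp => ?_) hθ
  rw [contr_single]
  refine Submodule.smul_mem _ _ (Submodule.sum_mem _ fun q hq => Submodule.sum_mem _ fun j _ => ?_)
  have h := congrArg sdeg (Finset.HasAntidiagonal.mem_antidiagonal.mp hq)
  rw [sdeg_add] at h
  refine Submodule.sub_mem _ (single_mem_Fil ?_) (single_mem_Fil ?_)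
  · simp only [sdeg_add, sdeg_inr]
    omega
  · simp only
    omega

end Operators

section Symbols

open Finsupp

variable {κ : Type} [Fintype κ] {m : ℕ} {K : Type*} [Field K]

/-- The operators with a single component. -/
def put (i : Fin m) : (Expo κ m →₀ K) →ₗ[K] Op κ m K := Finsupp.lmapDomain K K (Prod.mk i)

@[simp] theorem put_single (i : Fin m) (α : Expo κ m) (c : K) :
    put i (single α c) = single (i, α) c := by
  simp [put, Finsupp.lmapDomain_apply, Finsupp.mapDomain_single]

open Classical in
/-- The coefficient of the fibre monomial `γ` in the `i`-th component. -/
def ycoef (γ : Expo κ m) (i : Fin m) : Op κ m K →ₗ[K] (Expo κ m →₀ K) :=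
  Finsupp.linearCombination K fun p => if p.1 = i ∧ ypart p.2 = γ then single (spart p.2) 1 else 0

open Classical in
theorem ycoef_single (γ : Expo κ m) (i : Fin m) (p : Fin m × Expo κ m) :
    ycoef γ i (single p (1 : K)) =
      if p.1 = i ∧ ypart p.2 = γ then single (spart p.2) 1 else 0 := by
  simp [ycoef]

/-- The coefficient of the fibre monomial `γ` in `η_j θ_i - η_i θ_j`. -/
def curl (i j : Fin m) (γ : Expo κ m) : Op κ m K →ₗ[K] (Expo κ m →₀ K) :=
  (γ (Sum.inr j) : K) • ycoef (γ - unitE (Sum.inr j)) i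
    - (γ (Sum.inr i) : K) • ycoef (γ - unitE (Sum.inr i)) j

theorem eq_tsub_unitE {y γ : Expo κ m} {j : κ ⊕ Fin m} (h : γ j ≠ 0) :
    y = γ - unitE j ↔ y + unitE j = γ := by
  have hle : unitE j ≤ γ := by
    rw [Finsupp.single_le_iff]
    omega
  exact eq_tsub_iff_add_eq_of_le hle

open Classical in
theorem curl_scalar (y γ : Expo κ m) (l j : κ ⊕ Fin m) :
    ((y l : K) + 1) * ((γ j : K) * if y + unitE l = γ - unitE j then 1 else 0)
      = (γ l : K) * (((γ - unitE l) j : ℕ) * if y = γ - unitE l - unitE j then 1 else 0) := by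
  by_cases h : y + unitE l + unitE j = γ
  · have h1 : y + unitE l = γ - unitE j := by rw [← h, add_tsub_cancel_right]
    have h2 : y + unitE j = γ - unitE l := by rw [← h, add_right_comm, add_tsub_cancel_right]
    have h3 : y = γ - unitE l - unitE j := by rw [← h2, add_tsub_cancel_right]
    rw [if_pos h1, if_pos h3, ← h2, ← h]
    by_cases hlj : l = j
    · subst hlj
      simp
      ring
    · simp [hlj, Ne.symm hlj, Finsupp.single_apply]
  · by_cases hj : γ j = 0
    · have : (γ - unitE l) j = 0 := by simp [hj]
      simp [hj, this]
    rw [if_neg (by rwa [eq_tsub_unitE hj])]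
    by_cases hl : γ l = 0
    · simp [hl]
    by_cases hlj : (γ - unitE l) j = 0
    · simp [hlj]
    rw [if_neg]
    · simp
    · rw [eq_tsub_unitE hlj, eq_tsub_unitE hl, add_right_comm]
      exact h

/-- The operators whose top fibre symbol (in fibre degree at most `d` and base degree zero) is
proportional to `(η_1, …, η_m)`. -/
def CurlFree (N : Submodule K (Op κ m K)) : Prop :=
  ∀ d : ℕ, ∀ θ ∈ N, θ ∈ Fil κ m K 0 (d + 1) → ∀ i j : Fin m, ∀ γ : Expo κ m, sdeg γ = 0 →
    ydeg γ = d + 1 → curl i j γ θ = 0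

/-- Leading base symbols of the operators in `N`. -/
def lead (N : Submodule K (Op κ m K)) (a : ℕ) : Submodule K (Expo κ m →₀ K) :=
  Finsupp.supported K K {α | sdeg α = a ∧ ydeg α = 0} ⊓
    ⨅ i, (N ⊔ Fil κ m K a 0).comap (put i)

theorem mem_lead {N : Submodule K (Op κ m K)} {a : ℕ} {f : Expo κ m →₀ K} :
    f ∈ lead N a ↔ f ∈ Finsupp.supported K K {α : Expo κ m | sdeg α = a ∧ ydeg α = 0} ∧
      ∀ i, put i f ∈ N ⊔ Fil κ m K a 0 := by
  simp [lead]

theorem put_mem_Fil {a d e : ℕ} (i : Fin m) {f : Expo κ m →₀ K}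
    (hf : f ∈ Finsupp.supported K K {α : Expo κ m | sdeg α < a ∨ sdeg α = a ∧ ydeg α < d})
    (he : d ≤ e) : put i f ∈ Fil κ m K a e := by
  have : Finsupp.supported K K {α : Expo κ m | sdeg α < a ∨ sdeg α = a ∧ ydeg α < d} ≤
      (Fil κ m K a e).comap (put i) := by
    rw [Finsupp.supported_eq_span_single, Submodule.span_le]
    rintro _ ⟨α, hα, rfl⟩
    simp only [Submodule.comap_coe, Set.mem_preimage, put_single, SetLike.mem_coe]
    simp only [Set.mem_ofPred_eq] at hα
    refine single_mem_Fil ?_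
    simp only
    omega
  exact this hf

theorem put_mem_Fil_of_sym {a : ℕ} (i : Fin m) {f : Expo κ m →₀ K}
    (hf : f ∈ Finsupp.supported K K {α : Expo κ m | sdeg α = a ∧ ydeg α = 0}) :
    put i f ∈ Fil κ m K a 1 := by
  refine put_mem_Fil (d := 1) i (Finsupp.supported_mono (fun α hα => ?_) hf) le_rfl
  simp only [Set.mem_ofPred_eq] at hα ⊢
  omega

theorem eq_spart_of_ydeg {α : Expo κ m} (h : ydeg α = 0) : spart α = α :=
  expo_ext (by simp) (by simp [inr_eq_zero_of_ydeg h])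

theorem eq_ypart_of_sdeg {α : Expo κ m} (h : sdeg α = 0) : ypart α = α :=
  expo_ext (by simp [inl_eq_zero_of_sdeg h]) (by simp)

theorem ypart_eq_zero {α : Expo κ m} (h : ydeg α = 0) : ypart α = 0 :=
  expo_ext (by simp) (by simp [inr_eq_zero_of_ydeg h])

theorem spart_eq_zero {α : Expo κ m} (h : sdeg α = 0) : spart α = 0 :=
  expo_ext (by simp [inl_eq_zero_of_sdeg h]) (by simp)

/-- The top symbol of the contraction with a field vanishing to order `d` along the base. -/
theorem contr_single_top {X : Fin m → MvPowerSeries (κ ⊕ Fin m) K} {d : ℕ}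
    (hX : ∀ i η, sdeg η = 0 → ydeg η ≤ d → MvPowerSeries.coeff η (X i) = 0)
    (p : Fin m × Expo κ m) (hp : ydeg p.2 ≤ d) :
    contr X (single p 1) + ∑ l, single (l, spart p.2) (((p.2 (Sum.inr l) : K) + 1) *
      MvPowerSeries.coeff (ypart p.2 + unitE (Sum.inr l)) (X p.1)) ∈ Fil κ m K (sdeg p.2) 0 := by
  classical
  have hq0 : (spart p.2, ypart p.2) ∈ Finset.HasAntidiagonal.antidiagonal p.2 := by
    rw [Finset.HasAntidiagonal.mem_antidiagonal]
    exact spart_add_ypart _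
  rw [contr_single, one_smul, ← Finset.add_sum_erase _ _ hq0, add_right_comm]
  refine Submodule.add_mem _ ?_ (Submodule.sum_mem _ fun q hq => Submodule.sum_mem _ fun j _ => ?_)
  · rw [← Finset.sum_add_distrib]
    refine Submodule.sum_mem _ fun j _ => ?_
    simp only [hX j (ypart p.2) (by simp) (by simpa using hp), mul_zero, Finsupp.single_zero,
      zero_sub, ypart_inr, neg_add_cancel]
    exact Submodule.zero_mem _
  · obtain ⟨hne, hq⟩ := Finset.mem_erase.mp hq
    rw [Finset.HasAntidiagonal.mem_antidiagonal] at hq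
    have h1 := congrArg sdeg hq
    have h2 := congrArg ydeg hq
    rw [sdeg_add] at h1
    rw [ydeg_add] at h2
    by_cases h3 : sdeg q.2 = 0
    · have hy : ydeg q.1 ≠ 0 := by
        intro h4
        refine hne (Prod.ext ?_ ?_)
        · simp only [← hq]
          exact expo_ext (by simp [inl_eq_zero_of_sdeg h3]) (by simp [inr_eq_zero_of_ydeg h4])
        · simp only [← hq]
          exact expo_ext (by simp [inl_eq_zero_of_sdeg h3]) (by simp [inr_eq_zero_of_ydeg h4])
      rw [hX j q.2 h3 (by omega), hX p.1 (q.2 + unitE (Sum.inr j)) (by simp [h3])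
        (by simp only [ydeg_add, ydeg_inr]; omega)]
      simp only [mul_zero, Finsupp.single_zero, sub_zero]
      exact Submodule.zero_mem _
    · refine Submodule.sub_mem _ (single_mem_Fil ?_) (single_mem_Fil ?_)
      · simp only [sdeg_add, sdeg_inr]
        omega
      · simp only
        omega

variable [CharZero K]

/-- A field with prescribed curl in `N`. -/
theorem exists_curl_field {N : Submodule K (Op κ m K)} (hc : CurlFree N) (i j : Fin m) (d : ℕ)
    (γ : Expo κ m) (h0 : sdeg γ = 0) (hγ : ydeg γ = d + 2) :
    ∃ X ∈ perp N, (∀ l η, sdeg η = 0 → ydeg η ≤ d → MvPowerSeries.coeff η (X l) = 0) ∧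
      ∀ l η, sdeg η = 0 → ydeg η ≤ d + 1 → MvPowerSeries.coeff η (X l)
        = curl i j γ (single (l, η) 1) 0 := by
  classical
  obtain ⟨X, hX, h⟩ := exists_perp_extending N (Fil κ m K 0 (d + 2))
    (Finsupp.lapply 0 ∘ₗ curl i j γ) (fun θ h1 h2 => by
      rw [LinearMap.comp_apply, hc (d + 1) θ h1 h2 i j γ h0 hγ, map_zero])
  have key : ∀ l η, sdeg η = 0 → ydeg η ≤ d + 1 → MvPowerSeries.coeff η (X l)
        = curl i j γ (single (l, η) 1) 0 := by
    intro l η h1 h2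
    have := h (single (l, η) 1) (single_mem_Fil (by simp only; omega))
    simpa using this
  refine ⟨X, hX, fun l η h1 h2 => ?_, key⟩
  rw [key l η h1 (by omega)]
  have aux : ∀ i j : Fin m, (γ (Sum.inr j) : K) • ycoef (γ - unitE (Sum.inr j)) i
      (single (l, η) (1 : K)) = 0 := by
    intro i j
    by_cases hj : γ (Sum.inr j) = 0
    · simp [hj]
    · rw [ycoef_single, if_neg, smul_zero]
      rintro ⟨-, h3⟩
      have h4 := congrArg ydeg ((eq_tsub_unitE hj).mp h3)
      simp only [ydeg_add, ydeg_ypart, ydeg_inr] at h4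
      omega
  simp only [curl, LinearMap.sub_apply, LinearMap.smul_apply, aux, sub_zero, Finsupp.coe_zero,
    Pi.zero_apply]

/-- The contraction with a curl field, up to lower base degree. -/
theorem contr_curl_field {X : Fin m → MvPowerSeries (κ ⊕ Fin m) K} (i j : Fin m) {d : ℕ}
    (γ : Expo κ m)
    (hX : ∀ l η, sdeg η = 0 → ydeg η ≤ d → MvPowerSeries.coeff η (X l) = 0)
    (hX' : ∀ l η, sdeg η = 0 → ydeg η ≤ d + 1 → MvPowerSeries.coeff η (X l)
        = curl i j γ (single (l, η) 1) 0) {a : ℕ} {θ : Op κ m K} (hθ : θ ∈ Fil κ m K a (d + 1)) :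
    contr X θ + ∑ l, put l ((γ (Sum.inr l) : K) • curl i j (γ - unitE (Sum.inr l)) θ)
      ∈ Fil κ m K a 0 := by
  classical
  have hcurl : ∀ (γ : Expo κ m) (p : Fin m × Expo κ m), curl i j γ (single p (1 : K)) =
      single (spart p.2) ((γ (Sum.inr j) : K) * (if p.1 = i then
          (if ypart p.2 = γ - unitE (Sum.inr j) then 1 else 0) else 0)
        - (γ (Sum.inr i) : K) * (if p.1 = j then
          (if ypart p.2 = γ - unitE (Sum.inr i) then 1 else 0) else 0)) := by
    intro γ p
    simp only [curl, LinearMap.sub_apply, LinearMap.smul_apply, ycoef_single, ← ite_and]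
    rw [Finsupp.single_sub]
    congr 1 <;> split_ifs <;> simp
  let f : Op κ m K →ₗ[K] Op κ m K := contr X + ∑ l, put l ∘ₗ
    ((γ (Sum.inr l) : K) • curl i j (γ - unitE (Sum.inr l)))
  have hf : ∀ θ, f θ = contr X θ
      + ∑ l, put l ((γ (Sum.inr l) : K) • curl i j (γ - unitE (Sum.inr l)) θ) := by
    intro θ
    simp [f]
  rw [← hf]
  refine Fil_induction f _ (fun p hp => ?_) hθ
  rw [hf]
  rcases hp with hp | ⟨hp, hd⟩
  · refine Submodule.add_mem _ (contr_mem_Fil_zero X (single_mem_Fil (Or.inl hp)))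
      (Submodule.sum_mem _ fun l _ => ?_)
    rw [hcurl, Finsupp.smul_single, put_single]
    exact single_mem_Fil (Or.inl (by simpa using hp))
  · have h1 := contr_single_top hX p (by omega)
    rw [hp] at h1
    convert h1 using 2
    refine Finset.sum_congr rfl fun l _ => ?_
    rw [hcurl, Finsupp.smul_single, put_single, hX' p.1 _ (by simp) (by simp; omega), hcurl]
    simp only
    have h2 : spart (ypart p.2 + unitE (Sum.inr l)) = 0 := spart_eq_zero (by simp)
    have h3 : ypart (ypart p.2 + unitE (Sum.inr l)) = ypart p.2 + unitE (Sum.inr l) :=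
      eq_ypart_of_sdeg (by simp)
    rw [h2, h3, Finsupp.single_eq_same, smul_eq_mul]
    congr 1
    have s1 := curl_scalar (K := K) (ypart p.2) γ (Sum.inr l) (Sum.inr j)
    have s2 := curl_scalar (K := K) (ypart p.2) γ (Sum.inr l) (Sum.inr i)
    rw [ypart_inr] at s1 s2
    rw [mul_sub, mul_sub]
    congr 1
    · by_cases hi : p.1 = i
      · rw [if_pos hi, if_pos hi]
        exact s1.symm
      · rw [if_neg hi, if_neg hi]
        ring
    · by_cases hi : p.1 = j
      · rw [if_pos hi, if_pos hi]
        exact s2.symm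
      · rw [if_neg hi, if_neg hi]
        ring

/-- The coefficients of the curl of a symbol of `N` are leading base symbols, first for symbols of
fibre degree zero. -/
theorem put_mem_of_sum {N : Submodule K (Op κ m K)} (hb : BracketClosed N) (hc : CurlFree N)
    {a : ℕ} {f : Fin m → (Expo κ m →₀ K)} (hm : 2 ≤ m)
    (hf : ∀ i, f i ∈ Finsupp.supported K K {α : Expo κ m | sdeg α = a ∧ ydeg α = 0})
    (h : ∑ i, put i (f i) ∈ N ⊔ Fil κ m K a 0) (i : Fin m) : f i ∈ lead N a := by
  classical
  have step : ∀ f : Fin m → (Expo κ m →₀ K),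
      (∀ i, f i ∈ Finsupp.supported K K {α : Expo κ m | sdeg α = a ∧ ydeg α = 0}) →
      ∑ i, put i (f i) ∈ N ⊔ Fil κ m K a 0 → ∀ i j, i ≠ j →
      put j (f i) ∈ N ⊔ Fil κ m K a 0 := by
    intro f hf h i j hij
    obtain ⟨X, hX, h1, h2⟩ := exists_curl_field hc i j 0
      (unitE (Sum.inr j) + unitE (Sum.inr j)) (by simp) (by simp)
    obtain ⟨n, hn, u, hu, hnu⟩ := Submodule.mem_sup.mp h
    have h3 := contr_curl_field i j (a := a) (θ := ∑ i, put i (f i)) _ h1 h2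
      (Submodule.sum_mem _ fun i _ => put_mem_Fil_of_sym i (hf i))
    have h4 : contr X (∑ i, put i (f i)) ∈ N ⊔ Fil κ m K a 0 := by
      rw [← hnu, map_add]
      exact Submodule.add_mem_sup (hb.contr_mem hX hn) (contr_mem_Fil_zero X hu)
    have h5 := Submodule.sub_mem _ (Submodule.mem_sup_right (S := N) h3) h4
    rw [add_sub_cancel_left, Finset.sum_eq_single j] at h5
    · have h6 : curl i j (unitE (Sum.inr j) + unitE (Sum.inr j) - unitE (Sum.inr j))
          (∑ i, put i (f i)) = f i := by
        rw [add_tsub_cancel_right, map_sum, Finset.sum_eq_single i]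
        · have : Finsupp.supported K K {α : Expo κ m | sdeg α = a ∧ ydeg α = 0} ≤
              LinearMap.eqLocus (curl i j (unitE (Sum.inr j)) ∘ₗ put i) LinearMap.id := by
            rw [Finsupp.supported_eq_span_single, Submodule.span_le]
            rintro _ ⟨α, hα, rfl⟩
            simp only [Set.mem_ofPred_eq] at hα
            simp [curl, ycoef_single, ypart_eq_zero hα.2, eq_spart_of_ydeg hα.2, hij, Ne.symm hij,
              Finsupp.single_apply]
          exact this (hf i)
        · intro b _ hbi
          have : Finsupp.supported K K {α : Expo κ m | sdeg α = a ∧ ydeg α = 0} ≤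
              LinearMap.ker (curl i j (unitE (Sum.inr j)) ∘ₗ put b) := by
            rw [Finsupp.supported_eq_span_single, Submodule.span_le]
            rintro _ ⟨α, hα, rfl⟩
            simp [curl, ycoef_single, hbi, hij, Ne.symm hij, Finsupp.single_apply]
          exact this (hf b)
        · simp
      rw [h6, map_smul] at h5
      have h7 : (((unitE (Sum.inr j) + unitE (Sum.inr j) : Expo κ m) (Sum.inr j) : ℕ) : K) ≠ 0 := by
        simp
      exact (Submodule.smul_mem_iff _ h7).mp h5
    · intro b _ hb
      simp [hb, Ne.symm hb, Finsupp.single_apply]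
    · simp
  rw [mem_lead]
  refine ⟨hf i, fun j => ?_⟩
  obtain ⟨l, hl⟩ : ∃ l : Fin m, l ≠ i := by
    have : Nontrivial (Fin m) := Fin.nontrivial_iff_two_le.mpr hm
    exact exists_ne i
  by_cases hij : i = j
  · subst hij
    have h1 := step f hf h i l (Ne.symm hl)
    have h2 := step (fun b => if b = l then f i else 0) (fun b => by
      by_cases hb : b = l
      · simpa [hb] using hf i
      · simp [hb]) (by simpa [apply_ite] using h1) l i hl
    simpa using h2
  · exact step f hf h i j hij

/-- Operators of exact base degree `a` and fibre degree at most `d`. -/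
def Homog (κ : Type) [Fintype κ] (m : ℕ) (K : Type*) [Field K] (a d : ℕ) : Submodule K (Op κ m K) :=
  Finsupp.supported K K {p | sdeg p.2 = a ∧ ydeg p.2 ≤ d}

theorem Homog_le_Fil {a d : ℕ} : Homog κ m K a d ≤ Fil κ m K a (d + 1) := by
  refine Finsupp.supported_mono fun p hp => ?_
  simp only [Set.mem_ofPred_eq] at hp ⊢
  omega

theorem ycoef_mem_supported {a d : ℕ} {θ : Op κ m K} (hθ : θ ∈ Homog κ m K a d) (γ : Expo κ m)
    (i : Fin m) : ycoef γ i θ ∈ Finsupp.supported K K {α : Expo κ m | sdeg α = a ∧ ydeg α = 0} := by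
  classical
  have : Homog κ m K a d ≤ (Finsupp.supported K K {α : Expo κ m | sdeg α = a ∧ ydeg α = 0}).comap
      (ycoef γ i) := by
    rw [Homog, Finsupp.supported_eq_span_single, Submodule.span_le]
    rintro _ ⟨p, hp, rfl⟩
    simp only [Submodule.comap_coe, Set.mem_preimage, ycoef_single, SetLike.mem_coe]
    split_ifs
    · exact Finsupp.single_mem_supported K _ (by simpa using hp.1)
    · exact Submodule.zero_mem _
  exact this hθ

theorem curl_mem_supported {a d : ℕ} {θ : Op κ m K} (hθ : θ ∈ Homog κ m K a d) (γ : Expo κ m)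
    (i j : Fin m) :
    curl i j γ θ ∈ Finsupp.supported K K {α : Expo κ m | sdeg α = a ∧ ydeg α = 0} :=
  Submodule.sub_mem _ (Submodule.smul_mem _ _ (ycoef_mem_supported hθ _ _))
    (Submodule.smul_mem _ _ (ycoef_mem_supported hθ _ _))

theorem curl_mem_lead {N : Submodule K (Op κ m K)} (hb : BracketClosed N) (hc : CurlFree N)
    (hm : 2 ≤ m) {a d : ℕ} {θ : Op κ m K} (hθ : θ ∈ N ⊔ Fil κ m K a 0)
    (hθ' : θ ∈ Homog κ m K a d) (i j : Fin m) (γ : Expo κ m) (h0 : sdeg γ = 0)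
    (hγ : ydeg γ = d + 1) : curl i j γ θ ∈ lead N a := by
  classical
  let l : Fin m := ⟨0, by omega⟩
  obtain ⟨X, hX, h1, h2⟩ := exists_curl_field hc i j d (γ + unitE (Sum.inr l)) (by simp [h0])
    (by simp [hγ])
  have h3 := contr_curl_field i j (a := a) (θ := θ) _ h1 h2 (Homog_le_Fil hθ')
  have h4 : contr X θ ∈ N ⊔ Fil κ m K a 0 := by
    obtain ⟨n, hn, u, hu, rfl⟩ := Submodule.mem_sup.mp hθ
    rw [map_add]
    exact Submodule.add_mem_sup (hb.contr_mem hX hn) (contr_mem_Fil_zero X hu)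
  have h5 := Submodule.sub_mem _ (Submodule.mem_sup_right (S := N) h3) h4
  rw [add_sub_cancel_left] at h5
  have h6 := put_mem_of_sum hb hc hm (f := fun b => ((γ + unitE (Sum.inr l) : Expo κ m) (Sum.inr b) : K) • curl i j (γ + unitE (Sum.inr l) - unitE (Sum.inr b)) θ)
    (fun b => Submodule.smul_mem _ _ (curl_mem_supported (a := a) (d := d) hθ' _ i j)) h5 l
  have h7 : ((γ + unitE (Sum.inr l) : Expo κ m) (Sum.inr l) : K) ≠ 0 := by
    rw [Finsupp.add_apply, Finsupp.single_eq_same, Nat.cast_add, Nat.cast_one]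
    exact Nat.cast_add_one_ne_zero _
  rw [add_tsub_cancel_right] at h6
  exact (Submodule.smul_mem_iff (lead N a) h7).mp h6

end Symbols

section Lifting

open Finsupp

variable {κ : Type} [Fintype κ] {m : ℕ} {K : Type*} [Field K] [Algebra ℂ K]
  {δ : κ ⊕ Fin m → Derivation ℂ K K}

theorem shift_inr_mem_sup {N : Submodule K (Op κ m K)} (hN : DStable δ N) (l : Fin m) {a d : ℕ}
    {θ : Op κ m K} (hθ : θ ∈ N ⊔ Fil κ m K a d) (hθ' : θ ∈ Fil κ m K a (d + 1)) :
    shift (Sum.inr l) θ ∈ N ⊔ Fil κ m K a (d + 1) := by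
  obtain ⟨n, hn, w, hw, rfl⟩ := Submodule.mem_sup.mp hθ
  have hn' : n ∈ Fil κ m K a (d + 1) := by
    have := Submodule.sub_mem _ hθ' (Fil_mono_right (Nat.le_succ d) hw)
    rwa [add_sub_cancel_right] at this
  have h : shift (Sum.inr l) (n + w) = dmul δ (Sum.inr l) n
      + (shift (Sum.inr l) w - coefD (δ (Sum.inr l)) n) := by
    rw [map_add, dmul_apply]
    abel
  rw [h]
  exact Submodule.add_mem_sup (hN _ _ hn)
    (Submodule.sub_mem _ (shift_inr_mem_Fil l hw) (coefD_mem_Fil _ hn'))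

theorem shift_inl_mem_sup {N : Submodule K (Op κ m K)} (hN : DStable δ N) (k : κ) {a d : ℕ}
    {θ : Op κ m K} (hθ : θ ∈ N ⊔ Fil κ m K a d) (hθ' : θ ∈ Fil κ m K a (d + 1)) :
    shift (Sum.inl k) θ ∈ N ⊔ Fil κ m K (a + 1) d := by
  obtain ⟨n, hn, w, hw, rfl⟩ := Submodule.mem_sup.mp hθ
  have hn' : n ∈ Fil κ m K a (d + 1) := by
    have := Submodule.sub_mem _ hθ' (Fil_mono_right (Nat.le_succ d) hw)
    rwa [add_sub_cancel_right] at this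
  have h : shift (Sum.inl k) (n + w) = dmul δ (Sum.inl k) n
      + (shift (Sum.inl k) w - coefD (δ (Sum.inl k)) n) := by
    rw [map_add, dmul_apply]
    abel
  rw [h]
  exact Submodule.add_mem_sup (hN _ _ hn)
    (Submodule.sub_mem _ (shift_inl_mem_Fil k hw)
      (Fil_mono_left (Nat.lt_succ_self a) (coefD_mem_Fil _ hn')))

theorem expo_induction {C : Expo κ m → Prop} (h0 : C 0) (hs : ∀ β k, C β → C (β + unitE k))
    (β : Expo κ m) : C β := by
  obtain ⟨n, hn⟩ : ∃ n, β.degree = n := ⟨_, rfl⟩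
  induction n generalizing β with
  | zero =>
    rw [Finsupp.degree_eq_zero_iff] at hn
    exact hn ▸ h0
  | succ n ih =>
    have hne : β ≠ 0 := by
      rintro rfl
      simp at hn
    obtain ⟨k, hk⟩ := Finsupp.ne_iff.mp hne
    have hle : unitE k ≤ β := by
      rw [Finsupp.single_le_iff]
      simp only [Finsupp.coe_zero, Pi.zero_apply] at hk
      omega
    have h := tsub_add_cancel_of_le hle
    rw [← h]
    refine hs _ k (ih _ ?_)
    have h2 := congrArg Finsupp.degree h
    rw [map_add, Finsupp.degree_single] at h2
    omega

theorem shift_comm (j k : κ ⊕ Fin m) (θ : Op κ m K) :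
    shift j (shift k θ) = shift k (shift j θ) := by
  classical
  have : (shift j ∘ₗ shift k : Op κ m K →ₗ[K] Op κ m K) = shift k ∘ₗ shift j := by
    refine Finsupp.lhom_ext fun p c => ?_
    simp only [LinearMap.comp_apply, shift_single, add_right_comm p.2]
    congr 1
    simp only [Finsupp.add_apply, Finsupp.single_apply]
    by_cases h : j = k
    · subst h
      ring
    · rw [if_neg h, if_neg (Ne.symm h)]
      push_cast
      ring
  exact LinearMap.congr_fun this θ

/-- Multiplication of a base symbol by a fibre monomial. -/
def raise (γ : Expo κ m) (i : Fin m) : (Expo κ m →₀ K) →ₗ[K] Op κ m K :=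
  Finsupp.lmapDomain K K (fun s => (i, s + γ))

@[simp] theorem raise_single (γ : Expo κ m) (i : Fin m) (α : Expo κ m) (c : K) :
    raise γ i (single α c) = single (i, α + γ) c := by
  simp [raise, Finsupp.lmapDomain_apply, Finsupp.mapDomain_single]

theorem raise_mem_Homog {a : ℕ} {f : Expo κ m →₀ K}
    (hf : f ∈ Finsupp.supported K K {α : Expo κ m | sdeg α = a ∧ ydeg α = 0}) (γ : Expo κ m)
    (hγ : sdeg γ = 0) (i : Fin m) : raise γ i f ∈ Homog κ m K a (ydeg γ) := by
  have : Finsupp.supported K K {α : Expo κ m | sdeg α = a ∧ ydeg α = 0} ≤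
      (Homog κ m K a (ydeg γ)).comap (raise γ i) := by
    rw [Finsupp.supported_eq_span_single, Submodule.span_le]
    rintro _ ⟨α, hα, rfl⟩
    simp only [Set.mem_ofPred_eq] at hα
    simp only [Submodule.comap_coe, Set.mem_preimage, raise_single, SetLike.mem_coe]
    refine Finsupp.single_mem_supported K _ ?_
    simp [hα.1, hα.2, hγ]
  exact this hf

theorem shift_raise {a : ℕ} {f : Expo κ m →₀ K}
    (hf : f ∈ Finsupp.supported K K {α : Expo κ m | sdeg α = a ∧ ydeg α = 0}) (γ : Expo κ m)
    (i l : Fin m) : shift (Sum.inr l) (raise γ i f) =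
      ((γ (Sum.inr l) : K) + 1) • raise (γ + unitE (Sum.inr l)) i f := by
  have : Finsupp.supported K K {α : Expo κ m | sdeg α = a ∧ ydeg α = 0} ≤
      LinearMap.eqLocus (shift (Sum.inr l) ∘ₗ raise γ i)
        (((γ (Sum.inr l) : K) + 1) • raise (γ + unitE (Sum.inr l)) i) := by
    rw [Finsupp.supported_eq_span_single, Submodule.span_le]
    rintro _ ⟨α, hα, rfl⟩
    simp only [Set.mem_ofPred_eq] at hα
    simp [inr_eq_zero_of_ydeg hα.2, add_assoc]
  exact this hf

variable [CharZero K]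

theorem raise_mem_sup {N : Submodule K (Op κ m K)} (hN : DStable δ N) {a : ℕ} {f : Expo κ m →₀ K}
    (hf : f ∈ lead N a) (i : Fin m) (γ : Expo κ m) (hγ : sdeg γ = 0) :
    raise γ i f ∈ N ⊔ Fil κ m K a (ydeg γ) := by
  obtain ⟨hf1, hf2⟩ := mem_lead.mp hf
  revert hγ
  induction γ using expo_induction with
  | h0 =>
    intro _
    have : raise 0 i f = put i f := by simp [raise, put]
    rw [this, ydeg_zero]
    exact hf2 i
  | hs β k ih =>
    intro hγ
    rcases k with k | l
    · simp at hγ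
    · have hβ : sdeg β = 0 := by simpa using hγ
      have h := shift_inr_mem_sup hN l (ih hβ) (Homog_le_Fil (raise_mem_Homog hf1 β hβ i))
      rw [shift_raise hf1, Submodule.smul_mem_iff _ (Nat.cast_add_one_ne_zero _)] at h
      simpa using h

/-- The symbol of the divergence multiplied by a monomial. -/
def symOp (K : Type*) [Field K] (β : Expo κ m) : Op κ m K := ∑ i, shift (Sum.inr i) (single (i, β) 1)

/-- The divergence of a volume form with logarithmic derivatives `h`. -/
def divOp (κ : Type) (h : Fin m → K) : Op κ m K :=
  ∑ i, (single (i, unitE (Sum.inr i)) 1 + single (i, 0) (h i))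

theorem shift_symOp (β : Expo κ m) (j : κ ⊕ Fin m) :
    shift j (symOp K β) = ((β j : K) + 1) • symOp K (β + unitE j) := by
  rw [symOp, symOp, map_sum, Finset.smul_sum]
  refine Finset.sum_congr rfl fun i _ => ?_
  rw [shift_comm, shift_single, ← map_smul, Finsupp.smul_single, one_mul, smul_eq_mul, mul_one]

theorem symOp_mem_Fil (β : Expo κ m) : symOp K β ∈ Fil κ m K (sdeg β) (ydeg β + 2) :=
  Submodule.sum_mem _ fun i _ => shift_inr_mem_Fil i (single_mem_Fil (by simp))

theorem symOp_mem_sup {N : Submodule K (Op κ m K)} (hN : DStable δ N) {h : Fin m → K}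
    (hdiv : divOp κ h ∈ N) (β : Expo κ m) :
    symOp K β ∈ N ⊔ Fil κ m K (sdeg β) (ydeg β + 1) := by
  induction β using expo_induction with
  | h0 =>
    have h1 : symOp K (0 : Expo κ m) = divOp κ h - ∑ i, single (i, 0) (h i) := by
      simp [symOp, divOp, Finset.sum_add_distrib]
    rw [h1]
    exact Submodule.sub_mem _ (Submodule.mem_sup_left hdiv)
      (Submodule.mem_sup_right (Submodule.sum_mem _ fun i _ => single_mem_Fil (by simp)))
  | hs β k ih =>
    rw [← Submodule.smul_mem_iff _ (Nat.cast_add_one_ne_zero (R := K) (β k)), ← shift_symOp]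
    rcases k with k | l
    · simpa using shift_inl_mem_sup hN k ih (symOp_mem_Fil β)
    · simpa using shift_inr_mem_sup hN l ih (symOp_mem_Fil β)

/-- The fibre monomials of degree `d`. -/
def fibreMonomials (κ : Type) [Fintype κ] (m d : ℕ) : Finset (Expo κ m) := by
  classical
  exact (Finset.Iic (Finsupp.equivFunOnFinite.symm fun _ => d)).filter
    fun γ => sdeg γ = 0 ∧ ydeg γ = d

theorem mem_fibreMonomials {d : ℕ} {γ : Expo κ m} :
    γ ∈ fibreMonomials κ m d ↔ sdeg γ = 0 ∧ ydeg γ = d := by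
  classical
  rw [fibreMonomials, Finset.mem_filter, and_iff_right_of_imp]
  rintro ⟨h1, h2⟩
  rw [Finset.mem_Iic]
  rintro (k | l)
  · simp [inl_eq_zero_of_sdeg h1]
  · simp only [Finsupp.equivFunOnFinite_symm_apply_apply]
    rw [← h2, ydeg]
    exact Finset.single_le_sum (f := fun l => γ (Sum.inr l)) (fun _ _ => Nat.zero_le _)
      (Finset.mem_univ l)

theorem curl_single_eq_zero {p : Fin m × Expo κ m} {γ : Expo κ m} (h : ydeg p.2 + 1 ≠ ydeg γ)
    (i j : Fin m) : curl i j γ (single p (1 : K)) = 0 := by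
  classical
  have aux : ∀ i j : Fin m, (γ (Sum.inr j) : K) • ycoef (γ - unitE (Sum.inr j)) i
      (single p (1 : K)) = 0 := by
    intro i j
    by_cases hj : γ (Sum.inr j) = 0
    · simp [hj]
    · rw [ycoef_single, if_neg, smul_zero]
      rintro ⟨-, h3⟩
      have h4 := congrArg ydeg ((eq_tsub_unitE hj).mp h3)
      simp only [ydeg_add, ydeg_ypart, ydeg_inr] at h4
      omega
  simp only [curl, LinearMap.sub_apply, LinearMap.smul_apply, aux, sub_zero]

open Classical in
theorem raise_curl_single {d : ℕ} (l : Fin m) (α : Expo κ m) (hα : ydeg α = d) (i j : Fin m) :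
    ∑ γ ∈ fibreMonomials κ m d, raise γ i (curl i j (γ + unitE (Sum.inr j)) (single (l, α) (1 : K)))
      = (if l = i then ((α (Sum.inr j) : K) + 1) • single (i, α) 1 else 0) -
        (if l = j then ∑ γ ∈ fibreMonomials κ m d,
          if ypart α + unitE (Sum.inr i) = γ + unitE (Sum.inr j) then
          (((γ + unitE (Sum.inr j) : Expo κ m) (Sum.inr i) : ℕ) : K) • single (i, spart α + γ) 1 else 0
          else 0) := by
  simp only [curl, LinearMap.sub_apply, LinearMap.smul_apply, map_sub, map_smul,
    Finset.sum_sub_distrib, ycoef_single, add_tsub_cancel_right]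
  congr 1
  · by_cases hli : l = i
    · rw [if_pos hli, Finset.sum_eq_single (ypart α)]
      · simp [hli, spart_add_ypart]
      · intro b _ hb
        simp [Ne.symm hb]
      · intro h
        exact absurd (mem_fibreMonomials.mpr (by simp [hα])) h
    · simp [hli]
  · by_cases hlj : l = j
    · rw [if_pos hlj]
      refine Finset.sum_congr rfl fun γ _ => ?_
      by_cases h0 : (γ + unitE (Sum.inr j) : Expo κ m) (Sum.inr i) = 0
      · simp [h0]
      · simp only [eq_tsub_unitE h0, hlj, true_and]
        split_ifs <;> simp
    · simp [hlj]

/-- An operator whose curls are symbols of `N` is in `N` up to lower order. -/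
theorem mem_sup_of_curl {N : Submodule K (Op κ m K)} (hN : DStable δ N) {h : Fin m → K}
    (hdiv : divOp κ h ∈ N) (hm : 2 ≤ m) {a d : ℕ} {θ : Op κ m K} (hθ : θ ∈ Homog κ m K a d)
    (hcurl : ∀ i j γ, sdeg γ = 0 → ydeg γ = d + 1 → curl i j γ θ ∈ lead N a) :
    θ ∈ N ⊔ Fil κ m K a d := by
  classical
  let f : Op κ m K →ₗ[K] Op κ m K := ((d : K) + m - 1) • LinearMap.id - ∑ i, ∑ j,
    ∑ γ ∈ fibreMonomials κ m d, raise γ i ∘ₗ curl i j (γ + unitE (Sum.inr j))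
  have hf : ∀ θ, f θ = ((d : K) + m - 1) • θ - ∑ i, ∑ j,
      ∑ γ ∈ fibreMonomials κ m d, raise γ i (curl i j (γ + unitE (Sum.inr j)) θ) := by
    intro θ
    simp [f]
  have key : Homog κ m K a d ≤ (N ⊔ Fil κ m K a d).comap f := by
    rw [Homog, Finsupp.supported_eq_span_single, Submodule.span_le]
    rintro _ ⟨⟨l, α⟩, hα, rfl⟩
    simp only [Set.mem_ofPred_eq] at hα
    simp only [Submodule.comap_coe, Set.mem_preimage, SetLike.mem_coe]
    rw [hf]
    rcases hα.2.lt_or_eq with hlt | heq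
    · refine Submodule.sub_mem _ (Submodule.smul_mem _ _ (Submodule.mem_sup_right
        (single_mem_Fil (Or.inr ⟨hα.1, hlt⟩)))) (Submodule.sum_mem _ fun i _ =>
        Submodule.sum_mem _ fun j _ => Submodule.sum_mem _ fun γ hγ => ?_)
      have h4 := (mem_fibreMonomials.mp hγ).2
      rw [curl_single_eq_zero (by simp only [ydeg_add, ydeg_inr]; omega), map_zero]
      exact Submodule.zero_mem _
    simp only [raise_curl_single l α heq, Finset.sum_sub_distrib, Finset.sum_ite_eq,
      Finset.mem_univ, if_true]
    have e1 : ∑ i, ∑ j, (if l = i then ((α (Sum.inr j) : K) + 1) • single (i, α) (1 : K) else 0)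
        = ((d : K) + m) • single (l, α) (1 : K) := by
      rw [Finset.sum_comm]
      simp only [Finset.sum_ite_eq, Finset.mem_univ, if_true]
      rw [← Finset.sum_smul, Finset.sum_add_distrib, ← heq, ydeg]
      simp
    rw [e1]
    by_cases hl : α (Sum.inr l) = 0
    · have e2 : ∑ i, ∑ γ ∈ fibreMonomials κ m d,
          (if ypart α + unitE (Sum.inr i) = γ + unitE (Sum.inr l) then
          (((γ + unitE (Sum.inr l) : Expo κ m) (Sum.inr i) : ℕ) : K) • single (i, spart α + γ) 1
          else 0) = single (l, α) (1 : K) := by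
        rw [Finset.sum_eq_single l, Finset.sum_eq_single (ypart α)]
        · simp [spart_add_ypart, hl]
        · intro b _ hb
          rw [if_neg]
          intro h5
          exact hb (add_right_cancel h5).symm
        · intro h
          exact absurd (mem_fibreMonomials.mpr (by simp [heq])) h
        · intro i _ hi
          refine Finset.sum_eq_zero fun γ _ => ?_
          rw [if_neg]
          intro h5
          have := DFunLike.congr_fun h5 (Sum.inr l)
          simp [hl, hi, Finsupp.single_apply] at this
        · simp
      rw [e2]
      have : ((d : K) + m - 1) • single (l, α) (1 : K)
          - (((d : K) + m) • single (l, α) (1 : K) - single (l, α) (1 : K)) = 0 := by module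
      rw [this]
      exact Submodule.zero_mem _
    · obtain ⟨β, rfl⟩ : ∃ β, α = β + unitE (Sum.inr l) :=
        ⟨α - unitE (Sum.inr l), ((eq_tsub_unitE hl).mp rfl).symm⟩
      have hβ : ydeg β + 1 = d := by simpa using heq
      have e2 : ∑ i, ∑ γ ∈ fibreMonomials κ m d,
          (if ypart (β + unitE (Sum.inr l)) + unitE (Sum.inr i) = γ + unitE (Sum.inr l) then
          (((γ + unitE (Sum.inr l) : Expo κ m) (Sum.inr i) : ℕ) : K) •
            single (i, spart (β + unitE (Sum.inr l)) + γ) 1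
          else 0) = symOp K β + single (l, β + unitE (Sum.inr l)) (1 : K) := by
        have hy : ypart (β + unitE (Sum.inr l)) = ypart β + unitE (Sum.inr l) :=
          expo_ext (by simp) (by simp)
        have hs : spart (β + unitE (Sum.inr l)) = spart β := expo_ext (by simp) (by simp)
        rw [hy, hs]
        have e3 : ∀ i, ∑ γ ∈ fibreMonomials κ m d,
            (if ypart β + unitE (Sum.inr l) + unitE (Sum.inr i) = γ + unitE (Sum.inr l) then
            (((γ + unitE (Sum.inr l) : Expo κ m) (Sum.inr i) : ℕ) : K) •
              single (i, spart β + γ) 1 else 0)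
            = shift (Sum.inr i) (single (i, β) 1) +
              if i = l then single (l, β + unitE (Sum.inr l)) (1 : K) else 0 := by
          intro i
          rw [Finset.sum_eq_single (ypart β + unitE (Sum.inr i))]
          · rw [if_pos (add_right_comm _ _ _), ← add_assoc, spart_add_ypart, shift_single]
            by_cases hi : i = l
            · subst hi
              simp [← Finsupp.single_add]
            · simp [hi, Finsupp.single_apply]
          · intro b _ hb
            rw [if_neg]
            intro h5
            rw [add_right_comm] at h5
            exact hb (add_right_cancel h5).symm
          · intro h
            exact absurd (mem_fibreMonomials.mpr (by simp [hβ])) h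
        simp only [e3, Finset.sum_add_distrib, symOp, Finset.sum_ite_eq', Finset.mem_univ, if_true]
      rw [e2]
      have : ((d : K) + m - 1) • single (l, β + unitE (Sum.inr l)) (1 : K)
          - (((d : K) + m) • single (l, β + unitE (Sum.inr l)) (1 : K) -
            (symOp K β + single (l, β + unitE (Sum.inr l)) (1 : K))) = symOp K β := by module
      rw [this]
      have := symOp_mem_sup hN hdiv β
      simp only [sdeg_add, sdeg_inr, add_zero] at hα
      rwa [hα.1, hβ] at this
  have h1 := key hθ
  simp only [Submodule.mem_comap, hf] at h1
  have h2 : ∑ i, ∑ j, ∑ γ ∈ fibreMonomials κ m d,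
      raise γ i (curl i j (γ + unitE (Sum.inr j)) θ) ∈ N ⊔ Fil κ m K a d := by
    refine Submodule.sum_mem _ fun i _ => Submodule.sum_mem _ fun j _ =>
      Submodule.sum_mem _ fun γ hγ => ?_
    obtain ⟨h3, h4⟩ := mem_fibreMonomials.mp hγ
    rw [← h4]
    exact raise_mem_sup hN (hcurl i j _ (by simp [h3]) (by simp [h4])) i γ h3
  have h3 := Submodule.add_mem _ h1 h2
  rw [sub_add_cancel] at h3
  refine (Submodule.smul_mem_iff _ ?_).mp h3
  have : ((d : K) + m - 1) = ((d + (m - 2) : ℕ) : K) + 1 := by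
    rw [Nat.cast_add, Nat.cast_sub hm]
    push_cast
    ring
  rw [this]
  exact Nat.cast_add_one_ne_zero _

end Lifting

section Lead

open Finsupp

variable {κ : Type} [Fintype κ] {m : ℕ} {K : Type*} [Field K] [Algebra ℂ K] [CharZero K]
  {δ : κ ⊕ Fin m → Derivation ℂ K K}

/-- Multiplication of base symbols by a base direction. -/
def up (k : κ) : (Expo κ m →₀ K) →ₗ[K] (Expo κ m →₀ K) :=
  Finsupp.linearCombination K fun α => single (α + unitE (Sum.inl k)) ((α (Sum.inl k) : K) + 1)

@[simp] theorem up_single (k : κ) (α : Expo κ m) (c : K) : up k (single α c)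
    = single (α + unitE (Sum.inl k)) (c * ((α (Sum.inl k) : K) + 1)) := by
  rw [up, Finsupp.linearCombination_single, Finsupp.smul_single, smul_eq_mul]

open Classical in
/-- The partial derivative of base symbols. -/
def down (k : κ) : (Expo κ m →₀ K) →ₗ[K] (Expo κ m →₀ K) :=
  Finsupp.linearCombination K fun α => if α (Sum.inl k) = 0 then 0
    else single (α - unitE (Sum.inl k)) 1

open Classical in
@[simp] theorem down_single (k : κ) (α : Expo κ m) : down k (single α (1 : K))
    = if α (Sum.inl k) = 0 then 0 else single (α - unitE (Sum.inl k)) 1 := by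
  simp [down]

/-- The base symbols of degree `a`. -/
abbrev Sym (κ : Type) [Fintype κ] (m : ℕ) (K : Type*) [Field K] (a : ℕ) :
    Submodule K (Expo κ m →₀ K) :=
  Finsupp.supported K K {α : Expo κ m | sdeg α = a ∧ ydeg α = 0}

theorem Sym_induction {M : Type*} [AddCommGroup M] [Module K M] {a : ℕ}
    (g : (Expo κ m →₀ K) →ₗ[K] M) (S : Submodule K M)
    (h : ∀ α : Expo κ m, sdeg α = a → ydeg α = 0 → g (single α 1) ∈ S) {f : Expo κ m →₀ K}
    (hf : f ∈ Sym κ m K a) : g f ∈ S := by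
  have : Sym κ m K a ≤ S.comap g := by
    rw [Sym, Finsupp.supported_eq_span_single, Submodule.span_le]
    rintro _ ⟨α, hα, rfl⟩
    exact h α hα.1 hα.2
  exact this hf

theorem up_mem_Sym (k : κ) {a : ℕ} {f : Expo κ m →₀ K} (hf : f ∈ Sym κ m K a) :
    up k f ∈ Sym κ m K (a + 1) := by
  refine Sym_induction (up k) _ (fun α h1 h2 => ?_) hf
  rw [up_single]
  exact Finsupp.single_mem_supported K _ (by simp [h1, h2])

theorem sdeg_sub_inl {α : Expo κ m} {k : κ} (h : α (Sum.inl k) ≠ 0) :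
    sdeg (α - unitE (Sum.inl k)) + 1 = sdeg α ∧ ydeg (α - unitE (Sum.inl k)) = ydeg α := by
  have h1 := (eq_tsub_unitE h).mp (rfl : α - unitE (Sum.inl k) = α - unitE (Sum.inl k))
  have h2 := congrArg sdeg h1
  have h3 := congrArg ydeg h1
  simpa using And.intro h2 h3

theorem exists_eq_unitE {α : Expo κ m} (h1 : sdeg α = 1) (h2 : ydeg α = 0) :
    ∃ k, α = unitE (Sum.inl k) := by
  obtain ⟨k, hk⟩ : ∃ k, α (Sum.inl k) ≠ 0 := by
    by_contra! hcon
    simp [sdeg, hcon] at h1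
  have h5 := sdeg_sub_inl hk
  have h6 := (eq_tsub_unitE hk).mp (rfl : α - unitE (Sum.inl k) = α - unitE (Sum.inl k))
  have h7 : α - unitE (Sum.inl k) = 0 := expo_ext
    (fun b => inl_eq_zero_of_sdeg (by omega) b) (fun b => inr_eq_zero_of_ydeg (by omega) b)
  rw [h7, zero_add] at h6
  exact ⟨k, h6.symm⟩

theorem down_mem_Sym (k : κ) {a : ℕ} {f : Expo κ m →₀ K} (hf : f ∈ Sym κ m K (a + 1)) :
    down k f ∈ Sym κ m K a := by
  refine Sym_induction (down k) _ (fun α h1 h2 => ?_) hf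
  rw [down_single]
  split_ifs with h
  · exact Submodule.zero_mem _
  · obtain ⟨h3, h4⟩ := sdeg_sub_inl h
    exact Finsupp.single_mem_supported K _ ⟨by omega, by omega⟩

theorem put_up (k : κ) (i : Fin m) (f : Expo κ m →₀ K) :
    put i (up k f) = shift (Sum.inl k) (put i f) := by
  have : (put i ∘ₗ up k : (Expo κ m →₀ K) →ₗ[K] Op κ m K) = shift (Sum.inl k) ∘ₗ put i :=
    Finsupp.lhom_ext fun α c => by
      simp only [LinearMap.comp_apply, up_single, put_single, shift_single]
  exact LinearMap.congr_fun this f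

theorem up_mem_lead {N : Submodule K (Op κ m K)} (hN : DStable δ N) (k : κ) {a : ℕ}
    {f : Expo κ m →₀ K} (hf : f ∈ lead N a) : up k f ∈ lead N (a + 1) := by
  obtain ⟨h1, h2⟩ := mem_lead.mp hf
  refine mem_lead.mpr ⟨up_mem_Sym k h1, fun i => ?_⟩
  rw [put_up]
  exact shift_inl_mem_sup hN k (h2 i) (put_mem_Fil_of_sym i h1)

theorem lead_zero {N : Submodule K (Op κ m K)} (hc : CurlFree N) (hm : 2 ≤ m)
    {f : Expo κ m →₀ K} (hf : f ∈ lead N 0) : f = 0 := by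
  classical
  obtain ⟨h1, h2⟩ := mem_lead.mp hf
  have hF : Fil κ m K 0 0 = ⊥ := by
    rw [Fil, ← Finsupp.supported_empty]
    congr 1
    ext p
    simp
  have hf0 : f = single 0 (f 0) := by
    ext α
    by_cases hα : α = 0
    · simp [hα]
    · rw [Finsupp.single_eq_of_ne hα]
      refine (Finsupp.mem_supported' K f).mp h1 α ?_
      rintro ⟨h3, h4⟩
      exact hα (expo_ext (by simp [inl_eq_zero_of_sdeg h3]) (by simp [inr_eq_zero_of_ydeg h4]))
  let i : Fin m := ⟨0, by omega⟩
  let j : Fin m := ⟨1, by omega⟩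
  have hij : i ≠ j := by simp [i, j]
  have h3 := h2 i
  rw [hF, sup_bot_eq] at h3
  have h4 := hc 0 _ h3 (Homog_le_Fil (by
    rw [hf0, put_single]; exact Finsupp.single_mem_supported K _ (by simp))) i j
    (unitE (Sum.inr j)) (by simp) (by simp)
  have h5 : curl i j (unitE (Sum.inr j)) (put i f) = f := by
    rw [hf0, put_single]
    have : (single (i, 0) (f 0) : Op κ m K) = f 0 • single (i, 0) 1 := by simp
    have h0 : ypart (0 : Expo κ m) = 0 := ypart_eq_zero (by simp)
    have h0' : spart (0 : Expo κ m) = 0 := spart_eq_zero (by simp)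
    rw [this, map_smul]
    simp [curl, ycoef_single, hij, Ne.symm hij, h0, h0', Finsupp.single_apply]
  rw [← h5, h4]

/-- A constant linear form on base directions as a derivation of symbols. -/
def downBy (ℓ : κ → K) : (Expo κ m →₀ K) →ₗ[K] (Expo κ m →₀ K) := ∑ k, ℓ k • down k

open Classical in
theorem contr_single_next {X : Fin m → MvPowerSeries (κ ⊕ Fin m) K} {ℓ : κ → K} {i j : Fin m}
    (h0 : ∀ l η, sdeg η = 0 → MvPowerSeries.coeff η (X l) = 0)
    (h1 : ∀ l k, MvPowerSeries.coeff (unitE (Sum.inl k)) (X l) = 0)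
    (h2 : ∀ l b k, MvPowerSeries.coeff (unitE (Sum.inl k) + unitE (Sum.inr b)) (X l)
      = if l = i ∧ b = j then ℓ k else 0) (l : Fin m) {a : ℕ} {α : Expo κ m}
    (ha : sdeg α = a + 1) (hα : ydeg α = 0) :
    contr X (single (l, α) 1) + (if l = i then put j (downBy ℓ (single α 1)) else 0)
      ∈ Fil κ m K a 0 := by
  have e1 : ∀ q ∈ Finset.HasAntidiagonal.antidiagonal α, (∑ b : Fin m,
      (single (l, q.1 + unitE (Sum.inr b))
        (((q.1 (Sum.inr b) : K) + 1) * MvPowerSeries.coeff q.2 (X b))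
      - single (b, q.1) (((q.2 (Sum.inr b) : K) + 1)
          * MvPowerSeries.coeff (q.2 + unitE (Sum.inr b)) (X l))))
      + (∑ k, if q.2 = unitE (Sum.inl k) then
          (if l = i then single (j, q.1) (ℓ k) else 0) else 0) ∈ Fil κ m K a 0 := by
    intro q hq
    rw [Finset.HasAntidiagonal.mem_antidiagonal] at hq
    have hs := congrArg sdeg hq
    have hy := congrArg ydeg hq
    rw [sdeg_add] at hs
    rw [ydeg_add] at hy
    by_cases hk : ∃ k, q.2 = unitE (Sum.inl k)
    · obtain ⟨k, hk⟩ := hk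
      rw [hk, Finset.sum_eq_single k, if_pos rfl]
      · have e2 : ∀ b : Fin m, (single (l, q.1 + unitE (Sum.inr b))
            (((q.1 (Sum.inr b) : K) + 1) * MvPowerSeries.coeff (unitE (Sum.inl k)) (X b))
          - single (b, q.1) ((((unitE (Sum.inl k) : Expo κ m) (Sum.inr b) : K) + 1)
          * MvPowerSeries.coeff (unitE (Sum.inl k) + unitE (Sum.inr b)) (X l)) : Op κ m K) =
            if b = j then (if l = i then - single (j, q.1) (ℓ k) else 0) else 0 := by
          intro b
          rw [h1, h2]
          by_cases hb : b = j
          · by_cases hl : l = i <;> simp [hb, hl]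
          · simp [hb]
        simp only [e2, Finset.sum_ite_eq', Finset.mem_univ, if_true]
        split_ifs
        · rw [neg_add_cancel]
          exact Submodule.zero_mem _
        · rw [add_zero]
          exact Submodule.zero_mem _
      · intro b _ hb
        rw [if_neg]
        intro h
        have := (Finsupp.single_left_inj (one_ne_zero (α := ℕ))).mp h
        exact hb (Sum.inl_injective this).symm
      · simp
    · rw [Finset.sum_eq_zero (s := Finset.univ) (f := fun k => if q.2 = unitE (Sum.inl k) then
          (if l = i then single (j, q.1) (ℓ k) else 0) else 0)
          (fun k _ => if_neg fun h => hk ⟨k, h⟩), add_zero]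
      refine Submodule.sum_mem _ fun b _ => ?_
      by_cases h3 : sdeg q.2 = 0
      · rw [h0 b q.2 h3, h0 l _ (by simp [h3])]
        simp only [mul_zero, Finsupp.single_zero, sub_zero]
        exact Submodule.zero_mem _
      · have h4 : sdeg q.2 ≠ 1 := by
          intro h4
          exact hk (exists_eq_unitE h4 (by omega))
        refine Submodule.sub_mem _ (single_mem_Fil (Or.inl ?_)) (single_mem_Fil (Or.inl ?_))
        · simp only [sdeg_add, sdeg_inr]
          omega
        · simp only
          omega
  have e3 := Submodule.sum_mem _ e1
  rw [Finset.sum_add_distrib] at e3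
  rw [contr_single, one_smul]
  convert e3 using 2
  rw [Finset.sum_comm]
  have e4 : ∀ k, ∑ q ∈ Finset.HasAntidiagonal.antidiagonal α, (if q.2 = unitE (Sum.inl k) then
      (if l = i then single (j, q.1) (ℓ k) else 0) else 0 : Op κ m K)
      = if l = i then put j (ℓ k • down k (single α 1)) else 0 := by
    intro k
    rw [down_single]
    by_cases hk : α (Sum.inl k) = 0
    · rw [if_pos hk, smul_zero, map_zero, ite_self]
      refine Finset.sum_eq_zero fun q hq => ?_
      rw [if_neg]
      intro h
      rw [Finset.HasAntidiagonal.mem_antidiagonal] at hq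
      have := DFunLike.congr_fun hq (Sum.inl k)
      rw [h] at this
      simp [hk] at this
    · have h6 := (eq_tsub_unitE hk).mp (rfl : α - unitE (Sum.inl k) = α - unitE (Sum.inl k))
      rw [if_neg hk, Finset.sum_eq_single (α - unitE (Sum.inl k), unitE (Sum.inl k)), if_pos rfl]
      · simp
      · intro q hq hne
        rw [if_neg]
        intro h
        rw [Finset.HasAntidiagonal.mem_antidiagonal, h] at hq
        exact hne (Prod.ext ((eq_tsub_unitE hk).mpr hq) h)
      · intro h
        exact absurd (Finset.HasAntidiagonal.mem_antidiagonal.mpr h6) h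
  simp only [e4, downBy, LinearMap.sum_apply, LinearMap.smul_apply, map_sum]
  split_ifs
  · rfl
  · simp

theorem contr_mem_Fil_pred {X : Fin m → MvPowerSeries (κ ⊕ Fin m) K}
    (h0 : ∀ l η, sdeg η = 0 → MvPowerSeries.coeff η (X l) = 0) {a : ℕ} {θ : Op κ m K}
    (hθ : θ ∈ Fil κ m K (a + 1) 0) : contr X θ ∈ Fil κ m K a 0 := by
  classical
  refine Fil_induction (contr X) _ (fun p hp => ?_) hθ
  rw [contr_single]
  refine Submodule.smul_mem _ _ (Submodule.sum_mem _ fun q hq => Submodule.sum_mem _ fun b _ => ?_)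
  rw [Finset.HasAntidiagonal.mem_antidiagonal] at hq
  have hs := congrArg sdeg hq
  rw [sdeg_add] at hs
  by_cases h3 : sdeg q.2 = 0
  · rw [h0 b q.2 h3, h0 p.1 _ (by simp [h3])]
    simp only [mul_zero, Finsupp.single_zero, sub_zero]
    exact Submodule.zero_mem _
  · refine Submodule.sub_mem _ (single_mem_Fil (Or.inl ?_)) (single_mem_Fil (Or.inl ?_))
    · simp only [sdeg_add, sdeg_inr]
      omega
    · simp only
      omega

theorem exists_homog_part {a d : ℕ} {θ : Op κ m K} (hθ : θ ∈ Fil κ m K a (d + 1)) :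
    ∃ τ ∈ Homog κ m K a d, θ - τ ∈ Fil κ m K a 0 ∧ ∀ p, sdeg p.2 = a → τ p = θ p := by
  classical
  rw [mem_Fil] at hθ
  refine ⟨θ.filter fun p => sdeg p.2 = a, ?_, ?_, fun p hp => Finsupp.filter_apply_pos _ _ hp⟩
  · rw [Homog, Finsupp.mem_supported']
    intro p hp
    rw [Finsupp.filter_apply]
    split_ifs with h
    · refine hθ p ?_
      simp only [Set.mem_ofPred_eq] at hp
      omega
    · rfl
  · rw [mem_Fil]
    intro p hp
    rw [Finsupp.sub_apply, Finsupp.filter_apply]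
    split_ifs with h
    · rw [sub_self]
    · rw [sub_zero]
      refine hθ p ?_
      omega

theorem ycoef_apply (γ : Expo κ m) (hγ : sdeg γ = 0) (i : Fin m) (θ : Op κ m K) {s : Expo κ m}
    (hs : ydeg s = 0) : ycoef γ i θ s = θ (i, s + γ) := by
  classical
  have : Finsupp.lapply s ∘ₗ ycoef γ i = (Finsupp.lapply (i, s + γ) : Op κ m K →ₗ[K] K) := by
    refine Finsupp.lhom_ext fun p c => ?_
    have hc : (single p c : Op κ m K) = c • single p 1 := by simp
    rw [hc, map_smul, map_smul, LinearMap.comp_apply, ycoef_single]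
    congr 1
    simp only [Finsupp.lapply_apply, Finsupp.single_apply]
    by_cases hp : p = (i, s + γ)
    · have h1 : ypart (s + γ) = γ := expo_ext (by simp [inl_eq_zero_of_sdeg hγ])
        (by simp [inr_eq_zero_of_ydeg hs])
      have h2 : spart (s + γ) = s := expo_ext (by simp [inl_eq_zero_of_sdeg hγ])
        (by simp [inr_eq_zero_of_ydeg hs])
      simp [hp, h1, h2]
    · rw [if_neg hp]
      split_ifs with h
      · rw [Finsupp.single_apply, if_neg]
        intro h3
        refine hp (Prod.ext h.1 ?_)
        rw [← spart_add_ypart p.2, h3, h.2]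
      · rfl
  exact LinearMap.congr_fun this θ

/-- Existence of a field in `N` vanishing on the fibre with a prescribed first jet. -/
theorem exists_transverse_field {N : Submodule K (Op κ m K)} (hb : BracketClosed N)
    (hc : CurlFree N) (hm : 2 ≤ m) (ℓ : κ → K)
    (hℓ : ∀ f ∈ lead N 1, ∑ k, ℓ k * f (unitE (Sum.inl k)) = 0) {i j : Fin m} (hij : i ≠ j) :
    ∃ X ∈ perp N, (∀ l η, sdeg η = 0 → MvPowerSeries.coeff η (X l) = 0) ∧
      (∀ l k, MvPowerSeries.coeff (unitE (Sum.inl k)) (X l) = 0) ∧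
      (∀ l b k, MvPowerSeries.coeff (unitE (Sum.inl k) + unitE (Sum.inr b)) (X l)
        = open Classical in if l = i ∧ b = j then ℓ k else 0) := by
  classical
  let z : Op κ m K →ₗ[K] K :=
    ∑ k, ℓ k • Finsupp.lapply (i, unitE (Sum.inl k) + unitE (Sum.inr j))
  have hz : ∀ θ, z θ = ∑ k, ℓ k * θ (i, unitE (Sum.inl k) + unitE (Sum.inr j)) := by
    intro θ
    simp [z]
  obtain ⟨X, hX, h⟩ := exists_perp_extending N (Fil κ m K 1 2) z (fun θ h1 h2 => by
    obtain ⟨τ, h3, h4, h5⟩ := exists_homog_part h2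
    have h6 := hℓ _ (curl_mem_lead hb hc hm (θ := τ) (by
      rw [← sub_sub_cancel θ τ]
      exact Submodule.sub_mem _ (Submodule.mem_sup_left h1) (Submodule.mem_sup_right h4)) h3 i j
      (unitE (Sum.inr j) + unitE (Sum.inr j)) (by simp) (by simp))
    have h7 : ∀ k, curl i j (unitE (Sum.inr j) + unitE (Sum.inr j)) τ (unitE (Sum.inl k))
        = 2 * θ (i, unitE (Sum.inl k) + unitE (Sum.inr j)) := by
      intro k
      have h8 := ycoef_apply (unitE (Sum.inr j)) (by simp) i τ (s := unitE (Sum.inl k)) (by simp)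
      rw [h5 _ (by simp)] at h8
      simp [curl, h8, hij, Ne.symm hij, one_add_one_eq_two]
    simp only [h7, mul_left_comm _ (2 : K), ← Finset.mul_sum] at h6
    rw [hz]
    exact (mul_eq_zero.mp h6).resolve_left two_ne_zero)
  have key : ∀ l η, (sdeg η < 1 ∨ sdeg η = 1 ∧ ydeg η < 2) →
      MvPowerSeries.coeff η (X l) = z (single (l, η) 1) := by
    intro l η hη
    rw [← h _ (single_mem_Fil hη), pair_single, one_mul]
  refine ⟨X, hX, fun l η hη => ?_, fun l k => ?_, fun l b k => ?_⟩
  · rw [key l η (Or.inl (by omega)), hz]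
    refine Finset.sum_eq_zero fun k _ => ?_
    rw [Finsupp.single_apply, if_neg, mul_zero]
    intro h
    have := congrArg (fun p : Fin m × Expo κ m => sdeg p.2) h
    simp [hη] at this
  · rw [key l _ (Or.inr (by simp)), hz]
    refine Finset.sum_eq_zero fun k' _ => ?_
    rw [Finsupp.single_apply, if_neg, mul_zero]
    intro h
    have := congrArg (fun p : Fin m × Expo κ m => ydeg p.2) h
    simp at this
  · rw [key l _ (Or.inr (by simp)), hz, Finset.sum_eq_single k]
    · by_cases hl : l = i
      · by_cases hbj : b = j
        · simp [hl, hbj]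
        · simp [hl, hbj, Finsupp.single_apply, Finsupp.single_left_inj]
      · simp [hl, Finsupp.single_apply]
    · intro k' _ hk'
      rw [Finsupp.single_apply, if_neg, mul_zero]
      intro h
      have := DFunLike.congr_fun (congrArg Prod.snd h) (Sum.inl k)
      simp [Finsupp.single_apply, hk'] at this
    · simp

theorem downBy_mem_lead {N : Submodule K (Op κ m K)} (hb : BracketClosed N)
    (hc : CurlFree N) (hm : 2 ≤ m) {ℓ : κ → K}
    (hℓ : ∀ f ∈ lead N 1, ∑ k, ℓ k * f (unitE (Sum.inl k)) = 0) {a : ℕ} {f : Expo κ m →₀ K}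
    (hf : f ∈ lead N (a + 1)) : downBy ℓ f ∈ lead N a := by
  classical
  obtain ⟨h1, h2⟩ := mem_lead.mp hf
  refine mem_lead.mpr ⟨?_, fun j => ?_⟩
  · rw [downBy, LinearMap.sum_apply]
    exact Submodule.sum_mem _ fun k _ => Submodule.smul_mem _ _ (down_mem_Sym k h1)
  · obtain ⟨i, hij⟩ : ∃ i : Fin m, i ≠ j := by
      have : Nontrivial (Fin m) := Fin.nontrivial_iff_two_le.mpr hm
      exact exists_ne j
    obtain ⟨X, hX, hX0, hX1, hX2⟩ := exists_transverse_field hb hc hm ℓ hℓ hij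
    have h3 : (contr X ∘ₗ put i + put j ∘ₗ downBy ℓ) f ∈ Fil κ m K a 0 := by
      refine Sym_induction _ _ (fun α ha hα => ?_) h1
      have := contr_single_next hX0 hX1 (ℓ := ℓ) (i := i) (j := j)
        (fun l b k => by rw [hX2 l b k]) i ha hα
      simpa using this
    have h4 : contr X (put i f) ∈ N ⊔ Fil κ m K a 0 := by
      obtain ⟨n, hn, u, hu, hnu⟩ := Submodule.mem_sup.mp (h2 i)
      rw [← hnu, map_add]
      exact Submodule.add_mem_sup (hb.contr_mem hX hn) (contr_mem_Fil_pred hX0 hu)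
    have h5 := Submodule.sub_mem _ (Submodule.mem_sup_right (S := N) h3) h4
    simpa using h5

/-- Euler's identity. -/
theorem sum_up_down {a : ℕ} {f : Expo κ m →₀ K} (hf : f ∈ Sym κ m K a) :
    ∑ k, up k (down k f) = (a : K) • f := by
  have : Sym κ m K a ≤ LinearMap.eqLocus (∑ k, up k ∘ₗ down k) ((a : K) • LinearMap.id) := by
    rw [Sym, Finsupp.supported_eq_span_single, Submodule.span_le]
    rintro _ ⟨α, hα, rfl⟩
    simp only [SetLike.mem_coe, LinearMap.mem_eqLocus, LinearMap.sum_apply, LinearMap.comp_apply,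
      LinearMap.smul_apply, LinearMap.id_apply]
    have h1 : ∀ k, up k (down k (single α (1 : K))) = (α (Sum.inl k) : K) • single α 1 := by
      intro k
      rw [down_single]
      split_ifs with h
      · simp [h]
      · have h2 := (eq_tsub_unitE h).mp (rfl : α - unitE (Sum.inl k) = α - unitE (Sum.inl k))
        have h3 := DFunLike.congr_fun h2 (Sum.inl k)
        rw [Finsupp.add_apply, Finsupp.single_eq_same] at h3
        rw [up_single, h2, ← h3]
        simp
    simp only [h1, ← Finset.sum_smul]
    rw [← hα.1, sdeg, Nat.cast_sum]
  simpa using this hf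

theorem mul_mem_lead {N : Submodule K (Op κ m K)} (hN : DStable δ N) (w : κ → K)
    (hw : ∑ k, w k • single (unitE (Sum.inl k)) (1 : K) ∈ lead N 1) {a : ℕ} {f : Expo κ m →₀ K}
    (hf : f ∈ Sym κ m K a) : ∑ k, w k • up k f ∈ lead N (a + 1) := by
  have h : (∑ k, w k • up k : (Expo κ m →₀ K) →ₗ[K] _) f ∈ lead N (a + 1) := by
    refine Sym_induction _ _ (fun α h1 h2 => ?_) hf
    clear hf
    revert h1 h2
    induction α using expo_induction generalizing a with
    | h0 =>
      intro h1 _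
      rw [sdeg_zero] at h1
      subst h1
      simpa using hw
    | hs β j ih =>
      intro h1 h2
      rcases j with j | j
      · simp only [sdeg_add, sdeg_inl] at h1
        subst h1
        have h3 := up_mem_lead hN j (ih (a := sdeg β) rfl (by simpa using h2))
        rw [← Submodule.smul_mem_iff _ (Nat.cast_add_one_ne_zero (R := K) (β (Sum.inl j)))]
        convert h3 using 1
        simp only [LinearMap.sum_apply, LinearMap.smul_apply, map_sum, map_smul, Finset.smul_sum]
        refine Finset.sum_congr rfl fun k _ => ?_
        rw [smul_comm]
        congr 1
        rw [up_single, up_single, up_single, Finsupp.smul_single, add_right_comm]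
        congr 1
        by_cases hjk : j = k
        · subst hjk
          simp
        · simp [Finsupp.single_apply, hjk, Ne.symm hjk]
          ring
      · simp at h2
  simpa using h

theorem sym_one_eq {f : Expo κ m →₀ K} (hf : f ∈ Sym κ m K 1) :
    f = ∑ k, f (unitE (Sum.inl k)) • single (unitE (Sum.inl k)) (1 : K) := by
  classical
  have : Sym κ m K 1 ≤ LinearMap.eqLocus LinearMap.id
      (∑ k, (Finsupp.lapply (unitE (Sum.inl k))).smulRight (single (unitE (Sum.inl k)) (1 : K))) := by
    rw [Sym, Finsupp.supported_eq_span_single, Submodule.span_le]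
    rintro _ ⟨α, hα, rfl⟩
    obtain ⟨k, rfl⟩ := exists_eq_unitE hα.1 hα.2
    simp only [SetLike.mem_coe, LinearMap.mem_eqLocus, LinearMap.sum_apply, LinearMap.id_apply,
      LinearMap.smulRight_apply, Finsupp.lapply_apply]
    rw [Finset.sum_eq_single k]
    · simp
    · intro b _ hb
      rw [Finsupp.single_eq_of_ne, zero_smul]
      intro h
      exact hb (Sum.inl_injective ((Finsupp.single_left_inj (one_ne_zero (α := ℕ))).mp h))
    · simp
  simpa using this hf

/-- The leading symbols are generated by those of degree one. -/
theorem lead_le_of_one {N N' : Submodule K (Op κ m K)} (hb : BracketClosed N)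
    (hc : CurlFree N) (hm : 2 ≤ m) (hN' : DStable δ N') (h1 : lead N 1 ≤ lead N' 1) (a : ℕ) :
    lead N a ≤ lead N' a := by
  classical
  induction a with
  | zero =>
    intro f hf
    rw [lead_zero hc hm hf]
    exact Submodule.zero_mem _
  | succ a ih =>
    intro f hf
    let g : (κ → K) →ₗ[K] (Expo κ m →₀ K) :=
      ∑ k, (LinearMap.proj k).smulRight (single (unitE (Sum.inl k)) (1 : K))
    have hg : ∀ w, g w = ∑ k, w k • single (unitE (Sum.inl k)) (1 : K) := by
      intro w
      simp [g]
    obtain ⟨p, hp⟩ := LinearMap.exists_leftInverse_of_injective ((lead N 1).comap g).subtype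
      (Submodule.ker_subtype _)
    have hp1 : ∀ w ∈ (lead N 1).comap g, (p w : κ → K) = w := fun w hw =>
      congrArg Subtype.val (LinearMap.congr_fun hp ⟨w, hw⟩)
    let P : κ → κ → K := fun l k => (p (Pi.single k 1) : κ → K) l
    have hP : ∀ w ∈ (lead N 1).comap g, ∀ l, ∑ k, P l k * w k = w l := by
      intro w hw l
      have h2 : (p w : κ → K) l = ∑ k, w k * (p (Pi.single k 1) : κ → K) l := by
        conv_lhs => rw [pi_eq_sum_univ' w]
        simp [Finset.sum_apply]
      rw [hp1 w hw] at h2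
      rw [h2]
      exact Finset.sum_congr rfl fun k _ => mul_comm _ _
    have hS := (mem_lead.mp hf).1
    have hA : ∑ k, ∑ l, P l k • up l (down k f) ∈ lead N' (a + 1) :=
      Submodule.sum_mem _ fun k _ => mul_mem_lead hN' (fun l => P l k)
        (h1 (by rw [← hg]; exact (p (Pi.single k 1)).2)) (down_mem_Sym k hS)
    have hB : ∑ l, up l (downBy (fun k => (Pi.single l 1 : κ → K) k - P l k) f)
        ∈ lead N' (a + 1) := by
      refine Submodule.sum_mem _ fun l _ => up_mem_lead hN' l (ih (downBy_mem_lead hb hc hm ?_ hf))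
      intro u hu
      have h3 := hP (fun k => u (unitE (Sum.inl k))) (by
        rw [Submodule.mem_comap, hg, ← sym_one_eq (mem_lead.mp hu).1]
        exact hu) l
      simp only [sub_mul, Finset.sum_sub_distrib, h3]
      simp [Pi.single_apply]
    have hE := sum_up_down hS
    have hsum : ∑ k, up k (down k f) = ∑ k, ∑ l, P l k • up l (down k f)
        + ∑ l, up l (downBy (fun k => (Pi.single l 1 : κ → K) k - P l k) f) := by
      simp only [downBy, LinearMap.sum_apply, LinearMap.smul_apply, sub_smul,
        Finset.sum_sub_distrib, map_sub, map_sum, map_smul]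
      rw [Finset.sum_comm (f := fun l k => P l k • up l (down k f)), add_sub_cancel]
      simp [Pi.single_apply]
    rw [← Submodule.smul_mem_iff _ (Nat.cast_ne_zero.mpr (Nat.succ_ne_zero a) :
      ((a + 1 : ℕ) : K) ≠ 0), ← hE, hsum]
    exact Submodule.add_mem _ hA hB

end Lead

section Linear

open Finsupp

variable {κ : Type} [Fintype κ] {m : ℕ} {K : Type*} [Field K] [Algebra ℂ K] [CharZero K]
  {δ : κ ⊕ Fin m → Derivation ℂ K K}

theorem curl_apply (i j : Fin m) (γ : Expo κ m) (hγ : sdeg γ = 0) (θ : Op κ m K) :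
    curl i j γ θ 0 = (γ (Sum.inr j) : K) * θ (i, γ - unitE (Sum.inr j))
      - (γ (Sum.inr i) : K) * θ (j, γ - unitE (Sum.inr i)) := by
  have h : ∀ i j : Fin m, (γ (Sum.inr j) : K) * ycoef (γ - unitE (Sum.inr j)) i θ 0
      = (γ (Sum.inr j) : K) * θ (i, γ - unitE (Sum.inr j)) := by
    intro i j
    by_cases hj : γ (Sum.inr j) = 0
    · simp [hj]
    · have h1 := congrArg sdeg ((eq_tsub_unitE hj).mp
        (rfl : γ - unitE (Sum.inr j) = γ - unitE (Sum.inr j)))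
      rw [ycoef_apply _ (by simpa [hγ] using h1) _ _ (by simp), zero_add]
  simp only [curl, LinearMap.sub_apply, LinearMap.smul_apply, Finsupp.sub_apply,
    Finsupp.smul_apply, smul_eq_mul, h]

theorem exists_eq_unitE_inr {α : Expo κ m} (h1 : sdeg α = 0) (h2 : ydeg α = 1) :
    ∃ b, α = unitE (Sum.inr b) := by
  obtain ⟨b, hb⟩ : ∃ b, α (Sum.inr b) ≠ 0 := by
    by_contra! hcon
    simp [ydeg, hcon] at h2
  have h6 := (eq_tsub_unitE hb).mp (rfl : α - unitE (Sum.inr b) = α - unitE (Sum.inr b))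
  have h3 := congrArg sdeg h6
  have h4 := congrArg ydeg h6
  simp only [sdeg_add, sdeg_inr, ydeg_add, ydeg_inr] at h3 h4
  have h7 : α - unitE (Sum.inr b) = 0 := expo_ext
    (fun b => inl_eq_zero_of_sdeg (by omega) b) (fun b => inr_eq_zero_of_ydeg (by omega) b)
  rw [h7, zero_add] at h6
  exact ⟨b, h6.symm⟩

theorem eq_zero_of_deg {α : Expo κ m} (h1 : sdeg α = 0) (h2 : ydeg α = 0) : α = 0 :=
  expo_ext (fun b => inl_eq_zero_of_sdeg h1 b) (fun b => inr_eq_zero_of_ydeg h2 b)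

theorem coef_linear_of_mem {N : Submodule K (Op κ m K)} (hc : CurlFree N) {θ : Op κ m K}
    (h1 : θ ∈ N) (h2 : θ ∈ Fil κ m K 0 2) (l b : Fin m) :
    (l ≠ b → θ (l, unitE (Sum.inr b)) = 0) ∧
      θ (l, unitE (Sum.inr l)) = θ (b, unitE (Sum.inr b)) := by
  by_cases hlb : l = b
  · subst hlb
    simp
  constructor
  · intro _
    have := congrArg (fun f => f 0) (hc 1 θ h1 h2 l b (unitE (Sum.inr b) + unitE (Sum.inr b))
      (by simp) (by simp))
    simp only [curl_apply _ _ _ (show sdeg (unitE (Sum.inr b) + unitE (Sum.inr b) : Expo κ m) = 0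
      by simp), add_tsub_cancel_right] at this
    simpa [hlb, Ne.symm hlb, Finsupp.single_apply] using this
  · have := congrArg (fun f => f 0) (hc 1 θ h1 h2 l b (unitE (Sum.inr l) + unitE (Sum.inr b))
      (by simp) (by simp))
    simp only [curl_apply _ _ _ (show sdeg (unitE (Sum.inr l) + unitE (Sum.inr b) : Expo κ m) = 0
      by simp), add_tsub_cancel_right, add_tsub_cancel_left] at this
    rw [← sub_eq_zero]
    simpa [hlb, Ne.symm hlb, Finsupp.single_apply] using this

theorem coef_zero_of_mem {N : Submodule K (Op κ m K)} (hc : CurlFree N) (hm : 2 ≤ m)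
    {θ : Op κ m K} (h1 : θ ∈ N) (h2 : θ ∈ Fil κ m K 0 1) (l : Fin m) : θ (l, 0) = 0 := by
  obtain ⟨b, hb⟩ : ∃ b : Fin m, b ≠ l := by
    have : Nontrivial (Fin m) := Fin.nontrivial_iff_two_le.mpr hm
    exact exists_ne l
  have := congrArg (fun f => f 0) (hc 0 θ h1 h2 l b (unitE (Sum.inr b)) (by simp) (by simp))
  simp only [curl_apply _ _ _ (show sdeg (unitE (Sum.inr b) : Expo κ m) = 0 by simp)] at this
  simpa [hb, Ne.symm hb, Finsupp.single_apply] using this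

/-- A formal field whose restriction to the fibre vanishes at the origin with linear part `M`. -/
structure HasLinearPart (X : Fin m → MvPowerSeries (κ ⊕ Fin m) K) (M : Fin m → Fin m → K) :
    Prop where
  zero : ∀ l, MvPowerSeries.coeff 0 (X l) = 0
  linear : ∀ l b, MvPowerSeries.coeff (unitE (Sum.inr b)) (X l) = M l b

theorem exists_linear_field {N : Submodule K (Op κ m K)} (hc : CurlFree N) (M : Fin m → Fin m → K)
    (hM : ∑ i, M i i = 0) : ∃ X ∈ perp N, HasLinearPart X M := by
  classical
  let z : Op κ m K →ₗ[K] K := ∑ i, ∑ j, M i j • Finsupp.lapply (i, unitE (Sum.inr j))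
  have hz : ∀ θ, z θ = ∑ i, ∑ j, M i j * θ (i, unitE (Sum.inr j)) := by
    intro θ
    simp [z]
  obtain ⟨X, hX, h⟩ := exists_perp_extending N (Fil κ m K 0 2) z (fun θ h1 h2 => by
    rw [hz]
    have h3 : ∀ i, ∑ j, M i j * θ (i, unitE (Sum.inr j)) = M i i * θ (i, unitE (Sum.inr i)) := by
      intro i
      refine Finset.sum_eq_single i (fun j _ hj => ?_) (by simp)
      rw [(coef_linear_of_mem hc h1 h2 i j).1 (Ne.symm hj), mul_zero]
    simp only [h3]
    rcases isEmpty_or_nonempty (Fin m) with h0 | ⟨⟨b⟩⟩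
    · simp
    · have h4 : ∀ i, M i i * θ (i, unitE (Sum.inr i)) = M i i * θ (b, unitE (Sum.inr b)) :=
        fun i => by rw [(coef_linear_of_mem hc h1 h2 i b).2]
      simp only [h4, ← Finset.sum_mul, hM, zero_mul])
  refine ⟨X, hX, fun l => ?_, fun l b => ?_⟩
  · have h1 := h (single (l, 0) 1) (single_mem_Fil (by simp))
    rw [pair_single, one_mul, hz] at h1
    rw [h1]
    refine Finset.sum_eq_zero fun i _ => Finset.sum_eq_zero fun j _ => ?_
    rw [Finsupp.single_apply, if_neg, mul_zero]
    intro h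
    have := congrArg (fun p : Fin m × Expo κ m => ydeg p.2) h
    simp at this
  · have h1 := h (single (l, unitE (Sum.inr b)) 1) (single_mem_Fil (by simp))
    rw [pair_single, one_mul, hz, Finset.sum_eq_single l, Finset.sum_eq_single b] at h1
    · simpa using h1
    · intro j _ hj
      rw [Finsupp.single_eq_of_ne, mul_zero]
      simp [Finsupp.single_left_inj, hj]
    · simp
    · intro i _ hi
      refine Finset.sum_eq_zero fun j _ => ?_
      rw [Finsupp.single_eq_of_ne, mul_zero]
      simp [hi]
    · simp

variable {X : Fin m → MvPowerSeries (κ ⊕ Fin m) K} {M : Fin m → Fin m → K}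

theorem HasLinearPart.contr_mem_Fil (hX : HasLinearPart X M) {d : ℕ} {θ : Op κ m K}
    (hθ : θ ∈ Fil κ m K 0 d) : contr X θ ∈ Fil κ m K 0 d := by
  classical
  refine Fil_induction (contr X) _ (fun p hp => ?_) hθ
  rw [contr_single]
  refine Submodule.smul_mem _ _ (Submodule.sum_mem _ fun q hq => Submodule.sum_mem _ fun j _ => ?_)
  rw [Finset.HasAntidiagonal.mem_antidiagonal] at hq
  have hs := congrArg sdeg hq
  have hy := congrArg ydeg hq
  rw [sdeg_add] at hs
  rw [ydeg_add] at hy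
  refine Submodule.sub_mem _ ?_ (single_mem_Fil ?_)
  · by_cases h0 : q.2 = 0
    · rw [h0, hX.zero, mul_zero, Finsupp.single_zero]
      exact Submodule.zero_mem _
    · refine single_mem_Fil ?_
      have : ydeg q.2 ≠ 0 := fun h => h0 (eq_zero_of_deg (by omega) h)
      simp only [sdeg_add, sdeg_inr, ydeg_add, ydeg_inr]
      omega
  · simp only
    omega

theorem HasLinearPart.contr_single_zero (hX : HasLinearPart X M) (i : Fin m) :
    contr X (single (i, 0) 1) = - ∑ j, single (j, 0) (M i j) := by
  classical
  have h : Finset.HasAntidiagonal.antidiagonal (0 : Expo κ m) = {(0, 0)} := by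
    ext ⟨a, b⟩
    simp [Finset.HasAntidiagonal.mem_antidiagonal, Prod.ext_iff]
  rw [contr_single, one_smul, h, Finset.sum_singleton, ← Finset.sum_neg_distrib]
  refine Finset.sum_congr rfl fun j _ => ?_
  simp [hX.zero, hX.linear]

theorem HasLinearPart.contr_single_unitE (hX : HasLinearPart X M) (i : Fin m) (c : κ ⊕ Fin m) :
    contr X (single (i, unitE c) 1) = ∑ j, (single (i, unitE (Sum.inr j))
        (MvPowerSeries.coeff (unitE c) (X j))
      - single (j, 0) ((((unitE c : Expo κ m) (Sum.inr j) : K) + 1) *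
          MvPowerSeries.coeff (unitE c + unitE (Sum.inr j)) (X i))
      - single (j, unitE c) (M i j)) := by
  classical
  have h : Finset.HasAntidiagonal.antidiagonal (unitE c : Expo κ m) =
      {(0, unitE c), (unitE c, 0)} := by
    ext ⟨a, b⟩
    simp only [Finset.HasAntidiagonal.mem_antidiagonal, Finset.mem_insert, Finset.mem_singleton,
      Prod.ext_iff]
    constructor
    · intro h
      by_cases ha : a c = 0
      · left
        have ha' : a = 0 := by
          ext x
          have := DFunLike.congr_fun h x
          by_cases hx : x = c
          · simpa [hx] using ha
          · simp [Finsupp.single_apply, Ne.symm hx] at this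
            simpa using this.1
        exact ⟨ha', by simpa [ha'] using h⟩
      · right
        have hb' : b = 0 := by
          ext x
          have := DFunLike.congr_fun h x
          by_cases hx : x = c
          · subst hx
            simp at this
            simp
            omega
          · simp [Finsupp.single_apply, Ne.symm hx] at this
            simpa using this.2
        exact ⟨by simpa [hb'] using h, hb'⟩
    · rintro (⟨rfl, rfl⟩ | ⟨rfl, rfl⟩) <;> simp
  have hne : ((0 : Expo κ m), (unitE c : Expo κ m)) ≠ (unitE c, 0) := by
    intro h
    simpa using congrArg (fun p : Expo κ m × Expo κ m => p.2 c) h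
  rw [contr_single, one_smul, h, Finset.sum_pair hne, ← Finset.sum_add_distrib]
  refine Finset.sum_congr rfl fun j _ => ?_
  simp [hX.zero, hX.linear, sub_eq_add_neg]

set_option maxHeartbeats 400000 in
/-- The top symbol of the contraction with a field with linear part `M`. -/
theorem HasLinearPart.contr_apply (hX : HasLinearPart X M) {d : ℕ} {θ : Op κ m K}
    (hθ : θ ∈ Fil κ m K 0 (d + 1)) (l : Fin m) {γ : Expo κ m} (h0 : sdeg γ = 0)
    (hγ : ydeg γ = d) :
    contr X θ (l, γ) = ∑ j, ∑ b, M j b * ((γ (Sum.inr j) : K) *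
        θ (l, γ - unitE (Sum.inr j) + unitE (Sum.inr b))) - ∑ j, M j l * θ (j, γ) := by
  classical
  let g : Op κ m K →ₗ[K] K := Finsupp.lapply (l, γ) ∘ₗ contr X
    - (∑ j, ∑ b, (M j b * (γ (Sum.inr j) : K)) •
        Finsupp.lapply (l, γ - unitE (Sum.inr j) + unitE (Sum.inr b))
      - ∑ j, M j l • Finsupp.lapply (j, γ))
  have hg : ∀ θ, g θ = contr X θ (l, γ) - (∑ j, ∑ b, M j b * ((γ (Sum.inr j) : K) *
        θ (l, γ - unitE (Sum.inr j) + unitE (Sum.inr b))) - ∑ j, M j l * θ (j, γ)) := by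
    intro θ
    simp [g, mul_assoc]
  have key : g θ ∈ (⊥ : Submodule K K) := by
    refine Fil_induction g _ (fun p hp => ?_) hθ
    obtain ⟨i, y⟩ := p
    simp only [not_lt_zero, false_or] at hp
    rw [Submodule.mem_bot, hg, sub_eq_zero, contr_single, one_smul, Finsupp.finsetSum_apply]
    simp only [Finsupp.finsetSum_apply, Finsupp.sub_apply, Finset.sum_sub_distrib]
    rw [Finset.sum_comm, Finset.sum_comm (s := Finset.HasAntidiagonal.antidiagonal y)]
    congr 1
    · refine Finset.sum_congr rfl fun j _ => ?_
      by_cases hj : γ (Sum.inr j) = 0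
      · simp only [hj, Nat.cast_zero, zero_mul, mul_zero, Finset.sum_const_zero]
        refine Finset.sum_eq_zero fun q _ => ?_
        rw [Finsupp.single_eq_of_ne]
        intro h
        have := DFunLike.congr_fun (congrArg Prod.snd h) (Sum.inr j)
        simp [hj] at this
      · obtain ⟨μ, rfl⟩ : ∃ μ, γ = μ + unitE (Sum.inr j) :=
          ⟨γ - unitE (Sum.inr j), ((eq_tsub_unitE hj).mp rfl).symm⟩
        simp only [add_tsub_cancel_right]
        simp only [sdeg_add, sdeg_inr, add_zero, ydeg_add, ydeg_inr] at h0 hγ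
        by_cases hil : i = l
        · subst hil
          have h1 : ∀ q : Expo κ m × Expo κ m, (single (i, q.1 + unitE (Sum.inr j))
              (((q.1 (Sum.inr j) : K) + 1) * MvPowerSeries.coeff q.2 (X j)) : Op κ m K)
              (i, μ + unitE (Sum.inr j)) = if q.1 = μ then
                ((μ (Sum.inr j) : K) + 1) * MvPowerSeries.coeff q.2 (X j) else 0 := by
            intro q
            rw [Finsupp.single_apply]
            by_cases hq : q.1 = μ
            · simp [hq]
            · rw [if_neg hq, if_neg]
              intro h
              exact hq (add_right_cancel (congrArg Prod.snd h))
          have h2 : ∀ b, (single (i, y) (1 : K) : Op κ m K) (i, μ + unitE (Sum.inr b)) =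
              if y = μ + unitE (Sum.inr b) then 1 else 0 := by
            intro b
            rw [Finsupp.single_apply]
            simp
          simp only [h1, h2]
          by_cases hb : ∃ b, y = μ + unitE (Sum.inr b)
          · obtain ⟨b, rfl⟩ := hb
            rw [Finset.sum_eq_single (μ, unitE (Sum.inr b)), Finset.sum_eq_single b]
            · simp [hX.linear]
              ring
            · intro c _ hc
              rw [if_neg]
              · simp
              · intro h
                exact hc (Sum.inr_injective ((Finsupp.single_left_inj (one_ne_zero (α := ℕ))).mp
                  (add_left_cancel h))).symm
            · simp
            · intro q hq hne
              rw [if_neg]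
              intro h
              rw [Finset.HasAntidiagonal.mem_antidiagonal, h] at hq
              exact hne (Prod.ext h (add_left_cancel hq))
            · intro h
              rw [Finset.HasAntidiagonal.mem_antidiagonal] at h
              simp at h
          · rw [Finset.sum_eq_zero, Finset.sum_eq_zero]
            · intro b _
              rw [if_neg fun h => hb ⟨b, h⟩]
              simp
            · intro q hq
              rw [Finset.HasAntidiagonal.mem_antidiagonal] at hq
              split_ifs with h
              · rw [h] at hq
                have hs := congrArg sdeg hq
                have hy := congrArg ydeg hq
                rw [sdeg_add] at hs
                rw [ydeg_add] at hy
                by_cases h3 : ydeg q.2 = 0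
                · rw [eq_zero_of_deg (by omega) h3, hX.zero, mul_zero]
                · obtain ⟨b, hb'⟩ := exists_eq_unitE_inr (α := q.2) (by omega) (by omega)
                  exact absurd ⟨b, by rw [← hq, hb']⟩ hb
              · rfl
        · rw [Finset.sum_eq_zero, Finset.sum_eq_zero]
          · intro b _
            rw [Finsupp.single_eq_of_ne]
            · simp
            · simp [Ne.symm hil]
          · intro q _
            rw [Finsupp.single_eq_of_ne]
            simp [Ne.symm hil]
    · rw [Finset.sum_eq_single l, Finset.sum_eq_single i]
      · by_cases hy : y = γ
        · subst hy
          rw [Finset.sum_eq_single (y, 0)]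
          · simp [hX.linear]
          · intro q hq hne
            rw [Finset.HasAntidiagonal.mem_antidiagonal] at hq
            rw [Finsupp.single_eq_of_ne]
            intro h
            have h1 : q.1 = y := (congrArg Prod.snd h).symm
            rw [h1] at hq
            exact hne (Prod.ext h1 (add_eq_left.mp hq))
          · intro h
            exact absurd (Finset.HasAntidiagonal.mem_antidiagonal.mpr (add_zero _)) h
        · rw [Finsupp.single_eq_of_ne (by simpa using Ne.symm hy), mul_zero]
          refine Finset.sum_eq_zero fun q hq => ?_
          rw [Finset.HasAntidiagonal.mem_antidiagonal] at hq
          rw [Finsupp.single_eq_of_ne]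
          intro h
          have h1 : q.1 = γ := (congrArg Prod.snd h).symm
          rw [h1] at hq
          have hs := congrArg sdeg hq
          have hy' := congrArg ydeg hq
          rw [sdeg_add] at hs
          rw [ydeg_add] at hy'
          rw [eq_zero_of_deg (α := q.2) (by omega) (by omega), add_zero] at hq
          exact hy hq.symm
      · intro j _ hj
        rw [Finsupp.single_eq_of_ne, mul_zero]
        simp [hj]
      · simp
      · intro j _ hj
        refine Finset.sum_eq_zero fun q _ => ?_
        rw [Finsupp.single_eq_of_ne]
        simp [Ne.symm hj]
      · simp
  rw [Submodule.mem_bot, hg, sub_eq_zero] at key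
  exact key

end Linear

section Constants

open Finsupp

variable {κ : Type} [Fintype κ] {m : ℕ} {K : Type*} [Field K] [Algebra ℂ K] [CharZero K]
  {δ : κ ⊕ Fin m → Derivation ℂ K K}
  {X : Fin m → MvPowerSeries (κ ⊕ Fin m) K} {M : Fin m → Fin m → K}

/-- The symbol of degree one with given coefficients. -/
def vec (m : ℕ) : (κ → K) →ₗ[K] (Expo κ m →₀ K) :=
  ∑ k, (LinearMap.proj k).smulRight (single (unitE (Sum.inl k)) (1 : K))

theorem vec_apply (w : κ → K) : vec m w = ∑ k, w k • single (unitE (Sum.inl k)) (1 : K) := by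
  simp [vec]

theorem put_vec (w : κ → K) (i : Fin m) :
    put i (vec m w) = ∑ k, w k • single (i, unitE (Sum.inl k)) (1 : K) := by
  simp only [vec_apply, map_sum, map_smul, put_single]

theorem vec_mem_Sym (w : κ → K) : vec m w ∈ Sym κ m K 1 := by
  rw [vec_apply]
  exact Submodule.sum_mem _ fun k _ => Submodule.smul_mem _ _
    (Finsupp.single_mem_supported K _ (by simp))

theorem coefD_put_vec (δ : Derivation ℂ K K) (w : κ → K) (i : Fin m) :
    coefD δ (put i (vec m w)) = put i (vec m fun k => δ (w k)) := by
  simp [put_vec]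

theorem HasLinearPart.contr_single_add (hX : HasLinearPart X M) (i : Fin m) (k : κ) (b : Fin m) :
    contr X (single (i, unitE (Sum.inl k) + unitE (Sum.inr b)) 1)
      + ∑ j, (single (j, unitE (Sum.inl k) + unitE (Sum.inr b)) (M i j)
        - single (i, unitE (Sum.inl k) + unitE (Sum.inr j)) (M j b)
        + single (j, unitE (Sum.inl k)) ((((unitE (Sum.inr b) : Expo κ m) (Sum.inr j) : K) + 1) *
          MvPowerSeries.coeff (unitE (Sum.inr b) + unitE (Sum.inr j)) (X i))) ∈ Fil κ m K 1 0 := by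
  classical
  have hq0 : (unitE (Sum.inl k) + unitE (Sum.inr b), (0 : Expo κ m)) ∈
      Finset.HasAntidiagonal.antidiagonal (unitE (Sum.inl k) + unitE (Sum.inr b) : Expo κ m) := by
    simp [Finset.HasAntidiagonal.mem_antidiagonal]
  have hq1 : (unitE (Sum.inl k), (unitE (Sum.inr b) : Expo κ m)) ∈
      (Finset.HasAntidiagonal.antidiagonal
        (unitE (Sum.inl k) + unitE (Sum.inr b) : Expo κ m)).erase
        (unitE (Sum.inl k) + unitE (Sum.inr b), (0 : Expo κ m)) := by
    simp [Finset.HasAntidiagonal.mem_antidiagonal, Prod.ext_iff]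
  rw [contr_single, one_smul, ← Finset.add_sum_erase _ _ hq0, ← Finset.add_sum_erase _ _ hq1,
    ← add_assoc, add_right_comm]
  refine Submodule.add_mem _ ?_ (Submodule.sum_mem _ fun q hq => Submodule.sum_mem _ fun j _ => ?_)
  · rw [← Finset.sum_add_distrib, ← Finset.sum_add_distrib]
    refine Submodule.sum_mem _ fun j _ => ?_
    simp only [hX.zero, hX.linear, mul_zero, Finsupp.single_zero, zero_add, Finsupp.coe_zero,
      Pi.zero_apply, Nat.cast_zero, one_mul]
    have : ∀ a b c : Op κ m K, 0 - a + (b - c) + (a - b + c) = 0 := fun a b c => by abel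
    have h0 : (unitE (Sum.inl k) : Expo κ m) (Sum.inr j) = 0 := by simp
    simp only [h0, Nat.cast_zero, zero_add, one_mul, this]
    exact Submodule.zero_mem _
  · obtain ⟨hne, hq⟩ := Finset.mem_erase.mp hq
    obtain ⟨hne', hq⟩ := Finset.mem_erase.mp hq
    rw [Finset.HasAntidiagonal.mem_antidiagonal] at hq
    have h1 := congrArg sdeg hq
    have h2 := congrArg ydeg hq
    simp only [sdeg_add, ydeg_add, sdeg_inl, sdeg_inr, ydeg_inl, ydeg_inr] at h1 h2
    have h3 : sdeg q.2 ≠ 0 := by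
      intro h3
      by_cases h4 : ydeg q.2 = 0
      · have h5 := eq_zero_of_deg h3 h4
        rw [h5, add_zero] at hq
        exact hne' (Prod.ext hq h5)
      · obtain ⟨k', hk⟩ := exists_eq_unitE (α := q.1) (by omega) (by omega)
        obtain ⟨b', hb⟩ := exists_eq_unitE_inr (α := q.2) h3 (by omega)
        rw [hk, hb] at hq
        have e1 := DFunLike.congr_fun hq (Sum.inl k')
        have e2 := DFunLike.congr_fun hq (Sum.inr b')
        simp [Finsupp.single_apply] at e1 e2
        exact hne (Prod.ext (by rw [hk, e1]) (by rw [hb, e2]))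
    refine Submodule.sub_mem _ (single_mem_Fil ?_) (single_mem_Fil ?_)
    · simp only [sdeg_add, sdeg_inr]
      omega
    · simp only
      omega

/-- The leading symbols of degree one are stable under derivation along the fibre. -/
theorem vec_deriv_mem {N : Submodule K (Op κ m K)} (hN : DStable δ N) (hb : BracketClosed N)
    (hc : CurlFree N) (hm : 2 ≤ m) {w : κ → K} (hw : vec m w ∈ lead N 1) (j : Fin m) :
    vec m (fun k => δ (Sum.inr j) (w k)) ∈ lead N 1 := by
  classical
  refine mem_lead.mpr ⟨vec_mem_Sym _, fun i => ?_⟩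
  have hL := (mem_lead.mp hw).2
  have hU : ∀ i j, shift (Sum.inr j) (put i (vec m w))
      + put i (vec m fun k => δ (Sum.inr j) (w k)) ∈ N ⊔ Fil κ m K 1 0 := by
    intro i j
    obtain ⟨n, hn, u, hu, hnu⟩ := Submodule.mem_sup.mp (hL i)
    rw [← coefD_put_vec, ← hnu, map_add, map_add]
    have : shift (Sum.inr j) n + shift (Sum.inr j) u + (coefD (δ (Sum.inr j)) n
        + coefD (δ (Sum.inr j)) u) = dmul δ (Sum.inr j) n
          + (shift (Sum.inr j) u + coefD (δ (Sum.inr j)) u) := by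
      rw [dmul_apply]
      abel
    rw [this]
    exact Submodule.add_mem_sup (hN _ _ hn)
      (Submodule.add_mem _ (shift_inr_mem_Fil_zero j hu) (coefD_mem_Fil _ hu))
  obtain ⟨b, hbj⟩ : ∃ b : Fin m, b ≠ j := by
    have : Nontrivial (Fin m) := Fin.nontrivial_iff_two_le.mpr hm
    exact exists_ne j
  obtain ⟨X, hX, hXM⟩ := exists_linear_field hc
    (fun l c => if l = j ∧ c = b then (1 : K) else 0) (by
      refine Finset.sum_eq_zero fun l _ => if_neg ?_
      rintro ⟨h1, h2⟩
      exact hbj (h2.symm.trans h1))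
  have hC : ∀ θ ∈ N ⊔ Fil κ m K 1 0, contr X θ ∈ N ⊔ Fil κ m K 1 0 := by
    intro θ hθ
    obtain ⟨n, hn, u, hu, rfl⟩ := Submodule.mem_sup.mp hθ
    rw [map_add]
    exact Submodule.add_mem_sup (hb.contr_mem hX hn) (contr_mem_Fil_zero X hu)
  have hsh : ∀ (l : Fin m) (i : Fin m) (w : κ → K), shift (Sum.inr l) (put i (vec m w))
      = ∑ k, w k • single (i, unitE (Sum.inl k) + unitE (Sum.inr l)) (1 : K) := by
    intro l i w
    simp [put_vec]
  have h1 := hC _ (hU i b)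
  rw [map_add] at h1
  -- the first term
  have h2 : contr X (shift (Sum.inr b) (put i (vec m w)))
      + ((if i = j then shift (Sum.inr b) (put b (vec m w)) else 0)
        - shift (Sum.inr j) (put i (vec m w))
        + ∑ l, ((((unitE (Sum.inr b) : Expo κ m) (Sum.inr l) : K) + 1) *
          MvPowerSeries.coeff (unitE (Sum.inr b) + unitE (Sum.inr l)) (X i)) • put l (vec m w))
      ∈ Fil κ m K 1 0 := by
    have h3 := Submodule.sum_mem (Fil κ m K 1 0) fun k (_ : k ∈ Finset.univ) =>
      Submodule.smul_mem _ (w k) (hXM.contr_single_add i k b)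
    convert h3 using 1
    simp only [hsh]
    simp only [put_vec, map_sum, map_smul, smul_add, Finset.sum_add_distrib,
      Finset.sum_sub_distrib, smul_sub]
    refine congrArg₂ (· + ·) rfl (congrArg₂ (· + ·) (congrArg₂ (· - ·) ?_ ?_) ?_)
    · split_ifs with hij
      · refine Finset.sum_congr rfl fun k _ => ?_
        rw [Finset.sum_eq_single b]
        · simp [hij]
        · intro c _ hc
          simp [hc]
        · simp
      · simp [hij]
    · refine Finset.sum_congr rfl fun k _ => ?_
      rw [Finset.sum_eq_single j]
      · simp
      · intro c _ hc
        simp [hc]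
      · simp
    · simp only [Finset.smul_sum]
      rw [Finset.sum_comm]
      refine Finset.sum_congr rfl fun k _ => Finset.sum_congr rfl fun l _ => ?_
      rw [smul_comm, Finsupp.smul_single, Finsupp.smul_single, Finsupp.smul_single, smul_eq_mul,
        smul_eq_mul, smul_eq_mul, mul_one]
  have h4 : contr X (put i (vec m fun k => δ (Sum.inr b) (w k)))
      + (if i = j then put b (vec m fun k => δ (Sum.inr b) (w k)) else 0) ∈ Fil κ m K 1 0 := by
    simp only [put_vec, map_sum, map_smul]
    have h5 : ∀ k, contr X (single (i, unitE (Sum.inl k)) 1)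
        + (if i = j then single (b, unitE (Sum.inl k)) (1 : K) else 0) ∈ Fil κ m K 1 0 := by
      intro k
      rw [hXM.contr_single_unitE]
      have : (∑ l, single (l, unitE (Sum.inl k)) (if i = j ∧ l = b then (1 : K) else 0) :
          Op κ m K) = if i = j then single (b, unitE (Sum.inl k)) (1 : K) else 0 := by
        rw [Finset.sum_eq_single b]
        · split_ifs <;> simp_all
        · intro c _ hc
          simp [hc]
        · simp
      simp only [Finset.sum_sub_distrib]
      rw [this, sub_add_cancel]
      exact Submodule.sub_mem _ (Submodule.sum_mem _ fun l _ => single_mem_Fil (by simp))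
        (Submodule.sum_mem _ fun l _ => single_mem_Fil (by simp))
    have h6 := Submodule.sum_mem (Fil κ m K 1 0) fun k (_ : k ∈ Finset.univ) =>
      Submodule.smul_mem _ (δ (Sum.inr b) (w k)) (h5 k)
    convert h6 using 1
    simp only [smul_add, Finset.sum_add_distrib]
    congr 1
    split_ifs <;> simp
  have h7 : (if i = j then shift (Sum.inr b) (put b (vec m w))
      + put b (vec m fun k => δ (Sum.inr b) (w k)) else 0) ∈ N ⊔ Fil κ m K 1 0 := by
    split_ifs
    · exact hU b b
    · exact Submodule.zero_mem _
  have h8 : ∑ l, ((((unitE (Sum.inr b) : Expo κ m) (Sum.inr l) : K) + 1) *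
      MvPowerSeries.coeff (unitE (Sum.inr b) + unitE (Sum.inr l)) (X i)) • put l (vec m w)
      ∈ N ⊔ Fil κ m K 1 0 :=
    Submodule.sum_mem _ fun l _ => Submodule.smul_mem _ _ (hL l)
  have h9 : shift (Sum.inr j) (put i (vec m w)) ∈ N ⊔ Fil κ m K 1 0 := by
    have := Submodule.sub_mem _ (Submodule.add_mem _ (Submodule.add_mem _ h1 h7) h8)
      (Submodule.mem_sup_right (S := N) (Submodule.add_mem _ h2 h4))
    convert this using 1
    split_ifs <;> abel
  simpa using Submodule.sub_mem _ (hU i j) h9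

/-- A space of vectors stable under derivations is spanned by its constant vectors. -/
theorem mem_span_constants {ι κ : Type*} [Fintype κ] {K : Type*} [Field K] [Algebra ℂ K]
    (δ : ι → Derivation ℂ K K) (F : Submodule K (κ → K))
    (hF : ∀ w ∈ F, ∀ j, (fun k => δ j (w k)) ∈ F) :
    ∀ w ∈ F, w ∈ Submodule.span K {v | v ∈ F ∧ ∀ j k, δ j (v k) = 0} := by
  classical
  intro w
  obtain ⟨n, hn⟩ : ∃ n, (Finset.univ.filter fun k => w k ≠ 0).card = n := ⟨_, rfl⟩
  induction n using Nat.strong_induction_on generalizing w with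
  | _ n ih =>
    intro hw
    by_cases hw0 : w = 0
    · rw [hw0]
      exact Submodule.zero_mem _
    let Q : ℕ → Prop := fun c => ∃ v ∈ F, v ≠ 0 ∧ (∀ k, w k = 0 → v k = 0) ∧
      (Finset.univ.filter fun k => v k ≠ 0).card = c
    have hQ : ∃ c, Q c := ⟨_, w, hw, hw0, fun _ h => h, rfl⟩
    obtain ⟨v, hv, hv0, hvw, hvc⟩ := Nat.find_spec hQ
    have hmin : ∀ u ∈ F, (∀ k, v k = 0 → u k = 0) → (∃ k, v k ≠ 0 ∧ u k = 0) → u = 0 := by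
      intro u hu huv hlt
      by_contra hu0
      refine Nat.find_min hQ (m := (Finset.univ.filter fun k => u k ≠ 0).card) ?_
        ⟨u, hu, hu0, fun k hk => huv k (hvw k hk), rfl⟩
      rw [← hvc]
      refine Finset.card_lt_card (Finset.ssubset_iff_subset_ne.mpr ⟨fun k hk => ?_, fun h => ?_⟩)
      · simp only [Finset.mem_filter, Finset.mem_univ, true_and] at hk ⊢
        exact fun h => hk (huv k h)
      · obtain ⟨k, hk1, hk2⟩ := hlt
        have : k ∈ Finset.univ.filter fun k => u k ≠ 0 := by
          rw [h]
          simpa using hk1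
        simp [hk2] at this
    obtain ⟨k0, hk0⟩ := Function.ne_iff.mp hv0
    simp only [Pi.zero_apply] at hk0
    let u : κ → K := (v k0)⁻¹ • v
    have huF : u ∈ F := Submodule.smul_mem _ _ hv
    have hu1 : u k0 = 1 := by simp [u, hk0]
    have hconst : ∀ j k, δ j (u k) = 0 := by
      intro j k
      have := hmin (fun k => δ j (u k)) (hF u huF j) (fun k hk => by simp [u, hk])
        ⟨k0, hk0, by simp only [hu1, Derivation.map_one_eq_zero]⟩
      exact congrFun this k
    have hz : w - w k0 • u ∈ Submodule.span K {v | v ∈ F ∧ ∀ j k, δ j (v k) = 0} := by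
      refine ih _ ?_ _ rfl (Submodule.sub_mem _ hw (Submodule.smul_mem _ _ huF))
      rw [← hn]
      refine Finset.card_lt_card (Finset.ssubset_iff_subset_ne.mpr ⟨fun k hk => ?_, fun h => ?_⟩)
      · simp only [Finset.mem_filter, Finset.mem_univ, true_and] at hk ⊢
        intro h
        exact hk (by simp [u, h, hvw k h])
      · have : k0 ∈ Finset.univ.filter fun k => (w - w k0 • u) k ≠ 0 := by
          rw [h]
          simp only [Finset.mem_filter, Finset.mem_univ, true_and]
          exact fun h => hk0 (hvw k0 h)
        simp [hu1] at this
    have := Submodule.add_mem _ hz (Submodule.smul_mem _ (w k0)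
      (Submodule.subset_span (show u ∈ {v | v ∈ F ∧ ∀ j k, δ j (v k) = 0} from ⟨huF, hconst⟩)))
    rwa [sub_add_cancel] at this

end Constants

section NormalForm

open Finsupp

variable {κ : Type} [Fintype κ] {m : ℕ} {K : Type*} [Field K] [Algebra ℂ K] [CharZero K]
  {δ : κ ⊕ Fin m → Derivation ℂ K K}
  {X : Fin m → MvPowerSeries (κ ⊕ Fin m) K} {M : Fin m → Fin m → K}

open Classical in
/-- An equivariant family of curls of degree at least two vanishes. -/
theorem equivariant_curl_eq_zero (R : Fin m → Fin m → Fin m → Expo κ m → K) {d : ℕ} (hd : 1 ≤ d)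
    (hanti : ∀ i k l γ, R i k l γ = - R i l k γ)
    (heq : ∀ a b, a ≠ b → ∀ i k l γ, sdeg γ = 0 → ydeg γ = d + 1 →
      (γ (Sum.inr a) : K) * R i k l (γ - unitE (Sum.inr a) + unitE (Sum.inr b))
        - (if k = b then R i a l γ else 0) - (if l = b then R i k a γ else 0)
        + (if i = a then R b k l γ else 0) = 0)
    (i k l : Fin m) (γ : Expo κ m) (h0 : sdeg γ = 0) (hγ : ydeg γ = d + 1) : R i k l γ = 0 := by
  have hself : ∀ i k γ, R i k k γ = 0 := by
    intro i k γ
    have := hanti i k k γ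
    exact self_eq_neg.mp this
  have hstep : ∀ a b, a ≠ b → ∀ i k l μ, sdeg μ = 0 → ydeg μ = d →
      ((μ (Sum.inr a) : K) + 1) * R i k l (μ + unitE (Sum.inr b))
        - (if k = b then R i a l (μ + unitE (Sum.inr a)) else 0)
        - (if l = b then R i k a (μ + unitE (Sum.inr a)) else 0)
        + (if i = a then R b k l (μ + unitE (Sum.inr a)) else 0) = 0 := by
    intro a b hab i k l μ h1 h2
    have := heq a b hab i k l (μ + unitE (Sum.inr a)) (by simp [h1]) (by simp [h2])
    simpa [add_tsub_cancel_right] using this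
  have hsub : ∀ (γ : Expo κ m) b, sdeg γ = 0 → ydeg γ = d + 1 → γ (Sum.inr b) ≠ 0 →
      ∃ μ, γ = μ + unitE (Sum.inr b) ∧ sdeg μ = 0 ∧ ydeg μ = d := by
    intro γ b h1 h2 hb
    have h := (eq_tsub_unitE hb).mp (rfl : γ - unitE (Sum.inr b) = _)
    have h3 := congrArg sdeg h
    have h4 := congrArg ydeg h
    simp only [sdeg_add, sdeg_inr, ydeg_add, ydeg_inr] at h3 h4
    exact ⟨_, h.symm, by omega, by omega⟩
  have A1 : ∀ i k l γ, sdeg γ = 0 → ydeg γ = d + 1 → l ≠ i → l ≠ k → γ (Sum.inr k) ≠ 0 →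
      R i k l γ = 0 := by
    intro i k l γ h1 h2 hli hlk hk
    obtain ⟨μ, rfl, h3, h4⟩ := hsub γ k h1 h2 hk
    have := hstep l k hlk i k l μ h3 h4
    rw [if_pos rfl, if_neg hlk, if_neg (Ne.symm hli), hself, sub_zero, sub_zero, add_zero] at this
    exact (mul_eq_zero.mp this).resolve_left (Nat.cast_add_one_ne_zero _)
  have A3 : ∀ i k l b γ, sdeg γ = 0 → ydeg γ = d + 1 → k ≠ i → b ≠ k → b ≠ l →
      γ (Sum.inr b) ≠ 0 → R i k l γ = 0 := by
    intro i k l b γ h1 h2 hki hbk hbl hb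
    obtain ⟨μ, rfl, h3, h4⟩ := hsub γ b h1 h2 hb
    have := hstep k b (Ne.symm hbk) i k l μ h3 h4
    rw [if_neg (Ne.symm hbk), if_neg (Ne.symm hbl), if_neg (Ne.symm hki), sub_zero, sub_zero,
      add_zero] at this
    exact (mul_eq_zero.mp this).resolve_left (Nat.cast_add_one_ne_zero _)
  have A2 : ∀ i k l γ, sdeg γ = 0 → ydeg γ = d + 1 → k ≠ i → k ≠ l → R i k l γ = 0 := by
    intro i k l γ h1 h2 hki hkl
    by_cases hb : ∃ b, b ≠ k ∧ γ (Sum.inr b) ≠ 0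
    · obtain ⟨b, hbk, hb⟩ := hb
      by_cases hbl : b = l
      · subst hbl
        rw [hanti, A1 i b k γ h1 h2 hki hkl hb, neg_zero]
      · exact A3 i k l b γ h1 h2 hki hbk hbl hb
    · push Not at hb
      have hk : γ (Sum.inr k) = d + 1 := by
        rw [← h2, ydeg, Finset.sum_eq_single k (fun b _ h => hb b h) (by simp)]
      by_cases hli : l = i
      · subst hli
        obtain ⟨μ, rfl, h3, h4⟩ := hsub γ k h1 h2 (by omega)
        have := hstep l k (Ne.symm hkl) l k l μ h3 h4
        rw [if_pos rfl, if_neg (Ne.symm hkl), if_pos rfl, hself, sub_zero, sub_zero,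
          A1 k k l _ (by simp [h3]) (by simp [h4]) (Ne.symm hkl) (Ne.symm hkl), add_zero] at this
        · exact (mul_eq_zero.mp this).resolve_left (Nat.cast_add_one_ne_zero _)
        · simp at hk
          simp
          omega
      · exact A1 i k l γ h1 h2 hli (Ne.symm hkl) (by omega)
  by_cases hkl : k = l
  · rw [hkl, hself]
  by_cases hki : k = i
  · rw [hanti, A2 i l k γ h0 hγ (fun h => hkl (hki.trans h.symm)) (Ne.symm hkl), neg_zero]
  · exact A2 i k l γ h0 hγ hki hkl

/-- Multiplication by a fibre variable, on coefficients. -/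
def mulVar (k : Fin m) (φ : Expo κ m → K) : Expo κ m → K :=
  fun γ => (γ (Sum.inr k) : K) * φ (γ - unitE (Sum.inr k))

open Classical in
theorem mulVar_shift (k b : Fin m) (φ : Expo κ m → K) (γ : Expo κ m) :
    mulVar k (fun γ => φ (γ + unitE (Sum.inr b))) γ
      = mulVar k φ (γ + unitE (Sum.inr b)) - if k = b then φ γ else 0 := by
  simp only [mulVar]
  by_cases hkb : k = b
  · subst hkb
    by_cases h : γ (Sum.inr k) = 0
    · simp [h, add_tsub_cancel_right]
    · rw [(eq_tsub_unitE h).mp rfl, add_tsub_cancel_right]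
      simp
      ring
  · rw [if_neg hkb, sub_zero]
    by_cases h : γ (Sum.inr k) = 0
    · simp [h, hkb, Ne.symm hkb, Finsupp.single_apply]
    · have h1 : γ + unitE (Sum.inr b) - unitE (Sum.inr k)
          = γ - unitE (Sum.inr k) + unitE (Sum.inr b) := by
        symm
        rw [eq_tsub_unitE (by simp [h]), add_right_comm, (eq_tsub_unitE h).mp rfl]
      rw [h1]
      simp [hkb, Ne.symm hkb, Finsupp.single_apply]

theorem mulVar_comm (k l : Fin m) (φ : Expo κ m → K) (γ : Expo κ m) :
    mulVar k (mulVar l φ) γ = mulVar l (mulVar k φ) γ := by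
  simp only [mulVar]
  by_cases hkl : k = l
  · rw [hkl]
  · rw [tsub_right_comm]
    simp [hkl, Ne.symm hkl, Finsupp.single_apply]
    ring

/-- The operators `P i` of base degree zero complete a base vector to elements of `N`. -/
structure IsCompletion (N : Submodule K (Op κ m K)) (v : κ → K) (P : Fin m → Op κ m K) (d : ℕ) :
    Prop where
  mem_Fil : ∀ i, P i ∈ Fil κ m K 0 (d + 1)
  mem : ∀ i, put i (vec m v) - P i ∈ N

/-- The contraction of a completed vector with a field with linear part `M`, corrected by a
combination of completed vectors. -/
def contrCompletion (X : Fin m → MvPowerSeries (κ ⊕ Fin m) K) (M : Fin m → Fin m → K) (v : κ → K)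
    (P : Fin m → Op κ m K) (i : Fin m) : Op κ m K :=
  ∑ j, (single (i, unitE (Sum.inr j)) (pair X (P j)) - single (j, 0)
      (∑ k, v k * MvPowerSeries.coeff (unitE (Sum.inl k) + unitE (Sum.inr j)) (X i))
      - M i j • P j) - contr X (P i)

theorem contrCompletion_mem {N : Submodule K (Op κ m K)} (hb : BracketClosed N) {v : κ → K}
    {P : Fin m → Op κ m K} {d : ℕ} (hP : IsCompletion N v P d) (hX : X ∈ perp N)
    (hXM : HasLinearPart X M) (i : Fin m) : contrCompletion X M v P i ∈ N := by
  have hv : ∀ j, pair X (P j) = ∑ k, v k * MvPowerSeries.coeff (unitE (Sum.inl k)) (X j) := by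
    intro j
    have h := hX _ (hP.mem j)
    rw [map_sub, sub_eq_zero] at h
    rw [← h, put_vec]
    simp
  have h1 : contr X (put i (vec m v) - P i) + ∑ j, M i j • (put j (vec m v) - P j) ∈ N :=
    Submodule.add_mem _ (hb.contr_mem hX (hP.mem i))
      (Submodule.sum_mem _ fun j _ => Submodule.smul_mem _ _ (hP.mem j))
  convert h1 using 1
  have h2 : contr X (put i (vec m v)) = ∑ j, (single (i, unitE (Sum.inr j)) (pair X (P j))
      - single (j, 0)
      (∑ k, v k * MvPowerSeries.coeff (unitE (Sum.inl k) + unitE (Sum.inr j)) (X i))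
      - M i j • put j (vec m v)) := by
    rw [put_vec, map_sum]
    simp only [map_smul, hXM.contr_single_unitE, hv, put_vec]
    simp only [Finset.smul_sum]
    rw [Finset.sum_comm]
    refine Finset.sum_congr rfl fun j _ => ?_
    have e1 : ∀ (p : Fin m × Expo κ m) (f : κ → K), (single p (∑ k, f k) : Op κ m K)
        = ∑ k, single p (f k) := fun p f =>
      map_sum (Finsupp.lsingle (R := K) p) f Finset.univ
    rw [e1, e1, ← Finset.sum_sub_distrib, ← Finset.sum_sub_distrib]
    refine Finset.sum_congr rfl fun k _ => ?_
    simp [Finsupp.smul_single, smul_sub, mul_comm]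
  rw [contrCompletion, map_sub, h2]
  simp only [smul_sub, Finset.sum_sub_distrib]
  abel

theorem contrCompletion_mem_Fil {N : Submodule K (Op κ m K)} {v : κ → K}
    {P : Fin m → Op κ m K} {d : ℕ} (hP : IsCompletion N v P (d + 1))
    (hXM : HasLinearPart X M) (i : Fin m) : contrCompletion X M v P i ∈ Fil κ m K 0 (d + 2) := by
  refine Submodule.sub_mem _ (Submodule.sum_mem _ fun j _ => Submodule.sub_mem _
    (Submodule.sub_mem _ (single_mem_Fil (by simp)) (single_mem_Fil (by simp)))
    (Submodule.smul_mem _ _ (hP.mem_Fil j))) (hXM.contr_mem_Fil (hP.mem_Fil i))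

open Classical in
theorem contrCompletion_apply {N : Submodule K (Op κ m K)} {v : κ → K}
    {P : Fin m → Op κ m K} {d : ℕ} (hP : IsCompletion N v P d)
    (hXM : HasLinearPart X M) (i l : Fin m) {γ : Expo κ m} (h0 : sdeg γ = 0) (hγ : ydeg γ = d)
    (hd : 1 ≤ d) :
    contrCompletion X M v P i (l, γ) =
      (if l = i then ∑ j, if γ = unitE (Sum.inr j) then pair X (P j) else 0 else 0)
      - ∑ j, M i j * P j (l, γ) - (∑ j, ∑ b, M j b * ((γ (Sum.inr j) : K) *
        P i (l, γ - unitE (Sum.inr j) + unitE (Sum.inr b))) - ∑ j, M j l * P i (j, γ)) := by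
  rw [contrCompletion, Finsupp.sub_apply, hXM.contr_apply (hP.mem_Fil i) l h0 hγ,
    Finsupp.finsetSum_apply]
  congr 1
  have h1 : ∀ j : Fin m, (single (j, (0 : Expo κ m))
      (∑ k, v k * MvPowerSeries.coeff (unitE (Sum.inl k) + unitE (Sum.inr j)) (X i)) : Op κ m K)
      (l, γ) = 0 := by
    intro j
    rw [Finsupp.single_eq_of_ne]
    intro h
    have := congrArg (fun p : Fin m × Expo κ m => ydeg p.2) h
    simp at this
    omega
  simp only [Finsupp.sub_apply, h1, sub_zero, Finsupp.smul_apply, smul_eq_mul,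
    Finset.sum_sub_distrib]
  congr 1
  by_cases hl : l = i
  · subst hl
    rw [if_pos rfl]
    refine Finset.sum_congr rfl fun j _ => ?_
    rw [Finsupp.single_apply]
    simp [eq_comm]
  · rw [if_neg hl]
    refine Finset.sum_eq_zero fun j _ => ?_
    rw [Finsupp.single_eq_of_ne]
    simp [hl]

/-- A completion of degree at least two can be replaced by one of smaller degree. -/
theorem IsCompletion.step {N : Submodule K (Op κ m K)} (hN : DStable δ N) (hb : BracketClosed N)
    (hc : CurlFree N) {h : Fin m → K} (hdiv : divOp κ h ∈ N) (hm : 2 ≤ m) {v : κ → K}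
    {P : Fin m → Op κ m K} {d : ℕ} (hP : IsCompletion N v P (d + 2)) :
    ∃ P', IsCompletion N v P' (d + 1) := by
  classical
  have hcurl : ∀ i k l γ, sdeg γ = 0 → ydeg γ = d + 2 + 1 →
      mulVar k (fun γ => P i (l, γ)) γ - mulVar l (fun γ => P i (k, γ)) γ = 0 := by
    refine equivariant_curl_eq_zero (fun i k l γ => mulVar k (fun γ => P i (l, γ)) γ
      - mulVar l (fun γ => P i (k, γ)) γ) (by omega) (fun i k l γ => (neg_sub _ _).symm) ?_
    intro a b hab i k l γ h0 hγ
    obtain ⟨X, hX, hXM⟩ := exists_linear_field hc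
      (fun l c => if l = a ∧ c = b then (1 : K) else 0) (by
        refine Finset.sum_eq_zero fun l _ => if_neg ?_
        rintro ⟨h1, h2⟩
        exact hab (h1.symm.trans h2))
    have hE := congrArg (fun f => f 0) (hc (d + 2) _ (contrCompletion_mem hb hP hX hXM i)
      (contrCompletion_mem_Fil hP hXM i) l k γ h0 hγ)
    simp only [curl_apply _ _ _ h0, Finsupp.coe_zero, Pi.zero_apply] at hE
    have hG : ∀ l γ, sdeg γ = 0 → ydeg γ = d + 2 →
        contrCompletion X (fun l c => if l = a ∧ c = b then (1 : K) else 0) v P i (l, γ) =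
        - (mulVar a (fun γ => P i (l, γ + unitE (Sum.inr b))) γ
          - (if l = b then P i (a, γ) else 0) + if i = a then P b (l, γ) else 0) := by
      intro l γ h0 hγ
      rw [contrCompletion_apply hP hXM i l h0 hγ (by omega)]
      have h1 : ∀ j, γ ≠ unitE (Sum.inr j) := by
        rintro j rfl
        simp at hγ
      simp only [h1, if_false, Finset.sum_const_zero, ite_self, ite_and, ite_mul, one_mul,
        zero_mul, Finset.sum_ite_eq', Finset.mem_univ, if_true, mulVar]
      have e1 : ∑ j, (if i = a then if j = b then P j (l, γ) else 0 else 0)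
          = if i = a then P b (l, γ) else 0 := by
        split_ifs <;> simp
      have e2 : ∑ j, ∑ c, (if j = a then if c = b then (γ (Sum.inr j) : K) *
          P i (l, γ - unitE (Sum.inr j) + unitE (Sum.inr c)) else 0 else 0)
          = (γ (Sum.inr a) : K) * P i (l, γ - unitE (Sum.inr a) + unitE (Sum.inr b)) := by
        rw [Finset.sum_eq_single a (fun j _ hj => by simp [hj]) (by simp)]
        simp
      rw [e1, e2]
      ring
    have hmul : ∀ k l, (γ (Sum.inr k) : K) *
        contrCompletion X (fun l c => if l = a ∧ c = b then (1 : K) else 0) v P i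
          (l, γ - unitE (Sum.inr k))
        = - (mulVar k (mulVar a (fun γ => P i (l, γ + unitE (Sum.inr b)))) γ
          - (if l = b then mulVar k (fun γ => P i (a, γ)) γ else 0)
          + if i = a then mulVar k (fun γ => P b (l, γ)) γ else 0) := by
      intro k l
      by_cases hk : γ (Sum.inr k) = 0
      · simp [mulVar, hk]
      · have h1 := (eq_tsub_unitE hk).mp (rfl : γ - unitE (Sum.inr k) = _)
        have h3 := congrArg sdeg h1
        have h4 := congrArg ydeg h1
        simp only [sdeg_add, sdeg_inr, ydeg_add, ydeg_inr] at h3 h4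
        rw [hG l _ (by omega) (by omega)]
        simp only [mulVar]
        split_ifs <;> ring
    rw [hmul, hmul, mulVar_comm k a, mulVar_comm l a] at hE
    have hsh : ∀ k l, mulVar a (mulVar k (fun γ => P i (l, γ + unitE (Sum.inr b)))) γ
        = (γ (Sum.inr a) : K) * mulVar k (fun γ => P i (l, γ))
          (γ - unitE (Sum.inr a) + unitE (Sum.inr b))
          - if k = b then mulVar a (fun γ => P i (l, γ)) γ else 0 := by
      intro k l
      have h1 : mulVar a (mulVar k (fun γ => P i (l, γ + unitE (Sum.inr b)))) γ
          = (γ (Sum.inr a) : K) * mulVar k (fun γ => P i (l, γ + unitE (Sum.inr b)))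
            (γ - unitE (Sum.inr a)) := rfl
      rw [h1, mulVar_shift k b (fun γ => P i (l, γ))]
      simp only [mulVar]
      split_ifs <;> ring
    rw [hsh, hsh] at hE
    rw [← neg_eq_zero]
    refine Eq.trans ?_ hE
    split_ifs <;> ring
  have hred : ∀ i, P i ∈ N ⊔ Fil κ m K 0 (d + 2) := by
    intro i
    have hH : P i ∈ Homog κ m K 0 (d + 2) := by
      refine Finsupp.supported_mono (fun p hp => ?_) (hP.mem_Fil i)
      simp only [Set.mem_ofPred_eq] at hp ⊢
      omega
    refine mem_sup_of_curl hN hdiv hm hH fun k l γ h0 hγ => ?_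
    have : curl k l γ (P i) = 0 := by
      have h1 := curl_mem_supported hH γ k l
      ext α
      by_cases hα : sdeg α = 0 ∧ ydeg α = 0
      · rw [eq_zero_of_deg hα.1 hα.2, curl_apply _ _ _ h0]
        simpa [mulVar] using hcurl i l k γ h0 hγ
      · exact (Finsupp.mem_supported' K _).mp h1 α hα
    rw [this]
    exact Submodule.zero_mem _
  choose n hn w hw hnw using fun i => Submodule.mem_sup.mp (hred i)
  refine ⟨w, hw, fun i => ?_⟩
  have := Submodule.add_mem _ (hP.mem i) (hn i)
  rw [← hnw i] at this
  convert this using 1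
  abel

end NormalForm

section Completion

open Finsupp

variable {κ : Type} [Fintype κ] {m : ℕ} {K : Type*} [Field K] [Algebra ℂ K] [CharZero K]
  {δ : κ ⊕ Fin m → Derivation ℂ K K}
  {X : Fin m → MvPowerSeries (κ ⊕ Fin m) K} {M : Fin m → Fin m → K}

theorem exists_completion {N : Submodule K (Op κ m K)} (hN : DStable δ N) (hb : BracketClosed N)
    (hc : CurlFree N) {h : Fin m → K} (hdiv : divOp κ h ∈ N) (hm : 2 ≤ m) {v : κ → K}
    (hv : vec m v ∈ lead N 1) : ∃ P, IsCompletion N v P 1 := by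
  choose n hn w hw hnw using fun i => Submodule.mem_sup.mp ((mem_lead.mp hv).2 i)
  choose d hd using fun i => exists_mem_Fil (hw i)
  let e := Finset.univ.sup d
  have hP : IsCompletion N v w (e + 1) := by
    refine ⟨fun i => Fil_mono_right ?_ (hd i), fun i => ?_⟩
    · have : d i ≤ e := Finset.le_sup (Finset.mem_univ i)
      omega
    · rw [← hnw i, add_sub_cancel_right]
      exact hn i
  clear_value e
  clear hn hw hnw hd
  induction e generalizing w with
  | zero => exact ⟨w, hP⟩
  | succ e ih =>
    obtain ⟨P', hP'⟩ := hP.step hN hb hc hdiv hm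
    exact ih P' hP'

/-- A traceless diagonal matrix. -/
def testDiag (m : ℕ) (i : Fin m) : ℤ := if (i : ℕ) = 0 then 1 - m else 1

theorem sum_testDiag (hm : 2 ≤ m) : ∑ i, testDiag m i = 0 := by
  have h : ∀ i : Fin m, testDiag m i = 1 - if i = ⟨0, by omega⟩ then (m : ℤ) else 0 := by
    intro i
    simp only [testDiag, Fin.ext_iff]
    split_ifs <;> ring
  simp only [h, Finset.sum_sub_distrib, Finset.sum_ite_eq', Finset.mem_univ, if_true]
  simp

theorem testDiag_ne_zero (hm : 2 ≤ m) (i : Fin m) : testDiag m i ≠ 0 := by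
  simp only [testDiag]
  split_ifs <;> omega

theorem testDiag_ne (hm : 2 ≤ m) (b l i : Fin m) :
    testDiag m b - testDiag m l + testDiag m i ≠ 0 := by
  simp only [testDiag]
  split_ifs <;> omega

/-- The operators of base degree zero in normal form. -/
def normalOp (κ : Type) [Fintype κ] (V : Fin m → K) (β : Fin m → Fin m → K) (i : Fin m) :
    Op κ m K :=
  ∑ l, β i l • single (l, 0) 1 - ∑ b, V b • single (i, unitE (Sum.inr b)) 1

theorem normalOp_mem_Fil (V : Fin m → K) (β : Fin m → Fin m → K) (i : Fin m) :
    normalOp κ V β i ∈ Fil κ m K 0 2 :=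
  Submodule.sub_mem _
    (Submodule.sum_mem _ fun l _ => Submodule.smul_mem _ _ (single_mem_Fil (by simp)))
    (Submodule.sum_mem _ fun l _ => Submodule.smul_mem _ _ (single_mem_Fil (by simp)))

theorem eq_sum_single_zero {θ : Op κ m K} (h : θ ∈ Fil κ m K 0 2)
    (h1 : ∀ l b, θ (l, unitE (Sum.inr b)) = 0) : θ = ∑ l, θ (l, 0) • single (l, 0) 1 := by
  classical
  ext ⟨l, α⟩
  rw [Finsupp.finsetSum_apply, Finset.sum_eq_single l]
  · by_cases hα : α = 0
    · simp [hα]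
    · rw [Finsupp.smul_apply, Finsupp.single_eq_of_ne (by simpa using hα), smul_zero]
      by_cases h2 : sdeg α = 0 ∧ ydeg α = 1
      · obtain ⟨b, rfl⟩ := exists_eq_unitE_inr h2.1 h2.2
        exact h1 l b
      · refine mem_Fil.mp h _ ?_
        rintro (h3 | ⟨h3, h4⟩)
        · simp at h3
        · simp only at h3 h4
          exact hα (eq_zero_of_deg h3 (by omega))
  · intro j _ hj
    rw [Finsupp.smul_apply, Finsupp.single_eq_of_ne (by simp [Ne.symm hj]), smul_zero]
  · simp

open Classical in
theorem normalOp_apply (V : Fin m → K) (β : Fin m → Fin m → K) (i l b : Fin m) :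
    normalOp κ V β i (l, unitE (Sum.inr b)) = if l = i then - V b else 0 := by
  rw [normalOp, Finsupp.sub_apply, Finsupp.finsetSum_apply, Finsupp.finsetSum_apply]
  have h1 : ∀ j : Fin m, (β i j • single (j, (0 : Expo κ m)) (1 : K)) (l, unitE (Sum.inr b)) = 0 := by
    intro j
    rw [Finsupp.smul_apply, Finsupp.single_eq_of_ne, smul_zero]
    simp
  simp only [h1, Finset.sum_const_zero, zero_sub]
  by_cases hl : l = i
  · rw [if_pos hl, Finset.sum_eq_single b]
    · simp [hl]
    · intro c _ hc
      rw [Finsupp.smul_apply, Finsupp.single_eq_of_ne, smul_zero]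
      simp [Finsupp.single_left_inj, Ne.symm hc]
    · simp
  · rw [if_neg hl, neg_eq_zero]
    refine Finset.sum_eq_zero fun c _ => ?_
    rw [Finsupp.smul_apply, Finsupp.single_eq_of_ne (by simp [hl]), smul_zero]

open Classical in
theorem divOp_apply (h : Fin m → K) (l b : Fin m) :
    divOp κ h (l, unitE (Sum.inr b)) = if l = b then 1 else 0 := by
  rw [divOp, Finsupp.finsetSum_apply]
  have h1 : ∀ j : Fin m,
      (single (j, unitE (Sum.inr j)) (1 : K) + single (j, 0) (h j) : Op κ m K) (l, unitE (Sum.inr b)) = if j = l ∧ j = b then 1 else 0 := by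
    intro j
    rw [Finsupp.add_apply, Finsupp.single_eq_of_ne (a := (j, (0 : Expo κ m))) (by simp), add_zero,
      Finsupp.single_apply]
    simp [Finsupp.single_left_inj]
  simp only [h1]
  by_cases hl : l = b
  · subst hl
    simp
  · rw [if_neg hl]
    refine Finset.sum_eq_zero fun j _ => if_neg ?_
    rintro ⟨rfl, rfl⟩
    exact hl rfl

theorem divOp_mem_Fil (h : Fin m → K) : divOp κ h ∈ Fil κ m K 0 2 :=
  Submodule.sum_mem _ fun _ _ => Submodule.add_mem _ (single_mem_Fil (by simp))
    (single_mem_Fil (by simp))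

theorem exists_normal_completion {N : Submodule K (Op κ m K)} (hb : BracketClosed N)
    (hc : CurlFree N) {h : Fin m → K} (hdiv : divOp κ h ∈ N) (hm : 2 ≤ m) {v : κ → K}
    {P : Fin m → Op κ m K} (hP : IsCompletion N v P 1) :
    ∃ V β, IsCompletion N v (normalOp κ V β) 1 := by
  classical
  obtain ⟨X, hX, hXM⟩ := exists_linear_field hc
    (fun l c => if l = c then (testDiag m l : K) else 0) (by
      simp only [if_true]
      exact_mod_cast congrArg (Int.cast (R := K)) (sum_testDiag hm))
  have hh0 : ∀ i, (testDiag m i : K) ≠ 0 := fun i => by exact_mod_cast testDiag_ne_zero hm i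
  have hcoef : ∀ i l b, contrCompletion X (fun l c => if l = c then (testDiag m l : K) else 0) v P i
      (l, unitE (Sum.inr b)) = (if l = i then pair X (P b) else 0)
        - ((testDiag m b : K) - testDiag m l + testDiag m i) * P i (l, unitE (Sum.inr b)) := by
    intro i l b
    rw [contrCompletion_apply hP hXM i l (by simp) (by simp) le_rfl]
    have e1 : ∑ j, (if (unitE (Sum.inr b) : Expo κ m) = unitE (Sum.inr j) then pair X (P j) else 0)
        = pair X (P b) := by
      rw [Finset.sum_eq_single b]
      · simp
      · intro j _ hj
        rw [if_neg]
        simp [Finsupp.single_left_inj, Ne.symm hj]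
      · simp
    have e2 : ∑ j, ∑ c, (if j = c then (testDiag m j : K) else 0) *
        ((((unitE (Sum.inr b) : Expo κ m) (Sum.inr j) : ℕ) : K) *
        P i (l, unitE (Sum.inr b) - unitE (Sum.inr j) + unitE (Sum.inr c)))
        = testDiag m b * P i (l, unitE (Sum.inr b)) := by
      rw [Finset.sum_eq_single b]
      · simp
      · intro j _ hj
        refine Finset.sum_eq_zero fun c _ => ?_
        simp [Finsupp.single_apply, Ne.symm hj]
      · simp
    rw [e1, e2]
    simp only [ite_mul, zero_mul, Finset.sum_ite_eq, Finset.sum_ite_eq', Finset.mem_univ, if_true]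
    split_ifs <;> ring
  have hE : ∀ i, _ := fun i => coef_linear_of_mem hc (contrCompletion_mem hb hP hX hXM i)
    (contrCompletion_mem_Fil (d := 0) hP hXM i)
  simp only [hcoef] at hE
  let V : Fin m → K := fun b => - pair X (P b) / testDiag m b
  let c : Fin m → K := fun i => (pair X (P i) - testDiag m i * P i (i, unitE (Sum.inr i)))
  let T : Fin m → Op κ m K := fun i => P i + (c i / testDiag m i) • divOp κ h
    + ∑ b, V b • single (i, unitE (Sum.inr b)) 1
  have hTF : ∀ i, T i ∈ Fil κ m K 0 2 := fun i => Submodule.add_mem _ (Submodule.add_mem _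
    (hP.mem_Fil i) (Submodule.smul_mem _ _ (divOp_mem_Fil h)))
    (Submodule.sum_mem _ fun b _ => Submodule.smul_mem _ _ (single_mem_Fil (by simp)))
  have hV : ∀ i l b : Fin m, (∑ b, V b • single (i, unitE (Sum.inr b)) (1 : K) : Op κ m K)
      (l, unitE (Sum.inr b)) = if l = i then V b else 0 := by
    intro i l b
    have := normalOp_apply (κ := κ) V 0 i l b
    simp only [normalOp, Pi.zero_apply, zero_smul, Finset.sum_const_zero, zero_sub,
      Finsupp.neg_apply] at this
    rw [← neg_inj, this]
    split_ifs <;> simp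
  have hT0 : ∀ i l b, T i (l, unitE (Sum.inr b)) = 0 := by
    intro i l b
    simp only [T, Finsupp.add_apply, Finsupp.smul_apply, smul_eq_mul, divOp_apply, hV]
    have hbi := hh0 b
    by_cases hlb : l = b
    · subst hlb
      have h1 := (hE i i l).2
      by_cases hli : l = i
      · subst hli
        simp only [if_true, V, c]
        field_simp
        ring
      · simp only [if_neg hli, if_true] at h1 ⊢
        have h2 : c i = - (testDiag m i * P i (l, unitE (Sum.inr l))) := by
          simp only [c]
          linear_combination h1
        rw [h2]
        have := hh0 i
        field_simp
        ring
    · have h1 := (hE i l b).1 hlb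
      rw [if_neg hlb]
      by_cases hli : l = i
      · subst hli
        simp only [if_true, V] at h1 ⊢
        field_simp
        linear_combination - h1
      · simp only [if_neg hli, zero_sub, neg_eq_zero] at h1 ⊢
        have h2 : ((testDiag m b : K) - testDiag m l + testDiag m i) ≠ 0 := by
          exact_mod_cast testDiag_ne hm b l i
        rw [(mul_eq_zero.mp h1).resolve_left h2]
        ring
  refine ⟨V, fun i l => T i (l, 0), fun i => normalOp_mem_Fil _ _ i, fun i => ?_⟩
  have h1 : normalOp κ V (fun i l => T i (l, 0)) i = P i + (c i / testDiag m i) • divOp κ h := by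
    rw [normalOp, ← eq_sum_single_zero (hTF i) (hT0 i)]
    simp only [T]
    abel
  rw [h1, ← sub_sub]
  exact Submodule.sub_mem _ (hP.mem i) (Submodule.smul_mem _ _ hdiv)

/-- The adjoint action of a vector field with constant base components `v` and fibre components
`V` on vertical vector fields. -/
def adOp (δ : κ ⊕ Fin m → Derivation ℂ K K) (v : κ → K) (V : Fin m → K) (i : Fin m) : Op κ m K :=
  put i (vec m v) - normalOp κ V (fun i l => δ (Sum.inr l) (V i)) i

theorem exists_adOp_mem {N : Submodule K (Op κ m K)} (hN : DStable δ N) (hb : BracketClosed N)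
    (hc : CurlFree N) {h : Fin m → K} (hdiv : divOp κ h ∈ N) (hm : 2 ≤ m) {v : κ → K}
    (hv : vec m v ∈ lead N 1) (hv0 : ∀ j k, δ (Sum.inr j) (v k) = 0) :
    ∃ V, ∀ i, adOp δ v V i ∈ N := by
  classical
  obtain ⟨P, hP⟩ := exists_completion hN hb hc hdiv hm hv
  obtain ⟨V, β, hP⟩ := exists_normal_completion hb hc hdiv hm hP
  refine ⟨V, ?_⟩
  have key : ∀ j l, β j l = δ (Sum.inr l) (V j) := by
    intro j l
    obtain ⟨i, hij⟩ : ∃ i : Fin m, i ≠ j := by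
      have : Nontrivial (Fin m) := Fin.nontrivial_iff_two_le.mpr hm
      exact exists_ne j
    obtain ⟨X, hX, hXM⟩ := exists_linear_field hc
      (fun l c => if l = i ∧ c = j then (1 : K) else 0) (by
        refine Finset.sum_eq_zero fun l _ => if_neg ?_
        rintro ⟨h1, h2⟩
        exact hij (h1.symm.trans h2))
    have hEF := contrCompletion_mem_Fil (d := 0) hP hXM i
    have hEN := contrCompletion_mem hb hP hX hXM i
    have hpair : ∀ b, pair X (normalOp κ V β b) = if b = i then - V j else 0 := by
      intro b
      simp [normalOp, hXM.zero, hXM.linear, ite_and]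
      split_ifs <;> simp
    have h1 : ∀ l b, contrCompletion X (fun l c => if l = i ∧ c = j then (1 : K) else 0) v
        (normalOp κ V β) i (l, unitE (Sum.inr b)) = 0 := by
      intro l b
      rw [contrCompletion_apply hP hXM i l (by simp) (by simp) le_rfl]
      have e1 : ∑ c, (if (unitE (Sum.inr b) : Expo κ m) = unitE (Sum.inr c) then
          pair X (normalOp κ V β c) else 0) = if b = i then - V j else 0 := by
        rw [Finset.sum_eq_single b]
        · simp [hpair]
        · intro c _ hc
          rw [if_neg]
          simp [Finsupp.single_left_inj, Ne.symm hc]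
        · simp
      have e2 : ∑ a, ∑ c, (if a = i ∧ c = j then (1 : K) else 0) *
          ((((unitE (Sum.inr b) : Expo κ m) (Sum.inr a) : ℕ) : K) *
          normalOp κ V β i (l, unitE (Sum.inr b) - unitE (Sum.inr a) + unitE (Sum.inr c)))
          = if b = i then (if l = i then - V j else 0) else 0 := by
        rw [Finset.sum_eq_single i (fun a _ ha => by simp [ha]) (by simp),
          Finset.sum_eq_single j (fun a _ ha => by simp [ha]) (by simp)]
        by_cases hbi : b = i
        · subst hbi
          simp [normalOp_apply]
        · simp [hbi, Finsupp.single_apply]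
      have e3 : ∑ a, (if i = i ∧ a = j then (1 : K) else 0) *
          normalOp κ V β a (l, unitE (Sum.inr b)) = if l = j then - V b else 0 := by
        simp [normalOp_apply]
        split_ifs <;> simp
      have e4 : ∑ a, (if a = i ∧ l = j then (1 : K) else 0) *
          normalOp κ V β i (a, unitE (Sum.inr b)) = if l = j then - V b else 0 := by
        rw [Finset.sum_eq_single i (fun a _ ha => by simp [ha]) (by simp)]
        simp [normalOp_apply]
        split_ifs <;> simp
      rw [e1, e2, e3, e4]
      split_ifs <;> simp
    have h2 : contrCompletion X (fun l c => if l = i ∧ c = j then (1 : K) else 0) v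
        (normalOp κ V β) i ∈ Fil κ m K 0 1 := by
      rw [eq_sum_single_zero hEF h1]
      exact Submodule.sum_mem _ fun l _ => Submodule.smul_mem _ _ (single_mem_Fil (by simp))
    have h3 := coef_zero_of_mem hc hm hEN h2 l
    let S : K := ∑ b, V b * ((((unitE (Sum.inr b) : Expo κ m) (Sum.inr l) : K) + 1) *
      MvPowerSeries.coeff (unitE (Sum.inr b) + unitE (Sum.inr l)) (X i))
    have hXv : (∑ k, v k * MvPowerSeries.coeff (unitE (Sum.inl k) + unitE (Sum.inr l)) (X i))
        = (if l = j then β i i else 0) - S - δ (Sum.inr l) (V j) := by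
      have h4 := hX _ (hN (Sum.inr l) _ (hP.mem i))
      rw [dmul_apply, map_sub (coefD (κ := κ) (m := m) (δ (Sum.inr l))), coefD_put_vec] at h4
      have h5 : (fun k => δ (Sum.inr l) (v k)) = 0 := funext fun k => hv0 l k
      have h6 : pair X (coefD (δ (Sum.inr l)) (normalOp κ V β i)) = - δ (Sum.inr l) (V j) := by
        simp [normalOp, hXM.zero, hXM.linear, ite_and]
      have h7 : pair X (shift (Sum.inr l) (normalOp κ V β i)) =
          (if l = j then β i i else 0) - S := by
        simp only [normalOp, map_sub, map_sum, map_smul, shift_single, pair_single, smul_eq_mul, S]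
        congr 1
        · simp [hXM.linear, ite_and]
        · refine Finset.sum_congr rfl fun b _ => ?_
          ring
      rw [h5, map_zero, map_zero, zero_sub, map_sub, map_add, map_neg, h6, map_sub, h7,
        put_vec] at h4
      simp only [map_sum, map_smul, shift_single, pair_single, smul_eq_mul] at h4
      simp at h4
      linear_combination h4
    have hct : contr X (normalOp κ V β i) (l, 0) = - (if l = j then β i i else 0) + S := by
      simp only [normalOp, map_sub, map_sum, map_smul, hXM.contr_single_zero,
        hXM.contr_single_unitE, Finsupp.sub_apply, Finsupp.finsetSum_apply, Finsupp.smul_apply,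
        Finsupp.neg_apply, S]
      rw [sub_eq_add_neg, ← Finset.sum_neg_distrib]
      congr 1
      · simp [Finsupp.single_apply, ite_and, eq_comm]
      · refine Finset.sum_congr rfl fun b _ => ?_
        rw [← smul_neg, smul_eq_mul, ← Finset.sum_neg_distrib]
        congr 1
        rw [Finset.sum_eq_single l]
        · simp [Finsupp.single_apply]
        · intro c _ hc
          simp [Finsupp.single_apply, hc]
        · simp
    have hP0 : ∀ c, normalOp κ V β c (l, 0) = β c l := by
      intro c
      simp [normalOp, Finsupp.finsetSum_apply, Finsupp.single_apply]
    rw [contrCompletion, Finsupp.sub_apply, hct, Finsupp.finsetSum_apply] at h3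
    simp only [Finsupp.sub_apply, Finsupp.smul_apply, hP0, smul_eq_mul,
      Finset.sum_sub_distrib] at h3
    have e1 : ∑ c : Fin m, (single (i, unitE (Sum.inr c)) (pair X (normalOp κ V β c)) : Op κ m K)
        (l, 0) = 0 := Finset.sum_eq_zero fun c _ => by
      rw [Finsupp.single_eq_of_ne]
      intro h
      have := congrArg (fun p : Fin m × Expo κ m => ydeg p.2) h
      simp at this
    have e2 : ∑ c : Fin m, (single (c, 0) (∑ k, v k * MvPowerSeries.coeff
        (unitE (Sum.inl k) + unitE (Sum.inr c)) (X i)) : Op κ m K) (l, 0)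
        = (if l = j then β i i else 0) - S - δ (Sum.inr l) (V j) := by
      rw [← hXv, Finset.sum_eq_single l]
      · simp
      · intro c _ hc
        rw [Finsupp.single_eq_of_ne]
        simp [Ne.symm hc]
      · simp
    rw [e1, e2] at h3
    simp at h3
    linear_combination - h3
  intro i
  have := hP.mem i
  rwa [show β = fun i l => δ (Sum.inr l) (V i) from funext fun i => funext fun l => key i l] at this

theorem inf_Fil_succ_le {N I : Submodule K (Op κ m K)} (hb : BracketClosed N) (hc : CurlFree N)
    {h : Fin m → K} (hm : 2 ≤ m) (hI : DStable δ I) (hdivI : divOp κ h ∈ I) (hIN : I ≤ N)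
    (hlead : ∀ a, lead N a ≤ lead I a) {a d : ℕ} (ih : N ⊓ Fil κ m K a d ≤ I) :
    N ⊓ Fil κ m K a (d + 1) ≤ I := by
  rintro θ ⟨h1, hθ⟩
  obtain ⟨τ, h2, h3, -⟩ := exists_homog_part hθ
  have hτ : τ ∈ N ⊔ Fil κ m K a 0 := by
    rw [← sub_sub_cancel θ τ]
    exact Submodule.sub_mem _ (Submodule.mem_sup_left h1) (Submodule.mem_sup_right h3)
  have h4 := mem_sup_of_curl hI hdivI hm h2
    fun i j γ h0 hγ => hlead a (curl_mem_lead hb hc hm hτ h2 i j γ h0 hγ)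
  have h5 := Submodule.add_mem _ h4
    (Submodule.mem_sup_right (S := I) (Fil_mono_right (Nat.zero_le d) h3))
  rw [add_sub_cancel] at h5
  obtain ⟨n, hn, w, hw, rfl⟩ := Submodule.mem_sup.mp h5
  refine Submodule.add_mem _ hn (ih ⟨?_, hw⟩)
  have := Submodule.sub_mem _ h1 (hIN hn)
  rwa [add_sub_cancel_left] at this

/-- The operators in `N` are generated by the divergence and by the adjoint actions of the vector
fields with constant base components. -/
theorem le_of_adOp_mem {N N' : Submodule K (Op κ m K)} (hN : DStable δ N) (hb : BracketClosed N)
    (hc : CurlFree N) {h : Fin m → K} (hdiv : divOp κ h ∈ N) (hm : 2 ≤ m) (hN' : DStable δ N')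
    (hdiv' : divOp κ h ∈ N') (had : ∀ v V, (∀ j k, δ (Sum.inr j) (v k) = 0) →
      (∀ i, adOp δ v V i ∈ N) → ∀ i, adOp δ v V i ∈ N') : N ≤ N' := by
  have hI : DStable δ (N ⊓ N') := fun j θ hθ => ⟨hN j θ hθ.1, hN' j θ hθ.2⟩
  have hdivI : divOp κ h ∈ N ⊓ N' := ⟨hdiv, hdiv'⟩
  have hone : lead N 1 ≤ lead (N ⊓ N') 1 := by
    intro f hf
    have hS := (mem_lead.mp hf).1
    have hfw : f = vec m (fun k => f (unitE (Sum.inl k))) := by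
      rw [vec_apply]
      exact sym_one_eq hS
    have h1 := mem_span_constants (fun j => δ (Sum.inr j)) ((lead N 1).comap (vec m))
      (fun w hw j => vec_deriv_mem hN hb hc hm hw j) (fun k => f (unitE (Sum.inl k)))
      (by rw [Submodule.mem_comap, ← hfw]; exact hf)
    have h2 : Submodule.span K {v | v ∈ (lead N 1).comap (vec m) ∧
        ∀ j k, δ (Sum.inr j) (v k) = 0} ≤ (lead (N ⊓ N') 1).comap (vec m) := by
      rw [Submodule.span_le]
      rintro v ⟨hv, hv0⟩
      obtain ⟨V, hV⟩ := exists_adOp_mem hN hb hc hdiv hm hv hv0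
      refine mem_lead.mpr ⟨vec_mem_Sym v, fun i => ?_⟩
      have h3 : put i (vec m v) = adOp δ v V i
          + normalOp κ V (fun i l => δ (Sum.inr l) (V i)) i := by
        rw [adOp, sub_add_cancel]
      rw [h3]
      exact Submodule.add_mem_sup ⟨hV i, had v V hv0 hV i⟩
        (Fil_mono_left (Nat.lt_succ_self 0) (normalOp_mem_Fil _ _ i))
    rw [hfw]
    exact h2 h1
  have hlead := lead_le_of_one hb hc hm hI hone
  have key : ∀ a d, N ⊓ Fil κ m K a d ≤ N ⊓ N' := by
    intro a
    induction a with
    | zero =>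
      intro d
      induction d with
      | zero =>
        rintro θ ⟨-, hθ⟩
        have : θ = 0 := by
          ext p
          exact mem_Fil.mp hθ p (by omega)
        rw [this]
        exact Submodule.zero_mem _
      | succ d ih => exact inf_Fil_succ_le hb hc hm hI hdivI inf_le_left hlead ih
    | succ a iha =>
      intro d
      induction d with
      | zero =>
        rintro θ ⟨h1, hθ⟩
        obtain ⟨d, hd⟩ := exists_mem_Fil hθ
        exact iha d ⟨h1, hd⟩
      | succ d ih => exact inf_Fil_succ_le hb hc hm hI hdivI inf_le_left hlead ih
  intro θ hθ
  obtain ⟨a, ha⟩ := exists_mem_Fil_zero θ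
  exact (key a 0 ⟨hθ, ha⟩).2

end Completion

section DerivationExtension

theorem exists_derivation_extension {R S T M : Type*} [CommRing R] [CommRing S] [CommRing T]
    [Algebra R S] [Algebra S T] [Algebra R T] [IsScalarTower R S T] [AddCommGroup M]
    [Module R M] [Module S M] [Module T M] [IsScalarTower S T M] [IsScalarTower R S M]
    [IsScalarTower R T M]
    [Algebra.FormallyEtale S T] (d : Derivation R S M) :
    ∃ D : Derivation R T M, ∀ s, D (algebraMap S T s) = d s := by
  let e := KaehlerDifferential.tensorKaehlerEquivOfFormallyEtale R S T
  let l : TensorProduct S T Ω[S⁄R] →ₗ[T] M :=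
    TensorProduct.AlgebraTensorModule.lift
      ((LinearMap.toSpanSingleton T (Ω[S⁄R] →ₗ[S] M) d.liftKaehlerDifferential))
  refine ⟨(l ∘ₗ e.symm.toLinearMap).compDer (KaehlerDifferential.D R T), fun s => ?_⟩
  change l (e.symm (KaehlerDifferential.D R T (algebraMap S T s))) = d s
  rw [KaehlerDifferential.tensorKaehlerEquivOfFormallyEtale_symm_D_algebraMap]
  simp [l]

theorem derivation_eq_zero_of_formallyUnramified {R S T M : Type*} [CommRing R] [CommRing S]
    [CommRing T] [Algebra R S] [Algebra S T] [Algebra R T] [IsScalarTower R S T] [AddCommGroup M]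
    [Module R M] [Module T M] [IsScalarTower R T M]
    [Algebra.FormallyUnramified S T] (D : Derivation R T M)
    (h : ∀ s, D (algebraMap S T s) = 0) : D = 0 := by
  let _ : Module S M := Module.compHom M (algebraMap S T)
  have : IsScalarTower S T M := ⟨fun a b c => by
    rw [Algebra.smul_def, mul_smul]; rfl⟩
  let D' : Derivation S T M :=
    { toFun := D
      map_add' := D.map_add
      map_smul' := fun s t => by
        rw [Algebra.smul_def, D.leibniz, h, smul_zero, add_zero]; rfl
      map_one_eq_zero' := D.map_one_eq_zero
      leibniz' := D.leibniz }
  have h1 : D' = 0 := by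
    rw [← D'.liftKaehlerDifferential_comp]
    have := (Algebra.formallyUnramified_iff S T).1 inferInstance
    ext t
    change D'.liftKaehlerDifferential (KaehlerDifferential.D S T t) = 0
    rw [Subsingleton.elim (KaehlerDifferential.D S T t) 0, map_zero]
  ext t
  exact DFunLike.congr_fun h1 t

variable {ι : Type*} {K : Type*} [Field K] [Algebra ℂ K] {x : ι → K}

theorem formallyEtale_of_isTranscendenceBasis (hx : IsTranscendenceBasis ℂ x) :
    @Algebra.FormallyEtale (MvPolynomial ι ℂ) K _ _ (MvPolynomial.aeval x).toAlgebra := by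
  let _ := (MvPolynomial.aeval (R := ℂ) x).toAlgebra
  have hst : IsScalarTower ℂ (MvPolynomial ι ℂ) K := IsScalarTower.of_algebraMap_eq fun r =>
    ((MvPolynomial.aeval (R := ℂ) x).commutes r).symm
  have hinj : Function.Injective (algebraMap (MvPolynomial ι ℂ) K) := hx.1
  have : FaithfulSMul (MvPolynomial ι ℂ) K := (faithfulSMul_iff_algebraMap_injective _ _).2 hinj
  let F := FractionRing (MvPolynomial ι ℂ)
  let _ : Algebra F K := FractionRing.liftAlgebra _ _
  have : IsScalarTower (MvPolynomial ι ℂ) F K := FractionRing.isScalarTower_liftAlgebra _ _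
  have : Algebra.IsAlgebraic (MvPolynomial ι ℂ) K := by
    have h1 := hx.isAlgebraic
    constructor
    intro z
    obtain ⟨p, hp, hz⟩ := h1.1 z
    let e := hx.1.aevalEquiv
    refine ⟨p.map (e.symm : _ →+* MvPolynomial ι ℂ), ?_, ?_⟩
    · rwa [Ne, Polynomial.map_eq_zero_iff e.symm.injective]
    · rw [Polynomial.aeval_def, Polynomial.eval₂_map]
      rw [Polynomial.aeval_def] at hz
      convert hz using 2
      ext y
      obtain ⟨w, rfl⟩ := e.surjective y
      simp [e]
      rfl
  have : Algebra.IsAlgebraic F K :=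
    Algebra.IsAlgebraic.extendScalars (R := MvPolynomial ι ℂ) (S := F)
      (IsFractionRing.injective (MvPolynomial ι ℂ) F)
  have : CharZero F := charZero_of_injective_algebraMap (algebraMap ℂ F).injective
  have : Algebra.FormallyEtale (MvPolynomial ι ℂ) F :=
    Algebra.FormallyEtale.of_isLocalization (nonZeroDivisors (MvPolynomial ι ℂ))
  have : Algebra.FormallyEtale F K := Algebra.FormallyEtale.of_isSeparable F K
  exact Algebra.FormallyEtale.comp _ F K

theorem derivation_ext_of_isTranscendenceBasis (hx : IsTranscendenceBasis ℂ x)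
    {M : Type*} [AddCommGroup M] [Module ℂ M] [Module K M] [IsScalarTower ℂ K M]
    {D D' : Derivation ℂ K M} (h : ∀ i, D (x i) = D' (x i)) : D = D' := by
  let _ := (MvPolynomial.aeval (R := ℂ) x).toAlgebra
  have hst : IsScalarTower ℂ (MvPolynomial ι ℂ) K := IsScalarTower.of_algebraMap_eq fun r =>
    ((MvPolynomial.aeval (R := ℂ) x).commutes r).symm
  have := formallyEtale_of_isTranscendenceBasis hx
  rw [← sub_eq_zero]
  refine derivation_eq_zero_of_formallyUnramified (S := MvPolynomial ι ℂ) _ fun p => ?_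
  change (D - D') (MvPolynomial.aeval x p) = 0
  induction p using MvPolynomial.induction_on with
  | C a => simp
  | add p q hp hq => simp only [map_add, hp, hq, add_zero]
  | mul_X p i hp =>
    rw [map_mul, Derivation.leibniz, hp, smul_zero, add_zero, MvPolynomial.aeval_X]
    simp [h]

theorem exists_dual_derivations [DecidableEq ι] (hx : IsTranscendenceBasis ℂ x) :
    ∃ δ : ι → Derivation ℂ K K, ∀ i j, δ i (x j) = if i = j then 1 else 0 := by
  let _ := (MvPolynomial.aeval (R := ℂ) x).toAlgebra
  have hst : IsScalarTower ℂ (MvPolynomial ι ℂ) K := IsScalarTower.of_algebraMap_eq fun r =>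
    ((MvPolynomial.aeval (R := ℂ) x).commutes r).symm
  have := formallyEtale_of_isTranscendenceBasis hx
  have h : ∀ i, ∃ D : Derivation ℂ K K, ∀ j, D (x j) = if i = j then 1 else 0 := by
    intro i
    obtain ⟨D, hD⟩ := exists_derivation_extension (T := K)
      (MvPolynomial.mkDerivation ℂ (A := K) (fun j => if i = j then 1 else 0) :
        Derivation ℂ (MvPolynomial ι ℂ) K)
    refine ⟨D, fun j => ?_⟩
    have := hD (MvPolynomial.X j)
    rw [MvPolynomial.mkDerivation_X] at this
    rw [← this]
    congr 1
    exact (MvPolynomial.aeval_X x j).symm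
  choose δ hδ using h
  exact ⟨δ, hδ⟩

end DerivationExtension

section FrameDef

variable (A B K k : Type*)
  [CommRing B] [IsDomain B] [Algebra ℂ B]
  [CommRing A] [IsDomain A] [Algebra ℂ A] [Algebra B A] [IsScalarTower ℂ B A]
  [Field k] [Algebra B k] [IsFractionRing B k] [Algebra ℂ k] [IsScalarTower ℂ B k]
  [Field K] [Algebra A K] [IsFractionRing A K] [Algebra ℂ K] [IsScalarTower ℂ A K]
  [Algebra k K] [IsScalarTower ℂ k K] [Algebra B K] [IsScalarTower B k K]
  [IsScalarTower B A K]

/-- Coordinates `s` on the base and `y` along the fibres, with the dual rational vector fields `δ`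
and their regular multiples `D = c δ`. -/
structure Frame (n m : ℕ) where
  s : Fin n → B
  y : Fin m → A
  δ : Fin n ⊕ Fin m → Derivation ℂ K K
  basis_k : IsTranscendenceBasis ℂ (algebraMap B k ∘ s)
  basis_K : IsTranscendenceBasis ℂ (algebraMap A K ∘ Sum.elim (algebraMap B A ∘ s) y)
  dual : ∀ i j, δ i (algebraMap A K (Sum.elim (algebraMap B A ∘ s) y j)) = if i = j then 1 else 0
  c : A
  c_ne : c ≠ 0
  D : Fin n ⊕ Fin m → Derivation ℂ A A
  D_spec : ∀ j a, algebraMap A K (D j a) = algebraMap A K c * δ j (algebraMap A K a)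
  euler : ∀ a, c • KaehlerDifferential.D ℂ A a =
    ∑ j, D j a • KaehlerDifferential.D ℂ A (Sum.elim (algebraMap B A ∘ s) y j)

variable {A B K k}

theorem derivation_sum_apply {R S M ι : Type*} [CommRing R] [CommRing S] [Algebra R S]
    [AddCommGroup M] [Module R M] [Module S M] (t : Finset ι) (D : ι → Derivation R S M) (a : S) :
    (∑ i ∈ t, D i) a = ∑ i ∈ t, D i a := by
  classical
  induction t using Finset.induction_on with
  | empty => simp
  | insert i t hi ih => rw [Finset.sum_insert hi, Finset.sum_insert hi, Derivation.add_apply, ih]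

theorem derivation_ext_of_adjoin {R S M : Type*} [CommRing R] [CommRing S] [Algebra R S]
    [AddCommGroup M] [Module R M] [Module S M] [IsScalarTower R S M] {s : Set S}
    (hs : Algebra.adjoin R s = ⊤) {D D' : Derivation R S M} (h : ∀ a ∈ s, D a = D' a) :
    D = D' :=
  Derivation.ext fun a => Derivation.eqOn_adjoin (s := s) h (by rw [hs]; trivial)

theorem exists_integral_derivation (S : Finset A)
    (hS : Algebra.adjoin ℂ (S : Set A) = ⊤) {ι : Type*} [Fintype ι] (δ : ι → Derivation ℂ K K) :
    ∃ (c : A) (D : ι → Derivation ℂ A A), c ≠ 0 ∧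
      ∀ j a, algebraMap A K (D j a) = algebraMap A K c * δ j (algebraMap A K a) := by
  classical
  have hinj := IsFractionRing.injective A K
  obtain ⟨c, hc⟩ := IsLocalization.exist_integer_multiples_of_finset (nonZeroDivisors A)
    (Finset.image (fun q : ι × A => δ q.1 (algebraMap A K q.2)) (Finset.univ ×ˢ S))
  have key : ∀ j a, ∃ b, algebraMap A K b = algebraMap A K c * δ j (algebraMap A K a) := by
    intro j a
    have ha : a ∈ Algebra.adjoin ℂ (S : Set A) := by rw [hS]; trivial
    induction ha using Algebra.adjoin_induction with
    | mem a ha =>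
      obtain ⟨b, hb⟩ := hc (δ j (algebraMap A K a))
        (Finset.mem_image.2 ⟨(j, a), by simpa using ha, rfl⟩)
      exact ⟨b, by rw [hb, Algebra.smul_def]⟩
    | algebraMap r =>
      exact ⟨0, by rw [← IsScalarTower.algebraMap_apply]; simp⟩
    | add a b _ _ ha hb =>
      obtain ⟨a', ha⟩ := ha
      obtain ⟨b', hb⟩ := hb
      exact ⟨a' + b', by simp only [map_add, ha, hb]; ring⟩
    | mul a b _ _ ha hb =>
      obtain ⟨a', ha⟩ := ha
      obtain ⟨b', hb⟩ := hb
      exact ⟨a * b' + b * a', by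
        simp only [map_add, map_mul, ha, hb, Derivation.leibniz, smul_eq_mul]; ring⟩
  choose D hD using key
  refine ⟨c, fun j => Derivation.mk' { toFun := D j, map_add' := ?_, map_smul' := ?_ } ?_,
    nonZeroDivisors.coe_ne_zero c, hD⟩
  · intro a b
    apply hinj
    simp only [map_add, hD, mul_add]
  · intro r a
    apply hinj
    simp only [RingHom.id_apply, hD, Algebra.smul_def, map_mul, ← IsScalarTower.algebraMap_apply,
      Derivation.leibniz, smul_eq_mul, Derivation.map_algebraMap]
    ring
  · intro a b
    apply hinj
    simp only [LinearMap.coe_mk, AddHom.coe_mk, smul_eq_mul, map_add, map_mul, hD,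
      Derivation.leibniz]
    ring

theorem exists_euler (S : Finset A)
    (hS : Algebra.adjoin ℂ (S : Set A) = ⊤) {ι : Type*} [Fintype ι] [DecidableEq ι]
    {x : ι → A} (hx : IsTranscendenceBasis ℂ (algebraMap A K ∘ x))
    {δ : ι → Derivation ℂ K K} (hδ : ∀ i j, δ i (algebraMap A K (x j)) = if i = j then 1 else 0) :
    ∃ (c : A) (D : ι → Derivation ℂ A A), c ≠ 0 ∧
      (∀ j a, algebraMap A K (D j a) = algebraMap A K c * δ j (algebraMap A K a)) ∧
      ∀ a, c • KaehlerDifferential.D ℂ A a = ∑ j, D j a • KaehlerDifferential.D ℂ A (x j) := by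
  obtain ⟨c, D, hc, hD⟩ := exists_integral_derivation S hS δ
  have h1 : KaehlerDifferential.D ℂ K = ∑ j, (LinearMap.toSpanSingleton K Ω[K⁄ℂ]
      (KaehlerDifferential.D ℂ K (algebraMap A K (x j)))).compDer (δ j) := by
    refine derivation_ext_of_isTranscendenceBasis hx fun i => ?_
    simp [derivation_sum_apply, hδ, ite_smul]
  have h2 : ∀ a, KaehlerDifferential.map ℂ ℂ A K (c • KaehlerDifferential.D ℂ A a -
      ∑ j, D j a • KaehlerDifferential.D ℂ A (x j)) = 0 := by
    intro a
    rw [map_sub, map_smul, map_sum, KaehlerDifferential.map_D, sub_eq_zero]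
    conv_lhs => rw [h1]
    simp only [map_smul, KaehlerDifferential.map_D, derivation_sum_apply,
      Finset.smul_sum]
    refine Finset.sum_congr rfl fun j _ => ?_
    rw [← algebraMap_smul K (D j a), hD, ← algebraMap_smul K c, mul_smul]
    rfl
  have h3 : ∀ a, ∃ u : nonZeroDivisors A, u • (c • KaehlerDifferential.D ℂ A a -
      ∑ j, D j a • KaehlerDifferential.D ℂ A (x j)) = 0 := fun a =>
    (IsLocalizedModule.eq_zero_iff (nonZeroDivisors A) (KaehlerDifferential.map ℂ ℂ A K)).1 (h2 a)
  choose u hu using h3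
  let v : A := ∏ a ∈ S, (u a : A)
  have hv : v ≠ 0 := Finset.prod_ne_zero_iff.2 fun a _ => nonZeroDivisors.coe_ne_zero _
  refine ⟨v * c, fun j => v • D j, mul_ne_zero hv hc, fun j a => ?_, fun a => ?_⟩
  · rw [Derivation.smul_apply, smul_eq_mul, map_mul, hD, map_mul, mul_assoc]
  · have h4 : (v * c) • KaehlerDifferential.D ℂ A = ∑ j, (LinearMap.toSpanSingleton A Ω[A⁄ℂ]
        (KaehlerDifferential.D ℂ A (x j))).compDer (v • D j) := by
      refine derivation_ext_of_adjoin hS fun a ha => ?_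
      obtain ⟨w, hw⟩ : (u a : A) ∣ v := Finset.dvd_prod_of_mem (fun a => (u a : A)) ha
      have := hu a
      rw [Submonoid.smul_def, smul_sub, sub_eq_zero] at this
      simp only [Derivation.smul_apply, derivation_sum_apply]
      rw [mul_smul, hw, mul_comm (u a : A) w, mul_smul, this, Finset.smul_sum, Finset.smul_sum]
      refine Finset.sum_congr rfl fun j _ => ?_
      change w • (u a : A) • D j a • _ = ((w * (u a : A)) * D j a) • KaehlerDifferential.D ℂ A (x j)
      rw [mul_smul, mul_smul]
    have := DFunLike.congr_fun h4 a
    rw [derivation_sum_apply] at this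
    exact this

open Algebra AlgebraicIndependent in
theorem exists_frame [Algebra.FiniteType ℂ B] [Algebra.FiniteType ℂ A] {m : ℕ}
    (hm : varietyDim K = varietyDim k + m) : ∃ n, Nonempty (Frame A B K k n m) := by
  have hBk : FaithfulSMul B k := inferInstance
  have : FaithfulSMul ℂ B := (faithfulSMul_iff_algebraMap_injective _ _).2
    (algebraMap ℂ B).injective
  have hBkalg : Algebra.IsAlgebraic B k := IsLocalization.isAlgebraic k (nonZeroDivisors B)
  have hAKalg : Algebra.IsAlgebraic A K := IsLocalization.isAlgebraic K (nonZeroDivisors A)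
  obtain ⟨s₀, hs₀⟩ := exists_isTranscendenceBasis ℂ B
  have hfin : s₀.Finite := Cardinal.lt_aleph0_iff_set_finite.1
    (hs₀.cardinalMk_eq_trdeg.trans_lt trdeg_lt_aleph0_of_finiteType)
  have := hfin.to_subtype
  let e₀ := (Finite.equivFin s₀).symm
  let s : Fin (Nat.card s₀) → B := fun i => e₀ i
  have hs : IsTranscendenceBasis ℂ s := (isTranscendenceBasis_equiv e₀).2 hs₀
  have hsk : IsTranscendenceBasis ℂ (algebraMap B k ∘ s) := hs.algebraMap_comp
  have hadj : Algebra.IsAlgebraic (Algebra.adjoin k (Set.range (algebraMap A K))) K := by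
    let f : A →+* Algebra.adjoin k (Set.range (algebraMap A K)) :=
      (algebraMap A K).codRestrict _ fun a => Algebra.subset_adjoin ⟨a, rfl⟩
    let _ := f.toAlgebra
    have : IsScalarTower A (Algebra.adjoin k (Set.range (algebraMap A K))) K :=
      IsScalarTower.of_algebraMap_eq fun _ => rfl
    refine Algebra.IsAlgebraic.extendScalars (R := A) ?_
    intro a b hab
    exact IsFractionRing.injective A K (congrArg Subtype.val hab)
  obtain ⟨y₀, hy₀s, hy₀⟩ := exists_isTranscendenceBasis_subset (R := k)
    (Set.range (algebraMap A K))
  have htr : Cardinal.mk y₀ = m := by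
    have h1 := lift_trdeg_add_eq ℂ k K
    have hk : Algebra.trdeg ℂ k < Cardinal.aleph0 := by
      have := hsk.lift_cardinalMk_eq_trdeg
      rw [← Cardinal.lift_lt_aleph0, ← this]
      simp
    have hK : Algebra.trdeg ℂ K < Cardinal.aleph0 := by
      have : FaithfulSMul ℂ A := (faithfulSMul_iff_algebraMap_injective _ _).2
        (algebraMap ℂ A).injective
      obtain ⟨t, ht⟩ := exists_isTranscendenceBasis ℂ A
      have h2 : IsTranscendenceBasis ℂ (algebraMap A K ∘ ((↑) : t → A)) := ht.algebraMap_comp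
      rw [← Cardinal.lift_lt_aleph0, ← h2.lift_cardinalMk_eq_trdeg, Cardinal.lift_lt_aleph0]
      exact ht.cardinalMk_eq_trdeg.trans_lt trdeg_lt_aleph0_of_finiteType
    rw [hy₀.cardinalMk_eq_trdeg]
    have hkK : Algebra.trdeg k K < Cardinal.aleph0 := by
      rw [← Cardinal.lift_lt_aleph0]
      refine lt_of_le_of_lt ?_ (Cardinal.lift_lt_aleph0.2 hK)
      rw [← h1]
      exact self_le_add_left _ _
    have h3 := congrArg Cardinal.toNat h1
    rw [Cardinal.toNat_add (Cardinal.lift_lt_aleph0.2 hk) (Cardinal.lift_lt_aleph0.2 hkK),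
      Cardinal.toNat_lift, Cardinal.toNat_lift, Cardinal.toNat_lift] at h3
    have h4 : Cardinal.toNat (Algebra.trdeg k K) = m := by
      unfold varietyDim at hm
      omega
    rw [← h4, Cardinal.cast_toNat_of_lt_aleph0 hkK]
  have hyfin : Finite y₀ := Cardinal.lt_aleph0_iff_finite.1 (htr ▸ Cardinal.natCast_lt_aleph0)
  have hcard : Nat.card y₀ = m := by
    have := congrArg Cardinal.toNat htr
    simpa [Nat.card] using this
  let e₁ : Fin m ≃ y₀ := (Finite.equivFinOfCardEq hcard).symm
  have hy₁ : ∀ i, ∃ a, algebraMap A K a = e₁ i := fun i => hy₀s (e₁ i).2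
  choose y hy using hy₁
  have hyK : IsTranscendenceBasis k (algebraMap A K ∘ y) := by
    have h1 : algebraMap A K ∘ y = ((↑) : y₀ → K) ∘ e₁ := funext hy
    rw [h1]
    exact (isTranscendenceBasis_equiv e₁).2 hy₀
  have hxK : IsTranscendenceBasis ℂ (algebraMap A K ∘ Sum.elim (algebraMap B A ∘ s) y) := by
    have h1 := hsk.sumElim_comp hyK
    rw [← isTranscendenceBasis_equiv (Equiv.sumComm _ _)] at h1
    convert h1 using 1
    ext i
    rcases i with i | i
    · exact (IsScalarTower.algebraMap_apply B A K _).symm.trans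
        (IsScalarTower.algebraMap_apply B k K _)
    · rfl
  obtain ⟨δ, hδ⟩ := exists_dual_derivations hxK
  obtain ⟨S, hS⟩ := Algebra.FiniteType.out (R := ℂ) (A := A)
  obtain ⟨c, D, hc, hD, heul⟩ := exists_euler S hS hxK hδ
  exact ⟨_, ⟨⟨s, y, δ, hsk, hxK, hδ, c, hc, D, hD, heul⟩⟩⟩

end FrameDef

section FormalFacts

variable {A : Type*} [CommRing A] [Algebra ℂ A] [IsNoetherianRing A]

/-- The maximal ideal of the completed local ring. -/
def formalMax (p : Pt A) : Ideal (FormalRing p) :=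
  (RingHom.ker p).map (algebraMap A (FormalRing p))

theorem mem_formalMax_pow {p : Pt A} {n : ℕ} {f : FormalRing p} :
    f ∈ formalMax p ^ n ↔ AdicCompletion.evalₐ (RingHom.ker p) n f = 0 := by
  have h1 := AdicCompletion.pow_smul_top_eq_ker_eval (I := RingHom.ker p) (M := A) (n := n)
    (IsNoetherian.noetherian _)
  have h2 : f ∈ formalMax p ^ n ↔
      f ∈ (RingHom.ker p ^ n • ⊤ : Submodule A (FormalRing p)) := by
    rw [formalMax, ← Ideal.map_pow, Ideal.smul_top_eq_map, Submodule.restrictScalars_mem]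
  have h3 : (RingHom.ker p ^ n • ⊤ : Ideal A) = RingHom.ker p ^ n := by simp
  rw [h2, h1, LinearMap.mem_ker]
  have h4 := AdicCompletion.factor_evalₐ_eq_eval _ f h3.ge
  have h5 := AdicCompletion.factor_eval_eq_evalₐ _ f h3.le
  constructor
  · intro h
    exact h5.symm.trans ((congrArg _ h).trans (map_zero _))
  · intro h
    exact h4.symm.trans ((congrArg _ h).trans (map_zero _))

theorem eq_zero_of_forall_mem_pow {p : Pt A} {f : FormalRing p}
    (h : ∀ n, f ∈ formalMax p ^ n) : f = 0 :=
  AdicCompletion.ext_evalₐ fun n => by rw [mem_formalMax_pow.1 (h n), map_zero]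

theorem algebraMap_mem_formalMax_pow {p : Pt A} {n : ℕ} {a : A} :
    algebraMap A (FormalRing p) a ∈ formalMax p ^ n ↔ a ∈ RingHom.ker p ^ n := by
  rw [mem_formalMax_pow]
  change AdicCompletion.evalₐ (RingHom.ker p) n (AdicCompletion.of (RingHom.ker p) A a) = 0 ↔ _
  rw [AdicCompletion.evalₐ_of, Ideal.Quotient.eq_zero_iff_mem]

theorem algebraMap_mem_formalMax {p : Pt A} {a : A} (h : p a = 0) :
    algebraMap A (FormalRing p) a ∈ formalMax p := Ideal.mem_map_of_mem _ h

theorem exists_sub_mem_formalMax_pow {p : Pt A} (n : ℕ) (f : FormalRing p) :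
    ∃ a : A, f - algebraMap A (FormalRing p) a ∈ formalMax p ^ n := by
  obtain ⟨a, ha⟩ := Ideal.Quotient.mk_surjective (AdicCompletion.evalₐ (RingHom.ker p) n f)
  refine ⟨a, mem_formalMax_pow.2 ?_⟩
  rw [map_sub, ← ha, sub_eq_zero]
  exact (AdicCompletion.evalₐ_of _ _ _).symm

theorem mem_formalMax_iff {p : Pt A} {f : FormalRing p} :
    f ∈ formalMax p ↔ evalAt p f = 0 := by
  obtain ⟨a, ha⟩ := exists_sub_mem_formalMax_pow 1 f
  have hle : ∀ g ∈ formalMax p, evalAt p g = 0 := by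
    intro g hg
    have : formalMax p ≤ RingHom.ker (evalAt p) := by
      rw [formalMax, Ideal.map_le_iff_le_comap]
      intro a ha
      exact (evalAt_algebraMap p a).trans ha
    exact this hg
  refine ⟨hle f, fun h => ?_⟩
  rw [pow_one] at ha
  have h1 := hle _ ha
  rw [map_sub, h, evalAt_algebraMap, zero_sub, neg_eq_zero] at h1
  have h2 : algebraMap A (FormalRing p) a ∈ formalMax p := Ideal.mem_map_of_mem _ h1
  simpa using Ideal.add_mem _ ha h2

theorem isUnit_of_evalAt_ne_zero {p : Pt A} {f : FormalRing p} (h : evalAt p f ≠ 0) :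
    IsUnit f := by
  have hc : IsAdicComplete (formalMax p) (FormalRing p) :=
    AdicCompletion.isAdicComplete_self _ (IsNoetherian.noetherian _)
  have hj := IsAdicComplete.le_jacobson_bot (formalMax p)
  have h1 : f - algebraMap ℂ _ (evalAt p f) ∈ formalMax p := by
    rw [mem_formalMax_iff, map_sub, AlgHom.commutes]
    exact sub_self _
  have h2 := Ideal.mem_jacobson_bot.1 (hj h1) (algebraMap ℂ _ (evalAt p f)⁻¹)
  rw [sub_mul, ← map_mul, mul_inv_cancel₀ h, map_one, sub_add_cancel] at h2
  exact isUnit_of_mul_isUnit_left h2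

theorem evalAt_ne_zero_of_isUnit {p : Pt A} {f : FormalRing p} (h : IsUnit f) :
    evalAt p f ≠ 0 := (h.map (evalAt p)).ne_zero

/-- Derivations along a morphism decrease the order of vanishing by at most one. -/
theorem map_pow_of_leibniz {R S : Type*} [CommRing R] [CommRing S] (φ : R →+* S)
    {I : Ideal R} {J : Ideal S} (hJ : ∀ x ∈ I, φ x ∈ J) (d : R →+ S)
    (hd : ∀ f g, d (f * g) = φ f * d g + φ g * d f) (n : ℕ) :
    ∀ x ∈ I ^ (n + 1), d x ∈ J ^ n := by
  have hφ : I.map φ ≤ J := Ideal.map_le_iff_le_comap.2 hJ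
  induction n with
  | zero => intro x _; simp
  | succ n ih =>
    intro x hx
    rw [pow_succ (n := n + 1)] at hx
    refine Submodule.mul_induction_on hx ?_ ?_
    · intro a ha b hb
      rw [hd]
      refine Ideal.add_mem _ (Ideal.mul_mem_right _ _ ?_) ?_
      · have : (I ^ (n + 1)).map φ ≤ J ^ (n + 1) := by
          rw [Ideal.map_pow]
          exact Ideal.pow_right_mono hφ _
        exact this (Ideal.mem_map_of_mem _ ha)
      · rw [mul_comm, pow_succ]
        exact Ideal.mul_mem_mul (ih a ha) (hJ b hb)
    · intro a b ha hb
      rw [map_add]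
      exact Ideal.add_mem _ ha hb

theorem derivation_mem_formalMax_pow {p : Pt A} (X : FormalVF p) {n : ℕ} {f : FormalRing p}
    (hf : f ∈ formalMax p ^ (n + 1)) : X f ∈ formalMax p ^ n :=
  map_pow_of_leibniz (RingHom.id (FormalRing p)) (fun _ h => h) (AddMonoidHom.mk' X (map_add X))
    (fun f g => by simp [Derivation.leibniz]) n f hf

variable {A' : Type*} [CommRing A'] [Algebra ℂ A'] [IsNoetherianRing A']

/-- Derivations of completed local rings along a morphism are determined by their values on
regular functions. -/
theorem formal_derivation_ext {p : Pt A} {q : Pt A'} (φ : FormalRing p →+* FormalRing q)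
    (hφ : ∀ f ∈ formalMax p, φ f ∈ formalMax q) (d d' : FormalRing p →+ FormalRing q)
    (hd : ∀ f g, d (f * g) = φ f * d g + φ g * d f)
    (hd' : ∀ f g, d' (f * g) = φ f * d' g + φ g * d' f)
    (h : ∀ a, d (algebraMap A _ a) = d' (algebraMap A _ a)) : d = d' := by
  refine AddMonoidHom.ext fun f => ?_
  rw [← sub_eq_zero]
  refine eq_zero_of_forall_mem_pow (p := q) fun n => ?_
  obtain ⟨a, ha⟩ := exists_sub_mem_formalMax_pow (n + 1) f
  have h1 := map_pow_of_leibniz φ hφ (d - d')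
    (fun f g => by simp only [AddMonoidHom.sub_apply, hd, hd']; ring) n _ ha
  rw [map_sub] at h1
  simpa [h] using h1

theorem formalVF_ext {p : Pt A} {X Y : FormalVF p}
    (h : ∀ a, X (algebraMap A _ a) = Y (algebraMap A _ a)) : X = Y := by
  have := formal_derivation_ext (RingHom.id (FormalRing p)) (fun _ h => h)
    (AddMonoidHom.mk' X (map_add X)) (AddMonoidHom.mk' Y (map_add Y))
    (fun f g => by simp [Derivation.leibniz]) (fun f g => by simp [Derivation.leibniz]) h
  exact Derivation.ext fun f => DFunLike.congr_fun this f

theorem formalMap_mem_formalMax (φ : A →ₐ[ℂ] A') (q : Pt A') :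
    ∀ f ∈ formalMax (q.comp φ), formalMap φ q f ∈ formalMax q := by
  have : formalMax (q.comp φ) ≤ (formalMax q).comap (formalMap φ q) := by
    rw [formalMax, Ideal.map_le_iff_le_comap]
    intro a ha
    rw [Ideal.mem_comap, Ideal.mem_comap]
    rw [formalMap_algebraMap]
    exact Ideal.mem_map_of_mem _ ha
  exact this

theorem evalAt_formalMap (φ : A →ₐ[ℂ] A') (q : Pt A') (f : FormalRing (q.comp φ)) :
    evalAt q (formalMap φ q f) = evalAt (q.comp φ) f := by
  obtain ⟨a, ha⟩ := exists_sub_mem_formalMax_pow 1 f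
  rw [pow_one] at ha
  have h1 := mem_formalMax_iff.1 ha
  have h2 := mem_formalMax_iff.1 (formalMap_mem_formalMax φ q _ ha)
  rw [map_sub, sub_eq_zero] at h1
  rw [map_sub, map_sub, sub_eq_zero, formalMap_algebraMap, evalAt_algebraMap] at h2
  rw [h2, h1, evalAt_algebraMap]
  rfl

theorem restrictsTo_of_algebraMap {φ : A →ₐ[ℂ] A'} {q : Pt A'} {X : FormalVF (q.comp φ)}
    {Z : FormalVF q} (h : ∀ a, formalMap φ q (X (algebraMap A _ a)) =
      Z (algebraMap A' _ (φ a))) : RestrictsTo φ q X Z := by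
  have := formal_derivation_ext (formalMap φ q).toRingHom (formalMap_mem_formalMax φ q)
    (AddMonoidHom.mk' (fun f => formalMap φ q (X f)) (fun f g => by simp only [map_add]))
    (AddMonoidHom.mk' (fun f => Z (formalMap φ q f)) (fun f g => by simp only [map_add]))
    (fun f g => by simp [Derivation.leibniz]) (fun f g => by simp [Derivation.leibniz])
    (fun a => by
      refine (h a).trans ?_
      rw [← formalMap_algebraMap]
      rfl)
  intro f
  exact DFunLike.congr_fun this f

end FormalFacts

section Euler

variable {A : Type*} [CommRing A] [Algebra ℂ A] [IsNoetherianRing A]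

theorem exists_finite_euler [Algebra.Smooth ℂ A] :
    ∃ (ι : Type) (_ : Fintype ι) (D : ι → Derivation ℂ A A) (b : ι → A),
      ∀ a, (1 : A) • KaehlerDifferential.D ℂ A a =
        ∑ j, D j a • KaehlerDifferential.D ℂ A (b j) := by
  obtain ⟨S, hS⟩ := Module.Finite.fg_top (R := A) (M := Ω[A⁄ℂ])
  have hspan := KaehlerDifferential.span_range_derivation ℂ A
  obtain ⟨T, hT, hTS⟩ := Submodule.fg_span_iff_fg_span_finset_subset
    (Set.range (KaehlerDifferential.D ℂ A)) |>.1 (by rw [hspan]; exact Module.Finite.fg_top)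
  rw [hspan] at hTS
  choose b hb using fun t : T => hT t.2
  let e := T.equivFin
  let f : (Fin T.card → A) →ₗ[A] Ω[A⁄ℂ] :=
    Fintype.linearCombination A (fun i => KaehlerDifferential.D ℂ A (b (e.symm i)))
  have hf : Function.Surjective f := by
    rw [← LinearMap.range_eq_top, Fintype.range_linearCombination, eq_top_iff, hTS]
    refine Submodule.span_mono fun t ht => ⟨e ⟨t, ht⟩, ?_⟩
    simp [hb]
  obtain ⟨σ, hσ⟩ := Module.projective_lifting_property f LinearMap.id hf
  refine ⟨Fin T.card, inferInstance, fun i => ((LinearMap.proj i) ∘ₗ σ).compDer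
    (KaehlerDifferential.D ℂ A), fun i => b (e.symm i), fun a => ?_⟩
  have := LinearMap.congr_fun hσ (KaehlerDifferential.D ℂ A a)
  rw [one_smul]
  conv_lhs => rw [← LinearMap.id_apply (R := A) (KaehlerDifferential.D ℂ A a), ← this]
  rw [LinearMap.comp_apply, Fintype.linearCombination_apply]
  rfl

/-- A derivation applied to an Euler identity for differentials. -/
theorem derivation_euler {ι M : Type*} [Fintype ι] {u : A} {D : ι → Derivation ℂ A A} {b : ι → A}
    (he : ∀ a, u • KaehlerDifferential.D ℂ A a = ∑ j, D j a • KaehlerDifferential.D ℂ A (b j))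
    [AddCommGroup M] [Module ℂ M] [Module A M] [IsScalarTower ℂ A M] (Y : Derivation ℂ A M)
    (a : A) : u • Y a = ∑ j, D j a • Y (b j) := by
  have := congrArg Y.liftKaehlerDifferential (he a)
  simpa only [map_smul, map_sum, Derivation.liftKaehlerDifferential_comp_D] using this

/-- The class of `a - a(p)` modulo the square of the maximal ideal. -/
def linearPart (p : Pt A) : Derivation ℂ A (A ⧸ RingHom.ker p ^ 2) :=
  Derivation.mk' ((Ideal.Quotient.mkₐ ℂ (RingHom.ker p ^ 2)).toLinearMap ∘ₗ
    (LinearMap.id - (Algebra.linearMap ℂ A) ∘ₗ p.toLinearMap)) (fun a b => by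
      have key : (a * b - algebraMap ℂ A (p (a * b))) - (a * (b - algebraMap ℂ A (p b)) +
          b * (a - algebraMap ℂ A (p a))) ∈ RingHom.ker p ^ 2 := by
        have h1 : (a * b - algebraMap ℂ A (p (a * b))) - (a * (b - algebraMap ℂ A (p b)) +
          b * (a - algebraMap ℂ A (p a))) =
            -((a - algebraMap ℂ A (p a)) * (b - algebraMap ℂ A (p b))) := by
          rw [map_mul, map_mul]; ring
        rw [h1, pow_two]
        refine Ideal.neg_mem_iff _ |>.2 (Ideal.mul_mem_mul ?_ ?_) <;>
        · rw [RingHom.mem_ker, map_sub, AlgHom.commutes]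
          exact sub_self _
      exact (Ideal.Quotient.mk_eq_mk_iff_sub_mem _ _).2 key)

theorem linearPart_apply (p : Pt A) (a : A) :
    linearPart p a = Ideal.Quotient.mk _ (a - algebraMap ℂ A (p a)) := rfl

theorem euler_mem_pow {ι : Type*} [Fintype ι] {u : A} {D : ι → Derivation ℂ A A} {b : ι → A}
    (he : ∀ a, u • KaehlerDifferential.D ℂ A a = ∑ j, D j a • KaehlerDifferential.D ℂ A (b j))
    (p : Pt A) (n : ℕ) : ∀ a ∈ RingHom.ker p ^ (n + 1),
      (∑ j, D j a * (b j - algebraMap ℂ A (p (b j)))) - (n + 1 : ℕ) * (u * a) ∈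
        RingHom.ker p ^ (n + 2) := by
  have h1 : ∀ a ∈ RingHom.ker p,
      (∑ j, D j a * (b j - algebraMap ℂ A (p (b j)))) - u * a ∈ RingHom.ker p ^ 2 := by
    intro a ha
    have := derivation_euler he (linearPart p) a
    simp only [linearPart_apply] at this
    rw [RingHom.mem_ker] at ha
    rw [ha, map_zero, sub_zero] at this
    rw [← Ideal.Quotient.mk_eq_mk_iff_sub_mem]
    rw [map_sum]
    exact this.symm
  induction n with
  | zero => intro a ha; simpa using h1 a (by simpa using ha)
  | succ n ih =>
    intro x hx
    rw [pow_succ (n := n + 1)] at hx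
    refine Submodule.mul_induction_on hx ?_ ?_
    · intro a ha c hc
      have h2 := ih a ha
      have h3 := h1 c hc
      have h4 : (∑ j, D j (a * c) * (b j - algebraMap ℂ A (p (b j)))) -
          (n + 1 + 1 : ℕ) * (u * (a * c)) =
          a * ((∑ j, D j c * (b j - algebraMap ℂ A (p (b j)))) - u * c) +
          ((∑ j, D j a * (b j - algebraMap ℂ A (p (b j)))) - (n + 1 : ℕ) * (u * a)) * c := by
        have h5 : (∑ j, D j (a * c) * (b j - algebraMap ℂ A (p (b j)))) =
            a * (∑ j, D j c * (b j - algebraMap ℂ A (p (b j)))) +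
            (∑ j, D j a * (b j - algebraMap ℂ A (p (b j)))) * c := by
          rw [Finset.mul_sum, Finset.sum_mul, ← Finset.sum_add_distrib]
          refine Finset.sum_congr rfl fun j _ => ?_
          rw [Derivation.leibniz, smul_eq_mul, smul_eq_mul]
          ring
        rw [h5]
        push_cast
        ring
      rw [h4]
      refine Ideal.add_mem _ ?_ ?_
      · rw [show n + 1 + 2 = (n + 1) + 2 from rfl, pow_add]
        exact Ideal.mul_mem_mul ha h3
      · rw [show n + 1 + 2 = (n + 2) + 1 from rfl, pow_succ (n := n + 2)]
        exact Ideal.mul_mem_mul h2 hc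
    · intro a c ha hc
      have := Ideal.add_mem _ ha hc
      convert this using 1
      simp only [map_add, add_mul, Finset.sum_add_distrib]
      ring

/-- A formal function all of whose iterated derivatives vanish at the base point is zero. -/
theorem eq_zero_of_iterated {ι : Type*} [Fintype ι] {u : A} {D : ι → Derivation ℂ A A} {b : ι → A}
    (he : ∀ a, u • KaehlerDifferential.D ℂ A a = ∑ j, D j a • KaehlerDifferential.D ℂ A (b j))
    {p : Pt A} (hu : p u ≠ 0) {S : Set (FormalRing p)} (hS : ∀ f ∈ S, evalAt p f = 0)
    (hD : ∀ f ∈ S, ∀ j, extendDer p (D j) f ∈ S) : ∀ f ∈ S, f = 0 := by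
  suffices h : ∀ n, ∀ f ∈ S, f ∈ formalMax p ^ (n + 1) by
    intro f hf
    refine eq_zero_of_forall_mem_pow fun n => ?_
    exact Ideal.pow_le_pow_right (Nat.le_succ n) (h n f hf)
  intro n
  induction n with
  | zero =>
    intro f hf
    rw [zero_add, pow_one, mem_formalMax_iff]
    exact hS f hf
  | succ n ih =>
    intro f hf
    obtain ⟨a, ha⟩ := exists_sub_mem_formalMax_pow (n + 2) f
    have hle : formalMax p ^ (n + 2) ≤ formalMax p ^ (n + 1) :=
      Ideal.pow_le_pow_right (Nat.le_succ _)
    have ha1 : a ∈ RingHom.ker p ^ (n + 1) := by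
      rw [← algebraMap_mem_formalMax_pow]
      have := Ideal.sub_mem _ (ih f hf) (hle ha)
      rwa [sub_sub_cancel] at this
    have hDa : ∀ j, D j a ∈ RingHom.ker p ^ (n + 1) := by
      intro j
      rw [← algebraMap_mem_formalMax_pow, ← extendDer_algebraMap]
      have h1 := derivation_mem_formalMax_pow (extendDer p (D j)) ha
      have h2 := ih _ (hD f hf j)
      have := Ideal.sub_mem _ h2 h1
      rwa [map_sub, sub_sub_cancel] at this
    have h3 := euler_mem_pow he p n a ha1
    have h4 : (∑ j, D j a * (b j - algebraMap ℂ A (p (b j)))) ∈ RingHom.ker p ^ (n + 2) := by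
      refine Ideal.sum_mem _ fun j _ => ?_
      rw [pow_succ (n := n + 1)]
      refine Ideal.mul_mem_mul (hDa j) ?_
      rw [RingHom.mem_ker, map_sub, AlgHom.commutes]
      exact sub_self _
    have h5 := Ideal.sub_mem _ h4 h3
    rw [sub_sub_cancel] at h5
    have h6 : algebraMap A (FormalRing p) ((n + 1 : ℕ) * (u * a)) ∈ formalMax p ^ (n + 2) :=
      algebraMap_mem_formalMax_pow.2 h5
    have h7 : IsUnit (algebraMap A (FormalRing p) ((n + 1 : ℕ) * u)) := by
      refine isUnit_of_evalAt_ne_zero ?_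
      rw [evalAt_algebraMap, map_mul, map_natCast]
      exact mul_ne_zero (Nat.cast_ne_zero.2 (Nat.succ_ne_zero n)) hu
    rw [← mul_assoc, map_mul, Ideal.unit_mul_mem_iff_mem _ h7] at h6
    have := Ideal.add_mem _ ha h6
    rwa [sub_add_cancel] at this

end Euler

section CountableNullstellensatz

variable {A : Type*} [CommRing A] [Algebra ℂ A]

theorem exists_countable_span [Algebra.FiniteType ℂ A] :
    ∃ U : Set A, U.Countable ∧ Submodule.span ℂ U = ⊤ := by
  obtain ⟨n, f, hf⟩ := Algebra.FiniteType.iff_quotient_mvPolynomial''.1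
    (inferInstance : Algebra.FiniteType ℂ A)
  refine ⟨Set.range fun α : Fin n →₀ ℕ => f (MvPolynomial.monomial α 1),
    Set.countable_range _, ?_⟩
  rw [eq_top_iff]
  intro a _
  obtain ⟨p, rfl⟩ := hf a
  rw [p.as_sum, map_sum]
  refine Submodule.sum_mem _ fun α _ => ?_
  rw [← mul_one (MvPolynomial.coeff α p), ← smul_eq_mul, ← MvPolynomial.smul_monomial, map_smul]
  exact Submodule.smul_mem _ _ (Submodule.subset_span ⟨α, rfl⟩)

theorem isAlgebraic_of_countable_span {F : Type*} [Field F] [Algebra ℂ F] {U : Set F}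
    (hU : U.Countable) (hspan : Submodule.span ℂ U = ⊤) : Algebra.IsAlgebraic ℂ F := by
  by_contra hna
  rw [Algebra.isAlgebraic_def] at hna
  push Not at hna
  obtain ⟨x, hx⟩ := hna
  have h1 := (Transcendental.linearIndependent_sub_inv hx).cardinal_lift_le_rank
  have h2 : Module.rank ℂ F ≤ Cardinal.aleph0 := by
    rw [← rank_top, ← hspan]
    exact (rank_span_le U).trans (Cardinal.le_aleph0_iff_set_countable.2 hU)
  have h3 := h1.trans (Cardinal.lift_le.2 h2)
  rw [Cardinal.lift_aleph0, Cardinal.lift_le_aleph0, ← Cardinal.mk_univ,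
    Cardinal.le_aleph0_iff_set_countable] at h3
  exact not_countable_complex h3

/-- The Nullstellensatz for countably many inequations. -/
theorem exists_pt_ne_zero [IsDomain A] [Algebra.FiniteType ℂ A] {T : Set A} (hT : T.Countable)
    (h0 : (0 : A) ∉ T) : ∃ p : Pt A, ∀ t ∈ T, p t ≠ 0 := by
  have := hT.to_subtype
  let S : Submonoid A := MonoidHom.mrange (FreeMonoid.lift ((↑) : T → A))
  have hTS : ∀ t ∈ T, t ∈ S := fun t ht => ⟨FreeMonoid.of ⟨t, ht⟩, by simp⟩
  have hS0 : S ≤ nonZeroDivisors A := by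
    rintro _ ⟨l, rfl⟩
    induction l using FreeMonoid.inductionOn' with
    | one => simp
    | of_mul t l ih =>
      rw [map_mul]
      refine mul_mem ?_ ih
      rw [FreeMonoid.lift_eval_of]
      exact mem_nonZeroDivisors_of_ne_zero fun h => h0 (h ▸ t.2)
  have hSc : (S : Set A).Countable := by
    have : Countable (FreeMonoid T) := inferInstanceAs (Countable (List T))
    exact Set.countable_range _
  let R := Localization S
  have hdom : IsDomain R := IsLocalization.isDomain_localization hS0
  obtain ⟨I, hI⟩ := Ideal.exists_maximal R
  let _ : Field (R ⧸ I) := Ideal.Quotient.field I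
  obtain ⟨U, hU, hUs⟩ := exists_countable_span (A := A)
  let φ : A →ₐ[ℂ] R ⧸ I := (Ideal.Quotient.mkₐ ℂ I).comp (IsScalarTower.toAlgHom ℂ A R)
  have hunit : ∀ s ∈ S, IsUnit (φ s) := fun s hs =>
    (IsLocalization.map_units R (⟨s, hs⟩ : S)).map (Ideal.Quotient.mkₐ ℂ I)
  let W : Set (R ⧸ I) := (fun q : A × A => φ q.1 * (φ q.2)⁻¹) '' (U ×ˢ (S : Set A))
  have hW : W.Countable := (hU.prod hSc).image _
  have hWs : Submodule.span ℂ W = ⊤ := by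
    rw [eq_top_iff]
    intro z _
    obtain ⟨r, rfl⟩ := Ideal.Quotient.mk_surjective z
    obtain ⟨a, s, rfl⟩ := IsLocalization.exists_mk'_eq S r
    have hz : Ideal.Quotient.mk I (IsLocalization.mk' R a s) = φ a * (φ s)⁻¹ := by
      rw [eq_mul_inv_iff_mul_eq₀ (hunit s s.2).ne_zero]
      change Ideal.Quotient.mk I _ * Ideal.Quotient.mk I (algebraMap A R s) = _
      rw [← map_mul, IsLocalization.mk'_spec]
      rfl
    rw [hz]
    clear hz
    have ha : a ∈ Submodule.span ℂ U := by rw [hUs]; trivial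
    induction ha using Submodule.span_induction with
    | mem a ha => exact Submodule.subset_span ⟨(a, s), ⟨ha, s.2⟩, rfl⟩
    | zero => simp
    | add a b _ _ ha hb => rw [map_add, add_mul]; exact Submodule.add_mem _ (ha trivial) (hb trivial)
    | smul c a _ ha =>
      rw [map_smul, smul_mul_assoc]; exact Submodule.smul_mem _ _ (ha trivial)
  have halg := isAlgebraic_of_countable_span hW hWs
  let e : ℂ ≃ₐ[ℂ] (R ⧸ I) := AlgEquiv.ofBijective (Algebra.ofId ℂ _)
    IsAlgClosed.algebraMap_bijective_of_isIntegral
  refine ⟨(e.symm : (R ⧸ I) →ₐ[ℂ] ℂ).comp φ, fun t ht => ?_⟩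
  exact ((hunit t (hTS t ht)).map (e.symm : (R ⧸ I) →ₐ[ℂ] ℂ)).ne_zero

theorem Generically.exists_countable {P : Pt A → Prop} (h : Generically A P) :
    ∃ T : Set A, T.Countable ∧ (0 : A) ∉ T ∧ ∀ p : Pt A, (∀ t ∈ T, p t ≠ 0) → P p := by
  obtain ⟨a, ha, h⟩ := h
  refine ⟨Set.range a, Set.countable_range _, ?_, fun p hp => h p fun i => hp _ ⟨i, rfl⟩⟩
  rintro ⟨i, hi⟩
  exact ha i hi

variable {B : Type*} [CommRing B] [Algebra ℂ B] [Algebra B A] [IsScalarTower ℂ B A]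

/-- A generic fibre on which countably many given nonzero functions do not vanish identically. -/
theorem exists_generic_fibre [IsDomain A] [Algebra.FiniteType ℂ A]
    (hBA : Function.Injective (algebraMap B A)) {P : Pt B → Prop} (hP : Generically B P)
    {T : Set A} (hT : T.Countable) (h0 : (0 : A) ∉ T) :
    ∃ s : Pt B, P s ∧ ∀ t ∈ T, fibreIncl A s t ≠ 0 := by
  obtain ⟨T', hT', h0', hP⟩ := hP.exists_countable
  obtain ⟨p, hp⟩ := exists_pt_ne_zero (hT.union (hT'.image (algebraMap B A))) (by
    rintro (h | ⟨b, hb, h⟩)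
    · exact h0 h
    · rw [← map_zero (algebraMap B A)] at h
      exact h0' (hBA h ▸ hb))
  refine ⟨p.comp (IsScalarTower.toAlgHom ℂ B A), hP _ fun t ht => hp _ (Or.inr ⟨t, ht, rfl⟩), ?_⟩
  intro t ht h
  refine hp t (Or.inl ht) ?_
  have h1 : t ∈ (RingHom.ker (p.comp (IsScalarTower.toAlgHom ℂ B A))).map (algebraMap B A) :=
    Ideal.Quotient.eq_zero_iff_mem.1 h
  have h2 : (RingHom.ker (p.comp (IsScalarTower.toAlgHom ℂ B A))).map (algebraMap B A) ≤
      RingHom.ker p := by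
    rw [Ideal.map_le_iff_le_comap]
    intro b hb
    exact hb
  exact h2 h1

end CountableNullstellensatz

section Taylor

variable {κ : Type} [Fintype κ] {m : ℕ} {R : Type*} [CommRing R] [Algebra ℂ R]

/-- The derivations of a family commute. -/
def CommutingDers (d : κ ⊕ Fin m → Derivation ℂ R R) : Prop := ∀ i j f, d i (d j f) = d j (d i f)

variable {d : κ ⊕ Fin m → Derivation ℂ R R} (hd : CommutingDers d)

theorem CommutingDers.commute (hd : CommutingDers d) (i j : κ ⊕ Fin m) :
    Commute (d i : Module.End ℂ R) (d j : Module.End ℂ R) :=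
  LinearMap.ext fun f => hd i j f

theorem CommutingDers.pairwise (hd : CommutingDers d) (α : κ ⊕ Fin m → ℕ) :
    ((Finset.univ : Finset (κ ⊕ Fin m)) : Set (κ ⊕ Fin m)).Pairwise
      (Function.onFun Commute fun j => (d j : Module.End ℂ R) ^ (α j)) :=
  fun i _ j _ _ => (hd.commute i j).pow_pow _ _

/-- The iterated derivative with a given exponent. -/
def iterDer (α : Expo κ m) : Module.End ℂ R :=
  Finset.univ.noncommProd (fun j => (d j : Module.End ℂ R) ^ (α j)) (hd.pairwise α)

theorem iterDer_zero : iterDer hd 0 = 1 := by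
  rw [iterDer]
  refine Finset.noncommProd_induction _ _ _ (fun x => x = 1) ?_ rfl ?_
  · rintro _ _ rfl rfl; rw [mul_one]
  · intro j _; simp

theorem iterDer_add (α β : Expo κ m) : iterDer hd (α + β) = iterDer hd α * iterDer hd β := by
  rw [iterDer, iterDer, iterDer, ← Finset.noncommProd_mul_distrib]
  · refine Finset.noncommProd_congr rfl (fun j _ => ?_) _
    simp [pow_add]
  · intro i _ j _ _
    exact (hd.commute _ _).pow_pow _ _

theorem iterDer_unitE (j : κ ⊕ Fin m) : iterDer hd (unitE j) = (d j : Module.End ℂ R) := by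
  classical
  have hc := hd.pairwise (unitE j)
  have h1 := Finset.noncommProd_eq_pow_card (Finset.univ.erase j)
    (fun i => (d i : Module.End ℂ R) ^ (unitE j i)) (hc.mono (Set.subset_univ _ |>.trans (by simp)))
    1 (fun i hi => by
      have := Finset.ne_of_mem_erase hi
      simp [Finsupp.single_apply, Ne.symm this])
  have h2 := Finset.mul_noncommProd_erase Finset.univ (Finset.mem_univ j)
    (fun i => (d i : Module.End ℂ R) ^ (unitE j i)) hc
    (hc.mono (Set.subset_univ _ |>.trans (by simp)))
  rw [iterDer, ← h2, h1]
  simp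

/-- The Taylor coefficient with a given exponent. -/
def tcoef (α : Expo κ m) : R →ₗ[ℂ] R :=
  ((∏ j, (α j).factorial : ℕ) : ℂ)⁻¹ • iterDer hd α

@[simp] theorem tcoef_zero (f : R) : tcoef hd 0 f = f := by
  simp [tcoef, iterDer_zero]

theorem factorial_add_unitE (α : Expo κ m) (j : κ ⊕ Fin m) :
    (∏ i, ((α + unitE j) i).factorial) = (α j + 1) * ∏ i, (α i).factorial := by
  classical
  rw [← Finset.mul_prod_erase _ _ (Finset.mem_univ j),
    ← Finset.mul_prod_erase _ (fun i => (α i).factorial) (Finset.mem_univ j), ← mul_assoc]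
  congr 1
  · simp [Nat.factorial_succ]
  · refine Finset.prod_congr rfl fun i hi => ?_
    have := Finset.ne_of_mem_erase hi
    simp [Finsupp.single_apply, Ne.symm this]

theorem tcoef_der (α : Expo κ m) (j : κ ⊕ Fin m) (f : R) :
    tcoef hd α (d j f) = ((α j : ℂ) + 1) • tcoef hd (α + unitE j) f := by
  have h1 : ((α j : ℂ) + 1) ≠ 0 := Nat.cast_add_one_ne_zero _
  have h2 : ((∏ j, (α j).factorial : ℕ) : ℂ) ≠ 0 :=
    Nat.cast_ne_zero.2 (Finset.prod_ne_zero_iff.2 fun j _ => Nat.factorial_ne_zero _)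
  rw [tcoef, tcoef, LinearMap.smul_apply, LinearMap.smul_apply, smul_smul, factorial_add_unitE,
    iterDer_add, iterDer_unitE]
  congr 1
  push_cast
  push_cast at h2
  field_simp

theorem tcoef_add_unitE (α : Expo κ m) (j : κ ⊕ Fin m) (f : R) :
    tcoef hd (α + unitE j) f = ((α j : ℂ) + 1)⁻¹ • tcoef hd α (d j f) := by
  have h1 : ((α j : ℂ) + 1) ≠ 0 := Nat.cast_add_one_ne_zero _
  rw [tcoef_der, smul_smul, inv_mul_cancel₀ h1, one_smul]

theorem tcoef_unitE (j : κ ⊕ Fin m) (f : R) : tcoef hd (unitE j) f = d j f := by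
  have := tcoef_der hd 0 j f
  simpa using this.symm

theorem tcoef_natural {R' : Type*} [CommRing R'] [Algebra ℂ R']
    {d' : κ ⊕ Fin m → Derivation ℂ R' R'} (hd' : CommutingDers d') (φ : R →ₗ[ℂ] R')
    (h : ∀ j f, φ (d j f) = d' j (φ f)) (α : Expo κ m) :
    ∀ f, φ (tcoef hd α f) = tcoef hd' α (φ f) := by
  induction α using expo_induction with
  | h0 => intro f; simp
  | hs β k ih => intro f; rw [tcoef_add_unitE, tcoef_add_unitE, map_smul, ih, h]

theorem der_tcoef (α : Expo κ m) (j : κ ⊕ Fin m) (f : R) :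
    d j (tcoef hd α f) = tcoef hd α (d j f) :=
  tcoef_natural hd hd (d j : R →ₗ[ℂ] R) (fun i f => hd j i f) α f

/-- The Taylor series of an element with respect to commuting derivations. -/
def taylor (f : R) : MvPowerSeries (κ ⊕ Fin m) R := fun α => tcoef hd α f

@[simp] theorem coeff_taylor (α : Expo κ m) (f : R) :
    MvPowerSeries.coeff α (taylor hd f) = tcoef hd α f := rfl

theorem taylor_add (f g : R) : taylor hd (f + g) = taylor hd f + taylor hd g := by
  ext α; simp

theorem taylor_sub (f g : R) : taylor hd (f - g) = taylor hd f - taylor hd g := by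
  ext α; simp

theorem taylor_sum {ι : Type*} (s : Finset ι) (f : ι → R) :
    taylor hd (∑ i ∈ s, f i) = ∑ i ∈ s, taylor hd (f i) := by
  ext α; simp [map_sum]

theorem pderiv_taylor (j : κ ⊕ Fin m) (f : R) :
    MvPowerSeries.pderiv R j (taylor hd f) = taylor hd (d j f) := by
  ext α
  rw [MvPowerSeries.coeff_pderiv, coeff_taylor, coeff_taylor, tcoef_der, Algebra.smul_def]
  simp [mul_comm]

theorem taylor_mul (f g : R) : taylor hd (f * g) = taylor hd f * taylor hd g := by
  suffices h : ∀ α : Expo κ m, ∀ f g, MvPowerSeries.coeff α (taylor hd (f * g)) =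
      MvPowerSeries.coeff α (taylor hd f * taylor hd g) from
    MvPowerSeries.ext fun α => h α f g
  have key : ∀ (β : Expo κ m) (j : κ ⊕ Fin m), (∀ f g, MvPowerSeries.coeff β (taylor hd (f * g)) =
      MvPowerSeries.coeff β (taylor hd f * taylor hd g)) → ∀ f g,
      MvPowerSeries.coeff (β + unitE j) (taylor hd (f * g)) =
      MvPowerSeries.coeff (β + unitE j) (taylor hd f * taylor hd g) := by
    intro β j ih f g
    have h1 : MvPowerSeries.coeff β (MvPowerSeries.pderiv R j (taylor hd (f * g))) =
        MvPowerSeries.coeff β (MvPowerSeries.pderiv R j (taylor hd f * taylor hd g)) := by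
      rw [pderiv_taylor, Derivation.leibniz, Derivation.leibniz, pderiv_taylor, pderiv_taylor,
        taylor_add, map_add, map_add, smul_eq_mul, smul_eq_mul, smul_eq_mul, smul_eq_mul, ih, ih]
    rw [MvPowerSeries.coeff_pderiv, MvPowerSeries.coeff_pderiv] at h1
    have h2 : IsUnit ((β j : R) + 1) := by
      have : ((β j : ℂ) + 1) ≠ 0 := Nat.cast_add_one_ne_zero _
      simpa using (IsUnit.mk0 _ this).map (algebraMap ℂ R)
    exact h2.mul_right_cancel h1
  intro α
  induction α using expo_induction with
  | h0 =>
    intro f g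
    rw [MvPowerSeries.coeff_zero_eq_constantCoeff, map_mul,
      ← MvPowerSeries.coeff_zero_eq_constantCoeff]
    simp only [coeff_taylor, tcoef_zero]
  | hs β k ih => exact key β _ ih

theorem taylor_one : taylor hd 1 = 1 := by
  classical
  ext α
  rw [coeff_taylor]
  induction α using expo_induction with
  | h0 => simp
  | hs β k ih =>
    rw [tcoef_add_unitE, Derivation.map_one_eq_zero, map_zero, smul_zero, MvPowerSeries.coeff_one,
      if_neg]
    intro h
    simpa using DFunLike.congr_fun h k

/-- The Taylor series as an algebra morphism. -/
def taylorHom : R →ₐ[ℂ] MvPowerSeries (κ ⊕ Fin m) R :=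
  AlgHom.ofLinearMap
    { toFun := taylor hd, map_add' := taylor_add hd, map_smul' := fun c f => by ext α; simp }
    (taylor_one hd) (taylor_mul hd)

@[simp] theorem coeff_taylorHom (α : Expo κ m) (f : R) :
    MvPowerSeries.coeff α (taylorHom hd f) = tcoef hd α f := rfl

theorem taylor_vbracket (X Y : Fin m → R) (i : Fin m) :
    taylor hd (∑ j, (X j * d (Sum.inr j) (Y i) - Y j * d (Sum.inr j) (X i))) =
      vbracket (fun l => taylor hd (X l)) (fun l => taylor hd (Y l)) i := by
  simp only [vbracket, pderiv_taylor, taylor_sum, taylor_sub, taylor_mul]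

theorem map_vbracket {R' : Type*} [CommRing R'] (φ : R →+* R')
    (X Y : Fin m → MvPowerSeries (κ ⊕ Fin m) R) (i : Fin m) :
    MvPowerSeries.map φ (vbracket X Y i) =
      vbracket (fun l => MvPowerSeries.map φ (X l)) (fun l => MvPowerSeries.map φ (Y l)) i := by
  have h : ∀ (j : κ ⊕ Fin m) (f : MvPowerSeries (κ ⊕ Fin m) R),
      MvPowerSeries.map φ (MvPowerSeries.pderiv R j f) =
        MvPowerSeries.pderiv R' j (MvPowerSeries.map φ f) := by
    intro j f
    ext α
    simp [MvPowerSeries.coeff_pderiv]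
  simp only [vbracket, map_sum, map_sub, map_mul, h]

end Taylor

section OpEval

variable {κ : Type} [Fintype κ] {m : ℕ} {K : Type*} [Field K] [Algebra ℂ K]
  {R : Type*} [CommRing R] [Algebra ℂ R] [Algebra K R]
  {d : κ ⊕ Fin m → Derivation ℂ R R} (hd : CommutingDers d)

/-- The value of an operator on a vertical vector field with given components. -/
def opEval (X : Fin m → R) : Op κ m K →ₗ[K] R :=
  Finsupp.linearCombination K fun p => tcoef hd p.2 (X p.1)

@[simp] theorem opEval_single (X : Fin m → R) (p : Fin m × Expo κ m) (c : K) :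
    opEval hd X (Finsupp.single p c) = c • tcoef hd p.2 (X p.1) := by
  simp [opEval]

theorem opEval_dmul {δ : κ ⊕ Fin m → Derivation ℂ K K}
    (hδ : ∀ j z, d j (algebraMap K R z) = algebraMap K R (δ j z)) [IsScalarTower ℂ K R]
    (X : Fin m → R) (j : κ ⊕ Fin m) (θ : Op κ m K) :
    opEval hd X (dmul δ j θ) = d j (opEval hd X θ) := by
  induction θ using Finsupp.induction_linear with
  | zero => simp
  | add θ θ' h h' => simp only [map_add, h, h']
  | single p c =>
    rw [dmul_apply, shift_single, coefD_single, map_add, opEval_single, opEval_single,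
      opEval_single, Algebra.smul_def c, Derivation.leibniz, hδ, der_tcoef, tcoef_der,
      smul_eq_mul, smul_eq_mul, Algebra.smul_def, Algebra.smul_def, Algebra.smul_def]
    have : algebraMap ℂ R ((p.2 j : ℂ) + 1) = algebraMap K R ((p.2 j : K) + 1) := by simp
    rw [this, map_mul]
    ring

end OpEval

section FrameBasic

variable {A B K k : Type*}
  [CommRing B] [IsDomain B] [Algebra ℂ B]
  [CommRing A] [IsDomain A] [Algebra ℂ A] [Algebra B A] [IsScalarTower ℂ B A]
  [Field k] [Algebra B k] [IsFractionRing B k] [Algebra ℂ k] [IsScalarTower ℂ B k]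
  [Field K] [Algebra A K] [IsFractionRing A K] [Algebra ℂ K] [IsScalarTower ℂ A K]
  [Algebra k K] [IsScalarTower ℂ k K] [Algebra B K] [IsScalarTower B k K]
  [IsScalarTower B A K] {n m : ℕ}

namespace Frame

variable (F : Frame A B K k n m)

/-- The coordinates on the total space. -/
def x : Fin n ⊕ Fin m → A := Sum.elim (algebraMap B A ∘ F.s) F.y

@[simp] theorem x_inl (i : Fin n) : F.x (Sum.inl i) = algebraMap B A (F.s i) := rfl
@[simp] theorem x_inr (l : Fin m) : F.x (Sum.inr l) = F.y l := rfl

theorem dual_x (i j : Fin n ⊕ Fin m) :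
    F.δ i (algebraMap A K (F.x j)) = if i = j then 1 else 0 := F.dual i j

theorem euler_x (a : A) : F.c • KaehlerDifferential.D ℂ A a =
    ∑ j, F.D j a • KaehlerDifferential.D ℂ A (F.x j) := F.euler a

/-- Derivations of the function field are combinations of the coordinate ones. -/
theorem expand {M : Type*} [AddCommGroup M] [Module ℂ M] [Module K M] [IsScalarTower ℂ K M]
    (Y : Derivation ℂ K M) (z : K) : Y z = ∑ j, F.δ j z • Y (algebraMap A K (F.x j)) := by
  have h : Y = ∑ j, (LinearMap.toSpanSingleton K M (Y (algebraMap A K (F.x j)))).compDer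
      (F.δ j) := by
    refine derivation_ext_of_isTranscendenceBasis F.basis_K fun i => ?_
    rw [derivation_sum_apply]
    change Y (algebraMap A K (F.x i)) = ∑ j, F.δ j (algebraMap A K (F.x i)) • _
    simp [F.dual_x, ite_smul]
  conv_lhs => rw [h]
  rw [derivation_sum_apply]
  rfl

theorem comm : CommutingDers F.δ := by
  intro i j f
  have h : ⁅F.δ i, F.δ j⁆ = 0 := by
    refine derivation_ext_of_isTranscendenceBasis F.basis_K fun l => ?_
    change ⁅F.δ i, F.δ j⁆ (algebraMap A K (F.x l)) = 0
    rw [Derivation.commutator_apply, F.dual_x, F.dual_x]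
    split_ifs <;> simp
  have := DFunLike.congr_fun h f
  rwa [Derivation.commutator_apply, Derivation.zero_apply, sub_eq_zero] at this

theorem const_der (l : Fin m) (z : k) : F.δ (Sum.inr l) (algebraMap k K z) = 0 := by
  have h : (F.δ (Sum.inr l)).compAlgebraMap k = 0 := by
    refine derivation_ext_of_isTranscendenceBasis F.basis_k fun i => ?_
    change F.δ (Sum.inr l) (algebraMap k K (algebraMap B k (F.s i))) = 0
    rw [← IsScalarTower.algebraMap_apply B k K, IsScalarTower.algebraMap_apply B A K, ← x_inl,
      F.dual_x]
    simp
  exact DFunLike.congr_fun h z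

theorem D_base (l : Fin m) (b : B) : F.D (Sum.inr l) (algebraMap B A b) = 0 := by
  apply IsFractionRing.injective A K
  rw [F.D_spec, ← IsScalarTower.algebraMap_apply, IsScalarTower.algebraMap_apply B k K,
    F.const_der, mul_zero, map_zero]

theorem injective_base (_F : Frame A B K k n m) : Function.Injective (algebraMap B A) := by
  intro b b' h
  apply IsFractionRing.injective B k
  apply (algebraMap k K).injective
  rw [← IsScalarTower.algebraMap_apply, ← IsScalarTower.algebraMap_apply,
    IsScalarTower.algebraMap_apply B A K, h, IsScalarTower.algebraMap_apply B A K]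

variable [IsNoetherianRing A]

/-- Formal vector fields are combinations of the coordinate ones. -/
theorem euler_formal {p : Pt A} (X : FormalVF p) :
    algebraMap A (FormalRing p) F.c • X =
      ∑ j, X (algebraMap A _ (F.x j)) • extendDer p (F.D j) := by
  refine formalVF_ext fun a => ?_
  rw [derivation_sum_apply, Derivation.smul_apply]
  have := derivation_euler F.euler_x (X.compAlgebraMap A) a
  simp only [Algebra.smul_def] at this
  refine this.trans (Finset.sum_congr rfl fun j _ => ?_)
  rw [Derivation.smul_apply, extendDer_algebraMap, smul_eq_mul, mul_comm]
  rfl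

theorem euler_vertical {p : Pt A} {X : FormalVF p} (hX : IsVertical B X) :
    algebraMap A (FormalRing p) F.c • X =
      ∑ l, X (algebraMap A _ (F.y l)) • extendDer p (F.D (Sum.inr l)) := by
  rw [F.euler_formal, Fintype.sum_sum_type]
  simp only [x_inl, x_inr]
  rw [Finset.sum_eq_zero, zero_add]
  intro i _
  rw [hX, zero_smul]

end Frame

end FrameBasic

section Mero

variable {A : Type*} [CommRing A] [Algebra ℂ A]

/-- Formal meromorphic functions at a point. -/
def Mero (p : Pt A) : Type _ := FractionRing (FormalRing p)

namespace Mero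

variable (p : Pt A)

instance : CommRing (Mero p) := inferInstanceAs (CommRing (FractionRing (FormalRing p)))
instance : Algebra (FormalRing p) (Mero p) :=
  inferInstanceAs (Algebra (FormalRing p) (FractionRing (FormalRing p)))
instance : IsFractionRing (FormalRing p) (Mero p) :=
  inferInstanceAs (IsFractionRing (FormalRing p) (FractionRing (FormalRing p)))
instance : Algebra A (Mero p) :=
  ((algebraMap (FormalRing p) (Mero p)).comp (algebraMap A (FormalRing p))).toAlgebra
instance : Algebra ℂ (Mero p) :=
  ((algebraMap (FormalRing p) (Mero p)).comp (algebraMap ℂ (FormalRing p))).toAlgebra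
instance : IsScalarTower A (FormalRing p) (Mero p) := IsScalarTower.of_algebraMap_eq fun _ => rfl
instance : IsScalarTower ℂ (FormalRing p) (Mero p) := IsScalarTower.of_algebraMap_eq fun _ => rfl
instance : IsScalarTower ℂ A (Mero p) := IsScalarTower.of_algebraMap_eq fun z => by
  rw [IsScalarTower.algebraMap_apply A (FormalRing p) (Mero p),
    IsScalarTower.algebraMap_apply ℂ (FormalRing p) (Mero p)]
  rw [← IsScalarTower.algebraMap_apply ℂ A (FormalRing p)]
variable [IsNoetherianRing A]

theorem formal_nonZeroDivisor {a : A} (ha : a ∈ nonZeroDivisors A) :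
    algebraMap A (FormalRing p) a ∈ nonZeroDivisors (FormalRing p) := by
  have : Module.Flat A (FormalRing p) := AdicCompletion.flat_of_isNoetherian _
  have h1 : IsSMulRegular A a := by
    intro b b' h
    exact (mul_cancel_left_mem_nonZeroDivisors ha).1 h
  have h2 : IsSMulRegular (FormalRing p) a := h1.of_flat
  rw [mem_nonZeroDivisors_iff_left]
  intro f hf
  refine h2 ?_
  change a • f = a • (0 : FormalRing p)
  rw [Algebra.smul_def, hf, smul_zero]

variable {K : Type*} [Field K] [Algebra A K] [IsFractionRing A K]

theorem isUnit_of_nonZeroDivisor (a : nonZeroDivisors A) : IsUnit (algebraMap A (Mero p) a) := by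
  rw [IsScalarTower.algebraMap_apply A (FormalRing p) (Mero p)]
  exact IsLocalization.map_units (Mero p) (⟨_, formal_nonZeroDivisor p a.2⟩ :
    nonZeroDivisors (FormalRing p))

instance (priority := 100) : Algebra K (Mero p) :=
  (IsLocalization.lift (M := nonZeroDivisors A) (g := algebraMap A (Mero p))
    (isUnit_of_nonZeroDivisor p)).toAlgebra

instance : IsScalarTower A K (Mero p) := IsScalarTower.of_algebraMap_eq fun a =>
  (IsLocalization.lift_eq (isUnit_of_nonZeroDivisor p) a).symm

variable [Algebra ℂ K] [IsScalarTower ℂ A K]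

instance : IsScalarTower ℂ K (Mero p) := IsScalarTower.of_algebraMap_eq fun z => by
  rw [IsScalarTower.algebraMap_apply ℂ A K, ← IsScalarTower.algebraMap_apply A K (Mero p),
    ← IsScalarTower.algebraMap_apply ℂ A (Mero p)]

end Mero

end Mero

section MeroDerivations

variable {A B K k : Type*}
  [CommRing B] [IsDomain B] [Algebra ℂ B]
  [CommRing A] [IsDomain A] [Algebra ℂ A] [Algebra B A] [IsScalarTower ℂ B A]
  [Field k] [Algebra B k] [IsFractionRing B k] [Algebra ℂ k] [IsScalarTower ℂ B k]
  [Field K] [Algebra A K] [IsFractionRing A K] [Algebra ℂ K] [IsScalarTower ℂ A K]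
  [Algebra k K] [IsScalarTower ℂ k K] [Algebra B K] [IsScalarTower B k K]
  [IsScalarTower B A K] {n m : ℕ} [IsNoetherianRing A]

theorem mero_derivation_ext {p : Pt A} {M : Type*} [AddCommGroup M] [Module ℂ M]
    [Module (Mero p) M] [IsScalarTower ℂ (Mero p) M] {W : Derivation ℂ (Mero p) M}
    (h : ∀ f : FormalRing p, W (algebraMap _ _ f) = 0) : W = 0 := by
  have : Algebra.FormallyEtale (FormalRing p) (Mero p) :=
    Algebra.FormallyEtale.of_isLocalization (nonZeroDivisors (FormalRing p))
  exact derivation_eq_zero_of_formallyUnramified (S := FormalRing p) W h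

theorem Mero.injective (p : Pt A) : Function.Injective (algebraMap (FormalRing p) (Mero p)) :=
  IsFractionRing.injective _ _

theorem Mero.algebraMap_apply (p : Pt A) (a : A) : algebraMap A (Mero p) a =
    algebraMap (FormalRing p) (Mero p) (algebraMap A (FormalRing p) a) := rfl

variable (F : Frame A B K k n m)

namespace Frame

theorem isUnit_c (p : Pt A) : IsUnit (algebraMap A (Mero p) F.c) :=
  Mero.isUnit_of_nonZeroDivisor p ⟨F.c, mem_nonZeroDivisors_of_ne_zero F.c_ne⟩

theorem exists_dM (p : Pt A) (j : Fin n ⊕ Fin m) : ∃ d : Derivation ℂ (Mero p) (Mero p),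
    ∀ f : FormalRing p, algebraMap A (Mero p) F.c * d (algebraMap _ _ f) =
      algebraMap _ _ (extendDer p (F.D j) f) := by
  have : Algebra.FormallyEtale (FormalRing p) (Mero p) :=
    Algebra.FormallyEtale.of_isLocalization (nonZeroDivisors (FormalRing p))
  obtain ⟨u, hu⟩ := F.isUnit_c p
  obtain ⟨d, hd⟩ := exists_derivation_extension (T := Mero p)
    ((Algebra.linearMap (FormalRing p) (Mero p)).compDer (extendDer p (F.D j)))
  refine ⟨(↑u⁻¹ : Mero p) • d, fun f => ?_⟩
  rw [Derivation.smul_apply, hd, smul_eq_mul, ← mul_assoc, ← hu, Units.mul_inv, one_mul]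
  rfl

/-- The coordinate vector fields acting on formal meromorphic functions. -/
def dM (p : Pt A) (j : Fin n ⊕ Fin m) : Derivation ℂ (Mero p) (Mero p) :=
  (F.exists_dM p j).choose

theorem dM_formal (p : Pt A) (j : Fin n ⊕ Fin m) (f : FormalRing p) :
    algebraMap A (Mero p) F.c * F.dM p j (algebraMap _ _ f) =
      algebraMap _ _ (extendDer p (F.D j) f) := (F.exists_dM p j).choose_spec f

theorem dM_algebraMap (p : Pt A) (j : Fin n ⊕ Fin m) (a : A) :
    F.dM p j (algebraMap A (Mero p) a) = algebraMap K (Mero p) (F.δ j (algebraMap A K a)) := by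
  apply (F.isUnit_c p).mul_left_cancel
  rw [Mero.algebraMap_apply p a, F.dM_formal, extendDer_algebraMap, ← Mero.algebraMap_apply,
    IsScalarTower.algebraMap_apply A K (Mero p), F.D_spec, map_mul,
    ← IsScalarTower.algebraMap_apply A K (Mero p)]

theorem derivation_ext_of_algebraMap {M : Type*} [AddCommGroup M] [Module ℂ M] [Module K M]
    [IsScalarTower ℂ K M] {W W' : Derivation ℂ K M}
    (h : ∀ a, W (algebraMap A K a) = W' (algebraMap A K a)) : W = W' := by
  rw [← sub_eq_zero]
  have : Algebra.FormallyEtale A K := Algebra.FormallyEtale.of_isLocalization (nonZeroDivisors A)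
  exact derivation_eq_zero_of_formallyUnramified (S := A) _ fun a => by
    rw [Derivation.sub_apply, h, sub_self]

theorem dM_K (p : Pt A) (j : Fin n ⊕ Fin m) (z : K) :
    F.dM p j (algebraMap K (Mero p) z) = algebraMap K (Mero p) (F.δ j z) := by
  have h : (F.dM p j).compAlgebraMap K = (Algebra.linearMap K (Mero p)).compDer (F.δ j) := by
    refine derivation_ext_of_algebraMap (A := A) fun a => ?_
    change F.dM p j (algebraMap K (Mero p) (algebraMap A K a)) = algebraMap K (Mero p) _
    rw [← IsScalarTower.algebraMap_apply A K (Mero p), F.dM_algebraMap]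
    rfl
  exact DFunLike.congr_fun h z

theorem dM_comm (p : Pt A) : CommutingDers (F.dM p) := by
  intro i j f
  set cM := algebraMap A (Mero p) F.c with hcM
  have h1 : ∀ i j (f : FormalRing p), cM * cM * cM * F.dM p i (F.dM p j (algebraMap _ _ f)) =
      algebraMap _ _ (algebraMap A (FormalRing p) F.c * extendDer p (F.D i) (extendDer p (F.D j) f)
        - algebraMap A (FormalRing p) (F.D i F.c) * extendDer p (F.D j) f) := by
    intro i j f
    have e2 := F.dM_formal p i (algebraMap A _ F.c)
    rw [← Mero.algebraMap_apply, extendDer_algebraMap] at e2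
    have e3 := F.dM_formal p i (extendDer p (F.D j) f)
    have e4 := F.dM_formal p j f
    rw [map_sub, map_mul, map_mul, ← e3, ← e2, ← e4, ← Mero.algebraMap_apply, ← hcM]
    rw [Derivation.leibniz, smul_eq_mul, smul_eq_mul]
    ring
  let E : FormalVF p := algebraMap A (FormalRing p) F.c • ⁅extendDer p (F.D i), extendDer p (F.D j)⁆
    - algebraMap A (FormalRing p) (F.D i F.c) • extendDer p (F.D j)
    + algebraMap A (FormalRing p) (F.D j F.c) • extendDer p (F.D i)
  have h2 : ∀ f : FormalRing p, algebraMap _ (Mero p) (E f) =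
      cM * cM * cM * (⁅F.dM p i, F.dM p j⁆ (algebraMap _ _ f)) := by
    intro f
    rw [Derivation.commutator_apply, mul_sub, h1, h1, ← map_sub]
    congr 1
    simp only [E, Derivation.add_apply, Derivation.sub_apply, Derivation.smul_apply, smul_eq_mul,
      Derivation.commutator_apply]
    ring
  have h3 : E = 0 := formalVF_ext fun a => by
    apply Mero.injective p
    rw [h2, ← Mero.algebraMap_apply, Derivation.commutator_apply, F.dM_algebraMap, F.dM_algebraMap,
      F.dM_K, F.dM_K, F.comm, sub_self, mul_zero, Derivation.zero_apply, map_zero]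
  have h4 : ⁅F.dM p i, F.dM p j⁆ = 0 := by
    refine mero_derivation_ext fun f => ?_
    have h5 := h2 f
    rw [h3, Derivation.zero_apply, map_zero] at h5
    have h6 : IsUnit (cM * cM * cM) := ((F.isUnit_c p).mul (F.isUnit_c p)).mul (F.isUnit_c p)
    exact h6.mul_left_cancel (h5.symm.trans (mul_zero _).symm)
  have := DFunLike.congr_fun h4 f
  rwa [Derivation.commutator_apply, Derivation.zero_apply, sub_eq_zero] at this

/-- The action of a formal vector field in coordinates. -/
theorem formal_apply {p : Pt A} (X : FormalVF p) (f : FormalRing p) :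
    algebraMap _ (Mero p) (X f) =
      ∑ j, algebraMap _ (Mero p) (X (algebraMap A _ (F.x j))) * F.dM p j (algebraMap _ _ f) := by
  apply (F.isUnit_c p).mul_left_cancel
  have := congrArg (algebraMap _ (Mero p)) (DFunLike.congr_fun (F.euler_formal X) f)
  rw [Derivation.smul_apply, derivation_sum_apply, smul_eq_mul, map_mul, map_sum] at this
  rw [Mero.algebraMap_apply, this, Finset.mul_sum]
  refine Finset.sum_congr rfl fun j _ => ?_
  rw [Derivation.smul_apply, smul_eq_mul, map_mul, ← F.dM_formal, Mero.algebraMap_apply]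
  ring

/-- The components of a vertical formal vector field. -/
def comps {p : Pt A} (X : FormalVF p) : Fin m → Mero p :=
  fun l => algebraMap _ (Mero p) (X (algebraMap A _ (F.y l)))

theorem vertical_apply {p : Pt A} {X : FormalVF p} (hX : IsVertical B X) (f : FormalRing p) :
    algebraMap _ (Mero p) (X f) = ∑ l, F.comps X l * F.dM p (Sum.inr l) (algebraMap _ _ f) := by
  rw [F.formal_apply, Fintype.sum_sum_type, Finset.sum_eq_zero, zero_add]
  · rfl
  · intro i _
    rw [x_inl, hX, map_zero, zero_mul]

/-- The value of an operator on a vertical formal vector field. -/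
def ev {p : Pt A} (X : FormalVF p) : Op (Fin n) m K →ₗ[K] Mero p :=
  opEval (F.dM_comm p) (F.comps X)

theorem ev_dmul {p : Pt A} (X : FormalVF p) (j : Fin n ⊕ Fin m) (θ : Op (Fin n) m K) :
    F.ev X (dmul F.δ j θ) = F.dM p j (F.ev X θ) :=
  opEval_dmul (F.dM_comm p) (F.dM_K p) _ j θ

/-- The operators vanishing on a set of formal vector fields. -/
def annOp (L : Set (Jet A)) : Submodule K (Op (Fin n) m K) where
  carrier := {θ | ∀ x ∈ L, F.ev x.2 θ = 0}
  add_mem' := fun h h' x hx => by rw [map_add, h x hx, h' x hx, add_zero]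
  zero_mem' := fun x _ => map_zero _
  smul_mem' := fun c θ h x hx => by rw [map_smul, h x hx, smul_zero]

theorem mem_annOp {L : Set (Jet A)} {θ : Op (Fin n) m K} :
    θ ∈ F.annOp L ↔ ∀ x ∈ L, F.ev x.2 θ = 0 := Iff.rfl

theorem dStable_annOp (L : Set (Jet A)) : DStable F.δ (F.annOp L) := fun j θ hθ x hx => by
  rw [F.ev_dmul, hθ x hx, map_zero]

/-- The coordinate expression of a regular differential operator on vertical vector fields. -/
theorem exists_op_of_diffOp (d : ℕ) : ∀ θ ∈ diffOp A d, ∃ θ' : Op (Fin n) m K,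
    ∀ (p : Pt A) (X : FormalVF p), IsVertical B X →
      algebraMap _ (Mero p) (θ p X) = F.ev X θ' := by
  let P : Submodule A (FormalOp A) :=
    { carrier := {θ | ∃ θ' : Op (Fin n) m K, ∀ (p : Pt A) (X : FormalVF p), IsVertical B X →
        algebraMap _ (Mero p) (θ p X) = F.ev X θ'}
      add_mem' := by
        rintro θ₁ θ₂ ⟨θ₁', h₁⟩ ⟨θ₂', h₂⟩
        refine ⟨θ₁' + θ₂', fun p X hX => ?_⟩
        rw [map_add, ← h₁ p X hX, ← h₂ p X hX, ← map_add]
        rfl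
      zero_mem' := ⟨0, fun p X _ => by rw [map_zero]; exact map_zero _⟩
      smul_mem' := by
        rintro a θ ⟨θ', h⟩
        refine ⟨algebraMap A K a • θ', fun p X hX => ?_⟩
        rw [map_smul, ← h p X hX, Algebra.smul_def,
          ← IsScalarTower.algebraMap_apply A K (Mero p), Mero.algebraMap_apply, ← map_mul,
          ← Algebra.smul_def]
        rfl }
  suffices h : diffOp A d ≤ P from fun θ hθ => h hθ
  induction d with
  | zero =>
    refine Submodule.span_le.2 ?_
    rintro _ ⟨a, rfl⟩
    refine ⟨∑ l, Finsupp.single (l, 0) (F.δ (Sum.inr l) (algebraMap A K a)), fun p X hX => ?_⟩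
    rw [map_sum]
    change algebraMap _ (Mero p) (X (algebraMap A _ a)) = _
    rw [F.vertical_apply hX]
    refine Finset.sum_congr rfl fun l _ => ?_
    rw [ev, opEval_single, tcoef_zero, Algebra.smul_def, ← Mero.algebraMap_apply, F.dM_algebraMap,
      mul_comm]
  | succ d ih =>
    refine sup_le ih (Submodule.span_le.2 ?_)
    rintro _ ⟨D, θ, hθ, rfl⟩
    obtain ⟨θ', h⟩ := ih hθ
    refine ⟨∑ j, algebraMap A K (D (F.x j)) • dmul F.δ j θ', fun p X hX => ?_⟩
    change algebraMap _ (Mero p) (extendDer p D (θ p X)) = _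
    rw [F.formal_apply, h p X hX, map_sum]
    refine Finset.sum_congr rfl fun j _ => ?_
    rw [map_smul, F.ev_dmul, extendDer_algebraMap, Algebra.smul_def,
      ← IsScalarTower.algebraMap_apply A K (Mero p), Mero.algebraMap_apply]

end Frame

end MeroDerivations

section Values

variable {A B K k : Type*}
  [CommRing B] [IsDomain B] [Algebra ℂ B]
  [CommRing A] [IsDomain A] [Algebra ℂ A] [Algebra B A] [IsScalarTower ℂ B A]
  [Field k] [Algebra B k] [IsFractionRing B k] [Algebra ℂ k] [IsScalarTower ℂ B k]
  [Field K] [Algebra A K] [IsFractionRing A K] [Algebra ℂ K] [IsScalarTower ℂ A K]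
  [Algebra k K] [IsScalarTower ℂ k K] [Algebra B K] [IsScalarTower B k K]
  [IsScalarTower B A K] {n m : ℕ} [IsNoetherianRing A]

/-- The formal meromorphic function `r` is regular with value `v` at the base point. -/
def MVal (q : Pt A) (r : Mero q) (v : ℂ) : Prop :=
  ∃ u : FormalRing q, algebraMap _ (Mero q) u = r ∧ evalAt q u = v

theorem MVal.unique {q : Pt A} {r : Mero q} {v w : ℂ} (h : MVal q r v) (h' : MVal q r w) :
    v = w := by
  obtain ⟨u, hu, rfl⟩ := h
  obtain ⟨u', hu', rfl⟩ := h'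
  rw [Mero.injective q (hu.trans hu'.symm)]

theorem MVal.zero (q : Pt A) : MVal q 0 0 := ⟨0, map_zero _, map_zero _⟩

theorem MVal.add {q : Pt A} {r r' : Mero q} {v v' : ℂ} (h : MVal q r v) (h' : MVal q r' v') :
    MVal q (r + r') (v + v') := by
  obtain ⟨u, rfl, rfl⟩ := h
  obtain ⟨u', rfl, rfl⟩ := h'
  exact ⟨u + u', map_add _ _ _, map_add _ _ _⟩

theorem MVal.mul {q : Pt A} {r r' : Mero q} {v v' : ℂ} (h : MVal q r v) (h' : MVal q r' v') :
    MVal q (r * r') (v * v') := by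
  obtain ⟨u, rfl, rfl⟩ := h
  obtain ⟨u', rfl, rfl⟩ := h'
  exact ⟨u * u', map_mul _ _ _, map_mul _ _ _⟩

theorem MVal.formal (q : Pt A) (u : FormalRing q) : MVal q (algebraMap _ _ u) (evalAt q u) :=
  ⟨u, rfl, rfl⟩

theorem MVal.regular (q : Pt A) (a : A) : MVal q (algebraMap A (Mero q) a) (q a) :=
  ⟨algebraMap A _ a, rfl, evalAt_algebraMap q a⟩

theorem MVal.of_mul {q : Pt A} {z : K} {a b : A} (hb : q b ≠ 0)
    (h : z * algebraMap A K b = algebraMap A K a) :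
    MVal q (algebraMap K (Mero q) z) (q a / q b) := by
  have hu : IsUnit (algebraMap A (FormalRing q) b) :=
    isUnit_of_evalAt_ne_zero (by rwa [evalAt_algebraMap])
  obtain ⟨u, hu⟩ := hu
  refine ⟨algebraMap A _ a * ↑u⁻¹, ?_, ?_⟩
  · have h1 := congrArg (algebraMap K (Mero q)) h
    rw [map_mul, ← IsScalarTower.algebraMap_apply A K (Mero q),
      ← IsScalarTower.algebraMap_apply A K (Mero q)] at h1
    rw [map_mul, ← Mero.algebraMap_apply, ← h1, mul_assoc, Mero.algebraMap_apply, ← map_mul, ← hu,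
      Units.mul_inv, map_one, mul_one]
  · rw [map_mul, evalAt_algebraMap, eq_div_iff hb, mul_assoc, ← evalAt_algebraMap q b, ← map_mul,
      ← hu, Units.inv_mul, map_one, mul_one]

variable (A) in
/-- Countably many rational functions are regular, and nonzero if they are not identically zero,
at all points outside of a countable union of proper closed subsets. -/
theorem exists_regular_values {T : Set K} (hT : T.Countable) : ∃ T' : Set A, T'.Countable ∧
    (0 : A) ∉ T' ∧ ∀ q : Pt A, (∀ t ∈ T', q t ≠ 0) → ∀ z ∈ T,
      ∃ v, MVal q (algebraMap K (Mero q) z) v ∧ (z ≠ 0 → v ≠ 0) := by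
  have h : ∀ z : K, ∃ a b : A, b ≠ 0 ∧ z * algebraMap A K b = algebraMap A K a := by
    intro z
    obtain ⟨⟨a, b⟩, h⟩ := IsLocalization.surj (nonZeroDivisors A) z
    exact ⟨a, b, nonZeroDivisors.coe_ne_zero b, h⟩
  choose num den hden hnd using h
  refine ⟨den '' T ∪ (num '' T) \ {0}, (hT.image _).union ((hT.image _).mono Set.sdiff_subset),
    ?_, fun q hq z hz => ?_⟩
  · rintro (⟨z, _, h⟩ | ⟨_, h⟩)
    · exact hden z h
    · exact h rfl
  · have h1 := hq _ (Or.inl ⟨z, hz, rfl⟩)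
    refine ⟨_, MVal.of_mul h1 (hnd z), fun hz0 => div_ne_zero (hq _ (Or.inr ⟨⟨z, hz, rfl⟩, ?_⟩)) h1⟩
    intro h
    have h2 := hnd z
    rw [Set.mem_singleton_iff.1 h, map_zero, mul_eq_zero] at h2
    rcases h2 with h2 | h2
    · exact hz0 h2
    · exact hden z (IsFractionRing.injective A K (h2.trans (map_zero _).symm))

variable (K) in
/-- Pairs of a rational and of a formal meromorphic function which are regular with the same value
at the base point. -/
def sameVal (q : Pt A) : Subalgebra ℂ (K × Mero q) where
  carrier := {z | ∃ v, MVal q (algebraMap K (Mero q) z.1) v ∧ MVal q z.2 v}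
  mul_mem' := by
    rintro a b ⟨v, h1, h2⟩ ⟨w, h3, h4⟩
    exact ⟨v * w, by rw [Prod.fst_mul, map_mul]; exact h1.mul h3, h2.mul h4⟩
  add_mem' := by
    rintro a b ⟨v, h1, h2⟩ ⟨w, h3, h4⟩
    exact ⟨v + w, by rw [Prod.fst_add, map_add]; exact h1.add h3, h2.add h4⟩
  algebraMap_mem' z := ⟨z, ⟨algebraMap ℂ _ z,
    by rw [← IsScalarTower.algebraMap_apply ℂ, Prod.algebraMap_apply,
      ← IsScalarTower.algebraMap_apply ℂ], (evalAt q).commutes z⟩,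
    ⟨algebraMap ℂ _ z, by rw [← IsScalarTower.algebraMap_apply ℂ, Prod.algebraMap_apply],
      (evalAt q).commutes z⟩⟩

variable (F : Frame A B K k n m)

namespace Frame

theorem exists_dF {q : Pt A} (hq : q F.c ≠ 0) (j : Fin n ⊕ Fin m) : ∃ d : FormalVF q,
    (∀ f, algebraMap _ (Mero q) (d f) = F.dM q j (algebraMap _ _ f)) ∧
    ∀ f, algebraMap A (FormalRing q) F.c * d f = extendDer q (F.D j) f := by
  obtain ⟨u, hu⟩ := isUnit_of_evalAt_ne_zero (p := q) (f := algebraMap A (FormalRing q) F.c)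
    (by rwa [evalAt_algebraMap])
  have key : ∀ f, algebraMap A (FormalRing q) F.c *
      (((↑u⁻¹ : FormalRing q) • extendDer q (F.D j)) f) = extendDer q (F.D j) f := fun f => by
    rw [Derivation.smul_apply, smul_eq_mul, ← mul_assoc, ← hu, Units.mul_inv, one_mul]
  refine ⟨(↑u⁻¹ : FormalRing q) • extendDer q (F.D j), fun f => ?_, key⟩
  apply (F.isUnit_c q).mul_left_cancel
  rw [F.dM_formal, Mero.algebraMap_apply, ← map_mul, key]

/-- The coordinate vector fields acting on formal functions, at a point where the coordinates
are étale. -/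
def dF {q : Pt A} (hq : q F.c ≠ 0) (j : Fin n ⊕ Fin m) : FormalVF q := (F.exists_dF hq j).choose

variable {q : Pt A} (hq : q F.c ≠ 0)

theorem dF_spec (j : Fin n ⊕ Fin m) (f : FormalRing q) :
    algebraMap _ (Mero q) (F.dF hq j f) = F.dM q j (algebraMap _ _ f) :=
  (F.exists_dF hq j).choose_spec.1 f

theorem c_mul_dF (j : Fin n ⊕ Fin m) (f : FormalRing q) :
    algebraMap A (FormalRing q) F.c * F.dF hq j f = extendDer q (F.D j) f :=
  (F.exists_dF hq j).choose_spec.2 f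

theorem dF_comm : CommutingDers (F.dF hq) := fun i j f => by
  apply Mero.injective q
  rw [F.dF_spec, F.dF_spec, F.dF_spec, F.dF_spec, F.dM_comm]

theorem dF_x (i j : Fin n ⊕ Fin m) :
    F.dF hq i (algebraMap A _ (F.x j)) = if i = j then 1 else 0 := by
  apply Mero.injective q
  rw [F.dF_spec, ← Mero.algebraMap_apply, F.dM_algebraMap, F.dual_x]
  split_ifs <;> simp

theorem dF_vertical (l : Fin m) : IsVertical B (F.dF hq (Sum.inr l)) := fun b => by
  apply Mero.injective q
  rw [F.dF_spec, ← Mero.algebraMap_apply, F.dM_algebraMap, ← IsScalarTower.algebraMap_apply,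
    IsScalarTower.algebraMap_apply B k K, F.const_der, map_zero, map_zero]

theorem tcoef_dF (α : Expo (Fin n) m) (f : FormalRing q) :
    algebraMap _ (Mero q) (tcoef (F.dF_comm hq) α f) = tcoef (F.dM_comm q) α (algebraMap _ _ f) :=
  tcoef_natural (F.dF_comm hq) (F.dM_comm q)
    (IsScalarTower.toAlgHom ℂ (FormalRing q) (Mero q)).toLinearMap (fun j f => F.dF_spec hq j f) α f

theorem tcoef_mem_pow (α : Expo (Fin n) m) : ∀ (i : ℕ) (f : FormalRing q),
    f ∈ formalMax q ^ (α.degree + i) → tcoef (F.dF_comm hq) α f ∈ formalMax q ^ i := by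
  induction α using expo_induction with
  | h0 => intro i f hf; simpa using hf
  | hs β j ih =>
    intro i f hf
    rw [tcoef_add_unitE, Algebra.smul_def]
    refine Ideal.mul_mem_left _ _ (ih i _ (derivation_mem_formalMax_pow _ ?_))
    convert hf using 2
    rw [map_add, Finsupp.degree_single]
    ring

/-- The Taylor series of a formal function at the base point. -/
def taylorAt : FormalRing q →+* MvPowerSeries (Fin n ⊕ Fin m) ℂ :=
  (MvPowerSeries.map (evalAt q).toRingHom).comp (taylorHom (F.dF_comm hq)).toRingHom

theorem coeff_taylorAt (α : Expo (Fin n) m) (f : FormalRing q) :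
    MvPowerSeries.coeff α (F.taylorAt hq f) = evalAt q (tcoef (F.dF_comm hq) α f) := rfl

theorem taylorAt_algebraMap (z : ℂ) :
    F.taylorAt hq (algebraMap ℂ _ z) = MvPowerSeries.C z := by
  classical
  ext α
  have h1 := congrArg (MvPowerSeries.coeff α) (map_one (F.taylorAt hq))
  rw [coeff_taylorAt, MvPowerSeries.coeff_one] at h1
  rw [coeff_taylorAt, Algebra.algebraMap_eq_smul_one, map_smul, map_smul, h1,
    MvPowerSeries.coeff_C, smul_eq_mul, mul_ite, mul_one, mul_zero]

theorem taylorAt_x (j : Fin n ⊕ Fin m) :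
    F.taylorAt hq (algebraMap A _ (F.x j - algebraMap ℂ A (q (F.x j)))) = MvPowerSeries.X j := by
  classical
  ext α
  rw [coeff_taylorAt, MvPowerSeries.coeff_X]
  induction α using expo_induction with
  | h0 =>
    rw [tcoef_zero, evalAt_algebraMap, map_sub, AlgHom.commutes, if_neg]
    · exact sub_self _
    · intro h
      simpa using DFunLike.congr_fun h j
  | hs β i _ =>
    rw [tcoef_add_unitE, map_sub, ← IsScalarTower.algebraMap_apply ℂ A (FormalRing q), map_sub,
      Derivation.map_algebraMap, sub_zero, F.dF_x]
    by_cases hij : i = j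
    · subst hij
      have h1 := congrArg (MvPowerSeries.coeff β) (map_one (F.taylorAt hq))
      rw [coeff_taylorAt, MvPowerSeries.coeff_one] at h1
      rw [if_pos rfl, map_smul, h1]
      by_cases hβ : β = 0
      · subst hβ; simp
      · have : ¬ β + unitE i = unitE i := fun h => hβ (by simpa using h)
        simp [hβ, this]
    · rw [if_neg hij, map_zero, smul_zero, map_zero, if_neg]
      intro h
      have := DFunLike.congr_fun h i
      simp [Finsupp.single_apply, Ne.symm hij] at this

theorem exists_formal_of_taylor (v : Expo (Fin n) m → ℂ) : ∃ f : FormalRing q,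
    ∀ α, evalAt q (tcoef (F.dF_comm hq) α f) = v α := by
  classical
  let t : Fin n ⊕ Fin m → FormalRing q :=
    fun j => algebraMap A _ (F.x j - algebraMap ℂ A (q (F.x j)))
  have ht : ∀ j, t j ∈ formalMax q := fun j => algebraMap_mem_formalMax (by
    rw [map_sub, AlgHom.commutes]; exact sub_self _)
  let E : ℕ → Finset (Expo (Fin n) m) := fun i =>
    (Finset.range i).biUnion fun d => Finset.finsuppAntidiag Finset.univ d
  have hE : ∀ i α, α ∈ E i ↔ α.degree < i := by
    intro i α
    simp [E, Finset.mem_finsuppAntidiag, Finsupp.degree_eq_sum]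
  let mon : Expo (Fin n) m → FormalRing q := fun α =>
    algebraMap ℂ _ (v α) * ∏ j, t j ^ α j
  have hmon : ∀ α, mon α ∈ formalMax q ^ α.degree := by
    intro α
    refine Ideal.mul_mem_left _ _ ?_
    rw [Finsupp.degree_eq_sum, ← Finset.prod_pow_eq_pow_sum]
    exact Ideal.prod_mem_prod fun j _ => Ideal.pow_mem_pow (ht j) _
  let s : ℕ → FormalRing q := fun i => ∑ α ∈ E i, mon α
  have hc : IsAdicComplete (formalMax q) (FormalRing q) :=
    AdicCompletion.isAdicComplete_self _ (IsNoetherian.noetherian _)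
  have hs : ∀ {i j}, i ≤ j →
      s i ≡ s j [SMOD (formalMax q ^ i • ⊤ : Submodule (FormalRing q) (FormalRing q))] := by
    intro i j hij
    have hsub : E i ⊆ E j := fun α hα => (hE j α).2 (((hE i α).1 hα).trans_le hij)
    rw [SModEq.comm, SModEq.sub_mem, smul_eq_mul, Ideal.mul_top]
    change (∑ α ∈ E j, mon α) - ∑ α ∈ E i, mon α ∈ _
    rw [← Finset.sum_sdiff hsub, add_sub_cancel_right]
    refine Ideal.sum_mem _ fun α hα => Ideal.pow_le_pow_right ?_ (hmon α)
    have := (Finset.mem_sdiff.1 hα).2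
    rw [hE] at this
    omega
  obtain ⟨f, hf⟩ := hc.prec' s hs
  refine ⟨f, fun α => ?_⟩
  have h1 : f - s (α.degree + 1) ∈ formalMax q ^ (α.degree + 1) := by
    have := (hf (α.degree + 1)).symm
    rwa [SModEq.sub_mem, smul_eq_mul, Ideal.mul_top] at this
  have h2 := F.tcoef_mem_pow hq α 1 _ h1
  rw [pow_one, mem_formalMax_iff, map_sub, map_sub, sub_eq_zero] at h2
  have key : ∀ β, F.taylorAt hq (mon β) = MvPowerSeries.monomial β (v β) := fun β => by
    rw [map_mul, taylorAt_algebraMap, map_prod, MvPowerSeries.monomial_eq',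
      Finsupp.prod_fintype _ _ (by simp)]
    congr 1
    exact Finset.prod_congr rfl fun j _ => by rw [map_pow, taylorAt_x]
  rw [h2, ← coeff_taylorAt, map_sum, map_sum, Finset.sum_eq_single α]
  · rw [key, MvPowerSeries.coeff_monomial_same]
  · intro β _ hβ
    rw [key, MvPowerSeries.coeff_monomial_ne hβ.symm]
  · intro h
    exact absurd ((hE _ _).2 (Nat.lt_succ_self _)) h

/-- Vertical formal vector fields with prescribed components. -/
theorem exists_vertical (hq : q F.c ≠ 0) (f : Fin m → FormalRing q) : ∃ Z : FormalVF q, IsVertical B Z ∧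
    ∀ l, Z (algebraMap A _ (F.y l)) = f l := by
  refine ⟨∑ l, f l • F.dF hq (Sum.inr l), fun b => ?_, fun l => ?_⟩
  · rw [derivation_sum_apply]
    refine Finset.sum_eq_zero fun l _ => ?_
    rw [Derivation.smul_apply, F.dF_vertical hq l b, smul_zero]
  · rw [derivation_sum_apply]
    have : ∀ i, (f i • F.dF hq (Sum.inr i)) (algebraMap A _ (F.y l)) =
        if i = l then f i else 0 := fun i => by
      rw [Derivation.smul_apply, ← x_inr, F.dF_x]
      simp only [Sum.inr.injEq, smul_eq_mul, mul_ite, mul_one, mul_zero]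
    simp only [this, Finset.sum_ite_eq', Finset.mem_univ, if_true]

/-- The formal vector field `Z` is a specialization of the formal vector field `X` at the generic
point. -/
def Matches (X : Fin m → MvPowerSeries (Fin n ⊕ Fin m) K) (Z : FormalVF q) : Prop :=
  ∀ l α, (MvPowerSeries.coeff α (X l), tcoef (F.dM_comm q) α (F.comps Z l)) ∈ sameVal K q

theorem exists_matches (hq : q F.c ≠ 0) {X : Fin m → MvPowerSeries (Fin n ⊕ Fin m) K}
    (hX : ∀ l α, ∃ v, MVal q (algebraMap K (Mero q) (MvPowerSeries.coeff α (X l))) v) :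
    ∃ Z : FormalVF q, IsVertical B Z ∧ F.Matches X Z := by
  choose v hv using hX
  choose f hf using fun l => F.exists_formal_of_taylor hq (v l)
  obtain ⟨Z, hZ, hZy⟩ := F.exists_vertical hq f
  refine ⟨Z, hZ, fun l α => ⟨v l α, hv l α, ?_⟩⟩
  change MVal q (tcoef (F.dM_comm q) α (algebraMap _ _ (Z _))) _
  rw [hZy, ← F.tcoef_dF hq, ← hf l α]
  exact MVal.formal _ _

theorem Matches.pair_ev {X : Fin m → MvPowerSeries (Fin n ⊕ Fin m) K} {Z : FormalVF q}
    (h : F.Matches X Z) {θ : Op (Fin n) m K}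
    (hθ : ∀ p, ∃ v, MVal q (algebraMap K (Mero q) (θ p)) v) :
    (pair X θ, F.ev Z θ) ∈ sameVal K q := by
  have h1 : (pair X θ, F.ev Z θ) = ∑ p ∈ θ.support,
      ((θ p, algebraMap K (Mero q) (θ p)) : K × Mero q) *
        (MvPowerSeries.coeff p.2 (X p.1), tcoef (F.dM_comm q) p.2 (F.comps Z p.1)) := by
    rw [pair, ev, opEval, Finsupp.linearCombination_apply, Finsupp.linearCombination_apply,
      Finsupp.sum, Finsupp.sum]
    ext
    · simp [Prod.fst_sum]
    · simp [Prod.snd_sum, Algebra.smul_def]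
  rw [h1]
  refine sum_mem fun p _ => mul_mem ?_ (h p.1 p.2)
  obtain ⟨v, hv⟩ := hθ p
  exact ⟨v, hv, hv⟩

theorem comps_bracket {Z W : FormalVF q} (hZ : IsVertical B Z) (hW : IsVertical B W) (i : Fin m) :
    F.comps ⁅Z, W⁆ i = ∑ j, (F.comps Z j * F.dM q (Sum.inr j) (F.comps W i) -
      F.comps W j * F.dM q (Sum.inr j) (F.comps Z i)) := by
  rw [Finset.sum_sub_distrib]
  change algebraMap _ (Mero q) (⁅Z, W⁆ (algebraMap A _ (F.y i))) = _
  rw [Derivation.commutator_apply, map_sub, F.vertical_apply hZ (W _), F.vertical_apply hW (Z _)]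
  rfl

theorem Matches.bracket {X Y : Fin m → MvPowerSeries (Fin n ⊕ Fin m) K} {Z W : FormalVF q}
    (h : F.Matches X Z) (h' : F.Matches Y W) (hZ : IsVertical B Z) (hW : IsVertical B W) :
    F.Matches (vbracket X Y) ⁅Z, W⁆ := by
  let X' : Fin m → MvPowerSeries (Fin n ⊕ Fin m) (sameVal K q) := fun l α => ⟨_, h l α⟩
  let Y' : Fin m → MvPowerSeries (Fin n ⊕ Fin m) (sameVal K q) := fun l α => ⟨_, h' l α⟩
  let φ : sameVal K q →ₐ[ℂ] K := (AlgHom.fst ℂ K (Mero q)).comp (sameVal K q).val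
  let ψ : sameVal K q →ₐ[ℂ] Mero q := (AlgHom.snd ℂ K (Mero q)).comp (sameVal K q).val
  intro l α
  have h1 : vbracket X Y l = MvPowerSeries.map φ (vbracket X' Y' l) := by
    rw [map_vbracket]; rfl
  have h2 : taylor (F.dM_comm q) (F.comps ⁅Z, W⁆ l) = MvPowerSeries.map ψ (vbracket X' Y' l) := by
    rw [map_vbracket, F.comps_bracket hZ hW, taylor_vbracket]; rfl
  rw [h1, ← coeff_taylor, h2, MvPowerSeries.coeff_map, MvPowerSeries.coeff_map]
  exact (MvPowerSeries.coeff α (vbracket X' Y' l)).2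

end Frame

end Values

/-- A polynomial vanishing on all linear images of a family of vectors in `K` vanishes on its
linear images in all `K`-algebras. -/
theorem aeval_eq_zero_of_forall_dual {K V ι R : Type*} [Field K] [Infinite K] [AddCommGroup V]
    [Module K V] [CommRing R] [Algebra K R] (v : ι → V) {P : MvPolynomial ι K}
    (h : ∀ φ : V →ₗ[K] K, MvPolynomial.eval (φ ∘ v) P = 0) (e : V →ₗ[K] R) :
    MvPolynomial.aeval (e ∘ v) P = 0 := by
  let b := Module.Basis.ofVectorSpace K V
  let Q := MvPolynomial.aeval (fun i => (b.repr (v i)).sum fun j c =>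
    c • (MvPolynomial.X j : MvPolynomial (Module.Basis.ofVectorSpaceIndex K V) K)) P
  have key : ∀ {S : Type _} [CommRing S] [Algebra K S] (e : V →ₗ[K] S),
      MvPolynomial.aeval (e ∘ b) Q = MvPolynomial.aeval (e ∘ v) P := by
    intro S _ _ e
    rw [← AlgHom.comp_apply, MvPolynomial.comp_aeval]
    congr 2
    funext i
    simp only [Finsupp.sum, map_sum, map_smul, MvPolynomial.aeval_X, Function.comp_apply]
    conv_rhs => rw [← b.linearCombination_repr (v i), Finsupp.linearCombination_apply,
      Finsupp.sum, map_sum]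
    simp only [map_smul]
  have hQ : Q = 0 := by
    refine MvPolynomial.funext fun w => ?_
    have h1 := h (b.constr K w)
    rw [← MvPolynomial.coe_aeval_eq_eval] at h1 ⊢
    have h2 : (b.constr K w) ∘ b = w := funext fun j => by simp
    rw [map_zero, ← h1]
    conv_lhs => rw [← h2]
    exact key _
  have h3 : MvPolynomial.aeval (e ∘ b) Q = MvPolynomial.aeval (e ∘ v) P := by
    rw [← AlgHom.comp_apply, MvPolynomial.comp_aeval]
    congr 2
    funext i
    simp only [Finsupp.sum, map_sum, map_smul, MvPolynomial.aeval_X, Function.comp_apply]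
    conv_rhs => rw [← b.linearCombination_repr (v i), Finsupp.linearCombination_apply,
      Finsupp.sum, map_sum]
    simp only [map_smul]
  rw [← h3, hQ, map_zero]

section Closure

variable {A : Type*} [CommRing A] [Algebra ℂ A]

theorem jetFun_mono : Monotone (jetFun A) := monotone_nat_of_le_succ fun _ =>
  Algebra.adjoin_mono (Set.union_subset_union_right _ fun _ ⟨θ, hθ, h⟩ =>
    ⟨θ, Submodule.mem_sup_left hθ, h⟩)

theorem mem_of_forall_jetClosure {L : Set (Jet A)} (hL : @IsClosed (Jet A) (proTopology A) L)
    {x : Jet A} (hx : ∀ k, x ∈ jetClosure k L) : x ∈ L := by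
  by_contra h
  have h1 : Lᶜ ∈ @nhds (Jet A) (proTopology A) x :=
    @IsOpen.mem_nhds (Jet A) (proTopology A) x _ (@IsClosed.isOpen_compl _ (proTopology A) _ hL) h
  rw [nhds_iInf] at h1
  have hdir : Directed (· ≥ ·) fun k => @nhds (Jet A) (jetTopology A k) x := by
    refine directed_of_isDirected_le fun i j hij => nhds_mono ?_
    exact TopologicalSpace.generateFrom_anti fun U ⟨f, hf, hU⟩ => ⟨f, jetFun_mono hij hf, hU⟩
  obtain ⟨k, hk⟩ := (Filter.mem_iInf_of_directed hdir _).1 h1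
  let := jetTopology A k
  obtain ⟨y, h2, h3⟩ := mem_closure_iff_nhds.1 (hx k) _ hk
  exact h2 h3

theorem exists_jetFun_of_notMem {L : Set (Jet A)} {k : ℕ} {x : Jet A} (hx : x ∉ jetClosure k L) :
    ∃ f ∈ jetFun A k, (∀ y ∈ L, f y = 0) ∧ f x ≠ 0 := by
  let := jetTopology A k
  have hb := TopologicalSpace.isTopologicalBasis_of_subbasis_of_inter
    (t := jetTopology A k) (r := {U | ∃ f ∈ jetFun A k, U = {x | f x ≠ 0}}) rfl (by
      rintro _ ⟨f, hf, rfl⟩ _ ⟨g, hg, rfl⟩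
      refine ⟨f * g, mul_mem hf hg, ?_⟩
      ext y
      simp)
  have h1 : (closure L)ᶜ ∈ nhds x := isClosed_closure.isOpen_compl.mem_nhds hx
  obtain ⟨U, hU, hxU, hUL⟩ := hb.mem_nhds_iff.1 h1
  rcases hU with rfl | ⟨f, hf, rfl⟩
  · exact ⟨1, one_mem _, fun y hy => absurd (subset_closure hy) (hUL (Set.mem_univ y)), one_ne_zero⟩
  · refine ⟨f, hf, fun y hy => ?_, hxU⟩
    by_contra h
    exact hUL h (subset_closure hy)

end Closure

section Operators

variable {A B K k : Type*}
  [CommRing B] [IsDomain B] [Algebra ℂ B]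
  [CommRing A] [IsDomain A] [Algebra ℂ A] [Algebra B A] [IsScalarTower ℂ B A]
  [Field k] [Algebra B k] [IsFractionRing B k] [Algebra ℂ k] [IsScalarTower ℂ B k]
  [Field K] [Algebra A K] [IsFractionRing A K] [Algebra ℂ K] [IsScalarTower ℂ A K]
  [Algebra k K] [IsScalarTower ℂ k K] [Algebra B K] [IsScalarTower B k K]
  [IsScalarTower B A K] {n m : ℕ} [IsNoetherianRing A]
variable [Algebra.Smooth ℂ A] (F : Frame A B K k n m) {L : Set (Jet A)}

theorem eq_zero_of_annihilates (hL : IsDLieAlgebra L) {d : ℕ} {θ : FormalOp A}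
    (hθ : θ ∈ diffOp A d) (hann : Annihilates θ L) {x : Jet A} (hx : x ∈ L) : θ x.1 x.2 = 0 := by
  obtain ⟨ι, _, D, b, he⟩ := exists_finite_euler (A := A)
  refine eq_zero_of_iterated he (p := x.1) (by simp)
    (S := {f | ∃ d, ∃ θ ∈ diffOp A d, Annihilates θ L ∧ f = θ x.1 x.2}) ?_ ?_ _
    ⟨d, θ, hθ, hann, rfl⟩
  · rintro _ ⟨d, θ, _, h, rfl⟩
    exact h x hx
  · rintro _ ⟨d, θ, hθ, h, rfl⟩ j
    exact ⟨d + 1, derComp (D j) θ, Submodule.mem_sup_right (Submodule.subset_span ⟨_, _, hθ, rfl⟩),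
      hL.ann_stable d θ hθ h _, rfl⟩

namespace Frame

/-- Countably many equations describe `L` over the points outside of a countable union of proper
closed subsets. -/
theorem exists_equations (hL : IsDLieAlgebra L) (hyp1 : ∀ x ∈ L, IsVertical B x.2) :
    ∃ (T : Set A) (Θ : Set (Op (Fin n) m K)), T.Countable ∧ (0 : A) ∉ T ∧ Θ.Countable ∧
      Θ ⊆ F.annOp L ∧ ∀ q : Pt A, (∀ t ∈ T, q t ≠ 0) → ∀ Z : FormalVF q, IsVertical B Z →
        (∀ θ ∈ Θ, MVal q (F.ev Z θ) 0) → (⟨q, Z⟩ : Jet A) ∈ L := by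
  choose g hg r θ hθ hgθ using hL.bundle
  have h1 : ∀ k i, g k • θ k i ∈ diffOp A k := fun k i => Submodule.smul_mem _ _ (hθ k i)
  have hcouple : ∀ k i (p : Pt A) (X : FormalVF p),
      couple (g k • θ k i) p X = p (g k) * couple (θ k i) p X := fun k i p X => by
    change evalAt p (g k • θ k i p X) = _
    rw [Algebra.smul_def, map_mul, evalAt_algebraMap]
    rfl
  have h2 : ∀ k i, Annihilates (g k • θ k i) L := by
    intro k i x hx
    rw [hcouple]
    by_cases h : x.1 (g k) = 0
    · rw [h, zero_mul]
    · let := jetTopology A k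
      rw [((hgθ k x.1 h).2 x.2).1 (subset_closure hx) i, mul_zero]
  choose θ' hθ' using fun k i => F.exists_op_of_diffOp k _ (h1 k i)
  refine ⟨Set.range g, Set.range fun i : Σ k, Fin (r k) => θ' i.1 i.2, Set.countable_range _, ?_,
    Set.countable_range _, ?_, fun q hq Z hZ hval => ?_⟩
  · rintro ⟨k, hk⟩
    exact hg k hk
  · rintro _ ⟨⟨k, i⟩, rfl⟩ x hx
    rw [← hθ' k i x.1 x.2 (hyp1 x hx), eq_zero_of_annihilates hL (h1 k i) (h2 k i) hx, map_zero]
  · refine mem_of_forall_jetClosure hL.closed fun k => ?_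
    have hgk := hq _ ⟨k, rfl⟩
    refine ((hgθ k q hgk).2 Z).2 fun i => ?_
    have h3 := hval _ ⟨⟨k, i⟩, rfl⟩
    rw [← hθ' k i q Z hZ] at h3
    have h4 := h3.unique (MVal.formal q _)
    have h5 : couple (g k • θ k i) q Z = 0 := h4.symm
    rw [hcouple] at h5
    exact (mul_eq_zero.1 h5).resolve_left hgk

theorem Matches.ev_eq_zero {X : Fin m → MvPowerSeries (Fin n ⊕ Fin m) K} {q : Pt A}
    {Z : FormalVF q} (h : F.Matches X Z) {θ : Op (Fin n) m K} (h0 : pair X θ = 0)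
    (hθ : ∀ p, ∃ v, MVal q (algebraMap K (Mero q) (θ p)) v) : MVal q (F.ev Z θ) 0 := by
  obtain ⟨v, h1, h2⟩ := h.pair_ev F hθ
  dsimp only at h1 h2
  rw [h0, map_zero] at h1
  rwa [(MVal.zero q).unique h1]

/-- Formal vector fields at the generic point satisfying the equations of `L` specialize to
elements of `L`. -/
theorem exists_specialization (hL : IsDLieAlgebra L) (hyp1 : ∀ x ∈ L, IsVertical B x.2)
    {X : Fin m → MvPowerSeries (Fin n ⊕ Fin m) K} (hX : X ∈ perp (F.annOp L)) :
    ∃ T : Set A, T.Countable ∧ (0 : A) ∉ T ∧ ∀ q : Pt A, (∀ t ∈ T, q t ≠ 0) →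
      ∃ Z : FormalVF q, (⟨q, Z⟩ : Jet A) ∈ L ∧ F.Matches X Z := by
  obtain ⟨T, Θ, hT, h0, hΘ, hΘL, hTL⟩ := F.exists_equations hL hyp1
  obtain ⟨T1, hT1, h01, h1⟩ := exists_regular_values A (Set.countable_range
    fun p : Fin m × Expo (Fin n) m => MvPowerSeries.coeff p.2 (X p.1))
  obtain ⟨T2, hT2, h02, h2⟩ := exists_regular_values A
    (hΘ.biUnion fun θ _ => Set.countable_range θ)
  refine ⟨insert F.c (T ∪ T1 ∪ T2), ((hT.union hT1).union hT2).insert _, ?_, fun q hq => ?_⟩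
  · rintro (h | (h | h) | h)
    exacts [F.c_ne h.symm, h0 h, h01 h, h02 h]
  · have hreg := h1 q fun t ht => hq t (Or.inr (Or.inl (Or.inr ht)))
    obtain ⟨Z, hZ, hXZ⟩ := F.exists_matches (hq _ (Or.inl rfl))
      (fun l α => (hreg _ ⟨(l, α), rfl⟩).imp fun _ h => h.1)
    refine ⟨Z, hTL q (fun t ht => hq t (Or.inr (Or.inl (Or.inl ht)))) Z hZ fun θ hθ => ?_, hXZ⟩
    refine hXZ.ev_eq_zero F (hX θ (hΘL hθ)) fun p => ?_
    exact (h2 q (fun t ht => hq t (Or.inr (Or.inr ht))) _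
      (Set.mem_biUnion hθ ⟨p, rfl⟩)).imp fun _ h => h.1

/-- The polynomial expression of functions on jet spaces. -/
theorem exists_polynomial {d : ℕ} {f : Jet A → ℂ} (hf : f ∈ jetFun A d) :
    ∃ (P : MvPolynomial (Fin m × Expo (Fin n) m) K) (u : ∀ x : Jet A, FormalRing x.1),
      (∀ x : Jet A, evalAt x.1 (u x) = f x) ∧ ∀ x : Jet A, IsVertical B x.2 →
        algebraMap _ (Mero x.1) (u x) =
          MvPolynomial.aeval (fun p => F.ev x.2 (Finsupp.single p 1)) P := by
  induction hf using Algebra.adjoin_induction with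
  | mem f hf =>
    rcases hf with ⟨a, rfl⟩ | ⟨θ, hθ, rfl⟩
    · exact ⟨MvPolynomial.C (algebraMap A K a), fun x => algebraMap A (FormalRing x.1) a,
        fun x => evalAt_algebraMap x.1 a, fun x _ => by rw [MvPolynomial.aeval_C, ← IsScalarTower.algebraMap_apply A K,
          Mero.algebraMap_apply]⟩
    · obtain ⟨θ', h⟩ := F.exists_op_of_diffOp d θ hθ
      refine ⟨θ'.sum fun p c => c • MvPolynomial.X p, fun x => θ x.1 x.2, fun _ => rfl,
        fun x hx => ?_⟩
      rw [h x.1 x.2 hx]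
      conv_lhs => rw [← Finsupp.sum_single θ']
      simp only [Finsupp.sum, map_sum, map_smul, MvPolynomial.aeval_X, ← map_smul (F.ev x.2),
        Finsupp.smul_single_one]
  | algebraMap r =>
    exact ⟨MvPolynomial.C (algebraMap ℂ K r), fun x => algebraMap ℂ (FormalRing x.1) r,
      fun x => (evalAt x.1).commutes r, fun x _ => by
        rw [MvPolynomial.aeval_C, ← IsScalarTower.algebraMap_apply ℂ K,
          ← IsScalarTower.algebraMap_apply ℂ]⟩
  | add f g _ _ hf hg =>
    obtain ⟨P, u, h1, h2⟩ := hf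
    obtain ⟨Q, w, h3, h4⟩ := hg
    exact ⟨P + Q, fun x => u x + w x, fun x => by rw [map_add, h1, h3]; rfl,
      fun x hx => by rw [map_add, map_add, h2 x hx, h4 x hx]⟩
  | mul f g _ _ hf hg =>
    obtain ⟨P, u, h1, h2⟩ := hf
    obtain ⟨Q, w, h3, h4⟩ := hg
    exact ⟨P * Q, fun x => u x * w x, fun x => by rw [map_mul, h1, h3]; rfl,
      fun x hx => by rw [map_mul, map_mul, h2 x hx, h4 x hx]⟩

theorem Matches.eval_aeval {X : Fin m → MvPowerSeries (Fin n ⊕ Fin m) K} {q : Pt A}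
    {Z : FormalVF q} (h : F.Matches X Z) {P : MvPolynomial (Fin m × Expo (Fin n) m) K}
    (hP : ∀ α, ∃ v, MVal q (algebraMap K (Mero q) (P.coeff α)) v) :
    (MvPolynomial.eval (fun p => pair X (Finsupp.single p 1)) P,
      MvPolynomial.aeval (fun p => F.ev Z (Finsupp.single p 1)) P) ∈ sameVal K q := by
  have h1 : (MvPolynomial.eval (fun p => pair X (Finsupp.single p 1)) P,
      MvPolynomial.aeval (fun p => F.ev Z (Finsupp.single p 1)) P) = ∑ α ∈ P.support,
      ((P.coeff α, algebraMap K (Mero q) (P.coeff α)) : K × Mero q) *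
        α.prod fun p e => (pair X (Finsupp.single p 1), F.ev Z (Finsupp.single p 1)) ^ e := by
    rw [MvPolynomial.eval_eq, MvPolynomial.aeval_def, MvPolynomial.eval₂_eq]
    simp only [Finsupp.prod]
    refine Prod.ext ?_ ?_
    · simp only [Prod.fst_sum, Prod.fst_mul, Prod.fst_prod, Prod.pow_fst]
    · simp only [Prod.snd_sum, Prod.snd_mul, Prod.snd_prod, Prod.pow_snd]
  rw [h1]
  refine sum_mem fun α _ => mul_mem ?_ (prod_mem fun p _ => pow_mem ?_ _)
  · obtain ⟨v, hv⟩ := hP α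
    exact ⟨v, hv, hv⟩
  · exact h.pair_ev F fun p' => by
      classical
      rw [Finsupp.single_apply]
      split_ifs
      · exact ⟨1, by rw [map_one]; simpa using MVal.regular q 1⟩
      · exact ⟨0, by rw [map_zero]; exact MVal.zero q⟩

/-- A formal vector field satisfying the equations of `L` belongs to `L`. -/
theorem mem_of_ev_eq_zero [Algebra.FiniteType ℂ A] (hL : IsDLieAlgebra L)
    (hyp1 : ∀ x ∈ L, IsVertical B x.2) {x : Jet A}
    (hx : IsVertical B x.2) (hev : ∀ θ ∈ F.annOp L, F.ev x.2 θ = 0) : x ∈ L := by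
  refine mem_of_forall_jetClosure hL.closed fun d => ?_
  by_contra h
  obtain ⟨f, hf, hfL, hfx⟩ := exists_jetFun_of_notMem h
  obtain ⟨P, u, hu, huP⟩ := F.exists_polynomial hf
  have key : ∀ φ : (Op (Fin n) m K ⧸ F.annOp L) →ₗ[K] K,
      MvPolynomial.eval (φ ∘ fun p => (F.annOp L).mkQ (Finsupp.single p 1)) P = 0 := by
    intro φ
    obtain ⟨X, hX⟩ := exists_pair_eq (φ ∘ₗ (F.annOp L).mkQ)
    have hXp : X ∈ perp (F.annOp L) := fun θ hθ => by
      rw [hX, LinearMap.comp_apply, Submodule.mkQ_apply, (Submodule.Quotient.mk_eq_zero _).2 hθ,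
        map_zero]
    have h1 : (φ ∘ fun p => (F.annOp L).mkQ (Finsupp.single p 1)) =
        fun p => pair X (Finsupp.single p 1) := funext fun p => by rw [hX]; rfl
    rw [h1]
    by_contra hne
    obtain ⟨T, hT, h0, hTL⟩ := F.exists_specialization hL hyp1 hXp
    obtain ⟨T1, hT1, h01, h2⟩ := exists_regular_values A (T := insert
      (MvPolynomial.eval (fun p => pair X (Finsupp.single p 1)) P)
      (insert 0 (P.coeff '' P.support))) (by
        exact ((P.support.countable_toSet.image _).insert _).insert _)
    obtain ⟨q, hq⟩ := exists_pt_ne_zero (hT.union hT1) (by rintro (h | h); exacts [h0 h, h01 h])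
    obtain ⟨Z, hZ, hXZ⟩ := hTL q fun t ht => hq t (Or.inl ht)
    have h2 := h2 q fun t ht => hq t (Or.inr ht)
    obtain ⟨v, h3, h4⟩ := hXZ.eval_aeval F (P := P) fun α => by
      by_cases hα : α ∈ P.support
      · exact (h2 _ (Or.inr (Or.inr ⟨α, hα, rfl⟩))).imp fun _ h => h.1
      · rw [MvPolynomial.notMem_support_iff.1 hα]
        exact (h2 _ (Or.inr (Or.inl rfl))).imp fun _ h => h.1
    obtain ⟨w, h5, h6⟩ := h2 _ (Or.inl rfl)
    rw [← huP ⟨q, Z⟩ (hyp1 _ hZ)] at h4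
    have h7 := h4.unique (MVal.formal q _)
    exact h6 hne ((h5.unique h3).trans (h7.trans ((hu ⟨q, Z⟩).trans (hfL _ hZ))))
  have : Infinite K := Infinite.of_injective _ (algebraMap ℂ K).injective
  have h3 := aeval_eq_zero_of_forall_dual _ key ((F.annOp L).liftQ (F.ev x.2) fun θ hθ => hev θ hθ)
  have h4 := huP x hx
  have h5 : MvPolynomial.aeval (fun p => F.ev x.2 (Finsupp.single p 1)) P = 0 := h3
  rw [h5] at h4
  have h6 : u x = 0 := Mero.injective x.1 (h4.trans (map_zero _).symm)
  rw [← hu, h6, map_zero] at hfx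
  exact hfx rfl

theorem bracketClosed_annOp [Algebra.FiniteType ℂ A] (hL : IsDLieAlgebra L)
    (hyp1 : ∀ x ∈ L, IsVertical B x.2) : BracketClosed (F.annOp L) := by
  intro X hX Y hY θ hθ
  by_contra hne
  obtain ⟨T1, hT1, h01, h1⟩ := F.exists_specialization hL hyp1 hX
  obtain ⟨T2, hT2, h02, h2⟩ := F.exists_specialization hL hyp1 hY
  obtain ⟨T3, hT3, h03, h3⟩ := hL.lie.exists_countable
  obtain ⟨T4, hT4, h04, h4⟩ := exists_regular_values A (T := insert (pair (vbracket X Y) θ)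
    (insert 0 (θ '' θ.support))) (by
      exact ((θ.support.countable_toSet.image _).insert _).insert _)
  obtain ⟨q, hq⟩ := exists_pt_ne_zero ((hT1.union hT2).union (hT3.union hT4)) (by
    rintro ((h | h) | (h | h))
    exacts [h01 h, h02 h, h03 h, h04 h])
  obtain ⟨Z, hZ, hXZ⟩ := h1 q fun t ht => hq t (Or.inl (Or.inl ht))
  obtain ⟨W, hW, hYW⟩ := h2 q fun t ht => hq t (Or.inl (Or.inr ht))
  have h5 := h3 q (fun t ht => hq t (Or.inr (Or.inl ht))) Z W hZ hW
  have h4 := h4 q fun t ht => hq t (Or.inr (Or.inr ht))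
  have hM := hXZ.bracket F hYW (hyp1 _ hZ) (hyp1 _ hW)
  obtain ⟨v, h6, h7⟩ := hM.pair_ev F (θ := θ) fun α => by
    by_cases hα : α ∈ θ.support
    · exact (h4 _ (Or.inr (Or.inr ⟨α, hα, rfl⟩))).imp fun _ h => h.1
    · rw [Finsupp.notMem_support_iff.1 hα]
      exact (h4 _ (Or.inr (Or.inl rfl))).imp fun _ h => h.1
  obtain ⟨w, h8, h9⟩ := h4 _ (Or.inl rfl)
  have h10 : F.ev ⁅Z, W⁆ θ = 0 := F.mem_annOp.1 hθ ⟨q, ⁅Z, W⁆⟩ h5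
  have h11 : MVal q (F.ev ⁅Z, W⁆ θ) v := h7
  rw [h10] at h11
  exact h9 hne ((MVal.unique h8 h6).trans (h11.unique (MVal.zero q)))

end Frame

end Operators

section Determinants

variable {R ι : Type*} [CommRing R] [Algebra ℂ R] [Fintype ι] [DecidableEq ι]

omit [Fintype ι] in
theorem derivation_prod (X : Derivation ℂ R R) (s : Finset ι) (f : ι → R) :
    X (∏ i ∈ s, f i) = ∑ i ∈ s, X (f i) * ∏ j ∈ s.erase i, f j := by
  induction s using Finset.induction_on with
  | empty => simp
  | insert a s ha ih =>
    rw [Finset.prod_insert ha, Finset.sum_insert ha, Derivation.leibniz, ih, smul_eq_mul,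
      smul_eq_mul, Finset.erase_insert ha, add_comm, mul_comm _ (X (f a)), Finset.mul_sum]
    congr 1
    refine Finset.sum_congr rfl fun i hi => ?_
    have hai : a ≠ i := fun h => ha (h ▸ hi)
    rw [Finset.erase_insert_of_ne hai, Finset.prod_insert (fun h => ha (Finset.mem_of_mem_erase h))]
    ring

theorem derivation_det (X : Derivation ℂ R R) (M : Matrix ι ι R) :
    X M.det = ∑ i, (M.updateRow i fun j => X (M i j)).det := by
  have h : ∀ M : Matrix ι ι R, M.det = ∑ σ : Equiv.Perm ι,
      ((Equiv.Perm.sign σ : ℤ) : R) * ∏ i, M i (σ i) := fun M => by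
    rw [← Matrix.det_transpose, Matrix.det_apply']
    rfl
  simp only [h]
  rw [map_sum, Finset.sum_comm]
  refine Finset.sum_congr rfl fun σ _ => ?_
  rw [Derivation.leibniz, Derivation.map_intCast, smul_zero, add_zero, smul_eq_mul,
    ← Finset.mul_sum, derivation_prod]
  congr 1
  refine Finset.sum_congr rfl fun i _ => ?_
  rw [← Finset.mul_prod_erase _ _ (Finset.mem_univ i), Matrix.updateRow_self]
  congr 1
  refine Finset.prod_congr rfl fun j hj => ?_
  rw [Matrix.updateRow_ne (Finset.ne_of_mem_erase hj)]

omit [Algebra ℂ R] in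
theorem sum_det_updateRow_mul (M J : Matrix ι ι R) :
    ∑ i, (M.updateRow i ((M * J) i)).det = M.det * J.trace := by
  have h : ∀ i, (M.updateRow i ((M * J) i)).det = ∑ j, M.adjugate j i * (M * J) i j := fun i => by
    rw [← Matrix.cramer_transpose_apply, Matrix.cramer_eq_adjugate_mulVec, Matrix.mulVec,
      dotProduct, ← Matrix.adjugate_transpose]
    rfl
  simp only [h]
  have h1 : (M.adjugate * (M * J)).trace = M.det * J.trace := by
    rw [← mul_assoc, Matrix.adjugate_mul, Matrix.smul_mul, one_mul, Matrix.trace_smul, smul_eq_mul]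
  rw [← h1, Matrix.trace, Finset.sum_comm]
  rfl

end Determinants

section Evaluation

variable {A : Type*} [CommRing A] [Algebra ℂ A] {m : ℕ} {R : Type*} [CommRing R] [Algebra ℂ R]
  [Algebra A R] [IsScalarTower ℂ A R]

/-- The value of an `m`-form on derivations with values in an algebra. -/
def evalDer (Y : Fin m → Derivation ℂ A R) : ⋀[A]^m Ω[A⁄ℂ] →ₗ[A] R :=
  exteriorPower.alternatingMapLinearEquiv
    { toMultilinearMap :=
        ((Matrix.detRowAlternating (n := Fin m) (R := R)).toMultilinearMap.restrictScalars
          A).compLinearMap (fun _ => LinearMap.pi fun i => (Y i).liftKaehlerDifferential)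
      map_eq_zero_of_eq' := fun v i j h hij => by
        exact (Matrix.detRowAlternating (n := Fin m) (R := R)).map_eq_zero_of_eq
          (fun k => LinearMap.pi (fun i => (Y i).liftKaehlerDifferential) (v k))
          (by simp only [h]) hij }

theorem evalDer_ιMulti (Y : Fin m → Derivation ℂ A R) (v : Fin m → Ω[A⁄ℂ]) :
    evalDer Y (exteriorPower.ιMulti A m v) =
      (Matrix.of fun k i => (Y i).liftKaehlerDifferential (v k)).det :=
  exteriorPower.alternatingMapLinearEquiv_apply_ιMulti _ _

theorem exteriorPower_induction {A' : Type*} [AddCommGroup A'] [Module A A']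
    {f g : ⋀[A]^m Ω[A⁄ℂ] →ₗ[A] A'}
    (h : ∀ v, f (exteriorPower.ιMulti A m v) = g (exteriorPower.ιMulti A m v)) : f = g :=
  exteriorPower.linearMap_ext (AlternatingMap.ext h)

theorem evalDer_map {R' : Type*} [CommRing R'] [Algebra ℂ R'] [Algebra A R'] [IsScalarTower ℂ A R']
    (φ : R →ₐ[A] R') (Y : Fin m → Derivation ℂ A R) (Y' : Fin m → Derivation ℂ A R')
    (h : ∀ i a, φ (Y i a) = Y' i a) (α : ⋀[A]^m Ω[A⁄ℂ]) :
    φ (evalDer Y α) = evalDer Y' α := by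
  refine DFunLike.congr_fun (exteriorPower_induction (f := φ.toLinearMap ∘ₗ evalDer Y) fun v => ?_) α
  have h1 : ∀ i, φ.toLinearMap ∘ₗ (Y i).liftKaehlerDifferential = (Y' i).liftKaehlerDifferential :=
    fun i => Derivation.liftKaehlerDifferential_unique _ _ (Derivation.ext fun a => by simp [h])
  rw [LinearMap.comp_apply, evalDer_ιMulti, evalDer_ιMulti, AlgHom.toLinearMap_apply,
    AlgHom.map_det]
  congr 1
  ext k i
  exact DFunLike.congr_fun (h1 i) (v k)

theorem evalDer_formMap {A' : Type*} [CommRing A'] [Algebra ℂ A'] [Algebra A A']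
    [IsScalarTower ℂ A A'] [Algebra A' R] [IsScalarTower A A' R] [IsScalarTower ℂ A' R]
    (Y : Fin m → Derivation ℂ A' R) (α : ⋀[A]^m Ω[A⁄ℂ]) :
    evalDer Y (formMap A A' m α) = evalDer (fun i => (Y i).compAlgebraMap A) α := by
  refine DFunLike.congr_fun (exteriorPower_induction
    (f := (evalDer Y).restrictScalars A ∘ₗ formMap A A' m) fun v => ?_) α
  have h1 : ∀ i, (Y i).liftKaehlerDifferential.restrictScalars A ∘ₗ
      KaehlerDifferential.map ℂ ℂ A A' = ((Y i).compAlgebraMap A).liftKaehlerDifferential :=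
    fun i => Derivation.liftKaehlerDifferential_unique _ _ (Derivation.ext fun a => by simp)
  have h2 : formMap A A' m (exteriorPower.ιMulti A m v) =
      exteriorPower.ιMulti A' m fun i => KaehlerDifferential.map ℂ ℂ A A' (v i) :=
    exteriorPower.alternatingMapLinearEquiv_apply_ιMulti _ _
  rw [LinearMap.comp_apply, h2, LinearMap.restrictScalars_apply, evalDer_ιMulti, evalDer_ιMulti]
  congr 1
  ext k i
  exact DFunLike.congr_fun (h1 i) (v k)

theorem evalDer_of_matrix {c : R} {M : Matrix (Fin m) (Fin m) R} {Y D : Fin m → Derivation ℂ A R}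
    (h : ∀ i a, c * Y i a = ∑ l, M i l * D l a) (α : ⋀[A]^m Ω[A⁄ℂ]) :
    c ^ m * evalDer Y α = M.det * evalDer D α := by
  refine DFunLike.congr_fun (exteriorPower_induction
    (f := (LinearMap.mulLeft A (c ^ m)) ∘ₗ evalDer Y)
    (g := (LinearMap.mulLeft A M.det) ∘ₗ evalDer D) fun v => ?_) α
  have h1 : ∀ i, LinearMap.mulLeft A c ∘ₗ (Y i).liftKaehlerDifferential =
      ∑ l, LinearMap.mulLeft A (M i l) ∘ₗ (D l).liftKaehlerDifferential := fun i => by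
    refine Derivation.liftKaehlerDifferential_unique _ _ (Derivation.ext fun a => ?_)
    simpa using h i a
  simp only [LinearMap.comp_apply, evalDer_ιMulti, LinearMap.mulLeft_apply]
  have h2 : c • Matrix.of (fun k i => (Y i).liftKaehlerDifferential (v k)) =
      Matrix.of (fun k i => (D i).liftKaehlerDifferential (v k)) * M.transpose := by
    ext k i
    have := DFunLike.congr_fun (h1 i) (v k)
    simpa [Matrix.mul_apply, mul_comm] using this
  have h3 := congrArg Matrix.det h2
  rw [Matrix.det_smul, Fintype.card_fin, Matrix.det_mul, Matrix.det_transpose] at h3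
  rw [h3, mul_comm]

end Evaluation

section Lie

variable {A K : Type*} [CommRing A] [IsDomain A] [Algebra ℂ A] [IsNoetherianRing A] [Field K]
  [Algebra A K] [IsFractionRing A K] [Algebra ℂ K] [IsScalarTower ℂ A K] {m : ℕ} {q : Pt A}

theorem exists_mero_derivation (X : FormalVF q) : ∃ W : Derivation ℂ (Mero q) (Mero q),
    ∀ f, W (algebraMap _ _ f) = algebraMap _ _ (X f) := by
  have : Algebra.FormallyEtale (FormalRing q) (Mero q) :=
    Algebra.FormallyEtale.of_isLocalization (nonZeroDivisors (FormalRing q))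
  obtain ⟨W, hW⟩ := exists_derivation_extension (S := FormalRing q) (T := Mero q)
    ((Algebra.linearMap (FormalRing q) (Mero q)).compDer X)
  exact ⟨W, hW⟩

/-- The infinitesimal invariance of a form of maximal degree under a vector field, in terms of the
divergence. -/
theorem lieVanishesOn_iff {T : Set (FormalVF q)} {y : Fin m → A}
    {d : Fin m → Derivation ℂ (Mero q) (Mero q)}
    (hT : ∀ Y ∈ T, ∀ f, algebraMap _ (Mero q) (Y f) =
      ∑ l, algebraMap _ (Mero q) (Y (algebraMap A _ (y l))) * d l (algebraMap _ _ f))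
    (hne : ∃ Y : Fin m → FormalVF q, (∀ i, Y i ∈ T) ∧
      IsUnit (Matrix.of fun i l => algebraMap _ (Mero q) (Y i (algebraMap A _ (y l)))).det)
    {X : FormalVF q} (hX : X ∈ T) (hbr : ∀ Y ∈ T, ⁅X, Y⁆ ∈ T) {ω : ⋀[K]^m Ω[K⁄ℂ]}
    (hω : ∃ g ∈ nonZeroDivisors A, ∃ α : ⋀[A]^m Ω[A⁄ℂ], algebraMap A K g • ω = formMap A K m α)
    {h : Mero q} (hh : h = evalDer (fun l => (d l).compAlgebraMap K) ω) :
    LieVanishesOn q X ω T ↔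
      ∑ l, d l (h * algebraMap _ (Mero q) (X (algebraMap A _ (y l)))) = 0 := by
  obtain ⟨W, hW⟩ := exists_mero_derivation X
  set x : Fin m → Mero q := fun l => algebraMap _ (Mero q) (X (algebraMap A _ (y l))) with hx
  let M : (Fin m → FormalVF q) → Matrix (Fin m) (Fin m) (Mero q) := fun Y =>
    Matrix.of fun i l => algebraMap _ (Mero q) (Y i (algebraMap A _ (y l)))
  have hd : ∀ i, (d i).compAlgebraMap A = ((d i).compAlgebraMap K).compAlgebraMap A := fun i =>
    Derivation.ext fun a => by
      simp only [Derivation.compAlgebraMap_apply]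
      rw [← IsScalarTower.algebraMap_apply A K (Mero q)]
  -- values of regular multiples of the form
  have key : ∀ (g : A) (α : ⋀[A]^m Ω[A⁄ℂ]), algebraMap A K g • ω = formMap A K m α →
      ∀ Y : Fin m → FormalVF q, (∀ i, Y i ∈ T) →
        algebraMap _ (Mero q) (evalForm q Y α) = algebraMap A (Mero q) g * ((M Y).det * h) := by
    intro g α hgα Y hY
    have h1 : algebraMap _ (Mero q) (evalForm q Y α) =
        evalDer (fun i => (Algebra.linearMap (FormalRing q) (Mero q)).compDer (Y i)
          |>.compAlgebraMap A) α :=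
      evalDer_map (IsScalarTower.toAlgHom A (FormalRing q) (Mero q)) _ _ (fun i a => rfl) α
    have h2 := evalDer_of_matrix (c := (1 : Mero q)) (M := M Y)
      (Y := fun i => (Algebra.linearMap (FormalRing q) (Mero q)).compDer (Y i)
          |>.compAlgebraMap A) (D := fun l => (d l).compAlgebraMap A)
      (fun i a => by rw [one_mul]; exact hT (Y i) (hY i) (algebraMap A _ a)) α
    rw [one_pow, one_mul] at h2
    rw [h1, h2, funext hd, ← evalDer_formMap, ← hgα, map_smul, ← hh, Algebra.smul_def,
      ← IsScalarTower.algebraMap_apply A K (Mero q)]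
    ring
  have hJ : ∀ Y : Fin m → FormalVF q, (∀ i, Y i ∈ T) →
      W ((M Y).det * h) - ∑ i, (M (Function.update Y i ⁅X, Y i⁆)).det * h =
        (M Y).det * ∑ l, d l (h * x l) := by
    intro Y hY
    have h1 : ∀ i, (M (Function.update Y i ⁅X, Y i⁆)) = (M Y).updateRow i
        ((fun l => W (M Y i l)) - (M Y * Matrix.of fun j l => d j (x l)) i) := by
      intro i
      ext i' l
      by_cases hi : i' = i
      · subst hi
        rw [Matrix.updateRow_self]
        simp only [M, Matrix.of_apply, Function.update_self, Pi.sub_apply, Matrix.mul_apply, hW]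
        rw [Derivation.commutator_apply, map_sub, hT (Y i') (hY i')]
      · rw [Matrix.updateRow_ne hi]
        simp only [M, Matrix.of_apply, Function.update_of_ne hi]
    have h2 : ∀ i, (M (Function.update Y i ⁅X, Y i⁆)).det =
        ((M Y).updateRow i (fun l => W (M Y i l))).det -
          ((M Y).updateRow i ((M Y * Matrix.of fun j l => d j (x l)) i)).det := by
      intro i
      rw [h1, sub_eq_add_neg, Matrix.det_updateRow_add, ← neg_one_smul (Mero q),
        Matrix.det_updateRow_smul, neg_one_mul, sub_eq_add_neg]
    have h3 : W h = ∑ l, x l * d l h := by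
      have h4 : W - ∑ l, x l • d l = 0 := mero_derivation_ext fun f => by
        rw [Derivation.sub_apply, derivation_sum_apply, hW, hT X hX f, sub_eq_zero]
        rfl
      rw [sub_eq_zero.1 h4, derivation_sum_apply]
      rfl
    rw [← Finset.sum_mul, Finset.sum_congr rfl fun i _ => h2 i, Finset.sum_sub_distrib,
      ← derivation_det, sum_det_updateRow_mul, Derivation.leibniz, h3, Matrix.trace]
    simp only [Derivation.leibniz, smul_eq_mul, Finset.sum_add_distrib, Matrix.diag_apply,
      Matrix.of_apply, ← Finset.mul_sum]
    ring
  have hfin : ∀ (g : A) (α : ⋀[A]^m Ω[A⁄ℂ]), algebraMap A K g • ω = formMap A K m α →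
      ∀ Y : Fin m → FormalVF q, (∀ i, Y i ∈ T) →
        algebraMap _ (Mero q) (algebraMap A (FormalRing q) g * lieDeriv q X α Y -
          X (algebraMap A (FormalRing q) g) * evalForm q Y α) =
          algebraMap A (Mero q) g ^ 2 * ((M Y).det * ∑ l, d l (h * x l)) := by
    intro g α hgα Y hY
    have hup : ∀ i i', Function.update Y i ⁅X, Y i⁆ i' ∈ T := fun i i' => by
      by_cases hi : i' = i
      · subst hi; rw [Function.update_self]; exact hbr _ (hY _)
      · rw [Function.update_of_ne hi]; exact hY _
    rw [lieDeriv, map_sub, map_mul, map_mul, map_sub, ← hW, ← hW, map_sum, key g α hgα Y hY,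
      Finset.sum_congr rfl fun i _ => key g α hgα _ (hup i), ← Finset.mul_sum, ← hJ Y hY,
      Derivation.leibniz, ← Mero.algebraMap_apply]
    simp only [smul_eq_mul]
    ring
  constructor
  · rintro ⟨g, hg, α, hgα, h1⟩
    obtain ⟨Y, hY, hu⟩ := hne
    have h2 := hfin g α hgα Y hY
    rw [h1 Y hY, sub_self, map_zero] at h2
    have hg' := Mero.isUnit_of_nonZeroDivisor q ⟨g, hg⟩
    exact (hu.mul_right_eq_zero).1 ((hg'.pow 2).mul_right_eq_zero.1 h2.symm)
  · rintro h1
    obtain ⟨g, hg, α, hgα⟩ := hω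
    refine ⟨g, hg, α, hgα, fun Y hY => ?_⟩
    have h2 := hfin g α hgα Y hY
    rw [h1, mul_zero, mul_zero] at h2
    exact sub_eq_zero.1 (Mero.injective q (h2.trans (map_zero _).symm))

end Lie

section Density

variable {A K R : Type*} [CommRing A] [Algebra ℂ A] [Field K] [Algebra A K] [Algebra ℂ K]
  [IsScalarTower ℂ A K] [CommRing R] [Algebra ℂ R] [Algebra K R] [IsScalarTower ℂ K R]
  [Algebra A R] [IsScalarTower A K R] [IsScalarTower ℂ A R] {m : ℕ}

theorem evalDer_mul_eq {d : Fin m → Derivation ℂ K R} {c : A} {D : Fin m → Derivation ℂ A A}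
    (hd : ∀ l a, algebraMap A R c * d l (algebraMap A K a) = algebraMap A R (D l a))
    {ω : ⋀[K]^m Ω[K⁄ℂ]} {g : A} {α : ⋀[A]^m Ω[A⁄ℂ]} (hg : algebraMap A K g • ω = formMap A K m α) :
    evalDer d ω * algebraMap A R (c ^ m * g) = algebraMap A R (evalDer D α) := by
  have h1 := congrArg (evalDer d) hg
  rw [evalDer_formMap, map_smul, Algebra.smul_def, ← IsScalarTower.algebraMap_apply] at h1
  have h2 := evalDer_of_matrix (c := algebraMap A R c) (M := 1)
    (Y := fun l => (d l).compAlgebraMap A)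
    (D := fun l => (Algebra.linearMap A R).compDer (D l)) (fun i a => by
      rw [Finset.sum_eq_single i (fun j _ hj => by rw [Matrix.one_apply_ne hj.symm, zero_mul])
        (fun h => absurd (Finset.mem_univ i) h), Matrix.one_apply_eq, one_mul]
      exact hd i a) α
  rw [Matrix.det_one, one_mul, ← h1] at h2
  rw [map_mul, map_pow, mul_comm, mul_assoc, h2]
  exact (evalDer_map (Algebra.ofId A R) D _ (fun _ _ => rfl) α).symm

/-- A form of maximal degree vanishes if it vanishes on a coordinate frame. -/
theorem eq_zero_of_evalDer {y : Fin m → K} {d : Fin m → Derivation ℂ K K}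
    (hdual : ∀ i j, d i (y j) = if i = j then 1 else 0)
    (hspan : ∀ z, KaehlerDifferential.D ℂ K z = ∑ l, d l z • KaehlerDifferential.D ℂ K (y l))
    {η : ⋀[K]^m Ω[K⁄ℂ]} (h : evalDer d η = 0) : η = 0 := by
  have hcoord : ∀ i j, (d i).liftKaehlerDifferential (KaehlerDifferential.D ℂ K (y j)) =
      if i = j then 1 else 0 := fun i j => by
    rw [Derivation.liftKaehlerDifferential_comp_D, hdual]
  have hli : LinearIndependent K fun l => KaehlerDifferential.D ℂ K (y l) := by
    rw [Fintype.linearIndependent_iff]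
    intro w hw i
    have := congrArg (d i).liftKaehlerDifferential hw
    simpa [hcoord] using this
  have hsp : ⊤ ≤ Submodule.span K (Set.range fun l => KaehlerDifferential.D ℂ K (y l)) := by
    rw [← KaehlerDifferential.span_range_derivation ℂ K, Submodule.span_le]
    rintro _ ⟨z, rfl⟩
    rw [SetLike.mem_coe, hspan]
    exact Submodule.sum_mem _ fun l _ => Submodule.smul_mem _ _ (Submodule.subset_span ⟨l, rfl⟩)
  let e := Module.Basis.mk hli hsp
  have he : ∀ i v, (d i).liftKaehlerDifferential v = e.repr v i := fun i v => by
    conv_lhs => rw [← e.sum_repr v]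
    simp [e, hcoord]
  rw [← Module.forall_dual_apply_eq_zero_iff K]
  intro φ
  have h1 : φ = φ (exteriorPower.ιMulti K m e) • evalDer d := exteriorPower_induction fun v => by
    have h2 := DFunLike.congr_fun
      (AlternatingMap.eq_smul_basis_det e (φ.compAlternatingMap (exteriorPower.ιMulti K m))) v
    rw [LinearMap.smul_apply, evalDer_ιMulti]
    refine h2.trans ?_
    rw [AlternatingMap.smul_apply, Module.Basis.det_apply, ← Matrix.det_transpose]
    have h3 : (e.toMatrix v).transpose =
        Matrix.of fun k i => (d i).liftKaehlerDifferential (v k) := by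
      ext k i
      exact (he i (v k)).symm
    rw [h3]
    rfl
  rw [h1, LinearMap.smul_apply, h, smul_zero]

end Density

section Fibres

variable {A B K k : Type*}
  [CommRing B] [IsDomain B] [Algebra ℂ B]
  [CommRing A] [IsDomain A] [Algebra ℂ A] [Algebra B A] [IsScalarTower ℂ B A]
  [Field k] [Algebra B k] [IsFractionRing B k] [Algebra ℂ k] [IsScalarTower ℂ B k]
  [Field K] [Algebra A K] [IsFractionRing A K] [Algebra ℂ K] [IsScalarTower ℂ A K]
  [Algebra k K] [IsScalarTower ℂ k K] [Algebra B K] [IsScalarTower B k K]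
  [IsScalarTower B A K] {n m : ℕ} [IsNoetherianRing A]
variable (F : Frame A B K k n m) {s : Pt B}

namespace Frame

variable (s) in
theorem exists_fibreD : ∃ D : Fin m → Derivation ℂ (FibreRing A s) (FibreRing A s),
    ∀ l a, D l (fibreIncl A s a) = fibreIncl A s (F.D (Sum.inr l) a) := by
  have h : ∀ l a, fibreIncl A s a = 0 → fibreIncl A s (F.D (Sum.inr l) a) = 0 := by
    intro l a ha
    have ha' : a ∈ (RingHom.ker s).map (algebraMap B A) := Ideal.Quotient.eq_zero_iff_mem.1 ha
    refine Ideal.Quotient.eq_zero_iff_mem.2 ?_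
    clear ha
    induction ha' using Submodule.span_induction with
    | mem a ha =>
      obtain ⟨b, _, rfl⟩ := ha
      rw [F.D_base]
      exact zero_mem _
    | zero => rw [map_zero]; exact zero_mem _
    | add a b ha hb h1 h2 =>
      rw [map_add]
      exact add_mem h1 h2
    | smul r a ha h1 =>
      rw [smul_eq_mul, Derivation.leibniz]
      exact add_mem (Ideal.mul_mem_left _ _ h1)
        (Ideal.mul_mem_right _ _ ha)
  exact ⟨fun l => Derivation.liftOfSurjective (Ideal.Quotient.mkₐ_surjective ℂ _) (h l),
    fun l a => Derivation.liftOfSurjective_apply _ _ _⟩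

variable (s) in
/-- The coordinate vector fields on the fibre. -/
def fibreD : Fin m → Derivation ℂ (FibreRing A s) (FibreRing A s) := (F.exists_fibreD s).choose

theorem fibreD_apply (l : Fin m) (a : A) :
    F.fibreD s l (fibreIncl A s a) = fibreIncl A s (F.D (Sum.inr l) a) :=
  (F.exists_fibreD s).choose_spec l a

omit [IsNoetherianRing A] in
theorem fibreIncl_base (b : B) :
    fibreIncl A s (algebraMap B A b) = algebraMap ℂ _ (s b) := by
  rw [← sub_eq_zero, ← (fibreIncl A s).commutes (s b)]
  rw [IsScalarTower.algebraMap_apply ℂ B A, ← map_sub, ← map_sub]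
  refine Ideal.Quotient.eq_zero_iff_mem.2 (Ideal.mem_map_of_mem _ ?_)
  rw [RingHom.mem_ker, map_sub, AlgHom.commutes]
  exact sub_self _

theorem euler_fibre (u : FibreRing A s) : fibreIncl A s F.c • KaehlerDifferential.D ℂ _ u =
    ∑ l, F.fibreD s l u • KaehlerDifferential.D ℂ _ (fibreIncl A s (F.y l)) := by
  obtain ⟨a, rfl⟩ := Ideal.Quotient.mkₐ_surjective ℂ _ u
  have h := congrArg (KaehlerDifferential.map ℂ ℂ A (FibreRing A s)) (F.euler_x a)
  have h1 : ∀ b a : A, KaehlerDifferential.map ℂ ℂ A (FibreRing A s)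
      (b • KaehlerDifferential.D ℂ A a) =
        b • KaehlerDifferential.D ℂ _ (algebraMap A (FibreRing A s) a) := fun b a => by
    rw [map_smul, KaehlerDifferential.map_D]
  rw [h1, map_sum, Finset.sum_congr rfl fun j _ => h1 _ _, Fintype.sum_sum_type,
    Finset.sum_eq_zero, zero_add] at h
  · refine (algebraMap_smul (FibreRing A s) F.c _).trans
      (h.trans (Finset.sum_congr rfl fun l _ => ?_))
    rw [F.fibreD_apply]
    exact (algebraMap_smul (FibreRing A s) _ _).symm
  · intro i _
    have : algebraMap A (FibreRing A s) (F.x (Sum.inl i)) = algebraMap ℂ _ (s (F.s i)) :=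
      fibreIncl_base (F.s i)
    rw [this, Derivation.map_algebraMap, smul_zero]

variable {q : Pt (FibreRing A s)}

theorem formalMap_extendDer (l : Fin m) (f : FormalRing (q.comp (fibreIncl A s))) :
    formalMap (fibreIncl A s) q (extendDer _ (F.D (Sum.inr l)) f) =
      extendDer q (F.fibreD s l) (formalMap (fibreIncl A s) q f) :=
  restrictsTo_of_algebraMap (fun a => by
    rw [extendDer_algebraMap, extendDer_algebraMap, formalMap_algebraMap, F.fibreD_apply]) f

theorem isUnit_fibre_c (hq : q (fibreIncl A s F.c) ≠ 0) :
    IsUnit (algebraMap (FibreRing A s) (FormalRing q) (fibreIncl A s F.c)) :=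
  isUnit_of_evalAt_ne_zero (by rwa [evalAt_algebraMap])

/-- Vertical formal vector fields restrict to the fibre. -/
theorem exists_restrictsTo (hq : q (fibreIncl A s F.c) ≠ 0)
    {X : FormalVF (q.comp (fibreIncl A s))} (hX : IsVertical B X) :
    ∃ Z : FormalVF q, RestrictsTo (fibreIncl A s) q X Z := by
  obtain ⟨u, hu⟩ := F.isUnit_fibre_c hq
  refine ⟨∑ l, ((↑u⁻¹ : FormalRing q) * formalMap (fibreIncl A s) q (X (algebraMap A _ (F.y l)))) •
    extendDer q (F.fibreD s l), restrictsTo_of_algebraMap fun a => ?_⟩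
  have h := congrArg (formalMap (fibreIncl A s) q)
    (DFunLike.congr_fun (F.euler_vertical hX) (algebraMap A _ a))
  rw [Derivation.smul_apply, derivation_sum_apply, smul_eq_mul, map_mul, map_sum,
    formalMap_algebraMap, ← hu] at h
  rw [derivation_sum_apply, ← u.inv_mul_cancel_left (formalMap _ q (X _)), h, Finset.mul_sum]
  refine Finset.sum_congr rfl fun l _ => ?_
  rw [Derivation.smul_apply, Derivation.smul_apply, smul_eq_mul, smul_eq_mul, map_mul, mul_assoc,
    formalMap_extendDer, formalMap_algebraMap]

/-- Formal functions vanishing on the fibre have no Taylor coefficients along the fibre. -/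
theorem evalAt_tcoef_of_formalMap (hq : (q.comp (fibreIncl A s)) F.c ≠ 0) {β : Expo (Fin n) m}
    (hβ : sdeg β = 0) : ∀ {f : FormalRing (q.comp (fibreIncl A s))},
      formalMap (fibreIncl A s) q f = 0 →
      evalAt _ (tcoef (F.dF_comm hq) β f) = 0 := by
  induction β using expo_induction with
  | h0 => intro f hf; rw [tcoef_zero, ← evalAt_formalMap, hf, map_zero]
  | hs β j ih =>
    intro f hf
    rcases j with i | l
    · simp at hβ
    · rw [tcoef_add_unitE, map_smul, ih (by simpa using hβ), smul_zero]
      refine (F.isUnit_fibre_c hq).mul_right_eq_zero.1 ?_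
      rw [← formalMap_algebraMap, ← map_mul, F.c_mul_dF, formalMap_extendDer, hf, map_zero]

variable (ω : ⋀[K]^m Ω[K⁄ℂ])

/-- The density of a form in the fibre coordinates. -/
def density : K := evalDer (fun l => F.δ (Sum.inr l)) ω

/-- The infinitesimal change of the density `a / b` under a formal vector field. -/
def lieFun {p : Pt A} (a b : A) (X : FormalVF p) : FormalRing p :=
  ∑ l, (algebraMap A _ b * extendDer p (F.D (Sum.inr l))
      (algebraMap A _ a * X (algebraMap A _ (F.y l))) -
    algebraMap A _ a * X (algebraMap A _ (F.y l)) * extendDer p (F.D (Sum.inr l)) (algebraMap A _ b))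

theorem derivation_quotient {R : Type*} [CommRing R] [Algebra ℂ R] (d : Derivation ℂ R R)
    {h a b : R} (hab : h * b = a) (x : R) :
    b * d (a * x) - a * x * d b = b ^ 2 * d (h * x) := by
  subst hab
  simp only [Derivation.leibniz, smul_eq_mul]
  ring

theorem algebraMap_lieFun {p : Pt A} {a b : A} (hab : F.density ω * algebraMap A K b =
    algebraMap A K a) (X : FormalVF p) : algebraMap _ (Mero p) (F.lieFun a b X) =
      algebraMap A (Mero p) (F.c * b ^ 2) * ∑ l, F.dM p (Sum.inr l)
        (algebraMap K (Mero p) (F.density ω) * F.comps X l) := by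
  have h1 : algebraMap K (Mero p) (F.density ω) * algebraMap A (Mero p) b =
      algebraMap A (Mero p) a := by
    have := congrArg (algebraMap K (Mero p)) hab
    rwa [map_mul, ← IsScalarTower.algebraMap_apply, ← IsScalarTower.algebraMap_apply] at this
  rw [lieFun, map_sum, Finset.mul_sum]
  refine Finset.sum_congr rfl fun l _ => ?_
  have h2 := derivation_quotient (F.dM p (Sum.inr l)) h1 (F.comps X l)
  rw [map_mul (algebraMap A (Mero p)) F.c, map_pow, mul_assoc (algebraMap A (Mero p) F.c), ← h2]
  simp only [map_sub (algebraMap (FormalRing p) (Mero p)),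
    map_mul (algebraMap (FormalRing p) (Mero p)), ← F.dM_formal, ← Mero.algebraMap_apply, comps]
  ring

end Frame

end Fibres

theorem Generically.and {B : Type*} [CommRing B] [Algebra ℂ B] {P Q : Pt B → Prop}
    (h : Generically B P) (h' : Generically B Q) : Generically B fun s => P s ∧ Q s := by
  obtain ⟨a, ha, hP⟩ := h
  obtain ⟨b, hb, hQ⟩ := h'
  refine ⟨fun i => if Even i then a (i / 2) else b (i / 2), fun i => ?_, fun p hp =>
    ⟨hP p fun i => ?_, hQ p fun i => ?_⟩⟩
  · dsimp only
    split_ifs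
    exacts [ha _, hb _]
  · simpa using hp (2 * i)
  · have h1 : ¬ Even (2 * i + 1) := by simp
    have h2 : (2 * i + 1) / 2 = i := by omega
    simpa [h1, h2] using hp (2 * i + 1)

section FibreForms

variable {A B K k : Type*}
  [CommRing B] [IsDomain B] [Algebra ℂ B]
  [CommRing A] [IsDomain A] [Algebra ℂ A] [Algebra B A] [IsScalarTower ℂ B A]
  [Field k] [Algebra B k] [IsFractionRing B k] [Algebra ℂ k] [IsScalarTower ℂ B k]
  [Field K] [Algebra A K] [IsFractionRing A K] [Algebra ℂ K] [IsScalarTower ℂ A K]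
  [Algebra k K] [IsScalarTower ℂ k K] [Algebra B K] [IsScalarTower B k K]
  [IsScalarTower B A K] {n m : ℕ} [IsNoetherianRing A]
variable (F : Frame A B K k n m) {s : Pt B}

namespace Frame

theorem D_y (i j : Fin m) : F.D (Sum.inr i) (F.y j) = if i = j then F.c else 0 := by
  apply IsFractionRing.injective A K
  rw [F.D_spec, ← x_inr, F.dual_x]
  simp only [Sum.inr.injEq]
  split_ifs <;> simp

theorem fibreD_y (i j : Fin m) :
    F.fibreD s i (fibreIncl A s (F.y j)) = if i = j then fibreIncl A s F.c else 0 := by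
  rw [fibreD_apply, D_y]
  split_ifs <;> simp

theorem evalDer_fibreD_ne_zero [IsDomain (FibreRing A s)] (hc : fibreIncl A s F.c ≠ 0)
    {η : ⋀[FractionRing (FibreRing A s)]^m Ω[FractionRing (FibreRing A s)⁄ℂ]} (hη : η ≠ 0)
    {g : FibreRing A s} {α : ⋀[FibreRing A s]^m Ω[FibreRing A s⁄ℂ]} (hg : g ≠ 0)
    (hgα : algebraMap _ (FractionRing (FibreRing A s)) g • η = formMap _ _ m α) :
    evalDer (F.fibreD s) α ≠ 0 := by
  let K' := FractionRing (FibreRing A s)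
  let c : K' := algebraMap _ K' (fibreIncl A s F.c)
  have hc' : c ≠ 0 := fun h => hc (IsFractionRing.injective (FibreRing A s) K' (h.trans
    (map_zero _).symm))
  have : Algebra.FormallyEtale (FibreRing A s) K' :=
    Algebra.FormallyEtale.of_isLocalization (nonZeroDivisors (FibreRing A s))
  have hex : ∀ l, ∃ d : Derivation ℂ K' K', ∀ u, c * d (algebraMap _ K' u) =
      algebraMap _ K' (F.fibreD s l u) := fun l => by
    obtain ⟨d, hd⟩ := exists_derivation_extension (S := FibreRing A s) (T := K')
      (((LinearMap.mulLeft (FibreRing A s) c⁻¹) ∘ₗ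
        (Algebra.linearMap (FibreRing A s) K')).compDer (F.fibreD s l))
    refine ⟨d, fun u => ?_⟩
    rw [hd]
    exact mul_inv_cancel_left₀ hc' _
  choose d hd using hex
  have h1 := evalDer_mul_eq (R := K') (d := d) (c := fibreIncl A s F.c) (D := F.fibreD s) hd hgα
  intro h0
  rw [h0, map_zero, mul_eq_zero] at h1
  rcases h1 with h1 | h1
  · refine hη (eq_zero_of_evalDer (y := fun l => algebraMap _ K' (fibreIncl A s (F.y l)))
      (fun i j => ?_) (fun z => ?_) h1)
    · apply mul_left_cancel₀ hc'
      rw [hd, F.fibreD_y]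
      split_ifs
      · rw [mul_one]
      · rw [mul_zero, map_zero]
    · have h2 : KaehlerDifferential.D ℂ K' = ∑ l, (LinearMap.toSpanSingleton K' Ω[K'⁄ℂ]
          (KaehlerDifferential.D ℂ K' (algebraMap _ K' (fibreIncl A s (F.y l))))).compDer (d l) := by
        refine derivation_ext_of_algebraMap (A := FibreRing A s) fun u => ?_
        have h3 := derivation_euler F.euler_fibre
          ((KaehlerDifferential.D ℂ K').compAlgebraMap (FibreRing A s)) u
        rw [derivation_sum_apply, ← sub_eq_zero, ← smul_eq_zero_iff_right hc', smul_sub, sub_eq_zero,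
          Finset.smul_sum]
        refine (algebraMap_smul K' _ _).trans (h3.trans (Finset.sum_congr rfl fun l _ => ?_))
        change _ = c • (d l (algebraMap (FibreRing A s) K' u) • KaehlerDifferential.D ℂ K'
          (algebraMap _ K' (fibreIncl A s (F.y l))))
        rw [smul_smul, hd, algebraMap_smul]
        rfl
      conv_lhs => rw [h2]
      rw [derivation_sum_apply]
      rfl
  · have h2 := IsFractionRing.injective (FibreRing A s) K' (h1.trans (map_zero _).symm)
    exact (mul_ne_zero (pow_ne_zero _ hc) hg) h2

theorem lieVanishesOn_fibre_iff [IsDomain (FibreRing A s)]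
    {η : ⋀[FractionRing (FibreRing A s)]^m Ω[FractionRing (FibreRing A s)⁄ℂ]}
    {g a b : A} {α : ⋀[FibreRing A s]^m Ω[FibreRing A s⁄ℂ]} (hg : fibreIncl A s g ≠ 0)
    (hgα : algebraMap _ (FractionRing (FibreRing A s)) (fibreIncl A s g) • η = formMap _ _ m α)
    (ha : fibreIncl A s a = evalDer (F.fibreD s) α) (hb : b = F.c ^ m * g)
    {q : Pt (FibreRing A s)} (hq : q (fibreIncl A s F.c) ≠ 0)
    {X : FormalVF (q.comp (fibreIncl A s))} {Z : FormalVF q} (hZ : RestrictsTo _ q X Z) :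
    LieVanishesOn q Z η Set.univ ↔ formalMap (fibreIncl A s) q (F.lieFun a b X) = 0 := by
  obtain ⟨u, hu⟩ := F.isUnit_fibre_c hq
  let e : Fin m → FormalVF q := fun l => (↑u⁻¹ : FormalRing q) • extendDer q (F.fibreD s l)
  have he : ∀ l f, (u : FormalRing q) * e l f = extendDer q (F.fibreD s l) f := fun l f =>
    u.mul_inv_cancel_left _
  choose d hd using fun l => exists_mero_derivation (e l)
  let C : Mero q := algebraMap (FibreRing A s) (Mero q) (fibreIncl A s F.c)
  have hC : C = algebraMap _ (Mero q) (u : FormalRing q) := by rw [hu]; rfl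
  have hCd : ∀ l f, C * d l (algebraMap _ _ f) = algebraMap _ _ (extendDer q (F.fibreD s l) f) :=
    fun l f => by rw [hC, hd, ← map_mul, he]
  have hT : ∀ Y : FormalVF q, Y = ∑ l, Y (algebraMap _ _ (fibreIncl A s (F.y l))) • e l := by
    intro Y
    refine formalVF_ext fun v => u.isUnit.mul_left_cancel ?_
    have h1 := derivation_euler F.euler_fibre (Y.compAlgebraMap (FibreRing A s)) v
    rw [derivation_sum_apply, Finset.mul_sum, hu]
    refine (Algebra.smul_def _ _).symm.trans (h1.trans (Finset.sum_congr rfl fun l _ => ?_))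
    rw [Algebra.smul_def, Derivation.smul_apply, smul_eq_mul, mul_left_comm, ← hu, he,
      extendDer_algebraMap, mul_comm]
    rfl
  obtain ⟨h, hh⟩ : ∃ h : Mero q,
    h = evalDer (fun l => (d l).compAlgebraMap (FractionRing (FibreRing A s))) η := ⟨_, rfl⟩
  have hiff := lieVanishesOn_iff (K := FractionRing (FibreRing A s)) (T := Set.univ)
    (y := fun l => fibreIncl A s (F.y l)) (d := d) (fun Y _ f => by
      conv_lhs => rw [hT Y, derivation_sum_apply, map_sum]
      refine Finset.sum_congr rfl fun l _ => ?_
      rw [Derivation.smul_apply, smul_eq_mul, map_mul, hd])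
    ⟨e, fun _ => Set.mem_univ _, by
      have h1 : ∀ i l, e i (algebraMap _ _ (fibreIncl A s (F.y l))) = if i = l then 1 else 0 := by
        intro i l
        apply u.isUnit.mul_left_cancel
        rw [he, extendDer_algebraMap, F.fibreD_y]
        split_ifs
        · rw [mul_one, hu]
        · rw [mul_zero, map_zero]
      have h2 : (Matrix.of fun i l => algebraMap _ (Mero q)
          (e i (algebraMap _ _ (fibreIncl A s (F.y l))))) = 1 := by
        ext i l
        rw [Matrix.of_apply, Matrix.one_apply, h1]
        split_ifs
        · exact map_one _
        · exact map_zero _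
      rw [h2, Matrix.det_one]
      exact isUnit_one⟩
    (Set.mem_univ Z) (fun _ _ => Set.mem_univ _)
    ⟨_, mem_nonZeroDivisors_of_ne_zero hg, α, hgα⟩ hh
  rw [hiff]
  have hdC : ∀ l v, algebraMap (FibreRing A s) (Mero q) (fibreIncl A s F.c) *
      (d l).compAlgebraMap (FractionRing (FibreRing A s)) (algebraMap _ _ v) =
        algebraMap (FibreRing A s) (Mero q) (F.fibreD s l v) := fun l v => by
    have h4 := hCd l (algebraMap _ _ v)
    rw [extendDer_algebraMap] at h4
    rw [Derivation.compAlgebraMap_apply, ← IsScalarTower.algebraMap_apply]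
    exact h4
  have h1 : h * algebraMap (FibreRing A s) (Mero q) (fibreIncl A s b) =
      algebraMap (FibreRing A s) (Mero q) (fibreIncl A s a) := by
    have h4 := evalDer_mul_eq hdC hgα
    rw [hh, ha, hb, map_mul, map_pow]
    exact h4
  have h2 : algebraMap _ (Mero q) (formalMap (fibreIncl A s) q (F.lieFun a b X)) =
      C * algebraMap (FibreRing A s) (Mero q) (fibreIncl A s b) ^ 2 *
        ∑ l, d l (h * algebraMap _ (Mero q) (Z (algebraMap _ _ (fibreIncl A s (F.y l))))) := by
    rw [lieFun, map_sum, map_sum, Finset.mul_sum]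
    refine Finset.sum_congr rfl fun l _ => ?_
    rw [mul_assoc C, ← derivation_quotient (d l) h1, ← formalMap_algebraMap, ← hZ]
    simp only [map_sub (formalMap (fibreIncl A s) q), map_mul (formalMap (fibreIncl A s) q),
      formalMap_extendDer, formalMap_algebraMap, map_sub (algebraMap (FormalRing q) (Mero q)),
      map_mul (algebraMap (FormalRing q) (Mero q)), ← hCd, ← Mero.algebraMap_apply]
    ring
  have hbne : fibreIncl A s b ≠ 0 := by
    rw [hb, map_mul, map_pow]
    refine mul_ne_zero (pow_ne_zero _ fun h => hq ?_) hg
    rw [h, map_zero]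
  have hub := Mero.isUnit_of_nonZeroDivisor q ⟨_, mem_nonZeroDivisors_of_ne_zero hbne⟩
  have huC : IsUnit C := hC ▸ u.isUnit.map _
  constructor
  · intro h3
    rw [h3, mul_zero] at h2
    exact Mero.injective q (h2.trans (map_zero _).symm)
  · intro h3
    rw [h3, map_zero] at h2
    exact ((huC.mul (hub.pow 2)).mul_right_eq_zero).1 h2.symm

/-- There are sufficiently general points at which the membership in the restriction of `L` to the
fibre is the vanishing of the divergence. -/
def HasGoodPoints (L : Set (Jet A)) (ω : ⋀[K]^m Ω[K⁄ℂ]) : Prop :=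
  ∀ T : Set A, T.Countable → (0 : A) ∉ T → ∃ (s : Pt B) (q : Pt (FibreRing A s)) (a b : A),
    (∀ t ∈ T, (q.comp (fibreIncl A s)) t ≠ 0) ∧ (q.comp (fibreIncl A s)) F.c ≠ 0 ∧
    (q.comp (fibreIncl A s)) a ≠ 0 ∧ (q.comp (fibreIncl A s)) b ≠ 0 ∧
    F.density ω * algebraMap A K b = algebraMap A K a ∧
    (∃ (g : A) (α : ⋀[A]^m Ω[A⁄ℂ]), g ≠ 0 ∧ algebraMap A K g • ω = formMap A K m α) ∧
    ∀ X : FormalVF (q.comp (fibreIncl A s)), ∀ Z : FormalVF q, RestrictsTo _ q X Z →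
      ((⟨q, Z⟩ : Jet (FibreRing A s)) ∈ restrictFibre L s ↔
        formalMap (fibreIncl A s) q (F.lieFun a b X) = 0)

theorem hasGoodPoints [Algebra.FiniteType ℂ A] {L : Set (Jet A)} {ω : ⋀[K]^m Ω[K⁄ℂ]}
    (hfib : Generically B fun s => IsDomain (FibreRing A s))
    (hyp2 : Generically B fun s =>
      ∃ η : ⋀[FractionRing (FibreRing A s)]^m Ω[FractionRing (FibreRing A s)⁄ℂ],
        FormRestrictsTo (A := A) (FibreRing A s) (FractionRing (FibreRing A s)) ω η ∧ η ≠ 0 ∧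
        ∃ g : FibreRing A s, g ≠ 0 ∧ ∀ q : Pt (FibreRing A s), q g ≠ 0 →
          ∀ Z : FormalVF q, (⟨q, Z⟩ : Jet (FibreRing A s)) ∈ restrictFibre L s ↔
            LieVanishesOn q Z η Set.univ) : F.HasGoodPoints L ω := by
  intro T hT h0
  obtain ⟨s, ⟨hs, η, ⟨g, α, hg, hgω, hgη⟩, hη, f, hf, hfZ⟩, hsT⟩ := exists_generic_fibre
    F.injective_base (hfib.and hyp2) (hT.insert F.c) (by
      rintro (h | h)
      exacts [F.c_ne h.symm, h0 h])
  have hc := hsT _ (Or.inl rfl)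
  have hg' : fibreIncl A s g ≠ 0 := nonZeroDivisors.ne_zero hg
  let a : A := evalDer (fun l => F.D (Sum.inr l)) α
  have ha : fibreIncl A s a = evalDer (F.fibreD s) (formMap A (FibreRing A s) m α) := by
    rw [evalDer_formMap]
    exact evalDer_map (Algebra.ofId A (FibreRing A s)) _ _ (fun i v => (F.fibreD_apply i v).symm) α
  have ha0 : fibreIncl A s a ≠ 0 := by
    rw [ha]
    exact F.evalDer_fibreD_ne_zero hc hη hg' hgη
  have hb0 : fibreIncl A s (F.c ^ m * g) ≠ 0 := by
    rw [map_mul, map_pow]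
    exact mul_ne_zero (pow_ne_zero _ hc) hg'
  obtain ⟨q, hq⟩ := exists_pt_ne_zero (A := FibreRing A s)
    (T := {fibreIncl A s F.c, fibreIncl A s a, fibreIncl A s (F.c ^ m * g), f} ∪ fibreIncl A s '' T)
    ((Set.toFinite _).countable.union (hT.image _)) (by
      rintro ((h | h | h | h) | ⟨t, ht, h⟩)
      exacts [hc h.symm, ha0 h.symm, hb0 h.symm, hf h.symm, hsT _ (Or.inr ht) h])
  refine ⟨s, q, a, F.c ^ m * g, fun t ht => hq _ (Or.inr ⟨t, ht, rfl⟩),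
    hq _ (Or.inl (Or.inl rfl)), hq _ (Or.inl (Or.inr (Or.inl rfl))),
    hq _ (Or.inl (Or.inr (Or.inr (Or.inl rfl)))), evalDer_mul_eq (fun l v => (F.D_spec _ v).symm) hgω,
    ⟨g, α, fun h => hg' (by rw [h, map_zero]), hgω⟩, fun X Z hXZ => ?_⟩
  rw [hfZ q (hq _ (Or.inl (Or.inr (Or.inr (Or.inr rfl)))))]
  exact F.lieVanishesOn_fibre_iff hg' hgη ha rfl (hq _ (Or.inl (Or.inl rfl))) hXZ

end Frame

end FibreForms

section Divergence

variable {A B K k : Type*}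
  [CommRing B] [IsDomain B] [Algebra ℂ B]
  [CommRing A] [IsDomain A] [Algebra ℂ A] [Algebra B A] [IsScalarTower ℂ B A]
  [Field k] [Algebra B k] [IsFractionRing B k] [Algebra ℂ k] [IsScalarTower ℂ B k]
  [Field K] [Algebra A K] [IsFractionRing A K] [Algebra ℂ K] [IsScalarTower ℂ A K]
  [Algebra k K] [IsScalarTower ℂ k K] [Algebra B K] [IsScalarTower B k K]
  [IsScalarTower B A K] {n m : ℕ} [IsNoetherianRing A]
variable (F : Frame A B K k n m) {L : Set (Jet A)} {ω : ⋀[K]^m Ω[K⁄ℂ]}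

namespace Frame

variable {F}

theorem HasGoodPoints.density_ne_zero (hG : F.HasGoodPoints L ω) : F.density ω ≠ 0 := by
  obtain ⟨s, q, a, b, -, -, ha, -, hab, -⟩ := hG ∅ Set.countable_empty (by simp)
  intro h
  rw [h, zero_mul] at hab
  rw [IsFractionRing.injective A K (hab.symm.trans (map_zero _).symm), map_zero] at ha
  exact ha rfl

theorem HasGoodPoints.exists_regular (hG : F.HasGoodPoints L ω) :
    ∃ g ∈ nonZeroDivisors A, ∃ α : ⋀[A]^m Ω[A⁄ℂ], algebraMap A K g • ω = formMap A K m α := by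
  obtain ⟨s, q, a, b, -, -, -, -, -, ⟨g, α, hg, h⟩, -⟩ := hG ∅ Set.countable_empty (by simp)
  exact ⟨g, mem_nonZeroDivisors_of_ne_zero hg, α, h⟩

variable (F)

/-- The divergence operator of a density. -/
def divergence (h : K) : Op (Fin n) m K := divOp (Fin n) fun l => F.δ (Sum.inr l) h / h

theorem ev_divergence {h : K} (hh : h ≠ 0) {p : Pt A} (X : FormalVF p) :
    algebraMap K (Mero p) h * F.ev X (F.divergence h) =
      ∑ l, F.dM p (Sum.inr l) (algebraMap K (Mero p) h * F.comps X l) := by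
  rw [divergence, divOp, map_sum, Finset.mul_sum]
  refine Finset.sum_congr rfl fun l _ => ?_
  rw [map_add, ev, opEval_single, opEval_single, tcoef_unitE, tcoef_zero, Derivation.leibniz,
    F.dM_K, one_smul, Algebra.smul_def, smul_eq_mul, smul_eq_mul, mul_add, ← mul_assoc, ← map_mul,
    mul_div_cancel₀ _ hh]
  ring

theorem lieVanishesOn_vertical_iff (hG : F.HasGoodPoints L ω) {p : Pt A} {X : FormalVF p}
    (hX : IsVertical B X) :
    LieVanishesOn p X ω {Y | IsVertical B Y} ↔ F.ev X (F.divergence (F.density ω)) = 0 := by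
  have h0 := hG.density_ne_zero
  have hu : IsUnit (algebraMap K (Mero p) (F.density ω)) := (IsUnit.mk0 _ h0).map _
  rw [← hu.mul_right_eq_zero, F.ev_divergence h0]
  refine lieVanishesOn_iff (T := {Y | IsVertical B Y}) (y := F.y)
    (d := fun l => F.dM p (Sum.inr l)) (fun Y hY f => F.vertical_apply hY f)
    ⟨fun i => extendDer p (F.D (Sum.inr i)), fun i b => ?_, ?_⟩ hX (fun Y hY b => ?_)
    hG.exists_regular ?_
  · rw [extendDer_algebraMap, F.D_base, map_zero]
  · have h1 : (Matrix.of fun i l => algebraMap _ (Mero p)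
        (extendDer p (F.D (Sum.inr i)) (algebraMap A _ (F.y l)))) =
          algebraMap A (Mero p) F.c • 1 := by
      ext i l
      rw [Matrix.of_apply, extendDer_algebraMap, F.D_y, Matrix.smul_apply, Matrix.one_apply,
        ← Mero.algebraMap_apply]
      split_ifs <;> simp
    rw [h1, Matrix.det_smul, Matrix.det_one, mul_one]
    exact (F.isUnit_c p).pow _
  · rw [Derivation.commutator_apply, hY b, hX b, map_zero, map_zero, sub_zero]
  · refine evalDer_map (Algebra.ofId K (Mero p)) _ _ (fun l z => ?_) ω
    exact (F.dM_K p (Sum.inr l) z).symm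

theorem algebraMap_lieFun_eq (h0 : F.density ω ≠ 0) {p : Pt A} {a b : A}
    (hab : F.density ω * algebraMap A K b = algebraMap A K a) (X : FormalVF p) :
    algebraMap _ (Mero p) (F.lieFun a b X) =
      algebraMap A (Mero p) (F.c * b * a) * F.ev X (F.divergence (F.density ω)) := by
  rw [F.algebraMap_lieFun ω hab, ← F.ev_divergence h0, ← mul_assoc]
  congr 1
  have := congrArg (algebraMap K (Mero p)) hab
  rw [map_mul, ← IsScalarTower.algebraMap_apply, ← IsScalarTower.algebraMap_apply] at this
  rw [map_mul, map_mul, map_mul, ← this, map_pow]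
  ring

omit [IsNoetherianRing A] in
theorem pair_eq_sum (X : Fin m → MvPowerSeries (Fin n ⊕ Fin m) K) (θ : Op (Fin n) m K) :
    pair X θ = ∑ p ∈ θ.support, θ p * MvPowerSeries.coeff p.2 (X p.1) := by
  rw [pair, Finsupp.linearCombination_apply, Finsupp.sum]
  rfl

theorem exists_regular_op (θ : Op (Fin n) m K) : ∃ T : Set A, T.Countable ∧ (0 : A) ∉ T ∧
    ∀ q : Pt A, (∀ t ∈ T, q t ≠ 0) → ∀ p, ∃ v, MVal q (algebraMap K (Mero q) (θ p)) v := by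
  obtain ⟨T, hT, h0, h⟩ := exists_regular_values A (T := insert 0 (θ '' θ.support))
    ((θ.support.countable_toSet.image _).insert _)
  refine ⟨T, hT, h0, fun q hq p => ?_⟩
  by_cases hp : p ∈ θ.support
  · exact (h q hq _ (Or.inr ⟨p, hp, rfl⟩)).imp fun _ h => h.1
  · rw [Finsupp.notMem_support_iff.1 hp]
    exact (h q hq _ (Or.inl rfl)).imp fun _ h => h.1

/-- Nonzero values of operators remain nonzero under specialization. -/
theorem exists_value_ne_zero {X : Fin m → MvPowerSeries (Fin n ⊕ Fin m) K} {θ : Op (Fin n) m K}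
    (h : pair X θ ≠ 0) : ∃ T : Set A, T.Countable ∧ (0 : A) ∉ T ∧
      ∀ q : Pt A, (∀ t ∈ T, q t ≠ 0) → ∀ Z : FormalVF q, F.Matches X Z →
        ∃ v ≠ 0, MVal q (F.ev Z θ) v := by
  obtain ⟨T1, hT1, h01, h1⟩ := exists_regular_op (A := A) θ
  obtain ⟨T2, hT2, h02, h2⟩ := exists_regular_values A (Set.countable_singleton (pair X θ))
  refine ⟨T1 ∪ T2, hT1.union hT2, by rintro (h | h); exacts [h01 h, h02 h], fun q hq Z hZ => ?_⟩
  obtain ⟨v, h3, h4⟩ := hZ.pair_ev F (h1 q fun t ht => hq t (Or.inl ht))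
  obtain ⟨w, h5, h6⟩ := h2 q (fun t ht => hq t (Or.inr ht)) _ rfl
  have h7 : MVal q (algebraMap K _ (pair X θ)) v := h3
  exact ⟨v, h5.unique h7 ▸ h6 h, h4⟩

theorem evalAt_lieFun {s : Pt B} {q : Pt (FibreRing A s)} (h0 : F.density ω ≠ 0) {a b : A}
    (hab : F.density ω * algebraMap A K b = algebraMap A K a)
    (hc : (q.comp (fibreIncl A s)) F.c ≠ 0) (ha : (q.comp (fibreIncl A s)) a ≠ 0)
    (hb : (q.comp (fibreIncl A s)) b ≠ 0) {X : FormalVF (q.comp (fibreIncl A s))}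
    (hX : formalMap (fibreIncl A s) q (F.lieFun a b X) = 0) {v : ℂ}
    (hv : MVal (q.comp (fibreIncl A s)) (F.ev X (F.divergence (F.density ω))) v) : v = 0 := by
  have h8 := MVal.formal _ (F.lieFun a b X)
  rw [← evalAt_formalMap, hX, map_zero, F.algebraMap_lieFun_eq h0 hab] at h8
  have h10 := h8.unique ((MVal.regular _ (F.c * b * a)).mul hv)
  rw [map_mul, map_mul] at h10
  exact (mul_eq_zero.1 h10.symm).resolve_left (mul_ne_zero (mul_ne_zero hc hb) ha)

theorem divergence_mem [Algebra.FiniteType ℂ A] [Algebra.Smooth ℂ A] (hL : IsDLieAlgebra L)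
    (hyp1 : ∀ x ∈ L, IsVertical B x.2) (hG : F.HasGoodPoints L ω) :
    F.divergence (F.density ω) ∈ F.annOp L := by
  refine mem_of_perp _ _ fun X hX => ?_
  by_contra hne
  obtain ⟨T1, hT1, h01, h1⟩ := F.exists_specialization hL hyp1 hX
  obtain ⟨T2, hT2, h02, h2⟩ := F.exists_value_ne_zero hne
  obtain ⟨s, q, a, b, hT, hc, ha, hb, hab, -, hrest⟩ := hG _ (hT1.union hT2) (by
    rintro (h | h)
    exacts [h01 h, h02 h])
  obtain ⟨Z, hZ, hXZ⟩ := h1 _ fun t ht => hT t (Or.inl ht)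
  obtain ⟨v, hv, h4⟩ := h2 _ (fun t ht => hT t (Or.inr ht)) Z hXZ
  have hZv : IsVertical B Z := hyp1 ⟨_, Z⟩ hZ
  obtain ⟨Z', hZ'⟩ := F.exists_restrictsTo hc hZv
  exact hv (F.evalAt_lieFun hG.density_ne_zero hab hc ha hb ((hrest Z Z' hZ').1 ⟨Z, hZ, hZ'⟩) h4)

variable {q : Pt A}

theorem matches_const (hq : q F.c ≠ 0) (Z : FormalVF q) :
    F.Matches (fun l α => algebraMap ℂ K
      (evalAt q (tcoef (F.dF_comm hq) α (Z (algebraMap A _ (F.y l)))))) Z := by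
  intro l α
  refine ⟨evalAt q (tcoef (F.dF_comm hq) α (Z (algebraMap A _ (F.y l)))), ?_, ?_⟩
  · refine ⟨algebraMap ℂ _ _, ?_, (evalAt q).commutes _⟩
    rw [← IsScalarTower.algebraMap_apply ℂ _ (Mero q)]
    exact IsScalarTower.algebraMap_apply ℂ K (Mero q) _
  · refine ⟨_, ?_, rfl⟩
    rw [F.tcoef_dF]
    rfl

/-- Taylor coefficients of low order of the product of a function and of a derivative of a
monomial. -/
theorem evalAt_tcoef_monomial (hq : q F.c ≠ 0) (γ : Expo (Fin n) m) : ∃ f : FormalRing q,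
    ∀ (w : FormalRing q) (j : Fin n ⊕ Fin m) (β : Expo (Fin n) m), β.degree + 1 ≤ γ.degree →
      evalAt q (tcoef (F.dF_comm hq) β (w * F.dF hq j f)) =
        if β = γ - unitE j then evalAt q w * γ j else 0 := by
  obtain ⟨f, hf⟩ := F.exists_formal_of_taylor hq (Pi.single γ 1)
  refine ⟨f, fun w j β hβ => ?_⟩
  classical
  have h1 : ∀ α, evalAt q (tcoef (F.dF_comm hq) α (F.dF hq j f)) =
      if α + unitE j = γ then (γ j : ℂ) else 0 := fun α => by
    rw [tcoef_der, map_smul, hf, smul_eq_mul, Pi.single_apply, mul_ite, mul_one, mul_zero]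
    split_ifs with h
    · rw [← h]; simp
    · rfl
  have h2 : F.taylorAt hq (F.dF hq j f) = MvPowerSeries.monomial (γ - unitE j) (γ j : ℂ) := by
    ext α
    rw [coeff_taylorAt, h1, MvPowerSeries.coeff_monomial]
    by_cases hj : γ j = 0
    · simp [hj]
    · simp only [eq_tsub_unitE hj]
  rw [← coeff_taylorAt, map_mul, h2, MvPowerSeries.coeff_mul_monomial]
  by_cases hj : γ j = 0
  · simp [hj]
  have hle : unitE j ≤ γ := by
    rw [Finsupp.single_le_iff]
    omega
  by_cases hβγ : β = γ - unitE j
  · rw [if_pos hβγ, if_pos hβγ.ge, hβγ, tsub_self, coeff_taylorAt, tcoef_zero]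
  · rw [if_neg hβγ, if_neg]
    intro h
    obtain ⟨δ, rfl⟩ := exists_add_of_le h
    have h3 : (γ - unitE j + unitE j).degree = γ.degree := by rw [tsub_add_cancel_of_le hle]
    rw [map_add] at h3 hβ
    have h4 : δ.degree = 0 := by
      rw [Finsupp.degree_single] at h3
      omega
    rw [Finsupp.degree_eq_zero_iff] at h4
    exact hβγ (by rw [h4, add_zero])

theorem curlFree [Algebra.FiniteType ℂ A] [Algebra.Smooth ℂ A] (hG : F.HasGoodPoints L ω) : CurlFree (F.annOp L) := by
  intro d θ hθ hθd i j γ h0 hγ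
  have : CharZero K := charZero_of_injective_algebraMap (algebraMap ℂ K).injective
  have hH : θ ∈ Homog (Fin n) m K 0 d := by
    refine Finsupp.supported_mono (fun p hp => ?_) hθd
    simp only [Set.mem_ofPred_eq] at hp ⊢
    omega
  suffices hκ : curl i j γ θ 0 = 0 by
    ext α
    by_cases hα : sdeg α = 0 ∧ ydeg α = 0
    · rw [eq_zero_of_deg hα.1 hα.2, hκ]
      rfl
    · exact (Finsupp.mem_supported' K _).mp (curl_mem_supported hH γ i j) α hα
  rw [curl_apply _ _ _ h0]
  set κ : K := (γ (Sum.inr j) : K) * θ (i, γ - unitE (Sum.inr j)) -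
    (γ (Sum.inr i) : K) * θ (j, γ - unitE (Sum.inr i)) with hκ
  by_contra hne
  obtain ⟨T1, hT1, h01, h1⟩ := exists_regular_op (A := A) θ
  obtain ⟨T2, hT2, h02, h2⟩ := exists_regular_values A (Set.countable_singleton κ)
  obtain ⟨s, q, a, b, hT, hc, ha, hb, hab, -, hrest⟩ := hG _ (hT1.union hT2) (by
    rintro (h | h)
    exacts [h01 h, h02 h])
  obtain ⟨f, hf⟩ := F.evalAt_tcoef_monomial hc γ
  obtain ⟨u, hu⟩ := isUnit_of_evalAt_ne_zero (p := q.comp (fibreIncl A s))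
    (f := algebraMap A _ a) (by rwa [evalAt_algebraMap])
  obtain ⟨w, hw, hw0⟩ : ∃ w : FormalRing (q.comp (fibreIncl A s)),
      algebraMap K (Mero (q.comp (fibreIncl A s))) (F.density ω) *
        algebraMap _ (Mero (q.comp (fibreIncl A s))) w = 1 ∧ evalAt _ w ≠ 0 := by
    refine ⟨algebraMap A _ b * ↑u⁻¹, ?_, ?_⟩
    · have h3 := congrArg (algebraMap K (Mero (q.comp (fibreIncl A s)))) hab
      rw [map_mul, ← IsScalarTower.algebraMap_apply, ← IsScalarTower.algebraMap_apply,
        Mero.algebraMap_apply, Mero.algebraMap_apply] at h3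
      rw [map_mul, ← mul_assoc, h3, ← map_mul, ← hu, Units.mul_inv, map_one]
    · rw [map_mul, evalAt_algebraMap]
      exact mul_ne_zero hb (evalAt_ne_zero_of_isUnit u⁻¹.isUnit)
  obtain ⟨Z, hZ, hZy⟩ := F.exists_vertical hc fun l =>
    w * (if l = i then F.dF hc (Sum.inr j) f else 0) -
      w * (if l = j then F.dF hc (Sum.inr i) f else 0)
  have hdiv : F.lieFun a b Z = 0 := by
    apply Mero.injective (q.comp (fibreIncl A s))
    have h3 : ∀ l, algebraMap K (Mero (q.comp (fibreIncl A s))) (F.density ω) * F.comps Z l =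
        (if l = i then F.dM _ (Sum.inr j) (algebraMap _ _ f) else 0) -
          (if l = j then F.dM _ (Sum.inr i) (algebraMap _ _ f) else 0) := fun l => by
      rw [comps, hZy, ← mul_sub, map_mul, ← mul_assoc, hw, one_mul, map_sub, ← F.dF_spec hc,
        ← F.dF_spec hc]
      congr 1 <;> split_ifs <;> simp
    rw [F.algebraMap_lieFun ω hab, map_zero]
    have h4 : ∀ l i g, F.dM (q.comp (fibreIncl A s)) (Sum.inr l) (if l = i then g else 0) =
        if l = i then F.dM _ (Sum.inr i) g else 0 := fun l i g => by
      split_ifs with h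
      · rw [h]
      · exact map_zero _
    simp only [h3, map_sub, Finset.sum_sub_distrib, h4, Finset.sum_ite_eq', Finset.mem_univ,
      if_true]
    rw [F.dM_comm, sub_self, mul_zero]
  obtain ⟨Z', hZ'⟩ := F.exists_restrictsTo hc hZ
  obtain ⟨X, hX, hXZ⟩ : ∃ X : FormalVF (q.comp (fibreIncl A s)),
      (⟨_, X⟩ : Jet A) ∈ L ∧ RestrictsTo _ q X Z' :=
    (hrest Z Z' hZ').2 (by rw [hdiv, map_zero])
  have hXZy : ∀ β : Expo (Fin n) m, sdeg β = 0 → ∀ l,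
      evalAt _ (tcoef (F.dF_comm hc) β (X (algebraMap A _ (F.y l)))) =
        evalAt _ (tcoef (F.dF_comm hc) β (Z (algebraMap A _ (F.y l)))) := by
    intro β hβ l
    rw [← sub_eq_zero, ← map_sub, ← map_sub]
    refine F.evalAt_tcoef_of_formalMap hc hβ ?_
    rw [map_sub, hXZ, hZ', sub_self]
  have hpair : pair (fun l α => algebraMap ℂ K
      (evalAt _ (tcoef (F.dF_comm hc) α (X (algebraMap A _ (F.y l)))))) θ =
        algebraMap ℂ K (evalAt _ w) * κ := by
    have hdeg : ∀ α : Expo (Fin n) m, α.degree = sdeg α + ydeg α := fun α => by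
      rw [Finsupp.degree_eq_sum, Fintype.sum_sum_type]
      rfl
    have h3 : ∀ p ∈ θ.support, evalAt _ (tcoef (F.dF_comm hc) p.2 (X (algebraMap A _ (F.y p.1)))) =
        (if p = (i, γ - unitE (Sum.inr j)) then evalAt _ w * γ (Sum.inr j) else 0) -
          (if p = (j, γ - unitE (Sum.inr i)) then evalAt _ w * γ (Sum.inr i) else 0) := by
      intro p hp
      have hp1 : sdeg p.2 = 0 ∧ ydeg p.2 ≤ d := hH hp
      have h5 : ∀ i j : Fin m, evalAt _ (tcoef (F.dF_comm hc) p.2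
          (w * (if p.1 = i then F.dF hc (Sum.inr j) f else 0))) =
            if p = (i, γ - unitE (Sum.inr j)) then evalAt _ w * γ (Sum.inr j) else 0 := by
        intro i j
        by_cases hi : p.1 = i
        · rw [if_pos hi, hf _ _ _ (by rw [hdeg, hdeg, hp1.1, h0, hγ]; omega)]
          simp only [Prod.ext_iff, hi, true_and]
        · rw [if_neg hi, mul_zero, map_zero, map_zero, if_neg fun h => hi (by rw [h])]
      rw [hXZy _ hp1.1, hZy, map_sub, map_sub, h5, h5]
    refine (pair_eq_sum _ _).trans ?_
    have h4 : ∀ p₀ (c : ℂ), ∑ p ∈ θ.support, θ p * algebraMap ℂ K (if p = p₀ then c else 0) =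
        algebraMap ℂ K c * θ p₀ := by
      intro p₀ c
      simp only [apply_ite (algebraMap ℂ K), map_zero, mul_ite, mul_zero, Finset.sum_ite_eq']
      split_ifs with h
      · exact mul_comm _ _
      · rw [Finsupp.notMem_support_iff.1 h, mul_zero]
    calc _ = ∑ p ∈ θ.support, (θ p * algebraMap ℂ K (if p = (i, γ - unitE (Sum.inr j)) then
            evalAt _ w * γ (Sum.inr j) else 0) - θ p * algebraMap ℂ K
              (if p = (j, γ - unitE (Sum.inr i)) then evalAt _ w * γ (Sum.inr i) else 0)) := by
          refine Finset.sum_congr rfl fun p hp => ?_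
          rw [← mul_sub, ← map_sub, ← h3 p hp]
          rfl
      _ = _ := by
          rw [Finset.sum_sub_distrib, h4, h4, hκ, map_mul, map_mul, map_natCast, map_natCast]
          ring
  obtain ⟨v, h3, h4⟩ := (F.matches_const hc X).pair_ev F (h1 _ fun t ht => hT t (Or.inl ht))
  have h5 : MVal (q.comp (fibreIncl A s)) (F.ev X θ) v := h4
  have h6 : F.ev X θ = 0 := F.mem_annOp.1 hθ ⟨_, X⟩ hX
  rw [h6] at h5
  have h7 : MVal (q.comp (fibreIncl A s)) (algebraMap K _ (algebraMap ℂ K (evalAt _ w) * κ)) v :=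
    hpair ▸ h3
  obtain ⟨v', h8, h9⟩ := h2 _ (fun t ht => hT t (Or.inr ht)) _ rfl
  have h10 : MVal (q.comp (fibreIncl A s)) (algebraMap K (Mero (q.comp (fibreIncl A s)))
      (algebraMap ℂ K (evalAt _ w))) (evalAt _ w) :=
    ⟨algebraMap ℂ _ _, (IsScalarTower.algebraMap_apply ℂ (FormalRing _) (Mero _) _).symm.trans
      (IsScalarTower.algebraMap_apply ℂ K (Mero _) _), (evalAt _).commutes _⟩
  rw [map_mul] at h7
  have h11 := (h10.mul h8).unique h7
  rw [h5.unique (MVal.zero _)] at h11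
  exact h9 hne ((mul_eq_zero.1 h11).resolve_left hw0)

end Frame

end Divergence

section Constants

variable {A B K k : Type*}
  [CommRing B] [IsDomain B] [Algebra ℂ B]
  [CommRing A] [IsDomain A] [Algebra ℂ A] [Algebra B A] [IsScalarTower ℂ B A]
  [Field k] [Algebra B k] [IsFractionRing B k] [Algebra ℂ k] [IsScalarTower ℂ B k]
  [Field K] [Algebra A K] [IsFractionRing A K] [Algebra ℂ K] [IsScalarTower ℂ A K]
  [Algebra k K] [IsScalarTower ℂ k K] [Algebra B K] [IsScalarTower B k K]
  [IsScalarTower B A K] {n m : ℕ} [IsNoetherianRing A]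
variable (F : Frame A B K k n m)

namespace Frame

/-- On an irreducible fibre, two functions with vanishing Wronskians are proportional. -/
theorem eq_smul_of_wronskian {s : Pt B} [IsDomain (FibreRing A s)] {q : Pt (FibreRing A s)}
    {a b : A} (hc : (q.comp (fibreIncl A s)) F.c ≠ 0) (hb : (q.comp (fibreIncl A s)) b ≠ 0)
    (h : ∀ l, F.D (Sum.inr l) a * b = a * F.D (Sum.inr l) b) :
    ∃ z : ℂ, fibreIncl A s a = fibreIncl A s (z • b) := by
  obtain ⟨z, hz⟩ : ∃ z, z = q (fibreIncl A s a) / q (fibreIncl A s b) := ⟨_, rfl⟩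
  have hb' : q (fibreIncl A s b) ≠ 0 := hb
  refine ⟨z, ?_⟩
  by_contra hne
  obtain ⟨e, he⟩ : ∃ e, e = fibreIncl A s (a - z • b) := ⟨_, rfl⟩
  have he0 : e ≠ 0 := by rwa [he, map_sub, sub_ne_zero]
  obtain ⟨u, hu⟩ := isUnit_of_evalAt_ne_zero (p := q)
    (f := algebraMap (FibreRing A s) _ (fibreIncl A s b)) (by rwa [evalAt_algebraMap])
  have hD : ∀ l, F.fibreD s l e * fibreIncl A s b = e * F.fibreD s l (fibreIncl A s b) := by
    intro l
    rw [he, fibreD_apply, fibreD_apply, ← map_mul, ← map_mul, map_sub, Derivation.map_smul,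
      sub_mul, sub_mul, h, smul_mul_assoc, smul_mul_assoc, mul_comm b]
  obtain ⟨f, hf⟩ : ∃ f, algebraMap (FibreRing A s) (FormalRing q) e = u * f :=
    ⟨↑u⁻¹ * algebraMap _ _ e, by rw [Units.mul_inv_cancel_left]⟩
  have hDf : ∀ l, extendDer q (F.fibreD s l) f = 0 := by
    intro l
    have h1 := congrArg (extendDer q (F.fibreD s l)) hf
    rw [Derivation.leibniz, hu, smul_eq_mul, smul_eq_mul, extendDer_algebraMap,
      extendDer_algebraMap] at h1
    have h2 := congrArg (algebraMap (FibreRing A s) (FormalRing q)) (hD l)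
    rw [map_mul, map_mul, h1, hf, hu] at h2
    have h3 : (u * u : FormalRing q) * extendDer q (F.fibreD s l) f = 0 := by
      rw [hu]
      linear_combination h2
    exact (u.isUnit.mul u.isUnit).mul_right_eq_zero.1 h3
  have hev : evalAt q f = 0 := by
    have h1 := congrArg (evalAt q) hf
    rw [map_mul, hu, evalAt_algebraMap, evalAt_algebraMap, he, map_sub, map_sub, map_smul, map_smul,
      hz, smul_eq_mul, div_mul_cancel₀ _ hb', sub_self] at h1
    exact (mul_eq_zero.1 h1.symm).resolve_left hb'
  have hf0 : f = 0 := eq_zero_of_iterated (S := {0, f}) (F.euler_fibre (s := s)) hc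
    (by rintro _ (rfl | rfl); exacts [map_zero _, hev])
    (by rintro _ (rfl | rfl) l; exacts [Or.inl (map_zero _), Or.inl (hDf l)]) f (Or.inr rfl)
  have : Nontrivial (FormalRing q) := (evalAt q).toRingHom.domain_nontrivial
  have h5 := nonZeroDivisors.ne_zero
    (Mero.formal_nonZeroDivisor q (mem_nonZeroDivisors_of_ne_zero he0))
  rw [hf, hf0, mul_zero] at h5
  exact h5 rfl

/-- The field of functions on the base is algebraically closed in the function field, so that the
functions which are constant along the fibres come from the base. -/
theorem mem_range_of_const [Algebra.FiniteType ℂ A] [IsNoetherianRing B]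
    (hfib : Generically B fun s => IsDomain (FibreRing A s)) {z : K}
    (hz : ∀ l, F.δ (Sum.inr l) z = 0) : z ∈ Set.range (algebraMap k K) := by
  obtain ⟨⟨a, b⟩, hab⟩ := IsLocalization.surj (nonZeroDivisors A) z
  have hb0 : (b : A) ≠ 0 := nonZeroDivisors.coe_ne_zero b
  by_contra hne
  have hspan : algebraMap A K a ∉ k ∙ algebraMap A K b := by
    rw [Submodule.mem_span_singleton]
    rintro ⟨c, hc⟩
    refine hne ⟨c, ?_⟩
    rw [Algebra.smul_def, ← hab] at hc
    exact mul_right_cancel₀ (fun h => hb0 (IsFractionRing.injective A K (h.trans (map_zero _).symm))) hc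
  obtain ⟨φ, hφa, hφb⟩ := Submodule.exists_le_ker_of_notMem hspan
  have hφb : φ (algebraMap A K b) = 0 := hφb (Submodule.mem_span_singleton_self _)
  obtain ⟨U, hU, hspan⟩ := exists_countable_span (A := A)
  obtain ⟨T, hT, h0, hTv⟩ := exists_regular_values B
    (T := insert (φ (algebraMap A K a)) ((fun u => φ (algebraMap A K u)) '' U))
    ((hU.image _).insert _)
  obtain ⟨s, hs, hsT⟩ := exists_generic_fibre F.injective_base hfib
    (T := insert (F.c * b) (algebraMap B A '' T)) ((hT.image _).insert _) (by
      rintro (h | ⟨t, ht, h⟩)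
      · exact mul_ne_zero F.c_ne hb0 h.symm
      · rw [F.injective_base (h.trans (map_zero _).symm)] at ht
        exact h0 ht)
  have : Algebra.FiniteType ℂ (FibreRing A s) :=
    Algebra.FiniteType.of_surjective (fibreIncl A s) (Ideal.Quotient.mkₐ_surjective ℂ _)
  obtain ⟨q, hq⟩ := exists_pt_ne_zero (Set.countable_singleton (fibreIncl A s (F.c * b)))
    (fun h => hsT _ (Or.inl rfl) h.symm)
  have hq := hq _ rfl
  rw [map_mul, map_mul] at hq
  obtain ⟨w, hw⟩ := F.eq_smul_of_wronskian (a := a) (left_ne_zero_of_mul hq)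
    (right_ne_zero_of_mul hq) fun l => by
      apply IsFractionRing.injective A K
      rw [map_mul, map_mul, F.D_spec, F.D_spec, ← hab, Derivation.leibniz, hz]
      simp only [smul_eq_mul]
      ring
  have hval := hTv s fun t ht h => hsT _ (Or.inr ⟨t, ht, rfl⟩) (by
    rw [fibreIncl_base, h, map_zero])
  have hval' : ∀ x : A, ∃ v, MVal s (algebraMap k (Mero s) (φ (algebraMap A K x))) v := by
    intro x
    have hx : x ∈ Submodule.span ℂ U := hspan ▸ Submodule.mem_top
    induction hx using Submodule.span_induction with
    | mem x hx => exact (hval _ (Or.inr ⟨x, hx, rfl⟩)).imp fun _ h => h.1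
    | zero => exact ⟨0, by simpa using MVal.zero s⟩
    | add x y _ _ hx hy =>
      obtain ⟨v, hv⟩ := hx
      obtain ⟨w, hw⟩ := hy
      exact ⟨v + w, by simpa using hv.add hw⟩
    | smul c x _ hx =>
      obtain ⟨v, hv⟩ := hx
      refine ⟨s (algebraMap ℂ B c) * v, ?_⟩
      have h1 : φ (algebraMap A K (c • x)) =
          algebraMap B k (algebraMap ℂ B c) * φ (algebraMap A K x) := by
        rw [← smul_eq_mul, ← φ.map_smul, Algebra.smul_def, Algebra.smul_def, map_mul,
          ← IsScalarTower.algebraMap_apply ℂ B k, ← IsScalarTower.algebraMap_apply ℂ k K,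
          ← IsScalarTower.algebraMap_apply ℂ A K]
      rw [h1, map_mul, ← IsScalarTower.algebraMap_apply B k (Mero s)]
      exact (MVal.regular s _).mul hv
  have hker : ∀ x ∈ (RingHom.ker s).map (algebraMap B A), ∀ r : A,
      MVal s (algebraMap k (Mero s) (φ (algebraMap A K (r * x)))) 0 := by
    intro x hx
    refine Submodule.span_induction (p := fun x _ => ∀ r : A,
      MVal s (algebraMap k (Mero s) (φ (algebraMap A K (r * x)))) 0) ?_ ?_ ?_ ?_ hx
    · rintro _ ⟨b, hb, rfl⟩ r
      obtain ⟨v, hv⟩ := hval' r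
      have h1 : φ (algebraMap A K (r * algebraMap B A b)) =
          algebraMap B k b * φ (algebraMap A K r) := by
        rw [← smul_eq_mul (algebraMap B k b), ← φ.map_smul, Algebra.smul_def, map_mul, mul_comm,
          ← IsScalarTower.algebraMap_apply B k K, ← IsScalarTower.algebraMap_apply B A K]
      rw [h1, map_mul, ← IsScalarTower.algebraMap_apply B k (Mero s)]
      have h2 := (MVal.regular s b).mul hv
      rwa [(hb : s b = 0), zero_mul] at h2
    · intro r
      simpa using MVal.zero s
    · intro x y _ _ hx hy r
      simpa [mul_add] using (hx r).add (hy r)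
    · intro a x _ hx r
      rw [smul_eq_mul, ← mul_assoc]
      exact hx _
  rw [← sub_eq_zero, ← map_sub] at hw
  have h1 := hker _ (Ideal.Quotient.eq_zero_iff_mem.1 hw) 1
  have h2 : φ (algebraMap A K (1 * (a - w • (b : A)))) = φ (algebraMap A K a) := by
    rw [one_mul, map_sub, map_sub, Algebra.smul_def, map_mul, ← IsScalarTower.algebraMap_apply ℂ A K,
      IsScalarTower.algebraMap_apply ℂ k K, ← Algebra.smul_def, map_smul, hφb, smul_zero, sub_zero]
  rw [h2] at h1
  obtain ⟨v, h3, h4⟩ := hval _ (Or.inl rfl)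
  exact h4 hφa (h3.unique h1)

end Frame

end Constants

section MeromorphicFields

theorem derivation_lie_smul {R S : Type*} [CommRing R] [CommRing S] [Algebra R S]
    (D E : Derivation R S S) (a : S) : ⁅D, a • E⁆ = D a • E + a • ⁅D, E⁆ := by
  ext f
  simp only [Derivation.commutator_apply, Derivation.smul_apply, Derivation.add_apply,
    Derivation.leibniz, smul_eq_mul]
  ring

variable {A B K k : Type*}
  [CommRing B] [IsDomain B] [Algebra ℂ B]
  [CommRing A] [IsDomain A] [Algebra ℂ A] [Algebra B A] [IsScalarTower ℂ B A]
  [Field k] [Algebra B k] [IsFractionRing B k] [Algebra ℂ k] [IsScalarTower ℂ B k]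
  [Field K] [Algebra A K] [IsFractionRing A K] [Algebra ℂ K] [IsScalarTower ℂ A K]
  [Algebra k K] [IsScalarTower ℂ k K] [Algebra B K] [IsScalarTower B k K]
  [IsScalarTower B A K] {n m : ℕ} [IsNoetherianRing A]
variable (F : Frame A B K k n m)

namespace Frame

/-- The meromorphic formal vector field with the given components. -/
def dirM (p : Pt A) (w : Fin n ⊕ Fin m → Mero p) : Derivation ℂ (Mero p) (Mero p) :=
  ∑ j, w j • F.dM p j

theorem dirM_apply (p : Pt A) (w : Fin n ⊕ Fin m → Mero p) (r : Mero p) :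
    F.dirM p w r = ∑ j, w j * F.dM p j r := by
  rw [dirM, derivation_sum_apply]
  rfl

theorem dirM_x (p : Pt A) (w : Fin n ⊕ Fin m → Mero p) (j : Fin n ⊕ Fin m) :
    F.dirM p w (algebraMap A (Mero p) (F.x j)) = w j := by
  rw [dirM_apply]
  simp [dM_algebraMap, dual_x]

theorem lie_dirM (p : Pt A) (v w : Fin n ⊕ Fin m → Mero p) :
    ⁅F.dirM p v, F.dirM p w⁆ = F.dirM p fun j => F.dirM p v (w j) - F.dirM p w (v j) := by
  ext r
  rw [Derivation.commutator_apply]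
  have h : ∀ v w : Fin n ⊕ Fin m → Mero p, F.dirM p v (F.dirM p w r) =
      ∑ j, F.dirM p v (w j) * F.dM p j r + ∑ j, ∑ i, v i * w j * F.dM p i (F.dM p j r) := by
    intro v w
    rw [F.dirM_apply p w, map_sum, ← Finset.sum_add_distrib]
    refine Finset.sum_congr rfl fun j _ => ?_
    rw [Derivation.leibniz, smul_eq_mul, smul_eq_mul, F.dirM_apply p v (F.dM p j r),
      Finset.mul_sum, add_comm, mul_comm (F.dM p j r)]
    congr 1
    exact Finset.sum_congr rfl fun i _ => by ring
  rw [h v w, h w v, F.dirM_apply p _ r, Finset.sum_comm (f := fun j i => w i * v j * _)]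
  simp only [sub_mul, Finset.sum_sub_distrib]
  have h2 : ∀ j i, v i * w j * F.dM p i (F.dM p j r) = w j * v i * F.dM p j (F.dM p i r) :=
    fun j i => by rw [F.dM_comm p i j r, mul_comm (v i)]
  simp only [h2]
  ring

theorem dirM_zero (p : Pt A) : F.dirM p 0 = 0 := by
  simp [dirM]

/-- The rational vector field `Y` at the point `p`. -/
def hat (p : Pt A) (Y : Derivation ℂ K K) : Derivation ℂ (Mero p) (Mero p) :=
  F.dirM p fun j => algebraMap K (Mero p) (Y (algebraMap A K (F.x j)))

theorem hat_K (p : Pt A) (Y : Derivation ℂ K K) (z : K) :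
    F.hat p Y (algebraMap K (Mero p) z) = algebraMap K (Mero p) (Y z) := by
  rw [hat, dirM_apply, F.expand Y z, map_sum]
  refine Finset.sum_congr rfl fun j _ => ?_
  rw [dM_K, smul_eq_mul, map_mul, mul_comm]

theorem hat_lie (p : Pt A) (Y Z : Derivation ℂ K K) : F.hat p ⁅Y, Z⁆ = ⁅F.hat p Y, F.hat p Z⁆ := by
  rw [hat, hat, hat, lie_dirM]
  congr 1
  ext j
  change _ = F.hat p Y _ - F.hat p Z _
  rw [hat_K, hat_K, Derivation.commutator_apply, map_sub]

/-- Rational vector fields as meromorphic formal vector fields. -/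
def hatHom (p : Pt A) : Derivation ℂ K K →ₗ[K] Derivation ℂ (Mero p) (Mero p) where
  toFun := F.hat p
  map_add' Y Z := by
    simp only [hat, dirM, Derivation.add_apply, map_add, add_smul, Finset.sum_add_distrib]
  map_smul' a Y := by
    simp only [hat, dirM, Derivation.smul_apply, smul_eq_mul, map_mul, mul_smul, Finset.smul_sum,
      RingHom.id_apply]
    refine Finset.sum_congr rfl fun j _ => ?_
    rw [← algebraMap_smul (Mero p) a]

theorem hat_smul (p : Pt A) (a : K) (Y : Derivation ℂ K K) :
    F.hat p (a • Y) = algebraMap K (Mero p) a • F.hat p Y :=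
  ((F.hatHom p).map_smul a Y).trans (algebraMap_smul (Mero p) a _).symm

/-- The formal vector field `X` as a meromorphic formal vector field. -/
def field {p : Pt A} (X : FormalVF p) : Derivation ℂ (Mero p) (Mero p) :=
  F.dirM p fun j => algebraMap _ _ (X (algebraMap A _ (F.x j)))

theorem field_formal {p : Pt A} (X : FormalVF p) (f : FormalRing p) :
    F.field X (algebraMap _ (Mero p) f) = algebraMap _ (Mero p) (X f) := by
  rw [field, dirM_apply, F.formal_apply]

theorem field_lie {p : Pt A} (X Z : FormalVF p) : F.field ⁅X, Z⁆ = ⁅F.field X, F.field Z⁆ := by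
  rw [field, field, field, lie_dirM]
  congr 1
  ext j
  change _ = F.field X _ - F.field Z _
  rw [field_formal, field_formal, Derivation.commutator_apply, map_sub]

theorem field_extendDer {p : Pt A} {D : Derivation ℂ A A} {Y : Derivation ℂ K K}
    (h : ∀ a, Y (algebraMap A K a) = algebraMap A K (D a)) :
    F.field (extendDer p D) = F.hat p Y := by
  rw [field, hat]
  congr 1
  ext j
  rw [h, extendDer_algebraMap, ← IsScalarTower.algebraMap_apply A K (Mero p)]
  rfl

theorem field_vertical {p : Pt A} {X : FormalVF p} (hX : IsVertical B X) (r : Mero p) :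
    F.field X r = ∑ l, F.comps X l * F.dM p (Sum.inr l) r := by
  rw [field, dirM_apply, Fintype.sum_sum_type, Finset.sum_eq_zero, zero_add]
  · rfl
  · intro i _
    rw [x_inl, hX, map_zero, zero_mul]

theorem field_const {p : Pt A} {X : FormalVF p} (hX : IsVertical B X) {z : K}
    (hz : ∀ l, F.δ (Sum.inr l) z = 0) : F.field X (algebraMap K (Mero p) z) = 0 := by
  rw [F.field_vertical hX]
  refine Finset.sum_eq_zero fun l _ => ?_
  rw [dM_K, hz, map_zero, mul_zero]

theorem lie_hat_field_eq_zero {p : Pt A} (Y : Derivation ℂ K K) {X : FormalVF p}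
    (h : ∀ j, ⁅F.hat p Y, F.field X⁆ (algebraMap A (Mero p) (F.x j)) = 0) :
    ⁅F.hat p Y, F.field X⁆ = 0 := by
  rw [hat, field, lie_dirM] at h ⊢
  simp only [dirM_x] at h
  rw [← F.dirM_zero p]
  exact congrArg _ (funext h)

theorem lie_hat_field_base {p : Pt A} (Y : Derivation ℂ K K) {X : FormalVF p}
    (hX : IsVertical B X) {i : Fin n}
    (hY : ∀ l, F.δ (Sum.inr l) (Y (algebraMap A K (F.x (Sum.inl i)))) = 0) :
    ⁅F.hat p Y, F.field X⁆ (algebraMap A (Mero p) (F.x (Sum.inl i))) = 0 := by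
  rw [Derivation.commutator_apply, IsScalarTower.algebraMap_apply A K (Mero p), hat_K,
    F.field_const hX hY, F.field_const hX, map_zero, sub_zero]
  intro l
  rw [dual_x, if_neg (by simp)]

theorem ev_adOp {p : Pt A} (Y : Derivation ℂ K K) {X : FormalVF p} (hX : IsVertical B X)
    (i : Fin m) : F.ev X (adOp F.δ (fun j => Y (algebraMap A K (F.x (Sum.inl j))))
      (fun l => Y (algebraMap A K (F.x (Sum.inr l)))) i) =
        ⁅F.hat p Y, F.field X⁆ (algebraMap A (Mero p) (F.x (Sum.inr i))) := by
  have : CharZero K := charZero_of_injective_algebraMap (algebraMap ℂ K).injective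
  have h1 : F.field X (algebraMap A (Mero p) (F.x (Sum.inr i))) = F.comps X i :=
    F.dirM_x p _ _
  rw [Derivation.commutator_apply, h1, IsScalarTower.algebraMap_apply A K (Mero p), hat_K,
    F.field_vertical hX, hat, dirM_apply, Fintype.sum_sum_type, adOp, normalOp, put_vec, ev]
  simp only [map_sub, map_sum, map_smul, opEval_single, tcoef_zero, tcoef_unitE, one_smul, dM_K,
    Algebra.smul_def, map_one, one_mul]
  simp only [mul_comm (F.comps X _)]
  ring

end Frame

end MeromorphicFields

section Symmetries

variable {A B K k : Type*}
  [CommRing B] [IsDomain B] [Algebra ℂ B]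
  [CommRing A] [IsDomain A] [Algebra ℂ A] [Algebra B A] [IsScalarTower ℂ B A]
  [Field k] [Algebra B k] [IsFractionRing B k] [Algebra ℂ k] [IsScalarTower ℂ B k]
  [Field K] [Algebra A K] [IsFractionRing A K] [Algebra ℂ K] [IsScalarTower ℂ A K]
  [Algebra k K] [IsScalarTower ℂ k K] [Algebra B K] [IsScalarTower B k K]
  [IsScalarTower B A K] {n m : ℕ} [IsNoetherianRing A]
variable (F : Frame A B K k n m) (L : Set (Jet A))

namespace Frame

/-- The rational vector fields, projectable to the base, which commute with the vertical members
of `L`. -/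
def symm : Submodule k (Derivation ℂ K K) where
  carrier := {Y | (∀ l i, F.δ (Sum.inr l) (Y (algebraMap A K (F.x (Sum.inl i)))) = 0) ∧
    ∀ (p : Pt A) (X : FormalVF p), (⟨p, X⟩ : Jet A) ∈ L → IsVertical B X →
      ⁅F.hat p Y, F.field X⁆ = 0}
  zero_mem' := ⟨fun _ _ => by simp, fun p X _ _ => by
    rw [show F.hat p 0 = 0 from (F.hatHom p).map_zero, zero_lie]⟩
  add_mem' {Y Z} hY hZ := ⟨fun l i => by
    rw [Derivation.add_apply, map_add, hY.1, hZ.1, add_zero], fun p X h h' => by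
    rw [show F.hat p (Y + Z) = F.hat p Y + F.hat p Z from (F.hatHom p).map_add Y Z, add_lie,
      hY.2 p X h h', hZ.2 p X h h', add_zero]⟩
  smul_mem' c Y hY := ⟨fun l i => by
    rw [Derivation.smul_apply, Algebra.smul_def, Derivation.leibniz, hY.1, F.const_der, smul_zero,
      smul_zero, add_zero], fun p X h h' => by
    rw [← algebraMap_smul K c Y, hat_smul, ← lie_skew, derivation_lie_smul,
      F.field_const h' fun l => F.const_der l c, zero_smul, zero_add, ← lie_skew, hY.2 p X h h',
      neg_zero, smul_zero, neg_zero]⟩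

variable {F L}

theorem mem_symm_iff (hyp1 : ∀ x ∈ L, IsVertical B x.2) {Y : Derivation ℂ K K} :
    Y ∈ F.symm L ↔ (∀ l i, F.δ (Sum.inr l) (Y (algebraMap A K (F.x (Sum.inl i)))) = 0) ∧
      ∀ i, adOp F.δ (fun j => Y (algebraMap A K (F.x (Sum.inl j))))
        (fun l => Y (algebraMap A K (F.x (Sum.inr l)))) i ∈ F.annOp L := by
  refine and_congr_right fun h1 => ⟨fun h i => F.mem_annOp.2 ?_, fun h p X hX hXv => ?_⟩
  · rintro ⟨p, X⟩ hX
    have hXv : IsVertical B X := hyp1 ⟨p, X⟩ hX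
    change F.ev X _ = 0
    rw [F.ev_adOp Y hXv, h p X hX hXv]
    rfl
  · refine F.lie_hat_field_eq_zero Y fun j => ?_
    rcases j with i | i
    · exact F.lie_hat_field_base Y hXv fun l => h1 l i
    · rw [← F.ev_adOp Y hXv]
      exact F.mem_annOp.1 (h i) ⟨p, X⟩ hX

/-- A rational vector field commuting with `L` is determined by its projection to the base. -/
theorem eq_zero_of_mem_symm (hyp1 : ∀ x ∈ L, IsVertical B x.2) (hc : CurlFree (F.annOp L))
    (hm : m ≠ 1) {Y : Derivation ℂ K K} (hY : Y ∈ F.symm L)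
    (h0 : ∀ i, Y (algebraMap A K (F.x (Sum.inl i))) = 0) : Y = 0 := by
  refine derivation_ext_of_isTranscendenceBasis F.basis_K fun j => ?_
  change Y (algebraMap A K (F.x j)) = 0
  rcases j with i | b
  · exact h0 i
  have : CharZero K := charZero_of_injective_algebraMap (algebraMap ℂ K).injective
  obtain ⟨j, hj⟩ : ∃ j : Fin m, j ≠ b := by
    have : Nontrivial (Fin m) := Fin.nontrivial_iff_two_le.2 (by have := b.2; omega)
    exact exists_ne b
  have h1 := ((mem_symm_iff hyp1).1 hY).2 b
  have h2 : put b (vec m fun j => Y (algebraMap A K (F.x (Sum.inl j)))) =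
      (0 : Op (Fin n) m K) := by
    simp only [h0]
    exact (congrArg (put b) (map_zero (vec m))).trans (map_zero _)
  rw [adOp, h2, zero_sub] at h1
  have h3 := hc 1 _ ((F.annOp L).neg_mem_iff.1 h1) (normalOp_mem_Fil _ _ b) b j
    (unitE (Sum.inr b) + unitE (Sum.inr j)) (by simp) (by simp)
  have h4 := DFunLike.congr_fun h3 0
  rw [curl_apply _ _ _ (by simp), add_tsub_cancel_right, add_tsub_cancel_left, normalOp_apply,
    normalOp_apply, if_pos rfl, if_neg hj, mul_zero, sub_zero] at h4
  simpa [Finsupp.single_apply, hj, hj.symm] using h4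

/-- A vector field with coefficients constant along the fibres projects to the base. -/
theorem exists_projection (hconst : ∀ z : K, (∀ l, F.δ (Sum.inr l) z = 0) →
    z ∈ Set.range (algebraMap k K)) {Y : Derivation ℂ K K}
    (hY : ∀ l i, F.δ (Sum.inr l) (Y (algebraMap A K (F.x (Sum.inl i)))) = 0) :
    ∃ y : Derivation ℂ k k, ∀ z, algebraMap k K (y z) = Y (algebraMap k K z) := by
  choose w hw using fun i => hconst _ fun l => hY l i
  obtain ⟨d, hd⟩ := exists_dual_derivations F.basis_k
  have hd : ∀ i j, d i (algebraMap B k (F.s j)) = if i = j then 1 else 0 := hd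
  refine ⟨∑ i, w i • d i, fun z => ?_⟩
  have h : (Algebra.linearMap k K).compDer (∑ i, w i • d i) = Y.compAlgebraMap k := by
    refine derivation_ext_of_isTranscendenceBasis F.basis_k fun j => ?_
    change algebraMap k K ((∑ i, w i • d i) ((algebraMap B k ∘ F.s) j)) =
      Y (algebraMap k K (algebraMap B k (F.s j)))
    rw [derivation_sum_apply, ← IsScalarTower.algebraMap_apply B k K,
      IsScalarTower.algebraMap_apply B A K, ← x_inl, ← hw j]
    simp [hd]
  exact DFunLike.congr_fun h z

theorem lie_mem_symm (hconst : ∀ z : K, (∀ l, F.δ (Sum.inr l) z = 0) →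
    z ∈ Set.range (algebraMap k K)) {Y Z : Derivation ℂ K K} (hY : Y ∈ F.symm L)
    (hZ : Z ∈ F.symm L) : ⁅Y, Z⁆ ∈ F.symm L := by
  refine ⟨fun l i => ?_, fun p X h h' => ?_⟩
  · obtain ⟨y, hy⟩ := exists_projection hconst hY.1
    obtain ⟨z, hz⟩ := exists_projection hconst hZ.1
    rw [x_inl, ← IsScalarTower.algebraMap_apply, IsScalarTower.algebraMap_apply B k K,
      Derivation.commutator_apply, ← hz, ← hy, ← hy, ← hz, ← map_sub, F.const_der]
  · rw [hat_lie, lie_lie, hY.2 p X h h', hZ.2 p X h h', lie_zero, lie_zero, sub_zero]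

variable (F L)

/-- The projections to the base of the vector fields commuting with `L`. -/
def symmBase : Submodule k (Derivation ℂ k k) where
  carrier := {y | ∃ Y ∈ F.symm L, ∀ z, algebraMap k K (y z) = Y (algebraMap k K z)}
  zero_mem' := ⟨0, Submodule.zero_mem _, fun _ => map_zero _⟩
  add_mem' := by
    rintro y y' ⟨Y, hY, h⟩ ⟨Y', hY', h'⟩
    exact ⟨Y + Y', Submodule.add_mem _ hY hY', fun z => by
      rw [Derivation.add_apply, map_add, h, h', Derivation.add_apply]⟩
  smul_mem' := by
    rintro c y ⟨Y, hY, h⟩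
    exact ⟨c • Y, Submodule.smul_mem _ _ hY, fun z => by
      rw [Derivation.smul_apply, smul_eq_mul, map_mul, h, Derivation.smul_apply, Algebra.smul_def]⟩

variable {F L}

/-- A basis of the vector fields commuting with `L`, with dual coordinates which depend only on the
projections to the base. -/
theorem exists_basis_symm (hyp1 : ∀ x ∈ L, IsVertical B x.2) (hc : CurlFree (F.annOp L))
    (hm : m ≠ 1) (hconst : ∀ z : K, (∀ l, F.δ (Sum.inr l) z = 0) →
      z ∈ Set.range (algebraMap k K)) :
    ∃ (Y : Fin (Module.finrank k (F.symmBase L)) → Derivation ℂ K K)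
      (P : Fin (Module.finrank k (F.symmBase L)) → Fin n → K), (∀ i, Y i ∈ F.symm L) ∧
      (∀ i i', ∑ j, P i j * Y i' (algebraMap A K (F.x (Sum.inl j))) = if i = i' then 1 else 0) ∧
      ∀ Z ∈ F.symm L, Z = ∑ i, (∑ j, P i j * Z (algebraMap A K (F.x (Sum.inl j)))) • Y i := by
  classical
  let ψ : Derivation ℂ k k →ₗ[k] (Fin n → k) :=
    { toFun := fun y j => y (algebraMap B k (F.s j))
      map_add' := fun _ _ => rfl
      map_smul' := fun _ _ => rfl }
  have hψ : Function.Injective ψ := fun y y' h =>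
    derivation_ext_of_isTranscendenceBasis F.basis_k fun j => congrFun h j
  have : Module.Finite k (Derivation ℂ k k) := Module.Finite.of_injective ψ hψ
  obtain ⟨ℓ, hℓ⟩ := (ψ ∘ₗ (F.symmBase L).subtype).exists_leftInverse_of_injective
    (LinearMap.ker_eq_bot.2 (hψ.comp Subtype.val_injective))
  have hb := Module.finBasis k (F.symmBase L)
  choose Y hY hYb using fun i => (hb i).2
  have hx : ∀ (y : Derivation ℂ k k) (Z : Derivation ℂ K K),
      (∀ z, algebraMap k K (y z) = Z (algebraMap k K z)) → ∀ j,
        Z (algebraMap A K (F.x (Sum.inl j))) = algebraMap k K (ψ y j) := fun y Z h j => by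
    rw [x_inl, ← IsScalarTower.algebraMap_apply, IsScalarTower.algebraMap_apply B k K, ← h]
    rfl
  have hP : ∀ (y : F.symmBase L) i,
      ∑ j, hb.repr (ℓ (Pi.single j 1)) i * ψ y j = hb.repr y i := fun y i => by
    have h1 : ℓ (ψ y) = y := DFunLike.congr_fun hℓ y
    conv_rhs => rw [← h1, pi_eq_sum_univ' (ψ y), map_sum, map_sum, Finsupp.finsetSum_apply]
    refine Finset.sum_congr rfl fun j _ => ?_
    rw [map_smul, map_smul, Finsupp.smul_apply, smul_eq_mul, mul_comm]
  have hPK : ∀ (y : F.symmBase L) (Z : Derivation ℂ K K),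
      (∀ z, algebraMap k K (y.1 z) = Z (algebraMap k K z)) → ∀ i,
        ∑ j, algebraMap k K (hb.repr (ℓ (Pi.single j 1)) i) *
          Z (algebraMap A K (F.x (Sum.inl j))) = algebraMap k K (hb.repr y i) := by
    intro y Z h i
    rw [← hP, map_sum]
    exact Finset.sum_congr rfl fun j _ => by rw [hx _ _ h, map_mul]
  refine ⟨Y, fun i j => algebraMap k K (hb.repr (ℓ (Pi.single j 1)) i), hY, fun i i' => ?_,
    fun Z hZ => ?_⟩
  · rw [hPK (hb i') _ (hYb i'), hb.repr_self, Finsupp.single_apply]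
    simp [eq_comm]
  · obtain ⟨y, hy⟩ := exists_projection hconst hZ.1
    have h2 := hPK ⟨y, Z, hZ, hy⟩ Z hy
    simp only [h2, algebraMap_smul]
    rw [← sub_eq_zero]
    refine eq_zero_of_mem_symm hyp1 hc hm (Submodule.sub_mem _ hZ
      (Submodule.sum_mem _ fun i _ => Submodule.smul_mem _ _ (hY i))) fun j => ?_
    have h3 := congrArg (fun y => ψ y j) (congrArg Subtype.val (hb.sum_repr ⟨y, Z, hZ, hy⟩))
    simp only [Submodule.coe_sum, Submodule.coe_smul, map_sum, map_smul, Finset.sum_apply,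
      Pi.smul_apply] at h3
    rw [Derivation.sub_apply, derivation_sum_apply, hx _ _ hy, ← h3, map_sum, sub_eq_zero]
    refine Finset.sum_congr rfl fun i _ => ?_
    rw [Derivation.smul_apply, hx _ _ (hYb i), smul_eq_mul, map_mul]
    exact (Algebra.smul_def _ _).symm

end Frame

end Symmetries

section Foliation

variable {A B K k : Type*}
  [CommRing B] [IsDomain B] [Algebra ℂ B]
  [CommRing A] [IsDomain A] [Algebra ℂ A] [Algebra B A] [IsScalarTower ℂ B A]
  [Field k] [Algebra B k] [IsFractionRing B k] [Algebra ℂ k] [IsScalarTower ℂ B k]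
  [Field K] [Algebra A K] [IsFractionRing A K] [Algebra ℂ K] [IsScalarTower ℂ A K]
  [Algebra k K] [IsScalarTower ℂ k K] [Algebra B K] [IsScalarTower B k K]
  [IsScalarTower B A K] {n m : ℕ} [IsNoetherianRing A]
variable (F : Frame A B K k n m) (L : Set (Jet A))

namespace Frame

/-- The singular foliation generated by the rational vector fields commuting with `L`. -/
def foliation : Submodule K (Derivation ℂ K K) := Submodule.span K (F.symm L)

/-- The meromorphic formal vector fields tangent to the foliation. -/
def meroSpan (p : Pt A) : Submodule (Mero p) (Derivation ℂ (Mero p) (Mero p)) :=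
  Submodule.span (Mero p) (F.hat p '' F.symm L)

variable {F L}

theorem hat_mem_meroSpan {p : Pt A} {Y : Derivation ℂ K K} (hY : Y ∈ F.foliation L) :
    F.hat p Y ∈ F.meroSpan L p := by
  induction hY using Submodule.span_induction with
  | mem Y hY => exact Submodule.subset_span ⟨Y, hY, rfl⟩
  | zero => exact ((F.hatHom p).map_zero ▸ Submodule.zero_mem _ : F.hatHom p 0 ∈ F.meroSpan L p)
  | add Y Z _ _ hY hZ =>
    exact ((F.hatHom p).map_add Y Z ▸ Submodule.add_mem _ hY hZ :
      F.hatHom p (Y + Z) ∈ F.meroSpan L p)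
  | smul a Y _ hY => exact F.hat_smul p a Y ▸ Submodule.smul_mem _ _ hY

theorem lie_field_hat_mem {p : Pt A} {X : FormalVF p} (hX : (⟨p, X⟩ : Jet A) ∈ L)
    (hXv : IsVertical B X) {Y : Derivation ℂ K K} (hY : Y ∈ F.foliation L) :
    ⁅F.field X, F.hat p Y⁆ ∈ F.meroSpan L p := by
  induction hY using Submodule.span_induction with
  | mem Y hY =>
    rw [← lie_skew, hY.2 p X hX hXv, neg_zero]
    exact Submodule.zero_mem _
  | zero =>
    rw [show F.hat p 0 = 0 from (F.hatHom p).map_zero, lie_zero]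
    exact Submodule.zero_mem _
  | add Y Z _ _ hY hZ =>
    rw [show F.hat p (Y + Z) = F.hat p Y + F.hat p Z from (F.hatHom p).map_add Y Z, lie_add]
    exact Submodule.add_mem _ hY hZ
  | smul a Y h hY =>
    rw [hat_smul, derivation_lie_smul]
    exact Submodule.add_mem _ (Submodule.smul_mem _ _ (hat_mem_meroSpan h))
      (Submodule.smul_mem _ _ hY)

omit [IsNoetherianRing A] in
theorem exists_regular_multiple [Algebra.FiniteType ℂ A] (Y : Derivation ℂ K K) :
    ∃ (g : A) (D : Derivation ℂ A A), g ≠ 0 ∧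
      ∀ a, (algebraMap A K g • Y) (algebraMap A K a) = algebraMap A K (D a) := by
  obtain ⟨S, hS⟩ := Algebra.FiniteType.out (R := ℂ) (A := A)
  obtain ⟨g, D, hg, hD⟩ := exists_integral_derivation (K := K) S hS fun _ : Unit => Y
  exact ⟨g, D (), hg, fun a => (hD () a).symm⟩

theorem exists_formal_multiple [Algebra.FiniteType ℂ A] {p : Pt A}
    {W : Derivation ℂ (Mero p) (Mero p)} (hW : W ∈ F.meroSpan L p) :
    ∃ g ∈ nonZeroDivisors (FormalRing p), ∃ Z ∈ Submodule.span (FormalRing p)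
      (extendDer p '' regularFields A (F.foliation L)),
        ∀ f, algebraMap _ (Mero p) g * W (algebraMap _ _ f) = algebraMap _ _ (Z f) := by
  induction hW using Submodule.span_induction with
  | mem W hW =>
    obtain ⟨Y, hY, rfl⟩ := hW
    obtain ⟨g, D, hg, hD⟩ := exists_regular_multiple (A := A) Y
    refine ⟨algebraMap A _ g, Mero.formal_nonZeroDivisor p (mem_nonZeroDivisors_of_ne_zero hg),
      extendDer p D, Submodule.subset_span ⟨D, ⟨_, Submodule.smul_mem _ _
        (Submodule.subset_span hY), hD⟩, rfl⟩, fun f => ?_⟩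
    rw [← F.field_formal, F.field_extendDer hD, hat_smul,
      ← IsScalarTower.algebraMap_apply A K (Mero p)]
    rfl
  | zero => exact ⟨1, one_mem _, 0, Submodule.zero_mem _, fun f => by simp⟩
  | add W W' _ _ h h' =>
    obtain ⟨g, hg, Z, hZ, h⟩ := h
    obtain ⟨g', hg', Z', hZ', h'⟩ := h'
    refine ⟨g * g', mul_mem hg hg', g' • Z + g • Z', Submodule.add_mem _
      (Submodule.smul_mem _ _ hZ) (Submodule.smul_mem _ _ hZ'), fun f => ?_⟩
    rw [Derivation.add_apply, Derivation.add_apply, Derivation.smul_apply, Derivation.smul_apply,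
      smul_eq_mul, smul_eq_mul, map_add, map_mul, map_mul, map_mul, ← h, ← h']
    ring
  | smul r W _ h =>
    obtain ⟨g, hg, Z, hZ, h⟩ := h
    obtain ⟨⟨u, t⟩, hr⟩ := IsLocalization.surj (nonZeroDivisors (FormalRing p)) r
    refine ⟨t * g, mul_mem t.2 hg, u • Z, Submodule.smul_mem _ _ hZ, fun f => ?_⟩
    rw [Derivation.smul_apply, Derivation.smul_apply, smul_eq_mul, smul_eq_mul, map_mul, map_mul,
      ← h, ← hr]
    ring

theorem isTangentTo_iff [Algebra.FiniteType ℂ A] {p : Pt A} {Z : FormalVF p} :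
    IsTangentTo (F.foliation L) p Z ↔ F.field Z ∈ F.meroSpan L p := by
  have hsmul : ∀ (g : FormalRing p) (Z : FormalVF p),
      F.field (g • Z) = algebraMap _ (Mero p) g • F.field Z := fun g Z => by
    simp only [field, dirM, Derivation.smul_apply, smul_eq_mul, map_mul, mul_smul, Finset.smul_sum]
  constructor
  · rintro ⟨g, hg, h⟩
    have h1 : ∀ Z ∈ Submodule.span (FormalRing p)
        (extendDer p '' regularFields A (F.foliation L)), F.field Z ∈ F.meroSpan L p := by
      intro Z hZ
      induction hZ using Submodule.span_induction with
      | mem Z hZ =>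
        obtain ⟨D, ⟨Y, hY, hD⟩, rfl⟩ := hZ
        rw [F.field_extendDer hD]
        exact hat_mem_meroSpan hY
      | zero =>
        rw [show F.field (0 : FormalVF p) = 0 by simp [field, dirM]]
        exact Submodule.zero_mem _
      | add Z Z' _ _ h h' =>
        rw [show F.field (Z + Z') = F.field Z + F.field Z' by
          simp only [field, dirM, Derivation.add_apply, map_add, add_smul, Finset.sum_add_distrib]]
        exact Submodule.add_mem _ h h'
      | smul f Z _ h =>
        rw [hsmul]
        exact Submodule.smul_mem _ _ h
    have h2 := h1 _ h
    rw [hsmul] at h2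
    exact (Submodule.smul_mem_iff_of_isUnit _ (IsLocalization.map_units (Mero p) ⟨g, hg⟩)).1 h2
  · intro h
    obtain ⟨g, hg, Z', hZ', h⟩ := exists_formal_multiple h
    refine ⟨g, hg, ?_⟩
    convert hZ' using 1
    refine Derivation.ext fun f => Mero.injective p ?_
    rw [← h, F.field_formal, ← map_mul]
    rfl

theorem normalizes_of_mem [Algebra.FiniteType ℂ A] {p : Pt A} {X : FormalVF p}
    (hX : (⟨p, X⟩ : Jet A) ∈ L) (hXv : IsVertical B X) : Normalizes p X (F.foliation L) := by
  rintro D ⟨Y, hY, hD⟩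
  rw [isTangentTo_iff, field_lie, F.field_extendDer hD]
  exact lie_field_hat_mem hX hXv hY

theorem lie_field_hat_mem_of_normalizes [Algebra.FiniteType ℂ A] {p : Pt A} {X : FormalVF p}
    (h : Normalizes p X (F.foliation L)) {Y : Derivation ℂ K K} (hY : Y ∈ F.symm L) :
    ⁅F.field X, F.hat p Y⁆ ∈ F.meroSpan L p := by
  have hY' : Y ∈ F.foliation L := Submodule.subset_span hY
  obtain ⟨g, D, hg, hD⟩ := exists_regular_multiple (A := A) Y
  have h1 := h D ⟨_, Submodule.smul_mem _ _ hY', hD⟩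
  rw [isTangentTo_iff, field_lie, F.field_extendDer hD, hat_smul, derivation_lie_smul] at h1
  have h2 := (Submodule.add_mem_iff_right _
    (Submodule.smul_mem _ _ (hat_mem_meroSpan hY'))).1 h1
  exact (Submodule.smul_mem_iff_of_isUnit _ ((IsUnit.mk0 _ fun h => hg
    (IsFractionRing.injective A K (h.trans (map_zero _).symm))).map _)).1 h2

section Basis

variable (hyp1 : ∀ x ∈ L, IsVertical B x.2) (hc : CurlFree (F.annOp L)) (hm : m ≠ 1)
  (hconst : ∀ z : K, (∀ l, F.δ (Sum.inr l) z = 0) → z ∈ Set.range (algebraMap k K))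

include hyp1 hc hm hconst

theorem eq_zero_of_mem_meroSpan {p : Pt A} {W : Derivation ℂ (Mero p) (Mero p)}
    (hW : W ∈ F.meroSpan L p) (h0 : ∀ i, W (algebraMap A (Mero p) (F.x (Sum.inl i))) = 0) :
    W = 0 := by
  obtain ⟨Y, P, -, -, hYP⟩ := exists_basis_symm hyp1 hc hm hconst
  suffices h : W = ∑ i, (∑ j, algebraMap K (Mero p) (P i j) *
      W (algebraMap A (Mero p) (F.x (Sum.inl j)))) • F.hat p (Y i) by
    rw [h]
    simp only [h0, mul_zero, Finset.sum_const_zero, zero_smul]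
  clear h0
  induction hW using Submodule.span_induction with
  | mem W hW =>
    obtain ⟨Z, hZ, rfl⟩ := hW
    have h := congrArg (F.hatHom p) (hYP Z hZ)
    rw [map_sum] at h
    refine h.trans (Finset.sum_congr rfl fun i _ => (F.hat_smul p _ _).trans ?_)
    simp only [IsScalarTower.algebraMap_apply A K (Mero p), hat_K, map_sum, map_mul]
  | zero => simp
  | add W W' _ _ h h' =>
    conv_lhs => rw [h, h']
    simp only [Derivation.add_apply, mul_add, Finset.sum_add_distrib, add_smul]
  | smul r W _ h =>
    conv_lhs => rw [h]
    simp only [Derivation.smul_apply, smul_eq_mul, Finset.smul_sum, smul_smul, Finset.mul_sum,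
      mul_left_comm r]

theorem finrank_foliation : Module.finrank K (F.foliation L) = Module.finrank k (F.symmBase L) := by
  obtain ⟨Y, P, hY, hP, hYP⟩ := exists_basis_symm hyp1 hc hm hconst
  have hspan : F.foliation L = Submodule.span K (Set.range Y) := by
    refine le_antisymm (Submodule.span_le.2 fun Z hZ => ?_) (Submodule.span_mono ?_)
    · rw [hYP Z hZ]
      exact Submodule.sum_mem _ fun i _ => Submodule.smul_mem _ _ (Submodule.subset_span ⟨i, rfl⟩)
    · rintro _ ⟨i, rfl⟩
      exact hY i
  have hli : LinearIndependent K Y := by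
    rw [Fintype.linearIndependent_iff]
    intro a ha i
    have h1 : ∀ j, ∑ i', a i' * Y i' (algebraMap A K (F.x (Sum.inl j))) = 0 := fun j => by
      have := DFunLike.congr_fun ha (algebraMap A K (F.x (Sum.inl j)))
      rwa [derivation_sum_apply] at this
    have h2 : ∑ j, P i j * ∑ i', a i' * Y i' (algebraMap A K (F.x (Sum.inl j))) = a i := by
      simp only [Finset.mul_sum]
      rw [Finset.sum_comm]
      simp only [mul_left_comm (P i _), ← Finset.mul_sum, hP]
      simp
    rw [← h2]
    simp only [h1, mul_zero, Finset.sum_const_zero]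
  rw [hspan, finrank_span_eq_card hli, Fintype.card_fin]

end Basis

theorem isFoliation (hconst : ∀ z : K, (∀ l, F.δ (Sum.inr l) z = 0) →
    z ∈ Set.range (algebraMap k K)) : IsFoliation (F.foliation L) := by
  have hsmul : ∀ (a : K) {Y Z : Derivation ℂ K K}, Z ∈ F.foliation L → ⁅Y, Z⁆ ∈ F.foliation L →
      ⁅Y, a • Z⁆ ∈ F.foliation L := fun a Y Z hZ h => by
    rw [derivation_lie_smul]
    exact Submodule.add_mem _ (Submodule.smul_mem _ _ hZ) (Submodule.smul_mem _ _ h)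
  intro Y hY Z hZ
  induction hZ using Submodule.span_induction with
  | zero =>
    rw [lie_zero]
    exact Submodule.zero_mem _
  | add Z Z' _ _ h h' =>
    rw [lie_add]
    exact Submodule.add_mem _ h h'
  | smul a Z hZ h => exact hsmul a hZ h
  | mem Z hZ =>
    rw [← lie_skew]
    refine Submodule.neg_mem _ ?_
    induction hY using Submodule.span_induction with
    | zero =>
      rw [lie_zero]
      exact Submodule.zero_mem _
    | add Z Z' _ _ h h' =>
      rw [lie_add]
      exact Submodule.add_mem _ h h'
    | smul a Z hZ h => exact hsmul a hZ h
    | mem Y hY => exact Submodule.subset_span (lie_mem_symm hconst hZ hY)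

theorem projectsTo (hconst : ∀ z : K, (∀ l, F.δ (Sum.inr l) z = 0) →
    z ∈ Set.range (algebraMap k K)) : ProjectsTo (F.foliation L) (F.symmBase L) := by
  rw [ProjectsTo, foliation, Submodule.map_span]
  congr 1
  ext d
  constructor
  · rintro ⟨Y, hY, rfl⟩
    obtain ⟨y, hy⟩ := exists_projection hconst hY.1
    exact ⟨y, ⟨Y, hY, hy⟩, Derivation.ext hy⟩
  · rintro ⟨y, ⟨Y, hY, hy⟩, rfl⟩
    exact ⟨Y, hY, Derivation.ext fun z => (hy z).symm⟩

end Frame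

end Foliation

section Characterization

variable {A B K k : Type*}
  [CommRing B] [IsDomain B] [Algebra ℂ B]
  [CommRing A] [IsDomain A] [Algebra ℂ A] [Algebra B A] [IsScalarTower ℂ B A]
  [Field k] [Algebra B k] [IsFractionRing B k] [Algebra ℂ k] [IsScalarTower ℂ B k]
  [Field K] [Algebra A K] [IsFractionRing A K] [Algebra ℂ K] [IsScalarTower ℂ A K]
  [Algebra k K] [IsScalarTower ℂ k K] [Algebra B K] [IsScalarTower B k K]
  [IsScalarTower B A K] {n m : ℕ} [IsNoetherianRing A]
variable (F : Frame A B K k n m) {L : Set (Jet A)} {ω : ⋀[K]^m Ω[K⁄ℂ]}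

namespace Frame

theorem exists_derivation_x (w : Fin n ⊕ Fin m → K) :
    ∃ Y : Derivation ℂ K K, ∀ j, Y (algebraMap A K (F.x j)) = w j :=
  ⟨∑ j, w j • F.δ j, fun j => by
    rw [derivation_sum_apply]
    simp only [Derivation.smul_apply, dual_x, smul_eq_mul, mul_ite, mul_one, mul_zero,
      Finset.sum_ite_eq', Finset.mem_univ, if_true]⟩

/-- The members of `L` are the vertical formal vector fields which preserve the volume form and
normalize the foliation. -/
theorem eq_setOf_normalizes [Algebra.FiniteType ℂ A] [Algebra.Smooth ℂ A] (hm : m ≠ 1)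
    (hL : IsDLieAlgebra L) (hyp1 : ∀ x ∈ L, IsVertical B x.2) (hG : F.HasGoodPoints L ω)
    (hconst : ∀ z : K, (∀ l, F.δ (Sum.inr l) z = 0) → z ∈ Set.range (algebraMap k K)) :
    L = {x : Jet A | IsVertical B x.2 ∧ LieVanishesOn x.1 x.2 ω {Y | IsVertical B Y} ∧
      Normalizes x.1 x.2 (F.foliation L)} := by
  have hdiv := F.divergence_mem hL hyp1 hG
  have hcurl := F.curlFree hG
  ext ⟨p, X⟩
  constructor
  · intro hX
    have hXv : IsVertical B X := hyp1 ⟨p, X⟩ hX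
    exact ⟨hXv, (F.lieVanishesOn_vertical_iff hG hXv).2 (F.mem_annOp.1 hdiv ⟨p, X⟩ hX),
      normalizes_of_mem hX hXv⟩
  · rintro ⟨hXv, hlie, hnorm⟩
    have hXv : IsVertical B X := hXv
    have hlie : LieVanishesOn p X ω {Y | IsVertical B Y} := hlie
    have hnorm : Normalizes p X (F.foliation L) := hnorm
    refine F.mem_of_ev_eq_zero hL hyp1 hXv fun θ hθ => ?_
    rcases Nat.eq_zero_or_pos m with h0 | h0
    · subst h0
      rw [Subsingleton.elim θ 0]
      exact map_zero _
    have : CharZero K := charZero_of_injective_algebraMap (algebraMap ℂ K).injective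
    have hmem : ∀ θ, θ ∈ F.annOp {⟨p, X⟩} ↔ F.ev X θ = 0 := fun θ =>
      ⟨fun h => F.mem_annOp.1 h ⟨p, X⟩ rfl, fun h => F.mem_annOp.2 fun x hx => by
        rw [Set.mem_singleton_iff.1 hx]
        exact h⟩
    refine (hmem θ).1 (le_of_adOp_mem (F.dStable_annOp L) (F.bracketClosed_annOp hL hyp1) hcurl
      hdiv (by omega) (F.dStable_annOp _)
      ((hmem _).2 ((F.lieVanishesOn_vertical_iff hG hXv).1 hlie)) ?_ hθ)
    intro v V hv hmemV i
    obtain ⟨Y, hY⟩ := F.exists_derivation_x (Sum.elim v V)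
    have hYv : (fun j => Y (algebraMap A K (F.x (Sum.inl j)))) = v := funext fun j => hY _
    have hYV : (fun j => Y (algebraMap A K (F.x (Sum.inr j)))) = V := funext fun j => hY _
    have hYs : Y ∈ F.symm L := by
      rw [mem_symm_iff hyp1, hYv, hYV]
      refine ⟨fun l j => ?_, hmemV⟩
      rw [hY]
      exact hv l j
    have h1 : ⁅F.field X, F.hat p Y⁆ = 0 := by
      refine eq_zero_of_mem_meroSpan hyp1 hcurl hm hconst
        (lie_field_hat_mem_of_normalizes hnorm hYs) fun j => ?_
      rw [← lie_skew, Derivation.neg_apply, F.lie_hat_field_base Y hXv fun l => hYs.1 l j, neg_zero]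
    have h2 := F.ev_adOp Y hXv i
    rw [hYv, hYV, ← lie_skew, h1, neg_zero] at h2
    exact (hmem _).2 h2

end Frame

end Characterization

end KisoMorimoto

end

open KisoMorimoto in
theorem theoremA1
    {A B K k : Type*}
    [CommRing B] [IsDomain B] [Algebra ℂ B] [Algebra.Smooth ℂ B]
    [CommRing A] [IsDomain A] [Algebra ℂ A] [Algebra B A] [IsScalarTower ℂ B A]
    [Algebra.Smooth B A]
    [Field k] [Algebra B k] [IsFractionRing B k] [Algebra ℂ k] [IsScalarTower ℂ B k]
    [Field K] [Algebra A K] [IsFractionRing A K] [Algebra ℂ K] [IsScalarTower ℂ A K]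
    [Algebra k K] [IsScalarTower ℂ k K] [Algebra B K] [IsScalarTower B k K]
    [IsScalarTower B A K]
    (m : ℕ) (hm : varietyDim K = varietyDim k + m) (hm1 : m ≠ 1)
    (hfib : Generically B fun s => IsDomain (FibreRing A s))
    (L : Set (Jet A)) (hL : IsDLieAlgebra L)
    (hyp1 : ∀ x ∈ L, IsVertical B x.2)
    (ω : ⋀[K]^m Ω[K⁄ℂ])
    (hyp2 : Generically B fun s =>
      ∃ η : ⋀[FractionRing (FibreRing A s)]^m Ω[FractionRing (FibreRing A s)⁄ℂ],
        FormRestrictsTo (A := A) (FibreRing A s) (FractionRing (FibreRing A s)) ω η ∧ η ≠ 0 ∧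
        ∃ g : FibreRing A s, g ≠ 0 ∧ ∀ q : Pt (FibreRing A s), q g ≠ 0 →
          ∀ Z : FormalVF q, (⟨q, Z⟩ : Jet (FibreRing A s)) ∈ restrictFibre L s ↔
            LieVanishesOn q Z η Set.univ) :
    ∃ H : Submodule K (Derivation ℂ K K),
      IsFoliation H ∧
      L = {x : Jet A | IsVertical B x.2 ∧
        LieVanishesOn x.1 x.2 ω {Y | IsVertical B Y} ∧ Normalizes x.1 x.2 H} ∧
      ∃ F : Submodule k (Derivation ℂ k k),
        ProjectsTo H F ∧ Module.finrank K H = Module.finrank k F := by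
  have : Algebra.Smooth ℂ A := Algebra.Smooth.comp ℂ B A
  have : IsNoetherianRing B := Algebra.FiniteType.isNoetherianRing ℂ B
  have : IsNoetherianRing A := Algebra.FiniteType.isNoetherianRing ℂ A
  obtain ⟨n, ⟨F⟩⟩ := exists_frame (A := A) (B := B) (K := K) (k := k) hm
  have hG := F.hasGoodPoints hfib hyp2
  have hconst := fun z => F.mem_range_of_const hfib (z := z)
  exact ⟨F.foliation L, F.isFoliation hconst, F.eq_setOf_normalizes hm1 hL hyp1 hG hconst,
    F.symmBase L, F.projectsTo hconst, F.finrank_foliation hyp1 (F.curlFree hG) hm1 hconst⟩
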